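/- Let $d\ge 2$, $T>0$, $\gamma>1$, and let $\mu,\lambda\in\mathbb R$ satisfy $\mu\ge 0$ and $2\mu+d\lambda>0$. On $(0,T)\times\mathbb T^d$, with $\mathbb T^d=\mathbb R^d/\mathbb Z^d$, consider the isentropic compressible Navier–Stokes equations $$\varrho_t+\operatorname{div}(\varrho v)=0,\qquad (\varrho v)_t+\operatorname{div}(\varrho v\otimes v)+\nabla\varrho^\gamma-\mu\Delta v-(\mu+\lambda)\nabla\operatorname{div}v=0,$$ with initial data $\varrho(0)=\varrho_0\ge 0$ and $(\varrho v)(0)=\varrho_0v_0$, where $\varrho_0\in L^\gamma(\mathbb T^d)$, $\varrho_0|v_0|^2\in L^1(\mathbb T^d)$ and $v_0=0$ on $\{\varrho_0=0\}$. Write $E(\varrho,v)=\int_{\mathbb T^d}\big(\tfrac12\varrho|v|^2+\tfrac{\varrho^\gamma}{\gamma-1}\big)dx$ and $L^pL^q=L^p(0,T;L^q(\mathbb T^d))$. A weak solution is a pair $(\varrho,v)$ of measurable functions on $(0,T)\times\mathbb T^d$ with $\varrho\ge 0$ (vacuum is allowed), $v$ integrable, $\varrho^\gamma,\ \varrho|v|^2\in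 L^\infty L^1$ and weak gradient $\nabla v\in L^2L^2$, such that: the equations hold in the sense of distributions with the given initial data (that is, against all smooth test functions on $[0,T)\times\mathbb T^d$ vanishing near $t=T$, the initial data entering through the boundary term at $t=0$); $\varrho$ is a renormalized solution of the continuity equation, i.e. $\partial_t b(\varrho)+\operatorname{div}(b(\varrho)v)+(b'(\varrho)\varrho-b(\varrho))\operatorname{div}v=0$ in $\mathcal D'((0,T)\times\mathbb T^d)$ for all $b\in C^1$ with $b'(s)=0$ for large $s$; and for almost every $t\in(0,T)$, $$E(\varrho(t),v(t))+\int_0^t\!\!\int_{\mathbb T^d}\big(\mu|\nabla v|^2+(\mu+\lambda)|\operatorname{div}v|^2\big)\,dx\,ds\le E(\varrho_0,v_0).$$ Let $(\varrho,v)$ be a weak solution, and suppose that, for some real numbers $k,l$, one of the following holds. 1. $\nabla v\in L^2L^2$, $\varrho\in L^kL^l$, $\nabla\sqrt\varrho\in L^{\frac{4k}{k+4}}L^{\frac{4l}{l+4}}$, $v\in L^{\frac{4k}{k-2}}L^{\frac{4l}{l-2}}$ and $v_0\in L^{\max\{\frac{2\gamma}{\gamma-1},\frac{2l}{l-2}\}}(\mathbb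 T^d)$, where $k,l>2\gamma$ and, if $(8-d)l+2d>0$, also $$k>\frac{2\big(2(d+4)\gamma+d\big)l-4d(2\gamma+1)}{(8-d)l+2d}.$$ 2. $v\in L^4L^4$, $\varrho\in L^kL^l$, $\nabla\sqrt\varrho\in L^{\frac{4k}{k-2}}L^{\frac{4l}{l-2}}$, $\nabla v\in L^{\frac{2k}{k-2}}L^{\frac{2l}{l-2}}$ and $v_0\in L^{\frac{2\gamma}{\gamma-1}}(\mathbb T^d)$, where $k,l>\max\{2,2(\gamma-1)\}$ and, if $d<8$, also $k>\frac{4(\gamma-1)(d+4)}{8-d}$. Then the energy equality holds on $[0,T]$: after modification on a set of measure zero in $(0,T)\times\mathbb T^d$ (and with values assigned at $t=0$ and $t=T$), $\varrho\in C([0,T];L^\gamma_{\rm weak}(\mathbb T^d))$ and $\varrho v\in C([0,T];L^{2\gamma/(\gamma+1)}_{\rm weak}(\mathbb T^d))$ with $\varrho(0)=\varrho_0$ and $(\varrho v)(0)=\varrho_0v_0$, and for every $t\in[0,T]$ the energy $E(\varrho(t),v(t))$ is finite and $$E(\varrho(t),v(t))+\int_0^t\!\!\int_{\mathbb T^d}\big(\mu|\nabla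 v|^2+(\mu+\lambda)|\operatorname{div}v|^2\big)\,dx\,ds=E(\varrho_0,v_0).$$ -/

import Mathlib

open MeasureTheory Set
open scoped ENNReal ContDiff

noncomputable section

namespace CompressibleNS

/-- The flat torus of dimension `d` (period one in each direction); its `volume` is the
normalised Lebesgue measure. -/
abbrev Torus (d : ℕ) : Type := UnitAddTorus (Fin d)

/-- Velocities: Euclidean vectors with `d` components. -/
abbrev Vel (d : ℕ) : Type := EuclideanSpace ℝ (Fin d)

/-- Velocity gradients: `d × d` arrays with the Euclidean (Frobenius) norm.
The entry `(i, j)` stands for the derivative of the `i`-th component in direction `j`. -/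
abbrev Grad (d : ℕ) : Type := EuclideanSpace ℝ (Fin d × Fin d)

/-- The covering map from the Euclidean space to the torus. -/
def toTorus {d : ℕ} (y : Fin d → ℝ) : Torus d := fun i => (y i : UnitAddCircle)

/-- Lebesgue measure on the slab `(0, T) × 𝕋^d`. -/
def slab (d : ℕ) (T : ℝ) : Measure (ℝ × Torus d) :=
  ((volume : Measure ℝ).restrict (Ioo 0 T)).prod (volume : Measure (Torus d))

/-- Classical time derivative of a function of time and space. -/
def timeDeriv {d : ℕ} (ψ : ℝ → Torus d → ℝ) (t : ℝ) (x : Torus d) : ℝ :=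
  deriv (fun s : ℝ => ψ s x) t

/-- Classical partial derivative in the `j`-th space direction. -/
def spaceDeriv {d : ℕ} (j : Fin d) (ψ : ℝ → Torus d → ℝ) (t : ℝ) (x : Torus d) : ℝ :=
  deriv (fun s : ℝ => ψ t (x + Pi.single j (s : UnitAddCircle))) 0

/-- Test functions on `[0, T) × 𝕋^d`: smooth in time and space, vanishing near and after `T`,
with no restriction at time `0`. -/
structure IsTest {d : ℕ} (T : ℝ) (ψ : ℝ → Torus d → ℝ) : Prop where
  smooth : ContDiff ℝ ∞ (fun z : ℝ × (Fin d → ℝ) => ψ z.1 (toTorus z.2))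
  vanish_late : ∃ b < T, ∀ t, b ≤ t → ∀ x, ψ t x = 0

/-- Test functions with compact support in `(0, T) × 𝕋^d`. -/
structure IsInteriorTest {d : ℕ} (T : ℝ) (ψ : ℝ → Torus d → ℝ) : Prop extends IsTest T ψ where
  vanish_early : ∃ a > 0, ∀ t, t ≤ a → ∀ x, ψ t x = 0

/-- `f ∈ L^p(0, T; L^q(𝕋^d))`. -/
def MemLpLq {d : ℕ} {F : Type*} [NormedAddCommGroup F] (T : ℝ) (p q : ℝ≥0∞)
    (f : ℝ → Torus d → F) : Prop :=
  AEStronglyMeasurable (fun z : ℝ × Torus d => f z.1 z.2) (slab d T) ∧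
    eLpNorm (fun t : ℝ => eLpNorm (f t) q (volume : Measure (Torus d))) p
      ((volume : Measure ℝ).restrict (Ioo 0 T)) < ⊤

/-- `H` is the weak (distributional) spatial gradient of the scalar function `f` on the slab. -/
def IsWeakGradScalar {d : ℕ} (T : ℝ) (f : ℝ → Torus d → ℝ) (H : ℝ → Torus d → Vel d) : Prop :=
  Integrable (fun z : ℝ × Torus d => f z.1 z.2) (slab d T) ∧
  Integrable (fun z : ℝ × Torus d => H z.1 z.2) (slab d T) ∧
  ∀ ψ : ℝ → Torus d → ℝ, IsInteriorTest T ψ → ∀ j : Fin d,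
    ∫ z, f z.1 z.2 * spaceDeriv j ψ z.1 z.2 ∂(slab d T)
      = -∫ z, H z.1 z.2 j * ψ z.1 z.2 ∂(slab d T)

/-- `G` is the weak (distributional) spatial gradient of the vector field `v` on the slab. -/
def IsWeakGrad {d : ℕ} (T : ℝ) (v : ℝ → Torus d → Vel d) (G : ℝ → Torus d → Grad d) : Prop :=
  Integrable (fun z : ℝ × Torus d => v z.1 z.2) (slab d T) ∧
  Integrable (fun z : ℝ × Torus d => G z.1 z.2) (slab d T) ∧
  ∀ ψ : ℝ → Torus d → ℝ, IsInteriorTest T ψ → ∀ i j : Fin d,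
    ∫ z, v z.1 z.2 i * spaceDeriv j ψ z.1 z.2 ∂(slab d T)
      = -∫ z, G z.1 z.2 (i, j) * ψ z.1 z.2 ∂(slab d T)

/-- The weak spatial gradient of the scalar function `f` exists and lies in
`L^p(0, T; L^q(𝕋^d))`. -/
def GradMemLpLq {d : ℕ} (T : ℝ) (p q : ℝ≥0∞) (f : ℝ → Torus d → ℝ) : Prop :=
  ∃ H : ℝ → Torus d → Vel d, IsWeakGradScalar T f H ∧ MemLpLq T p q H

/-- Divergence: the trace of the gradient. -/
def divg {d : ℕ} (A : Grad d) : ℝ := ∑ i, A (i, i)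

/-- Energy density `½ ϱ |v|² + ϱ^γ / (γ - 1)` of a density and a velocity field. -/
def energyDensity {d : ℕ} (γ : ℝ) (r : Torus d → ℝ) (u : Torus d → Vel d) (x : Torus d) : ℝ :=
  1 / 2 * r x * ‖u x‖ ^ 2 + r x ^ γ / (γ - 1)

/-- Total energy. -/
def energy {d : ℕ} (γ : ℝ) (r : Torus d → ℝ) (u : Torus d → Vel d) : ℝ :=
  ∫ x, energyDensity γ r u x

/-- Energy dissipated up to time `t`. -/
def dissipation {d : ℕ} (mu lam : ℝ) (G : ℝ → Torus d → Grad d) (t : ℝ) : ℝ :=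
  ∫ z, (mu * ‖G z.1 z.2‖ ^ 2 + (mu + lam) * divg (G z.1 z.2) ^ 2) ∂(slab d t)

/-- Finite energy initial data: nonnegative density, finite initial energy, and velocity equal to
zero on the vacuum set. -/
structure IsInitialDatum {d : ℕ} (γ : ℝ) (r₀ : Torus d → ℝ) (v₀ : Torus d → Vel d) : Prop where
  density_nonneg : ∀ᵐ x, 0 ≤ r₀ x
  density_memLp : MemLp r₀ (ENNReal.ofReal γ)
  velocity_measurable : AEStronglyMeasurable v₀
  kinetic_integrable : Integrable (fun x => r₀ x * ‖v₀ x‖ ^ 2)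
  vacuum : ∀ᵐ x, r₀ x = 0 → v₀ x = 0

/-- `(r, v)`, with weak velocity gradient `G`, is a finite energy weak solution on `(0, T) × 𝕋^d`
of the isentropic compressible Navier-Stokes equations
`∂ₜ r + div (r v) = 0`,
`∂ₜ (r v) + div (r v ⊗ v) + ∇ (r ^ γ) - μ Δ v - (μ + λ) ∇ div v = 0`
with initial density `r₀` and initial momentum `r₀ v₀`. -/
structure IsWeakSolution {d : ℕ} (T γ mu lam : ℝ) (r₀ : Torus d → ℝ) (v₀ : Torus d → Vel d)
    (r : ℝ → Torus d → ℝ) (v : ℝ → Torus d → Vel d) (G : ℝ → Torus d → Grad d) : Prop where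
  initial : IsInitialDatum γ r₀ v₀
  density_measurable : AEStronglyMeasurable (fun z : ℝ × Torus d => r z.1 z.2) (slab d T)
  density_nonneg : ∀ᵐ z ∂(slab d T), 0 ≤ r z.1 z.2
  weakGrad : IsWeakGrad T v G
  pressure_bound : MemLpLq T ⊤ 1 (fun t x => r t x ^ γ)
  kinetic_bound : MemLpLq T ⊤ 1 (fun t x => r t x * ‖v t x‖ ^ 2)
  grad_bound : MemLpLq T 2 2 G
  /-- The continuity equation, with the initial density. -/
  mass : ∀ ψ : ℝ → Torus d → ℝ, IsTest T ψ →
    ∫ z, (r z.1 z.2 * timeDeriv ψ z.1 z.2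
        + ∑ i, r z.1 z.2 * v z.1 z.2 i * spaceDeriv i ψ z.1 z.2) ∂(slab d T)
      + ∫ x, r₀ x * ψ 0 x = 0
  /-- The `j`-th component of the momentum equation, with the initial momentum. -/
  momentum : ∀ ψ : ℝ → Torus d → ℝ, IsTest T ψ → ∀ j : Fin d,
    ∫ z, (r z.1 z.2 * v z.1 z.2 j * timeDeriv ψ z.1 z.2
        + ∑ i, r z.1 z.2 * v z.1 z.2 i * v z.1 z.2 j * spaceDeriv i ψ z.1 z.2
        + r z.1 z.2 ^ γ * spaceDeriv j ψ z.1 z.2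
        - mu * ∑ i, G z.1 z.2 (j, i) * spaceDeriv i ψ z.1 z.2
        - (mu + lam) * divg (G z.1 z.2) * spaceDeriv j ψ z.1 z.2) ∂(slab d T)
      + ∫ x, r₀ x * v₀ x j * ψ 0 x = 0
  /-- The density is a renormalized solution of the continuity equation:
  `∂ₜ b(r) + div (b(r) v) + (b'(r) r - b(r)) div v = 0` in the sense of distributions for every
  continuously differentiable `b` whose derivative vanishes for large arguments. -/
  renormalized : ∀ b : ℝ → ℝ, ContDiff ℝ 1 b → (∃ R : ℝ, ∀ s, R ≤ s → deriv b s = 0) →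
    ∀ ψ : ℝ → Torus d → ℝ, IsInteriorTest T ψ →
    ∫ z, (b (r z.1 z.2) * timeDeriv ψ z.1 z.2
        + ∑ i, b (r z.1 z.2) * v z.1 z.2 i * spaceDeriv i ψ z.1 z.2
        - (deriv b (r z.1 z.2) * r z.1 z.2 - b (r z.1 z.2)) * divg (G z.1 z.2) * ψ z.1 z.2)
      ∂(slab d T) = 0
  /-- The energy inequality. -/
  energy_le : ∀ᵐ t ∂((volume : Measure ℝ).restrict (Ioo 0 T)),
    energy γ (r t) (v t) + dissipation mu lam G t ≤ energy γ r₀ v₀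

/-- `(r', v')` is a representative of `(r, v)` for which the density and the momentum are defined
at every time of `[0, T]`, depend weakly continuously on time, as functions with values in `L^γ`
and `L^{2γ/(γ+1)}`, and take the initial values `r₀` and `r₀ v₀`. -/
structure IsWeaklyContinuousRep {d : ℕ} (T γ : ℝ) (r₀ : Torus d → ℝ) (v₀ : Torus d → Vel d)
    (r : ℝ → Torus d → ℝ) (v : ℝ → Torus d → Vel d)
    (r' : ℝ → Torus d → ℝ) (v' : ℝ → Torus d → Vel d) : Prop where
  ae_eq : ∀ᵐ z ∂(slab d T), r' z.1 z.2 = r z.1 z.2 ∧ v' z.1 z.2 = v z.1 z.2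
  density_nonneg : ∀ t ∈ Icc 0 T, ∀ᵐ x, 0 ≤ r' t x
  density_memLp : ∀ t ∈ Icc 0 T, MemLp (r' t) (ENNReal.ofReal γ)
  momentum_memLp : ∀ t ∈ Icc 0 T,
    MemLp (fun x => r' t x • v' t x) (ENNReal.ofReal (2 * γ / (γ + 1)))
  density_cont : ∀ φ : Torus d → ℝ, MemLp φ (ENNReal.ofReal (γ / (γ - 1))) →
    ContinuousOn (fun t => ∫ x, r' t x * φ x) (Icc 0 T)
  momentum_cont : ∀ φ : Torus d → Vel d, MemLp φ (ENNReal.ofReal (2 * γ / (γ - 1))) →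
    ContinuousOn (fun t => ∫ x, inner ℝ (r' t x • v' t x) (φ x)) (Icc 0 T)
  density_zero : ∀ᵐ x, r' 0 x = r₀ x
  momentum_zero : ∀ᵐ x, r' 0 x • v' 0 x = r₀ x • v₀ x

/-- The energy equality on `[0, T]`: after a modification on a set of measure zero that makes
density and momentum weakly continuous in time, at every `t ∈ [0, T]` the energy is finite, and
energy plus dissipation up to time `t` equals the initial energy. -/
def EnergyEquality {d : ℕ} (T γ mu lam : ℝ) (r₀ : Torus d → ℝ) (v₀ : Torus d → Vel d)
    (r : ℝ → Torus d → ℝ) (v : ℝ → Torus d → Vel d) (G : ℝ → Torus d → Grad d) : Prop :=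
  ∃ (r' : ℝ → Torus d → ℝ) (v' : ℝ → Torus d → Vel d),
    IsWeaklyContinuousRep T γ r₀ v₀ r v r' v' ∧
    ∀ t ∈ Icc 0 T,
      Integrable (energyDensity γ (r' t) (v' t)) ∧
      energy γ (r' t) (v' t) + dissipation mu lam G t = energy γ r₀ v₀

end CompressibleNS

end

/-!
Energy equality for weak solutions of the isentropic compressible Navier–Stokes equations with
vacuum.

In both regularity classes the exponents are such that `ϱ v ⊗ v : ∇v` and `ϱ^γ div v` are
integrable in space-time, with `ϱ ∈ L^k L^l`, `v ∈ L^a L^b`, `∇v ∈ L^c L^e` and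
`1/k + 2/a + 1/c = 1`, `1/l + 2/b + 1/e = 1`; moreover `∇√ϱ ∈ L^{4/3} L^{4/3}`. These conditions
are collected in `IsRegular`, and `IsRegular.energyEquality` proves the energy equality from them.
The kinetic and the internal energy are balanced separately, and the work of the pressure cancels
in the sum.

*Internal energy.* Renormalization by cut-offs of `ϱ^γ` gives the balance between almost all times.
To reach every time one needs strong traces of the density: along suitable times tending to a given
`s`, the density converges almost everywhere (`IsRegular.exists_density_trace`). The
renormalized equation for `arctan ϱ` provides weak traces in `L²` at every time. To see that they
are strong, that equation is tested with smooth approximations of `arctan ϱ(t)` itself, for a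
typical time `t`. The flux at time `τ` then has absolute value at most `A(t) + A(τ)` with an
integrable `A` (`IsRegular.exists_arctan_flux_bound`), which rests on `∇√ϱ ∈ L^{4/3}` and `v ∈ L⁴`
and is the only use of the regularity of `√ϱ`. Along times `tₙ → s` with `|tₙ - s| A(tₙ) → 0` the
`L²` norms of `arctan ϱ(tₙ)` converge to that of the trace, so the convergence is strong, and a bound
on the mass excludes the value `π/2` of the trace. The balance passes to these traces
(`IsRegular.pressure_balance`), and the momentum bound of the weak formulation together with the
Riesz representation theorem in `L²(ϱ dx)` provides the velocity at every time
(`IsRegular.exists_slice_of_trace`). This yields the weakly continuous representative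
(`IsRegular.exists_representative`).

*Kinetic energy.* For every smooth field `φ`, the kinetic energy at time `s` is at least
`∫ ϱ v · φ - ½ ∫ ϱ |φ|²`, with equality for `φ = v` (`IsSlice.kinetic_eq`). The right-hand side
evolves by the momentum and the continuity equation. Taking for `φ` the Fejér means of the velocity
at a typical time `t` bounds the increment of the kinetic energy from `t` to any `s` below by an
integral of `B(t, τ)`, which pairs fluxes at time `τ` with the velocity and its gradient at time `t`
(`IsRegular.ae_kinetic_increment`). No time regularity of the velocity is needed, and vacuum is
harmless. Taking `s` after `t` and `s` before `t`, the difference quotients of the kinetic energy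
are bounded from both sides by averages of `B`, which converge to the diagonal `B(t, t)` by
continuity of translations in mixed Lebesgue spaces (`tendsto_steklov`). Hence the kinetic energy
agrees almost everywhere with a primitive of `B(t, t)`, and, being lower semicontinuous, it does so
everywhere (`eq_add_integral_of_increments`).
-/

namespace CompressibleNS

open Filter Topology

instance : IsProbabilityMeasure (volume : Measure UnitAddCircle) := ⟨by simp⟩

/-- Smoothness of a function on the torus, through the covering map. -/
def IsSmooth {d : ℕ} (φ : Torus d → ℝ) : Prop :=
  ContDiff ℝ ∞ (fun y : Fin d → ℝ => φ (toTorus y))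

/-- Classical partial derivative of a function on the torus. -/
noncomputable def pd {d : ℕ} (j : Fin d) (φ : Torus d → ℝ) (x : Torus d) : ℝ :=
  deriv (fun s : ℝ => φ (x + Pi.single j (s : UnitAddCircle))) 0

/-! ### Smooth functions on the torus -/

section Smooth

variable {d : ℕ}

lemma isOpenQuotientMap_toTorus : IsOpenQuotientMap (toTorus (d := d)) :=
  IsOpenQuotientMap.piMap (fun _ => QuotientAddGroup.isOpenQuotientMap_mk)

lemma toTorus_add_single (y : Fin d → ℝ) (j : Fin d) (s : ℝ) :
    toTorus y + Pi.single j (s : UnitAddCircle) = toTorus (y + s • Pi.single j 1) := by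
  funext i
  by_cases h : i = j
  · subst h; simp [toTorus]
  · simp [toTorus, h]

lemma IsSmooth.continuous {φ : Torus d → ℝ} (h : IsSmooth φ) : Continuous φ :=
  isOpenQuotientMap_toTorus.isQuotientMap.continuous_iff.2 (ContDiff.continuous h)

lemma IsSmooth.hasDerivAt {φ : Torus d → ℝ} (h : IsSmooth φ) (j : Fin d) (x : Torus d) :
    HasDerivAt (fun s : ℝ => φ (x + Pi.single j (s : UnitAddCircle))) (pd j φ x) 0 := by
  obtain ⟨y, rfl⟩ := isOpenQuotientMap_toTorus.surjective x
  refine DifferentiableAt.hasDerivAt ?_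
  simp_rw [toTorus_add_single]
  have h1 : Differentiable ℝ (fun y : Fin d → ℝ => φ (toTorus y)) :=
    ContDiff.differentiable h (by simp)
  exact (h1.comp (f := fun s : ℝ => y + s • Pi.single j 1) (by fun_prop)) 0

lemma IsSmooth.pd_toTorus {φ : Torus d → ℝ} (h : IsSmooth φ) (j : Fin d) (y : Fin d → ℝ) :
    pd j φ (toTorus y) = fderiv ℝ (fun y : Fin d → ℝ => φ (toTorus y)) y (Pi.single j 1) := by
  have h1 : Differentiable ℝ (fun y : Fin d → ℝ => φ (toTorus y)) :=
    ContDiff.differentiable h (by simp)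
  unfold pd
  simp_rw [toTorus_add_single]
  have h2 : HasDerivAt (fun s : ℝ => y + s • (Pi.single j 1 : Fin d → ℝ)) (Pi.single j 1) 0 := by
    simpa using ((hasDerivAt_id (0 : ℝ)).smul_const (Pi.single j 1 : Fin d → ℝ)).const_add y
  have h3 := HasFDerivAt.comp_hasDerivAt_of_eq (y := y) (0 : ℝ) (h1 y).hasFDerivAt h2 (by simp)
  exact h3.deriv

lemma IsSmooth.pd {φ : Torus d → ℝ} (h : IsSmooth φ) (j : Fin d) : IsSmooth (pd j φ) := by
  unfold IsSmooth
  simp_rw [h.pd_toTorus]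
  exact (ContDiff.fderiv_right h (by simp)).clm_apply contDiff_const

lemma IsSmooth.bounded {φ : Torus d → ℝ} (h : IsSmooth φ) : ∃ C, 0 ≤ C ∧ ∀ x, ‖φ x‖ ≤ C := by
  obtain ⟨C, hC⟩ := isCompact_univ.exists_bound_of_continuousOn h.continuous.continuousOn
  exact ⟨max C 0, le_max_right _ _, fun x => (hC x trivial).trans (le_max_left _ _)⟩

lemma isSmooth_const (c : ℝ) : IsSmooth (fun _ : Torus d => c) := by
  unfold IsSmooth; exact contDiff_const

lemma IsSmooth.add {φ ψ : Torus d → ℝ} (h : IsSmooth φ) (h' : IsSmooth ψ) :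
    IsSmooth (fun x => φ x + ψ x) := ContDiff.add h h'

lemma IsSmooth.mul {φ ψ : Torus d → ℝ} (h : IsSmooth φ) (h' : IsSmooth ψ) :
    IsSmooth (fun x => φ x * ψ x) := ContDiff.mul h h'

lemma IsSmooth.const_mul {φ : Torus d → ℝ} (c : ℝ) (h : IsSmooth φ) :
    IsSmooth (fun x => c * φ x) := (isSmooth_const c).mul h

lemma IsSmooth.sum {ι : Type*} {s : Finset ι} {φ : ι → Torus d → ℝ}
    (h : ∀ i ∈ s, IsSmooth (φ i)) : IsSmooth (fun x => ∑ i ∈ s, φ i x) :=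
  ContDiff.sum (f := fun i (y : Fin d → ℝ) => φ i (toTorus y)) h

lemma IsSmooth.comp {φ : Torus d → ℝ} (h : IsSmooth φ) {f : ℝ → ℝ} (hf : ContDiff ℝ ∞ f) :
    IsSmooth (fun x => f (φ x)) := ContDiff.comp (g := f) hf h

lemma pd_add {φ ψ : Torus d → ℝ} (h : IsSmooth φ) (h' : IsSmooth ψ) (j : Fin d) (x : Torus d) :
    pd j (fun x => φ x + ψ x) x = pd j φ x + pd j ψ x :=
  ((h.hasDerivAt j x).add (h'.hasDerivAt j x)).deriv

lemma pd_mul {φ ψ : Torus d → ℝ} (h : IsSmooth φ) (h' : IsSmooth ψ) (j : Fin d) (x : Torus d) :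
    pd j (fun x => φ x * ψ x) x = pd j φ x * ψ x + φ x * pd j ψ x := by
  have := ((h.hasDerivAt j x).fun_mul (h'.hasDerivAt j x)).deriv
  exact this.trans (by simp)

lemma pd_const_mul {φ : Torus d → ℝ} (c : ℝ) (h : IsSmooth φ) (j : Fin d) (x : Torus d) :
    pd j (fun x => c * φ x) x = c * pd j φ x :=
  ((h.hasDerivAt j x).const_mul c).deriv

lemma pd_sum {ι : Type*} {s : Finset ι} {φ : ι → Torus d → ℝ}
    (h : ∀ i ∈ s, IsSmooth (φ i)) (j : Fin d) (x : Torus d) :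
    pd j (fun x => ∑ i ∈ s, φ i x) x = ∑ i ∈ s, pd j (φ i) x :=
  (HasDerivAt.fun_sum fun i hi => (h i hi).hasDerivAt j x).deriv

lemma pd_comp {φ : Torus d → ℝ} (h : IsSmooth φ) {f f' : ℝ → ℝ} (hf : ∀ s, HasDerivAt f (f' s) s)
    (j : Fin d) (x : Torus d) :
    pd j (fun x => f (φ x)) x = f' (φ x) * pd j φ x := by
  have := HasDerivAt.comp_of_eq (y := φ x) (0 : ℝ) (hf (φ x)) (h.hasDerivAt j x) (by simp)
  exact this.deriv

/-- Products of smooth cutoffs in time and smooth functions in space are test functions. -/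
lemma isTest_mul {T : ℝ} {χ : ℝ → ℝ} {φ : Torus d → ℝ} (hχ : ContDiff ℝ ∞ χ)
    (hT : ∃ b < T, ∀ t, b ≤ t → χ t = 0) (h : IsSmooth φ) :
    IsTest T (fun t x => χ t * φ x) where
  smooth := (hχ.comp contDiff_fst).mul
    (ContDiff.comp (g := fun y : Fin d → ℝ => φ (toTorus y)) h contDiff_snd)
  vanish_late := by
    obtain ⟨b, hb, hb'⟩ := hT
    exact ⟨b, hb, fun t ht x => by simp [hb' t ht]⟩

lemma isInteriorTest_mul {T : ℝ} {χ : ℝ → ℝ} {φ : Torus d → ℝ} (hχ : ContDiff ℝ ∞ χ)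
    (hT : ∃ b < T, ∀ t, b ≤ t → χ t = 0) (h0 : ∃ a > 0, ∀ t, t ≤ a → χ t = 0) (h : IsSmooth φ) :
    IsInteriorTest T (fun t x => χ t * φ x) where
  toIsTest := isTest_mul hχ hT h
  vanish_early := by
    obtain ⟨b, hb, hb'⟩ := h0
    exact ⟨b, hb, fun t ht x => by simp [hb' t ht]⟩

lemma spaceDeriv_mul {χ : ℝ → ℝ} {φ : Torus d → ℝ} (h : IsSmooth φ) (j : Fin d) (t : ℝ)
    (x : Torus d) : spaceDeriv j (fun t x => χ t * φ x) t x = χ t * pd j φ x :=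
  ((h.hasDerivAt j x).const_mul (χ t)).deriv

lemma timeDeriv_mul {χ : ℝ → ℝ} {φ : Torus d → ℝ} (hχ : ContDiff ℝ ∞ χ) (t : ℝ)
    (x : Torus d) : timeDeriv (fun t x => χ t * φ x) t x = deriv χ t * φ x := by
  have := hχ.differentiable (by simp) t
  exact (this.hasDerivAt.mul_const (φ x)).deriv

lemma IsSmooth.aestronglyMeasurable {φ : Torus d → ℝ} (h : IsSmooth φ) (μ : Measure (Torus d)) :
    AEStronglyMeasurable φ μ := h.continuous.aestronglyMeasurable

lemma IsSmooth.memLp {φ : Torus d → ℝ} (h : IsSmooth φ) (μ : Measure (Torus d))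
    [IsFiniteMeasure μ] (p : ℝ≥0∞) : MemLp φ p μ := by
  obtain ⟨C, -, hC⟩ := h.bounded
  exact MemLp.of_bound (h.aestronglyMeasurable μ) C (Eventually.of_forall hC)

end Smooth

/-! ### Fejér means on the torus -/

section Fejer

open UnitAddTorus

variable {d : ℕ}

lemma mFourier_sub_apply (k : Fin d → ℤ) (x y : Torus d) :
    mFourier k (x - y) = mFourier k x * (starRingEnd ℂ) (mFourier k y) := by
  rw [← mFourier_neg]
  simp only [mFourier, ContinuousMap.coe_mk, ← Finset.prod_mul_distrib, Pi.sub_apply, Pi.neg_apply]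
  refine Finset.prod_congr rfl fun i _ => ?_
  rw [fourier_apply, fourier_apply, fourier_apply, ← Circle.coe_mul, ← AddCircle.toCircle_add]
  congr 2
  rw [neg_smul, smul_sub, sub_eq_add_neg]

lemma mFourier_add_apply (k : Fin d → ℤ) (x y : Torus d) :
    mFourier k (x + y) = mFourier k x * mFourier k y := by
  simp only [mFourier, ContinuousMap.coe_mk, ← Finset.prod_mul_distrib, Pi.add_apply]
  refine Finset.prod_congr rfl fun i _ => ?_
  rw [fourier_apply, fourier_apply, fourier_apply, ← Circle.coe_mul, ← AddCircle.toCircle_add,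
    smul_add]

lemma mFourier_toTorus (k : Fin d → ℤ) (y : Fin d → ℝ) :
    mFourier k (toTorus y) = Complex.exp (((2 * Real.pi * ∑ i, k i * y i : ℝ) : ℂ) * Complex.I) := by
  simp only [mFourier, ContinuousMap.coe_mk, toTorus]
  rw [Complex.ofReal_mul, Complex.ofReal_sum, Finset.mul_sum, Finset.sum_mul, Complex.exp_sum]
  refine Finset.prod_congr rfl fun i _ => ?_
  rw [fourier_coe_apply]
  congr 1
  push_cast
  ring

/-- The real trigonometric monomials `cos (2 π k ⬝ x)` and `sin (2 π k ⬝ x)`. -/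
noncomputable def trig (k : Bool × (Fin d → ℤ)) (x : Torus d) : ℝ :=
  if k.1 then (mFourier k.2 x).re else (mFourier k.2 x).im

lemma trig_true_toTorus (k : Fin d → ℤ) (y : Fin d → ℝ) :
    trig (true, k) (toTorus y) = Real.cos (2 * Real.pi * ∑ i, k i * y i) := by
  simp only [trig, if_true, mFourier_toTorus, Complex.exp_ofReal_mul_I_re]

lemma trig_false_toTorus (k : Fin d → ℤ) (y : Fin d → ℝ) :
    trig (false, k) (toTorus y) = Real.sin (2 * Real.pi * ∑ i, k i * y i) := by
  simp only [trig, Bool.false_eq_true, if_false, mFourier_toTorus, Complex.exp_ofReal_mul_I_im]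

lemma isSmooth_trig (k : Bool × (Fin d → ℤ)) : IsSmooth (trig k) := by
  obtain ⟨b, k⟩ := k
  unfold IsSmooth
  cases b
  · simp_rw [trig_false_toTorus]; fun_prop
  · simp_rw [trig_true_toTorus]; fun_prop

lemma hasDerivAt_phase (k : Fin d → ℤ) (y : Fin d → ℝ) (j : Fin d) :
    HasDerivAt (fun s : ℝ => 2 * Real.pi * ∑ i, k i * (y + s • Pi.single j 1 : Fin d → ℝ) i)
      (2 * Real.pi * k j) 0 := by
  have : (fun s : ℝ => 2 * Real.pi * ∑ i, k i * (y + s • Pi.single j 1 : Fin d → ℝ) i)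
      = fun s : ℝ => 2 * Real.pi * (∑ i, k i * y i) + 2 * Real.pi * k j * s := by
    funext s
    simp only [Pi.add_apply, Pi.smul_apply, smul_eq_mul, mul_add, Finset.sum_add_distrib]
    congr 1
    rw [Finset.sum_eq_single j] <;> simp +contextual [mul_assoc]
  rw [this]
  simpa using ((hasDerivAt_id (0 : ℝ)).const_mul (2 * Real.pi * k j)).const_add
    (2 * Real.pi * (∑ i, k i * y i))

lemma pd_trig_true (k : Fin d → ℤ) (j : Fin d) (x : Torus d) :
    pd j (trig (true, k)) x = -(2 * Real.pi * k j) * trig (false, k) x := by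
  obtain ⟨y, rfl⟩ := isOpenQuotientMap_toTorus.surjective x
  unfold pd
  simp_rw [toTorus_add_single, trig_true_toTorus, trig_false_toTorus]
  rw [((hasDerivAt_phase k y j).cos).deriv]
  simp; ring

lemma pd_trig_false (k : Fin d → ℤ) (j : Fin d) (x : Torus d) :
    pd j (trig (false, k)) x = (2 * Real.pi * k j) * trig (true, k) x := by
  obtain ⟨y, rfl⟩ := isOpenQuotientMap_toTorus.surjective x
  unfold pd
  simp_rw [toTorus_add_single, trig_true_toTorus, trig_false_toTorus]
  rw [((hasDerivAt_phase k y j).sin).deriv]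
  simp; ring

/-- The frequency box `{0, …, N}^d`. -/
noncomputable def box (d N : ℕ) : Finset (Fin d → ℤ) := Fintype.piFinset fun _ => Finset.Ico (0 : ℤ) (N + 1)

lemma card_box (d N : ℕ) : (box d N).card = (N + 1) ^ d := by
  simp [box]

/-- The (multivariate) Fejér kernel, as a normalised square modulus. -/
noncomputable def fejerKernel (N : ℕ) (z : Torus d) : ℝ :=
  ((N + 1 : ℝ) ^ d)⁻¹ * ‖∑ n ∈ box d N, mFourier n z‖ ^ 2

/-- The Fejér means of a function on the torus. -/
noncomputable def fejer (N : ℕ) (f : Torus d → ℝ) (x : Torus d) : ℝ :=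
  ∫ y, f y * fejerKernel N (x - y)

lemma fejerKernel_nonneg (N : ℕ) (z : Torus d) : 0 ≤ fejerKernel N z := by
  unfold fejerKernel; positivity

lemma continuous_fejerKernel (N : ℕ) : Continuous (fejerKernel (d := d) N) := by
  unfold fejerKernel; fun_prop

lemma fejerKernel_complex (N : ℕ) (z : Torus d) :
    (fejerKernel N z : ℂ)
      = ((N + 1 : ℂ) ^ d)⁻¹ * ∑ n ∈ box d N, ∑ m ∈ box d N, mFourier (n - m) z := by
  unfold fejerKernel
  push_cast
  rw [← Complex.mul_conj', map_sum, Finset.sum_mul_sum]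
  congr 1
  refine Finset.sum_congr rfl fun n _ => Finset.sum_congr rfl fun m _ => ?_
  rw [sub_eq_add_neg, mFourier_add, mFourier_neg]

lemma fejerKernel_sub (N : ℕ) (x y : Torus d) :
    fejerKernel N (x - y) = ((N + 1 : ℝ) ^ d)⁻¹ * ∑ n ∈ box d N, ∑ m ∈ box d N,
      (trig (true, n - m) x * trig (true, n - m) y
        + trig (false, n - m) x * trig (false, n - m) y) := by
  have h := congrArg Complex.re (fejerKernel_complex N (x - y))
  rw [Complex.ofReal_re] at h
  rw [h]
  have h2 : ((N + 1 : ℂ) ^ d)⁻¹ = ((((N + 1 : ℝ) ^ d)⁻¹ : ℝ) : ℂ) := by push_cast; rfl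
  rw [h2, Complex.re_ofReal_mul, Complex.re_sum]
  congr 1
  refine Finset.sum_congr rfl fun n _ => ?_
  rw [Complex.re_sum]
  refine Finset.sum_congr rfl fun m _ => ?_
  rw [mFourier_sub_apply, Complex.mul_re, Complex.conj_re, Complex.conj_im]
  simp [trig]

lemma fejerKernel_symm (N : ℕ) (x y : Torus d) :
    fejerKernel N (x - y) = fejerKernel N (y - x) := by
  rw [fejerKernel_sub, fejerKernel_sub]
  congr 1
  refine Finset.sum_congr rfl fun n _ => Finset.sum_congr rfl fun m _ => by ring

lemma integral_mFourier (k : Fin d → ℤ) :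
    ∫ x : Torus d, mFourier k x = if k = 0 then 1 else 0 := by
  split_ifs with h
  · subst h; simp [mFourier_zero]
  · obtain ⟨i, hi⟩ := Function.ne_iff.1 h
    have hi' : (k i : ℝ) ≠ 0 := by exact_mod_cast hi
    set a : Torus d := toTorus (Pi.single i (1 / (2 * k i))) with ha
    have h1 : mFourier k a = -1 := by
      rw [ha, mFourier_toTorus]
      have : (2 * Real.pi * ∑ j, k j * (Pi.single i (1 / (2 * (k i : ℝ))) : Fin d → ℝ) j)
          = Real.pi := by
        rw [Finset.sum_eq_single i]
        · simp; field_simp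
        · intro j _ hj; simp [hj]
        · simp
      rw [this, Complex.exp_pi_mul_I]
    have h2 := integral_add_right_eq_self (μ := (volume : Measure (Torus d)))
      (fun x => mFourier k x) a
    simp_rw [mFourier_add_apply, h1] at h2
    rw [integral_mul_const] at h2
    have h3 : (∫ x : Torus d, mFourier k x) + ∫ x : Torus d, mFourier k x = 0 := by
      nth_rewrite 1 [← h2]; ring
    simpa [← two_mul] using h3

lemma integrable_mFourier (k : Fin d → ℤ) : Integrable (fun x : Torus d => mFourier k x) :=
  ((mFourier k).continuous.integrable_of_hasCompactSupport
    (HasCompactSupport.of_compactSpace _))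

lemma IsSmooth.integrable_mul {φ : Torus d → ℝ} (h : IsSmooth φ) {f : Torus d → ℝ}
    (hf : Integrable f) : Integrable (fun x => f x * φ x) := by
  obtain ⟨C, -, hC⟩ := h.bounded
  exact hf.mul_bdd (c := C) (h.aestronglyMeasurable _) (Eventually.of_forall hC)

lemma fejer_eq_sum {f : Torus d → ℝ} (hf : Integrable f) (N : ℕ) (x : Torus d) :
    fejer N f x = ((N + 1 : ℝ) ^ d)⁻¹ * ∑ n ∈ box d N, ∑ m ∈ box d N,
      ((∫ y, f y * trig (true, n - m) y) * trig (true, n - m) x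
        + (∫ y, f y * trig (false, n - m) y) * trig (false, n - m) x) := by
  have hi : ∀ b k, Integrable (fun y => f y * trig (b, k) y) := fun b k =>
    (isSmooth_trig (b, k)).integrable_mul hf
  unfold fejer
  have : ∀ y, f y * fejerKernel N (x - y) = ((N + 1 : ℝ) ^ d)⁻¹ * ∑ n ∈ box d N, ∑ m ∈ box d N,
      ((f y * trig (true, n - m) y) * trig (true, n - m) x
        + (f y * trig (false, n - m) y) * trig (false, n - m) x) := by
    intro y
    rw [fejerKernel_sub, mul_left_comm, Finset.mul_sum]
    congr 1
    refine Finset.sum_congr rfl fun n _ => ?_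
    rw [Finset.mul_sum]
    refine Finset.sum_congr rfl fun m _ => by ring
  simp_rw [this]
  have hi2 : ∀ n m : Fin d → ℤ, Integrable (fun y => f y * trig (true, n - m) y *
      trig (true, n - m) x + (f y * trig (false, n - m) y) * trig (false, n - m) x) :=
    fun n m => ((hi _ _).mul_const _).add ((hi _ _).mul_const _)
  rw [integral_const_mul, integral_finsetSum _ fun n _ => integrable_finsetSum _ fun m _ => hi2 n m]
  congr 1
  refine Finset.sum_congr rfl fun n _ => ?_
  rw [integral_finsetSum _ fun m _ => hi2 n m]
  refine Finset.sum_congr rfl fun m _ => ?_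
  rw [integral_add ((hi _ _).mul_const _) ((hi _ _).mul_const _), integral_mul_const,
    integral_mul_const]

lemma isSmooth_fejer {f : Torus d → ℝ} (hf : Integrable f) (N : ℕ) : IsSmooth (fejer N f) := by
  have : fejer N f = fun x => _ := funext (fejer_eq_sum hf N)
  rw [this]
  exact IsSmooth.const_mul _ (IsSmooth.sum fun n _ => IsSmooth.sum fun m _ =>
    ((isSmooth_trig _).const_mul _).add ((isSmooth_trig _).const_mul _))

/-- Fejér means commute with weak derivatives; it is enough to know the weak derivative
against trigonometric monomials. -/
lemma pd_fejer {f h : Torus d → ℝ} (hf : Integrable f) (hh : Integrable h) (j : Fin d)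
    (hw : ∀ k, ∫ y, f y * pd j (trig k) y = -∫ y, h y * trig k y) (N : ℕ) (x : Torus d) :
    pd j (fejer N f) x = fejer N h x := by
  have : fejer N f = fun x => _ := funext (fejer_eq_sum hf N)
  have hs : ∀ n m : Fin d → ℤ, IsSmooth fun x =>
      (∫ y, f y * trig (true, n - m) y) * trig (true, n - m) x
        + (∫ y, f y * trig (false, n - m) y) * trig (false, n - m) x := fun n m =>
    ((isSmooth_trig _).const_mul _).add ((isSmooth_trig _).const_mul _)
  rw [this, pd_const_mul _ (IsSmooth.sum fun n _ => IsSmooth.sum fun m _ => hs n m),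
    pd_sum (fun n _ => IsSmooth.sum fun m _ => hs n m), fejer_eq_sum hh]
  congr 1
  refine Finset.sum_congr rfl fun n _ => ?_
  rw [pd_sum fun m _ => hs n m]
  refine Finset.sum_congr rfl fun m _ => ?_
  rw [pd_add ((isSmooth_trig _).const_mul _) ((isSmooth_trig _).const_mul _),
    pd_const_mul _ (isSmooth_trig _), pd_const_mul _ (isSmooth_trig _), pd_trig_true, pd_trig_false]
  have h1 := hw (true, n - m)
  have h2 := hw (false, n - m)
  simp_rw [pd_trig_true, mul_left_comm (f _)] at h1
  simp_rw [pd_trig_false, mul_left_comm (f _)] at h2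
  rw [integral_const_mul] at h1 h2
  linear_combination (-trig (true, n - m) x) * h1 - trig (false, n - m) x * h2

end Fejer

/-! ### Convergence of Fejér means -/

section FejerConvergence

open UnitAddTorus

variable {d : ℕ}

lemma integral_fejerKernel_right (N : ℕ) (x : Torus d) : ∫ y, fejerKernel N (x - y) = 1 := by
  have h1 : ∫ y, fejerKernel N (x - y) = fejer N (fun _ : Torus d => (1 : ℝ)) x := by
    simp [fejer]
  have h2 : ∀ k : Fin d → ℤ, (∫ y : Torus d, 1 * trig (true, k) y) = if k = 0 then 1 else 0 := by
    intro k
    have := congrArg Complex.re (integral_mFourier k)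
    rw [← RCLike.re_eq_complex_re, ← integral_re (integrable_mFourier k)] at this
    simp only [trig, if_true, one_mul]
    refine Eq.trans this ?_
    split_ifs <;> simp
  have h3 : ∀ k : Fin d → ℤ, (∫ y : Torus d, 1 * trig (false, k) y) = 0 := by
    intro k
    have := congrArg Complex.im (integral_mFourier k)
    rw [← RCLike.im_eq_complex_im, ← integral_im (integrable_mFourier k)] at this
    simp only [trig, Bool.false_eq_true, if_false, one_mul]
    refine Eq.trans this ?_
    split_ifs <;> simp
  rw [h1, fejer_eq_sum (integrable_const 1)]
  simp_rw [h2, h3, sub_eq_zero]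
  have h4 : ∀ n m : Fin d → ℤ, ((if n = m then (1 : ℝ) else 0) * trig (true, n - m) x
      + 0 * trig (false, n - m) x) = if n = m then 1 else 0 := by
    intro n m
    split_ifs with h
    · subst h; simp [trig, mFourier_zero]
    · simp
  simp_rw [h4, Finset.sum_ite_eq]
  rw [Finset.sum_congr rfl (fun n hn => if_pos hn), Finset.sum_const, card_box]
  simp only [nsmul_eq_mul, Nat.cast_pow, Nat.cast_add, Nat.cast_one, mul_one]
  exact inv_mul_cancel₀ (by positivity)

lemma integral_fejerKernel_left (N : ℕ) (y : Torus d) : ∫ x, fejerKernel N (x - y) = 1 := by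
  simp_rw [fejerKernel_symm N _ y]
  exact integral_fejerKernel_right N y

lemma continuous_fejerKernel_right (N : ℕ) (x : Torus d) :
    Continuous fun y : Torus d => fejerKernel N (x - y) :=
  (continuous_fejerKernel N).comp (continuous_const.sub continuous_id)

lemma measurable_fejerKernel_sub (N : ℕ) :
    Measurable fun p : Torus d × Torus d => fejerKernel N (p.1 - p.2) :=
  ((continuous_fejerKernel N).comp (continuous_fst.sub continuous_snd)).measurable

lemma integrable_of_continuous {E : Type*} [NormedAddCommGroup E] {f : Torus d → E}
    (hf : Continuous f) : Integrable f :=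
  hf.integrable_of_hasCompactSupport (HasCompactSupport.of_compactSpace f)

lemma integrable_fejerKernel_right (N : ℕ) (x : Torus d) :
    Integrable fun y => fejerKernel N (x - y) :=
  integrable_of_continuous (continuous_fejerKernel_right N x)

lemma integrable_continuousMap_mul_fejerKernel (Q : C(Torus d, ℂ)) (N : ℕ) (x : Torus d) :
    Integrable fun y => Q y * (fejerKernel N (x - y) : ℂ) :=
  integrable_of_continuous
    (Q.continuous.mul (Complex.continuous_ofReal.comp (continuous_fejerKernel_right N x)))

lemma integrable_mul_fejerKernel {f : Torus d → ℝ} (hf : Integrable f) (N : ℕ) (x : Torus d) :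
    Integrable fun y => f y * fejerKernel N (x - y) := by
  have hc := continuous_fejerKernel_right N x
  obtain ⟨C, hC⟩ := isCompact_univ.exists_bound_of_continuousOn hc.continuousOn
  exact hf.mul_bdd (c := C) hc.aestronglyMeasurable (Eventually.of_forall fun y => hC y trivial)

lemma fejer_sub {f g : Torus d → ℝ} (hf : Integrable f) (hg : Integrable g) (N : ℕ)
    (x : Torus d) : fejer N (fun y => f y - g y) x = fejer N f x - fejer N g x := by
  unfold fejer
  simp_rw [sub_mul]
  exact integral_sub (integrable_mul_fejerKernel hf N x) (integrable_mul_fejerKernel hg N x)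

lemma abs_fejer_le {f : Torus d → ℝ} {C : ℝ} (hf : ∀ x, |f x| ≤ C) (N : ℕ) (x : Torus d) :
    |fejer N f x| ≤ C := by
  calc |fejer N f x| ≤ ∫ y, |f y * fejerKernel N (x - y)| := abs_integral_le_integral_abs
    _ ≤ ∫ y, C * fejerKernel N (x - y) := by
        refine integral_mono_of_nonneg (Eventually.of_forall fun y => abs_nonneg _)
          ((integrable_fejerKernel_right N x).const_mul C) (Eventually.of_forall fun y => ?_)
        simp only [abs_mul, abs_of_nonneg (fejerKernel_nonneg N (x - y))]
        exact mul_le_mul_of_nonneg_right (hf y) (fejerKernel_nonneg N _)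
    _ = C := by rw [integral_const_mul, integral_fejerKernel_right, mul_one]

/-- The multiplier of the Fejér mean at a given frequency. -/
lemma integral_mFourier_mul_fejerKernel (N : ℕ) (k : Fin d → ℤ) (x : Torus d) :
    ∫ y, mFourier k y * (fejerKernel N (x - y) : ℂ)
      = ((∏ i, (((N + 1 : ℕ) : ℝ) - |k i|) ⊔ 0) / (N + 1 : ℝ) ^ d : ℝ) * mFourier k x := by
  have h1 : ∫ y, mFourier k y * (fejerKernel N (x - y) : ℂ)
      = ∫ y, mFourier k x * (mFourier k y * (fejerKernel N y : ℂ)) := by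
    rw [← integral_add_right_eq_self _ x]
    refine integral_congr_ae (Eventually.of_forall fun y => ?_)
    simp only
    rw [fejerKernel_symm, add_sub_cancel_right, mFourier_add_apply]
    ring
  have h2 : ∀ y : Torus d, mFourier k y * (fejerKernel N y : ℂ)
      = ((N + 1 : ℂ) ^ d)⁻¹ * ∑ n ∈ box d N, ∑ m ∈ box d N, mFourier (k + (n - m)) y := by
    intro y
    rw [fejerKernel_complex, mul_left_comm, Finset.mul_sum]
    simp_rw [Finset.mul_sum, mFourier_add]
  rw [h1, integral_const_mul]
  simp_rw [h2]
  rw [integral_const_mul, integral_finsetSum _ fun n _ => integrable_finsetSum _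
    fun m _ => integrable_mFourier _]
  have h3 : ∀ n ∈ box d N, ∫ y, ∑ m ∈ box d N, mFourier (k + (n - m)) y
      = if k + n ∈ box d N then (1 : ℂ) else 0 := by
    intro n _
    rw [integral_finsetSum _ fun m _ => integrable_mFourier _]
    simp_rw [integral_mFourier, ← add_sub_assoc, sub_eq_zero, Finset.sum_ite_eq]
  rw [Finset.sum_congr rfl h3, ← Finset.sum_filter, Finset.sum_const, nsmul_eq_mul, mul_one]
  have h4 : (box d N).filter (fun n => k + n ∈ box d N)
      = Fintype.piFinset fun i => Finset.Ico (max 0 (-k i)) (min (N + 1 : ℤ) (N + 1 - k i)) := by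
    ext n
    simp only [box, Finset.mem_filter, Fintype.mem_piFinset, Finset.mem_Ico, Pi.add_apply,
      ← forall_and]
    refine forall_congr' fun i => ?_
    omega
  have h5 : (((box d N).filter (fun n => k + n ∈ box d N)).card : ℝ)
      = ∏ i, (((N + 1 : ℕ) : ℝ) - |k i|) ⊔ 0 := by
    rw [h4, Fintype.card_piFinset, Nat.cast_prod]
    refine Finset.prod_congr rfl fun i _ => ?_
    rw [Int.card_Ico]
    have : ((min (N + 1 : ℤ) (N + 1 - k i) - max 0 (-k i)).toNat : ℤ)
        = max (((N + 1 : ℕ) : ℤ) - |k i|) 0 := by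
      rw [Int.toNat_eq_max]
      push_cast
      rcases abs_cases (k i) with ⟨h, _⟩ | ⟨h, _⟩ <;> rw [h] <;> omega
    exact_mod_cast congrArg (Int.cast : ℤ → ℝ) this
  have h6 : (((box d N).filter (fun n => k + n ∈ box d N)).card : ℂ)
      = ((∏ i, (((N + 1 : ℕ) : ℝ) - |k i|) ⊔ 0 : ℝ) : ℂ) := by
    rw [← h5]; simp
  rw [h6]
  push_cast
  ring

lemma tendsto_fejer_multiplier (k : Fin d → ℤ) :
    Tendsto (fun N : ℕ => (∏ i, (((N + 1 : ℕ) : ℝ) - |k i|) ⊔ 0) / (N + 1 : ℝ) ^ d) atTop (𝓝 1) := by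
  have h1 : ∀ N : ℕ, (∏ i, (((N + 1 : ℕ) : ℝ) - |k i|) ⊔ 0) / (N + 1 : ℝ) ^ d
      = ∏ i, ((1 - |(k i : ℝ)| * (1 / ((N : ℝ) + 1))) ⊔ 0) := by
    intro N
    have : ((N : ℝ) + 1) ^ d = ∏ _i : Fin d, ((N : ℝ) + 1) := by simp
    rw [this, ← Finset.prod_div_distrib]
    refine Finset.prod_congr rfl fun i _ => ?_
    have hN : (0 : ℝ) < N + 1 := by positivity
    rw [← max_div_div_right hN.le]
    congr 1
    · push_cast; field_simp
    · simp
  simp_rw [h1]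
  have h2 : ∀ i : Fin d, Tendsto (fun N : ℕ => ((1 - |(k i : ℝ)| * (1 / ((N : ℝ) + 1))) ⊔ 0))
      atTop (𝓝 1) := by
    intro i
    have h3 := ((tendsto_one_div_add_atTop_nhds_zero_nat (𝕜 := ℝ)).const_mul
      (|(k i : ℝ)|)).const_sub 1
    simpa using h3.max (tendsto_const_nhds (x := (0 : ℝ)))
  simpa using tendsto_finsetProd Finset.univ fun i _ => h2 i

/-- Fejér means of trigonometric polynomials converge uniformly. -/
lemma fejer_trigPoly (P : C(Torus d, ℂ)) (hP : P ∈ Submodule.span ℂ (range (mFourier (d := Fin d)))) :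
    ∀ ε > 0, ∀ᶠ N in atTop, ∀ x, ‖(∫ y, P y * (fejerKernel N (x - y) : ℂ)) - P x‖ ≤ ε := by
  have hint := integrable_continuousMap_mul_fejerKernel (d := d)
  induction hP using Submodule.span_induction with
  | mem P hP =>
    obtain ⟨k, rfl⟩ := hP
    intro ε hε
    have h := (tendsto_fejer_multiplier k).eventually (Metric.closedBall_mem_nhds 1 hε)
    filter_upwards [h] with N hN x
    rw [integral_mFourier_mul_fejerKernel]
    simp only [Real.dist_eq] at hN
    set c := (∏ i, (((N + 1 : ℕ) : ℝ) - |k i|) ⊔ 0) / (N + 1 : ℝ) ^ d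
    have h1 : (c : ℂ) * mFourier k x - mFourier k x = ((c - 1 : ℝ) : ℂ) * mFourier k x := by
      push_cast; ring
    have h2 : ‖mFourier k x‖ ≤ 1 := ((mFourier k).norm_coe_le_norm x).trans mFourier_norm.le
    rw [h1, norm_mul, Complex.norm_real, Real.norm_eq_abs]
    nlinarith [abs_nonneg (c - 1), norm_nonneg (mFourier k x)]
  | zero => intro ε hε; exact Eventually.of_forall fun N x => by simpa using hε.le
  | add P Q _ _ hP hQ =>
    intro ε hε
    filter_upwards [hP (ε / 2) (half_pos hε), hQ (ε / 2) (half_pos hε)] with N h1 h2 x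
    simp_rw [ContinuousMap.add_apply, add_mul]
    rw [integral_add (hint P N x) (hint Q N x)]
    calc _ = ‖((∫ y, P y * (fejerKernel N (x - y) : ℂ)) - P x)
            + ((∫ y, Q y * (fejerKernel N (x - y) : ℂ)) - Q x)‖ := by ring_nf
      _ ≤ _ := norm_add_le _ _
      _ ≤ ε := by linarith [h1 x, h2 x]
  | smul a P _ hP =>
    intro ε hε
    filter_upwards [hP (ε / (‖a‖ + 1)) (by positivity)] with N h1 x
    simp_rw [ContinuousMap.smul_apply, smul_eq_mul, mul_assoc]
    rw [integral_const_mul, ← mul_sub, norm_mul]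
    have h3 := h1 x
    rw [le_div_iff₀ (by positivity)] at h3
    nlinarith [norm_nonneg a, norm_nonneg ((∫ y, P y * (fejerKernel N (x - y) : ℂ)) - P x)]

/-- Fejér means of continuous functions converge uniformly. -/
lemma fejer_tendsto_uniform {f : Torus d → ℝ} (hf : Continuous f) :
    ∀ ε > 0, ∀ᶠ N in atTop, ∀ x, |fejer N f x - f x| ≤ ε := by
  intro ε hε
  set F : C(Torus d, ℂ) := ⟨fun x => (f x : ℂ), by fun_prop⟩ with hF
  have hmem : F ∈ (Submodule.span ℂ (range <| mFourier (d := Fin d))).topologicalClosure := by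
    rw [span_mFourier_closure_eq_top]; trivial
  obtain ⟨P, hP, hPF⟩ := Metric.mem_closure_iff.1 hmem (ε / 3) (by positivity)
  have hPx : ∀ x, ‖(f x : ℂ) - P x‖ ≤ ε / 3 := fun x => by
    have := ContinuousMap.dist_apply_le_dist (f := F) (g := P) x
    rw [dist_eq_norm] at this
    exact this.trans hPF.le
  have hre : ∀ x, |f x - (P x).re| ≤ ε / 3 := fun x => by
    have := (Complex.abs_re_le_norm _).trans (hPx x)
    simpa using this
  have hPc : Continuous fun x => (P x).re := by fun_prop
  filter_upwards [fejer_trigPoly P hP (ε / 3) (by positivity)] with N hN x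
  have hi : ∀ {g : Torus d → ℝ}, Continuous g → Integrable g := fun hg =>
    integrable_of_continuous hg
  have h1 : |fejer N f x - fejer N (fun x => (P x).re) x| ≤ ε / 3 := by
    rw [← fejer_sub (hi hf) (hi hPc)]
    exact abs_fejer_le hre N x
  have h2 : |fejer N (fun x => (P x).re) x - (P x).re| ≤ ε / 3 := by
    have hint := integrable_continuousMap_mul_fejerKernel P N x
    have h3 := (Complex.abs_re_le_norm _).trans (hN x)
    rw [Complex.sub_re, ← RCLike.re_eq_complex_re, ← integral_re hint] at h3
    simpa [fejer] using h3
  have h4 := hre x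
  rw [abs_le] at *
  constructor <;> linarith [h1.1, h1.2, h2.1, h2.2, h4.1, h4.2]

lemma integral_fejerKernel_enorm_left (N : ℕ) (y : Torus d) :
    ∫⁻ x, ENNReal.ofReal (fejerKernel N (x - y)) = 1 := by
  rw [← ofReal_integral_eq_lintegral_ofReal _ (Eventually.of_forall fun x => fejerKernel_nonneg _ _),
    integral_fejerKernel_left, ENNReal.ofReal_one]
  simp_rw [fejerKernel_symm N _ y]
  exact integrable_fejerKernel_right N y

/-- Fejér means are contractions of `L^q`, by Jensen's inequality. -/
lemma eLpNorm_fejer_le {q : ℝ≥0∞} (hq : 1 ≤ q) (hq' : q ≠ ⊤) {f : Torus d → ℝ}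
    (hf : AEStronglyMeasurable f) (N : ℕ) :
    eLpNorm (fejer N f) q volume ≤ eLpNorm f q volume := by
  have hq0 : q ≠ 0 := (zero_lt_one.trans_le hq).ne'
  have hqr : 0 < q.toReal := ENNReal.toReal_pos hq0 hq'
  have hkm : Measurable fun p : Torus d × Torus d => ENNReal.ofReal (fejerKernel N (p.1 - p.2)) :=
    (measurable_fejerKernel_sub N).ennreal_ofReal
  have hkx : ∀ x : Torus d, Measurable fun y => ENNReal.ofReal (fejerKernel N (x - y)) := fun x =>
    (continuous_fejerKernel_right N x).measurable.ennreal_ofReal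
  have key : ∀ x, ‖fejer N f x‖ₑ ^ q.toReal
      ≤ ∫⁻ y, ‖f y‖ₑ ^ q.toReal * ENNReal.ofReal (fejerKernel N (x - y)) := by
    intro x
    set μ : Measure (Torus d) :=
      volume.withDensity fun y => ENNReal.ofReal (fejerKernel N (x - y)) with hμ
    have : IsProbabilityMeasure μ := ⟨by
      rw [hμ, withDensity_apply _ MeasurableSet.univ, Measure.restrict_univ]
      simp_rw [fejerKernel_symm N x]
      exact integral_fejerKernel_enorm_left N x⟩
    have hfμ : AEStronglyMeasurable f μ := hf.mono_ac (withDensity_absolutelyContinuous _ _)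
    have h1 : ‖fejer N f x‖ₑ ≤ eLpNorm f 1 μ := by
      rw [eLpNorm_one_eq_lintegral_enorm, hμ,
        lintegral_withDensity_eq_lintegral_mul₀ (hkx x).aemeasurable hf.enorm]
      refine (enorm_integral_le_lintegral_enorm _).trans (lintegral_mono fun y => ?_)
      rw [enorm_mul, Real.enorm_eq_ofReal (fejerKernel_nonneg N _), mul_comm]
      rfl
    have h2 := h1.trans (eLpNorm_le_eLpNorm_of_exponent_le hq hfμ)
    have h3 := ENNReal.rpow_le_rpow h2 hqr.le
    refine h3.trans (le_of_eq ?_)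
    rw [eLpNorm_eq_lintegral_rpow_enorm_toReal hq0 hq', ← ENNReal.rpow_mul,
      one_div_mul_cancel hqr.ne', ENNReal.rpow_one, hμ,
      lintegral_withDensity_eq_lintegral_mul₀ (hkx x).aemeasurable (hf.enorm.pow_const _)]
    refine lintegral_congr fun y => ?_
    rw [mul_comm]; rfl
  rw [eLpNorm_eq_lintegral_rpow_enorm_toReal hq0 hq', eLpNorm_eq_lintegral_rpow_enorm_toReal hq0 hq']
  refine ENNReal.rpow_le_rpow ((lintegral_mono key).trans ?_) (by positivity)
  rw [lintegral_lintegral_swap]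
  · refine le_of_eq (lintegral_congr fun y => ?_)
    rw [lintegral_const_mul]
    · rw [integral_fejerKernel_enorm_left, mul_one]
    · simp_rw [fejerKernel_symm N _ y]; exact hkx y
  · exact ((hf.enorm.pow_const _).comp_snd).mul hkm.aemeasurable

/-- Fejér means converge in `L^q`, `1 ≤ q < ∞`. -/
lemma tendsto_eLpNorm_fejer_sub {q : ℝ≥0∞} (hq : 1 ≤ q) (hq' : q ≠ ⊤) {f : Torus d → ℝ}
    (hf : MemLp f q) :
    Tendsto (fun N => eLpNorm (fun x => fejer N f x - f x) q volume) atTop (𝓝 0) := by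
  rw [ENNReal.tendsto_nhds_zero]
  intro ε hε
  have hε3 : ε / 3 ≠ 0 := (ENNReal.div_pos hε.ne' (by simp)).ne'
  obtain ⟨g, hg, hgm⟩ := hf.exists_boundedContinuous_eLpNorm_sub_le hq' hε3
  rcases eq_or_ne ε ⊤ with rfl | hεt
  · exact Eventually.of_forall fun _ => le_top
  have hpos : 0 < (ε / 3).toReal := ENNReal.toReal_pos hε3 (ENNReal.div_lt_top hεt (by simp)).ne
  filter_upwards [fejer_tendsto_uniform g.continuous _ hpos] with N hN
  have hfi : Integrable f := hf.integrable hq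
  have hgi : Integrable g := hgm.integrable hq
  have hsm := fun {h : Torus d → ℝ} (hh : Integrable h) =>
    (isSmooth_fejer hh N).aestronglyMeasurable volume
  have e1 : (fun x => fejer N f x - f x) = (fejer N (fun x => f x - g x))
      + ((fun x => fejer N g x - g x) + ((g : Torus d → ℝ) - f)) := by
    funext x
    simp only [Pi.add_apply, Pi.sub_apply, fejer_sub hfi hgi]
    ring
  have h1 : eLpNorm (fejer N (fun x => f x - g x)) q volume ≤ ε / 3 :=
    (eLpNorm_fejer_le hq hq' (hf.1.sub hgm.1) N).trans hg
  have h2 : eLpNorm (fun x => fejer N g x - g x) q volume ≤ ε / 3 := by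
    refine (eLpNorm_le_of_ae_bound (C := (ε / 3).toReal)
      (Eventually.of_forall fun x => hN x)).trans ?_
    rw [ENNReal.ofReal_toReal (ENNReal.div_lt_top hεt (by simp : (3 : ℝ≥0∞) ≠ 0)).ne]
    simp
  have h3 : eLpNorm ((g : Torus d → ℝ) - f) q volume ≤ ε / 3 := by
    rw [eLpNorm_sub_comm]; exact hg
  rw [e1]
  refine (eLpNorm_add_le (hsm (hfi.sub hgi)) (((hsm hgi).sub hgm.1).add (hgm.1.sub hf.1)) hq).trans ?_
  refine (add_le_add h1 ((eLpNorm_add_le ((hsm hgi).sub hgm.1) (hgm.1.sub hf.1) hq).trans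
    (add_le_add h2 h3))).trans ?_
  rw [← add_assoc, ENNReal.add_thirds]

/-- Smooth functions are dense in `L^p(ν)` for every finite measure `ν` on the torus. -/
lemma exists_isSmooth_eLpNorm_sub_le {ν : Measure (Torus d)} [IsFiniteMeasure ν] {p : ℝ≥0∞}
    (hp : 1 ≤ p) (hp' : p ≠ ⊤) {f : Torus d → ℝ} (hf : MemLp f p ν) {ε : ℝ≥0∞} (hε : ε ≠ 0) :
    ∃ φ, IsSmooth φ ∧ eLpNorm (fun x => f x - φ x) p ν ≤ ε := by
  have hε2 : ε / 2 ≠ 0 := (ENNReal.div_pos hε (by simp)).ne'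
  obtain ⟨g, hg, hgm⟩ := hf.exists_boundedContinuous_eLpNorm_sub_le hp' hε2
  have hgi : Integrable g := integrable_of_continuous g.continuous
  set M := ν univ ^ p.toReal⁻¹ with hM
  have hMt : M ≠ ⊤ := ENNReal.rpow_ne_top_of_nonneg (by positivity) (measure_ne_top ν _)
  obtain ⟨δ, hδ, hδM⟩ : ∃ δ : ℝ, 0 < δ ∧ M * ENNReal.ofReal δ ≤ ε / 2 := by
    rcases eq_or_ne ε ⊤ with rfl | hεt
    · exact ⟨1, one_pos, by simp [ENNReal.top_div]⟩
    · have hm : (0 : ℝ) < M.toReal + 1 := by positivity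
      have he : 0 < (ε / 2).toReal :=
        ENNReal.toReal_pos hε2 (ENNReal.div_lt_top hεt (by simp)).ne
      refine ⟨(ε / 2).toReal / (M.toReal + 1), by positivity, ?_⟩
      rw [← ENNReal.ofReal_toReal hMt, ← ENNReal.ofReal_mul (by positivity),
        ENNReal.ofReal_toReal hMt]
      conv_rhs => rw [← ENNReal.ofReal_toReal (ENNReal.div_lt_top hεt (by simp : (2:ℝ≥0∞) ≠ 0)).ne]
      refine ENNReal.ofReal_le_ofReal ?_
      rw [mul_div_assoc', div_le_iff₀ hm]
      nlinarith
  obtain ⟨N, hN⟩ := (fejer_tendsto_uniform g.continuous δ hδ).exists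
  refine ⟨fejer N g, isSmooth_fejer hgi N, ?_⟩
  have e1 : (fun x => f x - fejer N g x) = (f - g) + fun x => g x - fejer N g x := by
    funext x; simp
  have hgs : AEStronglyMeasurable (fun x => g x - fejer N g x) ν :=
    hgm.1.sub ((isSmooth_fejer hgi N).aestronglyMeasurable ν)
  rw [e1]
  refine (eLpNorm_add_le (hf.1.sub hgm.1) hgs hp).trans ?_
  rw [← ENNReal.add_halves ε]
  refine add_le_add hg ((eLpNorm_le_of_ae_bound (C := δ)
    (Eventually.of_forall fun x => ?_)).trans hδM)
  rw [Real.norm_eq_abs, abs_sub_comm]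
  exact hN x

/-- An integrable function orthogonal to all trigonometric monomials vanishes. -/
lemma ae_eq_zero_of_integral_mul_trig {f : Torus d → ℝ} (hf : Integrable f)
    (h : ∀ k, ∫ x, f x * trig k x = 0) : f =ᵐ[volume] 0 := by
  have h0 : ∀ N x, fejer N f x = 0 := fun N x => by rw [fejer_eq_sum hf]; simp [h]
  have h1 := tendsto_eLpNorm_fejer_sub le_rfl ENNReal.one_ne_top (memLp_one_iff_integrable.2 hf)
  simp only [h0, zero_sub] at h1
  have h2 := tendsto_nhds_unique h1 tendsto_const_nhds
  have h3 : eLpNorm f 1 volume = 0 := by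
    rw [← eLpNorm_neg]; exact h2.symm
  exact (eLpNorm_eq_zero_iff hf.1 one_ne_zero).1 h3

lemma ae_eq_of_integral_mul_smooth {f g : Torus d → ℝ} (hf : Integrable f) (hg : Integrable g)
    (h : ∀ φ, IsSmooth φ → ∫ x, f x * φ x = ∫ x, g x * φ x) : f =ᵐ[volume] g := by
  have := ae_eq_zero_of_integral_mul_trig (hf.sub hg) fun k => by
    simp_rw [Pi.sub_apply, sub_mul]
    rw [integral_sub ((isSmooth_trig k).integrable_mul hf) ((isSmooth_trig k).integrable_mul hg),
      h _ (isSmooth_trig k), sub_self]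
  filter_upwards [this] with x hx
  simpa [sub_eq_zero] using hx

end FejerConvergence

/-! ### Mixed Lebesgue norms -/

section MixedNorm

variable {d : ℕ}

lemma eLpNorm_ofReal {α ε : Type*} [MeasurableSpace α] [ENorm ε] {μ : Measure α} (f : α → ε)
    {p : ℝ} (hp : 0 < p) :
    eLpNorm f (ENNReal.ofReal p) μ = (∫⁻ x, ‖f x‖ₑ ^ p ∂μ) ^ (1 / p) := by
  rw [eLpNorm_eq_lintegral_rpow_enorm_toReal (by simpa using hp) ENNReal.ofReal_ne_top,
    ENNReal.toReal_ofReal hp.le]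

/-- Hölder's inequality for extended nonnegative functions. -/
lemma eLpNorm_ennreal_mul_le {α : Type*} [MeasurableSpace α] {μ : Measure α} {F G : α → ℝ≥0∞}
    (hF : AEMeasurable F μ) (hG : AEMeasurable G μ) {p p₁ p₂ : ℝ} (hp : 0 < p) (hp₁ : 0 < p₁)
    (hp₂ : 0 < p₂) (h : 1 / p = 1 / p₁ + 1 / p₂) :
    eLpNorm (fun x => F x * G x) (ENNReal.ofReal p) μ
      ≤ eLpNorm F (ENNReal.ofReal p₁) μ * eLpNorm G (ENNReal.ofReal p₂) μ := by
  rw [eLpNorm_ofReal _ hp, eLpNorm_ofReal _ hp₁, eLpNorm_ofReal _ hp₂]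
  have hlt : p < p₁ := by
    rw [← one_div_lt_one_div hp₁ hp, h]
    have : 0 < 1 / p₂ := by positivity
    linarith
  exact ENNReal.lintegral_Lp_mul_le_Lq_mul_Lr hp hlt h μ hF hG

lemma eLpNorm_real_mul_le {α : Type*} [MeasurableSpace α] {μ : Measure α} {f g : α → ℝ}
    (hf : AEStronglyMeasurable f μ) (hg : AEStronglyMeasurable g μ) {p p₁ p₂ : ℝ} (hp : 0 < p)
    (hp₁ : 0 < p₁) (hp₂ : 0 < p₂) (h : 1 / p = 1 / p₁ + 1 / p₂) :
    eLpNorm (fun x => f x * g x) (ENNReal.ofReal p) μ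
      ≤ eLpNorm f (ENNReal.ofReal p₁) μ * eLpNorm g (ENNReal.ofReal p₂) μ := by
  have := eLpNorm_ennreal_mul_le hf.enorm hg.enorm hp hp₁ hp₂ h
  rw [eLpNorm_ofReal _ hp, eLpNorm_ofReal _ hp₁, eLpNorm_ofReal _ hp₂] at this ⊢
  simpa [enorm_mul] using this

/-- Hölder's inequality in the form `‖f g‖_1 ≤ ‖f‖_q ‖g‖_q'`. -/
lemma lintegral_enorm_mul_le {α : Type*} [MeasurableSpace α] {μ : Measure α} {f g : α → ℝ}
    (hf : AEStronglyMeasurable f μ) (hg : AEStronglyMeasurable g μ) {q q' : ℝ}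
    (h : q.HolderConjugate q') :
    ∫⁻ x, ‖f x * g x‖ₑ ∂μ ≤ eLpNorm f (ENNReal.ofReal q) μ * eLpNorm g (ENNReal.ofReal q') μ := by
  have := eLpNorm_real_mul_le hf hg one_pos h.pos h.symm.pos
    (by rw [one_div_one, one_div, one_div, h.inv_add_inv_eq_one])
  rwa [ENNReal.ofReal_one, eLpNorm_one_eq_lintegral_enorm] at this

instance (T : ℝ) : IsFiniteMeasure (slab d T) := by unfold slab; infer_instance

variable {T : ℝ}

lemma ae_aestronglyMeasurable_slice {F : Type*} [NormedAddCommGroup F] {f : ℝ → Torus d → F}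
    (hf : AEStronglyMeasurable (fun z : ℝ × Torus d => f z.1 z.2) (slab d T)) :
    ∀ᵐ t ∂((volume : Measure ℝ).restrict (Ioo 0 T)), AEStronglyMeasurable (f t) :=
  hf.prodMk_left

lemma aemeasurable_slice_eLpNorm {F : Type*} [NormedAddCommGroup F] {f : ℝ → Torus d → F}
    (hf : AEStronglyMeasurable (fun z : ℝ × Torus d => f z.1 z.2) (slab d T)) {q : ℝ}
    (hq : 0 < q) :
    AEMeasurable (fun t => eLpNorm (f t) (ENNReal.ofReal q) volume)
      ((volume : Measure ℝ).restrict (Ioo 0 T)) := by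
  simp_rw [eLpNorm_ofReal _ hq]
  exact (AEMeasurable.lintegral_prod_right'
    (f := fun z : ℝ × Torus d => ‖f z.1 z.2‖ₑ ^ q) (hf.enorm.pow_const q)).pow_const _

lemma MemLpLq.mono_norm {F G : Type*} [NormedAddCommGroup F] [NormedAddCommGroup G] {p q : ℝ≥0∞}
    {f : ℝ → Torus d → F} {g : ℝ → Torus d → G} (hg : MemLpLq T p q g)
    (hf : AEStronglyMeasurable (fun z : ℝ × Torus d => f z.1 z.2) (slab d T))
    (h : ∀ᵐ z ∂(slab d T), ‖f z.1 z.2‖ ≤ ‖g z.1 z.2‖) : MemLpLq T p q f := by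
  refine ⟨hf, lt_of_le_of_lt (eLpNorm_mono_enorm_ae ?_) hg.2⟩
  filter_upwards [Measure.ae_ae_of_ae_prod h] with t ht
  simp only [enorm_eq_self]
  exact eLpNorm_mono_ae ht

lemma MemLpLq.mono_exponent {F : Type*} [NormedAddCommGroup F] {p q p' q' : ℝ}
    {f : ℝ → Torus d → F} (hf : MemLpLq T (ENNReal.ofReal p) (ENNReal.ofReal q) f)
    (hp : p' ≤ p) (hq0 : 0 < q) (hq : q' ≤ q) :
    MemLpLq T (ENNReal.ofReal p') (ENNReal.ofReal q') f := by
  refine ⟨hf.1, ?_⟩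
  have h1 : eLpNorm (fun t : ℝ => eLpNorm (f t) (ENNReal.ofReal q') (volume : Measure (Torus d)))
      (ENNReal.ofReal p') ((volume : Measure ℝ).restrict (Ioo 0 T)) ≤
      eLpNorm (fun t : ℝ => eLpNorm (f t) (ENNReal.ofReal q) (volume : Measure (Torus d)))
      (ENNReal.ofReal p') ((volume : Measure ℝ).restrict (Ioo 0 T)) := by
    refine eLpNorm_mono_enorm_ae ?_
    filter_upwards [ae_aestronglyMeasurable_slice hf.1] with t ht
    simp only [enorm_eq_self]
    exact eLpNorm_le_eLpNorm_of_exponent_le (ENNReal.ofReal_le_ofReal hq) ht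
  refine h1.trans_lt ?_
  by_cases hp0 : p' ≤ 0
  · simp [ENNReal.ofReal_of_nonpos hp0]
  rw [not_le] at hp0
  refine (eLpNorm_le_eLpNorm_mul_rpow_measure_univ (ENNReal.ofReal_le_ofReal hp)
    (aemeasurable_slice_eLpNorm hf.1 hq0).aestronglyMeasurable).trans_lt ?_
  refine ENNReal.mul_lt_top hf.2 (ENNReal.rpow_lt_top_of_nonneg ?_ (measure_ne_top _ _))
  rw [ENNReal.toReal_ofReal hp0.le, ENNReal.toReal_ofReal (hp0.le.trans hp), sub_nonneg]
  exact one_div_le_one_div_of_le hp0 hp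

lemma MemLpLq.mul {p q p₁ q₁ p₂ q₂ : ℝ} {f g : ℝ → Torus d → ℝ}
    (hf : MemLpLq T (ENNReal.ofReal p₁) (ENNReal.ofReal q₁) f)
    (hg : MemLpLq T (ENNReal.ofReal p₂) (ENNReal.ofReal q₂) g)
    (hp : 0 < p) (hp₁ : 0 < p₁) (hp₂ : 0 < p₂) (h : 1 / p = 1 / p₁ + 1 / p₂)
    (hq : 0 < q) (hq₁ : 0 < q₁) (hq₂ : 0 < q₂) (h' : 1 / q = 1 / q₁ + 1 / q₂) :
    MemLpLq T (ENNReal.ofReal p) (ENNReal.ofReal q) (fun t x => f t x * g t x) := by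
  refine ⟨hf.1.mul hg.1, lt_of_le_of_lt ((eLpNorm_mono_enorm_ae ?_).trans
    (eLpNorm_ennreal_mul_le (aemeasurable_slice_eLpNorm hf.1 hq₁)
      (aemeasurable_slice_eLpNorm hg.1 hq₂) hp hp₁ hp₂ h)) (ENNReal.mul_lt_top hf.2 hg.2)⟩
  filter_upwards [ae_aestronglyMeasurable_slice hf.1, ae_aestronglyMeasurable_slice hg.1]
    with t h1 h2
  simp only [enorm_eq_self]
  exact eLpNorm_real_mul_le h1 h2 hq hq₁ hq₂ h'

lemma MemLpLq.add {p q : ℝ≥0∞} {f g : ℝ → Torus d → ℝ} (hf : MemLpLq T p q f)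
    (hg : MemLpLq T p q g) (hp : 1 ≤ p) (hq : 1 ≤ q) (hq' : q ≠ ⊤) :
    MemLpLq T p q (fun t x => f t x + g t x) := by
  obtain ⟨q, rfl⟩ : ∃ q' : ℝ, q = ENNReal.ofReal q' := ⟨q.toReal, (ENNReal.ofReal_toReal hq').symm⟩
  have hq0 : 0 < q := by
    by_contra h; rw [ENNReal.ofReal_of_nonpos (not_lt.1 h)] at hq; simp at hq
  refine ⟨hf.1.add hg.1, lt_of_le_of_lt ((eLpNorm_mono_enorm_ae ?_).trans
    (eLpNorm_add_le (aemeasurable_slice_eLpNorm hf.1 hq0).aestronglyMeasurable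
      (aemeasurable_slice_eLpNorm hg.1 hq0).aestronglyMeasurable hp)) (ENNReal.add_lt_top.2
        ⟨hf.2, hg.2⟩)⟩
  filter_upwards [ae_aestronglyMeasurable_slice hf.1, ae_aestronglyMeasurable_slice hg.1]
    with t h1 h2
  simp only [enorm_eq_self, Pi.add_apply]
  exact eLpNorm_add_le h1 h2 hq

lemma MemLpLq.const_mul {p q : ℝ≥0∞} {f : ℝ → Torus d → ℝ} (hf : MemLpLq T p q f) (c : ℝ) :
    MemLpLq T p q (fun t x => c * f t x) := by
  refine ⟨hf.1.const_mul c, ?_⟩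
  have : ∀ t, eLpNorm (fun x => c * f t x) q volume = ‖c‖ₑ * eLpNorm (f t) q volume := fun t =>
    eLpNorm_const_smul c (f t) q volume
  simp_rw [this]
  have h2 := eLpNorm_le_nnreal_smul_eLpNorm_of_ae_le_mul' (p := p)
    (μ := (volume : Measure ℝ).restrict (Ioo 0 T)) (c := ‖c‖₊)
    (f := fun t => ‖c‖ₑ * eLpNorm (f t) q volume) (g := fun t => eLpNorm (f t) q volume)
    (Eventually.of_forall fun t => le_rfl)
  refine h2.trans_lt ?_
  exact ENNReal.mul_lt_top (by simp) hf.2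

lemma memLpLq_finset_sum {ι : Type*} (s : Finset ι) {p q : ℝ≥0∞} {f : ι → ℝ → Torus d → ℝ}
    (hf : ∀ i ∈ s, MemLpLq T p q (f i)) (hp : 1 ≤ p) (hq : 1 ≤ q) (hq' : q ≠ ⊤) :
    MemLpLq T p q (fun t x => ∑ i ∈ s, f i t x) := by
  classical
  induction s using Finset.induction_on with
  | empty =>
    refine ⟨by simpa using aestronglyMeasurable_const, ?_⟩
    simp [eLpNorm_zero']
  | insert a s ha ih =>
    simp_rw [Finset.sum_insert ha]
    exact (hf a (Finset.mem_insert_self a s)).add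
      (ih fun i hi => hf i (Finset.mem_insert_of_mem hi)) hp hq hq'

lemma MemLpLq.norm_rpow {F : Type*} [NormedAddCommGroup F] {p q s : ℝ} {f : ℝ → Torus d → F}
    (hf : MemLpLq T (ENNReal.ofReal p) (ENNReal.ofReal q) f) (hp : 0 < p) (hq : 0 < q)
    (hs : 0 < s) :
    MemLpLq T (ENNReal.ofReal (p / s)) (ENNReal.ofReal (q / s)) (fun t x => ‖f t x‖ ^ s) := by
  refine ⟨(hf.1.norm.aemeasurable.pow_const s).aestronglyMeasurable, ?_⟩
  have h1 : ∀ t, eLpNorm (fun x => ‖f t x‖ ^ s) (ENNReal.ofReal (q / s)) volume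
      = eLpNorm (f t) (ENNReal.ofReal q) volume ^ s := by
    intro t
    rw [eLpNorm_norm_rpow _ hs, ← ENNReal.ofReal_mul (by positivity), div_mul_cancel₀ _ hs.ne']
  simp_rw [h1]
  have h2 := hf.2
  rw [eLpNorm_ofReal _ hp] at h2
  rw [eLpNorm_ofReal _ (by positivity)]
  have h3 := (ENNReal.rpow_lt_top_iff_of_pos (by positivity)).1 h2
  refine (ENNReal.rpow_lt_top_iff_of_pos (by positivity)).2 ?_
  refine lt_of_eq_of_lt (lintegral_congr fun t => ?_) h3
  simp only [enorm_eq_self]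
  rw [← ENNReal.rpow_mul, mul_div_cancel₀ _ hs.ne']

/-- The space `L^1 L^1` is `L^1` of the slab. -/
lemma MemLpLq.integrable {F : Type*} [NormedAddCommGroup F] {p q : ℝ} {f : ℝ → Torus d → F}
    (hf : MemLpLq T (ENNReal.ofReal p) (ENNReal.ofReal q) f) (hp : 1 ≤ p) (hq : 1 ≤ q) :
    Integrable (fun z : ℝ × Torus d => f z.1 z.2) (slab d T) := by
  have h := hf.mono_exponent hp (by linarith) hq
  refine ⟨hf.1, ?_⟩
  have h2 := h.2
  rw [ENNReal.ofReal_one, eLpNorm_one_eq_lintegral_enorm] at h2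
  simp only [enorm_eq_self, eLpNorm_one_eq_lintegral_enorm] at h2
  unfold HasFiniteIntegral slab
  rwa [lintegral_prod (fun z : ℝ × Torus d => ‖f z.1 z.2‖ₑ) hf.1.enorm]

lemma MemLpLq.ae_memLp {F : Type*} [NormedAddCommGroup F] {p q : ℝ} {f : ℝ → Torus d → F}
    (hf : MemLpLq T (ENNReal.ofReal p) (ENNReal.ofReal q) f) (hp : 0 < p) (hq : 0 < q) :
    ∀ᵐ t ∂((volume : Measure ℝ).restrict (Ioo 0 T)), MemLp (f t) (ENNReal.ofReal q) := by
  have h2 := hf.2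
  rw [eLpNorm_ofReal _ hp, ENNReal.rpow_lt_top_iff_of_pos (by positivity)] at h2
  filter_upwards [ae_aestronglyMeasurable_slice hf.1, ae_lt_top'
    ((aemeasurable_slice_eLpNorm hf.1 hq).enorm.pow_const p) h2.ne] with t h3 h4
  refine ⟨h3, ?_⟩
  simpa [ENNReal.rpow_lt_top_iff_of_pos hp] using h4

/-- Slices of dual pairs: by Hölder in space and Young in time, the pairing of slices at different
times is controlled by `A t + A s` with `A` integrable. -/
lemma exists_pairing_bound {p q p' q' : ℝ} (hp : p.HolderConjugate p') (hq : q.HolderConjugate q')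
    {f F : ℝ → Torus d → ℝ} (hf : MemLpLq T (ENNReal.ofReal p) (ENNReal.ofReal q) f)
    (hF : MemLpLq T (ENNReal.ofReal p') (ENNReal.ofReal q') F) :
    ∃ A : ℝ → ℝ, IntegrableOn A (Ioo 0 T) ∧ (∀ t, 0 ≤ A t) ∧
      ∀ t s, MemLp (f t) (ENNReal.ofReal q) → MemLp (F s) (ENNReal.ofReal q') →
        Integrable (fun x => f t x * F s x) ∧ ∫ x, |f t x * F s x| ≤ A t + A s := by
  set a : ℝ → ℝ≥0∞ := fun t => eLpNorm (f t) (ENNReal.ofReal q) volume with ha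
  set b : ℝ → ℝ≥0∞ := fun t => eLpNorm (F t) (ENNReal.ofReal q') volume with hb
  have hap := hf.2
  have hbp := hF.2
  rw [eLpNorm_ofReal _ hp.pos, ENNReal.rpow_lt_top_iff_of_pos (one_div_pos.2 hp.pos)] at hap
  rw [eLpNorm_ofReal _ hp.symm.pos, ENNReal.rpow_lt_top_iff_of_pos (one_div_pos.2 hp.symm.pos)] at hbp
  simp only [enorm_eq_self] at hap hbp
  refine ⟨fun t => (a t ^ p).toReal + (b t ^ p').toReal, ?_, fun t => by positivity, ?_⟩
  · refine Integrable.add ?_ ?_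
    · exact integrable_toReal_of_lintegral_ne_top
        ((aemeasurable_slice_eLpNorm hf.1 hq.pos).pow_const p) hap.ne
    · exact integrable_toReal_of_lintegral_ne_top
        ((aemeasurable_slice_eLpNorm hF.1 hq.symm.pos).pow_const p') hbp.ne
  · intro t s h1 h2
    have h3 := lintegral_enorm_mul_le h1.1 h2.1 hq
    have hat : a t ≠ ⊤ := h1.2.ne
    have hbs : b s ≠ ⊤ := h2.2.ne
    have hfin : Integrable (fun x => f t x * F s x) :=
      ⟨h1.1.mul h2.1, h3.trans_lt (ENNReal.mul_lt_top h1.2 h2.2)⟩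
    refine ⟨hfin, ?_⟩
    have h4 : ∫ x, |f t x * F s x| = (∫⁻ x, ‖f t x * F s x‖ₑ).toReal :=
      integral_norm_eq_lintegral_enorm hfin.1
    have h5 : (∫⁻ x, ‖f t x * F s x‖ₑ).toReal ≤ (a t).toReal * (b s).toReal := by
      rw [← ENNReal.toReal_mul]
      exact ENNReal.toReal_mono (ENNReal.mul_ne_top hat hbs) h3
    have h6 := Real.young_inequality_of_nonneg (a := (a t).toReal) (b := (b s).toReal)
      ENNReal.toReal_nonneg ENNReal.toReal_nonneg hp
    have h7 : (a t).toReal ^ p / p ≤ (a t ^ p).toReal := by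
      rw [← ENNReal.toReal_rpow]
      exact div_le_self (by positivity) hp.lt.le
    have h8 : (b s).toReal ^ p' / p' ≤ (b s ^ p').toReal := by
      rw [← ENNReal.toReal_rpow]
      exact div_le_self (by positivity) hp.symm.lt.le
    rw [h4]
    have : 0 ≤ (b t ^ p').toReal := ENNReal.toReal_nonneg
    have : 0 ≤ (a s ^ p).toReal := ENNReal.toReal_nonneg
    linarith

end MixedNorm

/-! ### Pairings of mixed Lebesgue spaces -/

section Pairing

variable {d : ℕ} {T : ℝ}

lemma memLpLq_const_time {g : Torus d → ℝ} {q : ℝ≥0∞} (hg : MemLp g q) (p : ℝ≥0∞) :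
    MemLpLq T p q (fun _ => g) := by
  refine ⟨hg.1.comp_snd, ?_⟩
  refine lt_of_le_of_lt (eLpNorm_le_of_ae_enorm_bound (C := eLpNorm g q volume)
    (Eventually.of_forall fun t => by simp)) ?_
  exact ENNReal.mul_lt_top hg.2 (ENNReal.rpow_lt_top_of_nonneg
    (inv_nonneg.2 ENNReal.toReal_nonneg) (measure_ne_top _ _))

lemma MemLpLq.integrable_mul {p q p' q' : ℝ} (hp : p.HolderConjugate p') (hq : q.HolderConjugate q')
    {f F : ℝ → Torus d → ℝ} (hf : MemLpLq T (ENNReal.ofReal p) (ENNReal.ofReal q) f)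
    (hF : MemLpLq T (ENNReal.ofReal p') (ENNReal.ofReal q') F) :
    Integrable (fun z : ℝ × Torus d => f z.1 z.2 * F z.1 z.2) (slab d T) := by
  have := hf.mul hF one_pos hp.pos hp.symm.pos
    (by rw [one_div_one, one_div, one_div, hp.inv_add_inv_eq_one]) one_pos hq.pos hq.symm.pos
    (by rw [one_div_one, one_div, one_div, hq.inv_add_inv_eq_one])
  exact this.integrable le_rfl le_rfl

lemma uIoc_subset_Ioc_of_mem_Icc {s t : ℝ} (hs : s ∈ Icc 0 T) (ht : t ∈ Icc 0 T) :
    uIoc s t ⊆ Ioc 0 T := by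
  intro x hx
  rw [uIoc, mem_Ioc] at hx
  exact ⟨(le_min hs.1 ht.1).trans_lt hx.1, hx.2.trans (max_le hs.2 ht.2)⟩

lemma IntegrableOn.intervalIntegrable_of_mem {g : ℝ → ℝ} (hg : IntegrableOn g (Ioo 0 T)) {s t : ℝ}
    (hs : s ∈ Icc 0 T) (ht : t ∈ Icc 0 T) : IntervalIntegrable g volume s t := by
  rw [intervalIntegrable_iff]
  exact (hg.congr_set_ae Ioo_ae_eq_Ioc.symm).mono_set (uIoc_subset_Ioc_of_mem_Icc hs ht)

lemma abs_intervalIntegral_le_setIntegral {g : ℝ → ℝ} (hg : IntegrableOn g (Ioo 0 T)) {s t : ℝ}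
    (hs : s ∈ Icc 0 T) (ht : t ∈ Icc 0 T) :
    |∫ τ in s..t, g τ| ≤ ∫ τ in Ioo 0 T, |g τ| := by
  refine (intervalIntegral.norm_integral_le_integral_norm_uIoc (f := g) (a := s) (b := t)
    (μ := volume)).trans ?_
  rw [← integral_Ioc_eq_integral_Ioo]
  exact setIntegral_mono_set (hg.congr_set_ae Ioo_ae_eq_Ioc.symm).norm
    (Eventually.of_forall fun _ => norm_nonneg _)
    (LE.le.eventuallyLE (uIoc_subset_Ioc_of_mem_Icc hs ht))

lemma integrableOn_integral_slice {H : ℝ → Torus d → ℝ}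
    (hH : Integrable (fun z : ℝ × Torus d => H z.1 z.2) (slab d T)) :
    IntegrableOn (fun t => ∫ x, H t x) (Ioo 0 T) := hH.integral_prod_left

/-- Convergence in `L^q` of the spatial factor passes to the limit in space-time pairings. -/
lemma tendsto_integral_pairing {p q p' q' : ℝ} (hp : p.HolderConjugate p')
    (hq : q.HolderConjugate q') {F : ℝ → Torus d → ℝ}
    (hF : MemLpLq T (ENNReal.ofReal p') (ENNReal.ofReal q') F) {g : ℕ → Torus d → ℝ}
    {g' : Torus d → ℝ} (hg : ∀ n, MemLp (g n) (ENNReal.ofReal q))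
    (hg' : MemLp g' (ENNReal.ofReal q))
    (hlim : Tendsto (fun n => eLpNorm (fun x => g n x - g' x) (ENNReal.ofReal q) volume) atTop (𝓝 0))
    {s t : ℝ} (hs : s ∈ Icc 0 T) (ht : t ∈ Icc 0 T) :
    Tendsto (fun n => ∫ τ in s..t, ∫ x, F τ x * g n x) atTop
      (𝓝 (∫ τ in s..t, ∫ x, F τ x * g' x)) := by
  have hint : ∀ {h : Torus d → ℝ}, MemLp h (ENNReal.ofReal q) →
      Integrable (fun z : ℝ × Torus d => F z.1 z.2 * h z.2) (slab d T) := fun hh =>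
    hF.integrable_mul hp.symm hq.symm (memLpLq_const_time hh (ENNReal.ofReal p))
  rw [← tendsto_sub_nhds_zero_iff]
  have hdiff : ∀ n, (∫ τ in s..t, ∫ x, F τ x * g n x) - (∫ τ in s..t, ∫ x, F τ x * g' x)
      = ∫ τ in s..t, ∫ x, F τ x * (g n x - g' x) := by
    intro n
    rw [← intervalIntegral.integral_sub
      (IntegrableOn.intervalIntegrable_of_mem (integrableOn_integral_slice (hint (hg n))) hs ht)
      (IntegrableOn.intervalIntegrable_of_mem (integrableOn_integral_slice (hint hg')) hs ht)]
    refine intervalIntegral.integral_congr_ae_restrict ?_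
    have h1 : ∀ᵐ τ ∂((volume : Measure ℝ).restrict (Ioo 0 T)),
        (∫ x, F τ x * g n x) - (∫ x, F τ x * g' x) = ∫ x, F τ x * (g n x - g' x) := by
      filter_upwards [(hint (hg n)).prod_right_ae, (hint hg').prod_right_ae] with τ h2 h3
      rw [← integral_sub h2 h3]
      simp_rw [mul_sub]
    rw [Measure.restrict_congr_set Ioo_ae_eq_Ioc] at h1
    exact ae_restrict_of_ae_restrict_of_subset (uIoc_subset_Ioc_of_mem_Icc hs ht) h1
  simp_rw [hdiff]
  set b : ℝ → ℝ≥0∞ := fun τ => eLpNorm (F τ) (ENNReal.ofReal q') volume with hb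
  have hB : ∫⁻ τ in Ioo 0 T, b τ ≠ ⊤ := by
    have := (hF.mono_exponent hp.symm.lt.le hq.symm.pos le_rfl).2
    rw [ENNReal.ofReal_one, eLpNorm_one_eq_lintegral_enorm] at this
    exact this.ne
  have hbound : ∀ n, ‖∫ τ in s..t, ∫ x, F τ x * (g n x - g' x)‖ₑ
      ≤ (∫⁻ τ in Ioo 0 T, b τ) * eLpNorm (fun x => g n x - g' x) (ENNReal.ofReal q) volume := by
    intro n
    rw [← lintegral_mul_const'' _ (aemeasurable_slice_eLpNorm hF.1 hq.symm.pos)]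
    have h1 : ‖∫ τ in s..t, ∫ x, F τ x * (g n x - g' x)‖ₑ
        = ‖∫ τ in uIoc s t, ∫ x, F τ x * (g n x - g' x)‖ₑ := by
      rw [← ofReal_norm, ← ofReal_norm,
        intervalIntegral.norm_intervalIntegral_eq]
    rw [h1]
    refine (enorm_integral_le_lintegral_enorm _).trans ?_
    refine (lintegral_mono_set (uIoc_subset_Ioc_of_mem_Icc hs ht)).trans ?_
    rw [← Measure.restrict_congr_set Ioo_ae_eq_Ioc]
    refine lintegral_mono_ae ?_
    filter_upwards [ae_aestronglyMeasurable_slice hF.1] with τ hτ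
    exact (enorm_integral_le_lintegral_enorm _).trans
      (lintegral_enorm_mul_le hτ ((hg n).1.sub hg'.1) hq.symm)
  rw [tendsto_zero_iff_enorm_tendsto_zero]
  refine tendsto_of_tendsto_of_tendsto_of_le_of_le tendsto_const_nhds ?_ (fun _ => zero_le)
    hbound
  simpa using ENNReal.Tendsto.const_mul hlim (Or.inr hB)

end Pairing

/-! ### Translations in time -/

section Translation

variable {d : ℕ}

/-- Extension by zero in time. -/
noncomputable def timeExt (S : Set ℝ) (f : ℝ → Torus d → ℝ) (z : ℝ × Torus d) : ℝ :=
  S.indicator (fun t => f t z.2) z.1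

lemma timeExt_eq_indicator (S : Set ℝ) (f : ℝ → Torus d → ℝ) :
    timeExt S f = (S ×ˢ (univ : Set (Torus d))).indicator fun z => f z.1 z.2 := by
  funext z
  by_cases h : z.1 ∈ S <;> simp [timeExt, h]

lemma timeExt_of_mem {S : Set ℝ} (f : ℝ → Torus d → ℝ) {t : ℝ} (ht : t ∈ S) (x : Torus d) :
    timeExt S f (t, x) = f t x := by simp [timeExt, ht]

lemma slab_eq_restrict (d : ℕ) (T : ℝ) : slab d T =
    ((volume : Measure ℝ).prod (volume : Measure (Torus d))).restrict (Ioo 0 T ×ˢ univ) := by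
  rw [← Measure.prod_restrict, Measure.restrict_univ, slab]

variable {T : ℝ}

lemma aestronglyMeasurable_timeExt {f : ℝ → Torus d → ℝ}
    (hf : AEStronglyMeasurable (fun z : ℝ × Torus d => f z.1 z.2) (slab d T)) :
    AEStronglyMeasurable (timeExt (Ioo 0 T) f)
      ((volume : Measure ℝ).prod (volume : Measure (Torus d))) := by
  rw [timeExt_eq_indicator, aestronglyMeasurable_indicator_iff
    (measurableSet_Ioo.prod MeasurableSet.univ), ← slab_eq_restrict]
  exact hf

lemma integrable_timeExt {f : ℝ → Torus d → ℝ}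
    (hf : Integrable (fun z : ℝ × Torus d => f z.1 z.2) (slab d T)) :
    Integrable (timeExt (Ioo 0 T) f)
      ((volume : Measure ℝ).prod (volume : Measure (Torus d))) := by
  rw [timeExt_eq_indicator, integrable_indicator_iff
    (measurableSet_Ioo.prod MeasurableSet.univ), IntegrableOn, ← slab_eq_restrict]
  exact hf

lemma eLpNorm_timeExt (f : ℝ → Torus d → ℝ) {p q : ℝ} :
    eLpNorm (fun t => eLpNorm (fun x => timeExt (Ioo 0 T) f (t, x)) (ENNReal.ofReal q) volume)
      (ENNReal.ofReal p) volume
    = eLpNorm (fun t => eLpNorm (f t) (ENNReal.ofReal q) volume) (ENNReal.ofReal p)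
      ((volume : Measure ℝ).restrict (Ioo 0 T)) := by
  rw [← eLpNorm_indicator_eq_eLpNorm_restrict measurableSet_Ioo]
  congr 1
  funext t
  by_cases h : t ∈ Ioo 0 T
  · simp only [timeExt, h, indicator_of_mem]
  · simp [timeExt, h, eLpNorm_zero']

/-- Translation in time. -/
def timeShift (d : ℕ) (σ : ℝ) (z : ℝ × Torus d) : ℝ × Torus d := (z.1 + σ, z.2)

lemma measurePreserving_timeShift (σ : ℝ) :
    MeasurePreserving (timeShift d σ) ((volume : Measure ℝ).prod (volume : Measure (Torus d)))
      ((volume : Measure ℝ).prod (volume : Measure (Torus d))) :=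
  (measurePreserving_add_right volume σ).prod (MeasurePreserving.id volume)

/-- Hölder's inequality for the pairing with a translate in time. -/
lemma lintegral_timeExt_mul_shift_le {p q p' q' : ℝ} (hp : p.HolderConjugate p')
    (hq : q.HolderConjugate q') {f F : ℝ → Torus d → ℝ}
    (hf : AEStronglyMeasurable (fun z : ℝ × Torus d => f z.1 z.2) (slab d T))
    (hF : AEStronglyMeasurable (fun z : ℝ × Torus d => F z.1 z.2) (slab d T)) (σ : ℝ) :
    ∫⁻ z, ‖timeExt (Ioo 0 T) f z * timeExt (Ioo 0 T) F (timeShift d σ z)‖ₑ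
        ∂((volume : Measure ℝ).prod (volume : Measure (Torus d)))
      ≤ eLpNorm (fun t => eLpNorm (f t) (ENNReal.ofReal q) volume) (ENNReal.ofReal p)
          ((volume : Measure ℝ).restrict (Ioo 0 T))
        * eLpNorm (fun t => eLpNorm (F t) (ENNReal.ofReal q') volume) (ENNReal.ofReal p')
          ((volume : Measure ℝ).restrict (Ioo 0 T)) := by
  have hfm := aestronglyMeasurable_timeExt hf
  have hFm := aestronglyMeasurable_timeExt hF
  have hm : AEMeasurable (fun z => ‖timeExt (Ioo 0 T) f z *
      timeExt (Ioo 0 T) F (timeShift d σ z)‖ₑ) ((volume : Measure ℝ).prod volume) :=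
    (hfm.mul (hFm.comp_measurePreserving (measurePreserving_timeShift (d := d) σ))).enorm
  rw [lintegral_prod _ hm]
  set a : ℝ → ℝ≥0∞ := fun t =>
    eLpNorm (fun x => timeExt (Ioo 0 T) f (t, x)) (ENNReal.ofReal q) volume with ha
  set b : ℝ → ℝ≥0∞ := fun t =>
    eLpNorm (fun x => timeExt (Ioo 0 T) F (t, x)) (ENNReal.ofReal q') volume with hb
  have ham : AEMeasurable a := by
    simp_rw [ha, eLpNorm_ofReal _ hq.pos]
    exact (AEMeasurable.lintegral_prod_right' (hfm.enorm.pow_const q)).pow_const _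
  have hbm : AEMeasurable b := by
    simp_rw [hb, eLpNorm_ofReal _ hq.symm.pos]
    exact (AEMeasurable.lintegral_prod_right' (hFm.enorm.pow_const q')).pow_const _
  have hmp := measurePreserving_add_right (volume : Measure ℝ) σ
  have h1 : ∫⁻ t, ∫⁻ x, ‖timeExt (Ioo 0 T) f (t, x) * timeExt (Ioo 0 T) F (timeShift d σ (t, x))‖ₑ
      ≤ ∫⁻ t, a t * b (t + σ) := by
    refine lintegral_mono_ae ?_
    filter_upwards [hfm.prodMk_left, hmp.quasiMeasurePreserving.ae hFm.prodMk_left] with t h2 h3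
    exact lintegral_enorm_mul_le h2 h3 hq
  refine h1.trans ?_
  have h2 := eLpNorm_ennreal_mul_le ham (hbm.comp_quasiMeasurePreserving
    hmp.quasiMeasurePreserving) one_pos hp.pos hp.symm.pos
    (by rw [one_div_one, one_div, one_div, hp.inv_add_inv_eq_one])
  rw [ENNReal.ofReal_one, eLpNorm_one_eq_lintegral_enorm] at h2
  refine h2.trans ?_
  rw [eLpNorm_comp_measurePreserving hbm.aestronglyMeasurable hmp, eLpNorm_timeExt,
    eLpNorm_timeExt]

/-- Translations in time are continuous in `L^1`. -/
lemma tendsto_lintegral_timeShift_sub {F : ℝ × Torus d → ℝ}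
    (hF : Integrable F ((volume : Measure ℝ).prod (volume : Measure (Torus d)))) :
    Tendsto (fun σ => ∫⁻ z, ‖F (timeShift d σ z) - F z‖ₑ
      ∂((volume : Measure ℝ).prod (volume : Measure (Torus d)))) (𝓝 0) (𝓝 0) := by
  set μ := (volume : Measure ℝ).prod (volume : Measure (Torus d)) with hμ
  have hreg : μ.Regular := Measure.Regular.of_sigmaCompactSpace_of_isLocallyFiniteMeasure _
  have hcont : Continuous fun p : ℝ × (ℝ × Torus d) => timeShift d p.1 p.2 := by
    unfold timeShift; fun_prop
  let g : C(ℝ, C(ℝ × Torus d, ℝ × Torus d)) := ContinuousMap.curry ⟨_, hcont⟩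
  have hgm : ∀ σ, MeasurePreserving (g σ) μ μ := fun σ => measurePreserving_timeShift σ
  have hg : Tendsto (fun σ => g σ) (𝓝 0) (𝓝 (g 0)) := g.continuous.tendsto 0
  have hF1 : MemLp F 1 μ := memLp_one_iff_integrable.2 hF
  have key := Tendsto.compMeasurePreservingLp (p := 1) (μ := μ) (ν := μ)
    (tendsto_const_nhds (x := hF1.toLp F)) hg hgm (hgm 0) ENNReal.one_ne_top
  rw [tendsto_iff_edist_tendsto_0] at key
  refine key.congr fun σ => ?_
  rw [Lp.edist_def, eLpNorm_one_eq_lintegral_enorm]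
  refine lintegral_congr_ae ?_
  have e0 : ∀ σ, (Lp.compMeasurePreserving (g σ) (hgm σ) (hF1.toLp F) : ℝ × Torus d → ℝ)
      =ᵐ[μ] fun z => F (timeShift d σ z) := fun σ =>
    (Lp.coeFn_compMeasurePreserving _ (hgm σ)).trans
      ((hgm σ).quasiMeasurePreserving.ae_eq_comp hF1.coeFn_toLp)
  filter_upwards [e0 σ, e0 0] with z h1 h2
  simp only [Pi.sub_apply]
  rw [h1, h2]
  simp [timeShift]

/-- Truncations converge in the mixed norm. -/
lemma tendsto_eLpNorm_truncate {p q : ℝ} (hp : 0 < p) (hq : 0 < q) {f : ℝ → Torus d → ℝ}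
    (hf : MemLpLq T (ENNReal.ofReal p) (ENNReal.ofReal q) f) :
    Tendsto (fun n : ℕ => eLpNorm (fun t => eLpNorm
        (fun x => f t x - (if |f t x| ≤ n then f t x else 0)) (ENNReal.ofReal q) volume)
        (ENNReal.ofReal p) ((volume : Measure ℝ).restrict (Ioo 0 T))) atTop (𝓝 0) := by
  have hm : ∀ n : ℕ, AEStronglyMeasurable (fun z : ℝ × Torus d =>
      f z.1 z.2 - (if |f z.1 z.2| ≤ n then f z.1 z.2 else 0)) (slab d T) := by
    intro n
    have : Measurable fun s : ℝ => s - (if |s| ≤ n then s else 0) :=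
      measurable_id.sub (Measurable.ite (measurableSet_le measurable_norm measurable_const)
        measurable_id measurable_const)
    exact (this.comp_aemeasurable hf.1.aemeasurable).aestronglyMeasurable
  have hle : ∀ (n : ℕ) t x, ‖f t x - (if |f t x| ≤ n then f t x else 0)‖ₑ ≤ ‖f t x‖ₑ := by
    intro n t x
    split_ifs <;> simp
  have hlim : ∀ t x, Tendsto (fun n : ℕ => ‖f t x - (if |f t x| ≤ n then f t x else 0)‖ₑ ^ q)
      atTop (𝓝 0) := by
    intro t x
    obtain ⟨m, hm⟩ := exists_nat_ge |f t x|
    refine tendsto_const_nhds.congr' ?_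
    filter_upwards [eventually_ge_atTop m] with n hn
    have : |f t x| ≤ n := hm.trans (by exact_mod_cast hn)
    simp [this, hq]
  have h0 := hf.2
  rw [eLpNorm_ofReal _ hp, ENNReal.rpow_lt_top_iff_of_pos (by positivity)] at h0
  simp_rw [eLpNorm_ofReal _ hp]
  have hz : (0 : ℝ≥0∞) = 0 ^ (1 / p) := by rw [ENNReal.zero_rpow_of_pos (by positivity)]
  rw [hz]
  refine ((ENNReal.continuous_rpow_const).tendsto 0).comp ?_
  have h1 : Tendsto (fun n : ℕ => ∫⁻ t in Ioo 0 T, ‖eLpNorm (fun x => f t x -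
      (if |f t x| ≤ n then f t x else 0)) (ENNReal.ofReal q) volume‖ₑ ^ p) atTop
      (𝓝 (∫⁻ _ in Ioo 0 T, 0)) := by
    refine tendsto_lintegral_of_dominated_convergence'
      (fun t => ‖eLpNorm (f t) (ENNReal.ofReal q) volume‖ₑ ^ p)
      (fun n => (aemeasurable_slice_eLpNorm (hm n) hq).enorm.pow_const p)
      (fun n => Eventually.of_forall fun t => ?_) h0.ne ?_
    · simp only [enorm_eq_self]
      exact ENNReal.rpow_le_rpow (eLpNorm_mono_enorm (hle n t)) hp.le
    · have hae : ∀ᵐ t ∂((volume : Measure ℝ).restrict (Ioo 0 T)), ∀ n : ℕ, AEStronglyMeasurable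
          (fun x => f t x - (if |f t x| ≤ n then f t x else 0)) :=
        ae_all_iff.2 fun n => ae_aestronglyMeasurable_slice (hm n)
      filter_upwards [hf.ae_memLp hp hq, hae] with t ht htn
      have hz' : (0 : ℝ≥0∞) = 0 ^ p := by rw [ENNReal.zero_rpow_of_pos hp]
      rw [hz']
      refine ((ENNReal.continuous_rpow_const).tendsto 0).comp ?_
      simp only [enorm_eq_self, eLpNorm_ofReal _ hq]
      have hz'' : (0 : ℝ≥0∞) = 0 ^ (1 / q) := by rw [ENNReal.zero_rpow_of_pos (by positivity)]
      rw [hz'']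
      refine ((ENNReal.continuous_rpow_const).tendsto 0).comp ?_
      have ht2 := ht.2
      rw [eLpNorm_ofReal _ hq, ENNReal.rpow_lt_top_iff_of_pos (by positivity)] at ht2
      have := tendsto_lintegral_of_dominated_convergence' (μ := (volume : Measure (Torus d)))
        (fun x => ‖f t x‖ₑ ^ q) (fun n => ((htn n).enorm.pow_const q))
        (fun n => Eventually.of_forall fun x => ENNReal.rpow_le_rpow (hle n t x) hq.le) ht2.ne
        (Eventually.of_forall fun x => hlim t x)
      simpa using this
  simpa using h1

/-- For dual pairs the pairing with translates in time is continuous at zero translation. -/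
lemma tendsto_integral_mul_timeShift {p q p' q' : ℝ} (hp : p.HolderConjugate p')
    (hq : q.HolderConjugate q') {f F : ℝ → Torus d → ℝ}
    (hf : MemLpLq T (ENNReal.ofReal p) (ENNReal.ofReal q) f)
    (hF : MemLpLq T (ENNReal.ofReal p') (ENNReal.ofReal q') F) :
    Tendsto (fun σ => ∫⁻ z, ‖timeExt (Ioo 0 T) f z *
        (timeExt (Ioo 0 T) F (timeShift d σ z) - timeExt (Ioo 0 T) F z)‖ₑ
      ∂((volume : Measure ℝ).prod (volume : Measure (Torus d)))) (𝓝 0) (𝓝 0) := by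
  set μ := (volume : Measure ℝ).prod (volume : Measure (Torus d)) with hμ
  set NF := eLpNorm (fun t => eLpNorm (F t) (ENNReal.ofReal q') volume) (ENNReal.ofReal p')
          ((volume : Measure ℝ).restrict (Ioo 0 T)) with hNF
  have hFi := integrable_timeExt (hF.integrable hp.symm.lt.le hq.symm.lt.le)
  rw [ENNReal.tendsto_nhds_zero]
  intro ε hε
  -- split `f` into a bounded part and a part that is small in the mixed norm
  have h1 := tendsto_eLpNorm_truncate hp.pos hq.pos hf
  have h2 : Tendsto (fun n : ℕ => 2 * (eLpNorm (fun t => eLpNorm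
        (fun x => f t x - (if |f t x| ≤ n then f t x else 0)) (ENNReal.ofReal q) volume)
        (ENNReal.ofReal p) ((volume : Measure ℝ).restrict (Ioo 0 T)) * NF)) atTop (𝓝 0) := by
    have := ENNReal.Tendsto.mul_const h1 (Or.inr (hF.2.ne : NF ≠ ⊤))
    simpa using ENNReal.Tendsto.const_mul this (Or.inr (by simp : (2 : ℝ≥0∞) ≠ ⊤))
  obtain ⟨n, hn⟩ := ((ENNReal.tendsto_nhds_zero.1 h2) (ε / 2) (ENNReal.half_pos hε.ne')).exists
  have h3 : Tendsto (fun σ => ENNReal.ofReal n * ∫⁻ z, ‖timeExt (Ioo 0 T) F (timeShift d σ z)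
      - timeExt (Ioo 0 T) F z‖ₑ ∂μ) (𝓝 0) (𝓝 0) := by
    simpa using ENNReal.Tendsto.const_mul (tendsto_lintegral_timeShift_sub hFi)
      (Or.inr (ENNReal.ofReal_ne_top (r := n)))
  set g : ℝ → Torus d → ℝ := fun t x => f t x - (if |f t x| ≤ n then f t x else 0) with hg
  have hgm : AEStronglyMeasurable (fun z : ℝ × Torus d => g z.1 z.2) (slab d T) := by
    have : Measurable fun s : ℝ => s - (if |s| ≤ n then s else 0) :=
      measurable_id.sub (Measurable.ite (measurableSet_le measurable_norm measurable_const)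
        measurable_id measurable_const)
    exact (this.comp_aemeasurable hf.1.aemeasurable).aestronglyMeasurable
  filter_upwards [(ENNReal.tendsto_nhds_zero.1 h3) (ε / 2) (ENNReal.half_pos hε.ne')] with σ hσ
  have hb1 := lintegral_timeExt_mul_shift_le hp hq hgm hF.1 σ
  have hb2 := lintegral_timeExt_mul_shift_le hp hq hgm hF.1 0
  have hpt : ∀ z, ‖timeExt (Ioo 0 T) f z * (timeExt (Ioo 0 T) F (timeShift d σ z)
      - timeExt (Ioo 0 T) F z)‖ₑ ≤ ENNReal.ofReal n * ‖timeExt (Ioo 0 T) F (timeShift d σ z)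
      - timeExt (Ioo 0 T) F z‖ₑ + (‖timeExt (Ioo 0 T) g z * timeExt (Ioo 0 T) F (timeShift d σ z)‖ₑ
      + ‖timeExt (Ioo 0 T) g z * timeExt (Ioo 0 T) F (timeShift d 0 z)‖ₑ) := by
    intro z
    have e1 : timeExt (Ioo 0 T) f z = (timeExt (Ioo 0 T) f z - timeExt (Ioo 0 T) g z)
        + timeExt (Ioo 0 T) g z := by ring
    have e2 : ‖timeExt (Ioo 0 T) f z - timeExt (Ioo 0 T) g z‖ₑ ≤ ENNReal.ofReal n := by
      rw [Real.enorm_eq_ofReal_abs]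
      refine ENNReal.ofReal_le_ofReal ?_
      by_cases hz : z.1 ∈ Ioo 0 T
      · simp only [timeExt, indicator_of_mem hz, hg, sub_sub_cancel]
        split_ifs with h
        · exact h
        · simp
      · simp [timeExt, indicator_of_notMem hz]
    have e3 : timeShift d 0 z = z := by simp [timeShift]
    rw [e3]
    nth_rewrite 1 [e1]
    rw [add_mul]
    refine (enorm_add_le _ _).trans (add_le_add ?_ ?_)
    · rw [enorm_mul]
      gcongr
    · rw [mul_sub]
      exact enorm_sub_le
  have hFs := (aestronglyMeasurable_timeExt hF.1).comp_measurePreserving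
    (measurePreserving_timeShift (d := d) σ)
  have hm0 : AEMeasurable (fun z => ENNReal.ofReal n * ‖timeExt (Ioo 0 T) F (timeShift d σ z)
      - timeExt (Ioo 0 T) F z‖ₑ) μ :=
    (hFs.sub (aestronglyMeasurable_timeExt hF.1)).enorm.const_mul _
  have hm1 : AEMeasurable (fun z => ‖timeExt (Ioo 0 T) g z *
      timeExt (Ioo 0 T) F (timeShift d σ z)‖ₑ) μ :=
    ((aestronglyMeasurable_timeExt hgm).mul hFs).enorm
  refine (lintegral_mono hpt).trans ?_
  rw [lintegral_add_left' hm0, lintegral_add_left' hm1, ← ENNReal.add_halves ε]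
  refine add_le_add ?_ ((add_le_add hb1 hb2).trans ?_)
  · have hm2 : AEMeasurable (fun z => ‖timeExt (Ioo 0 T) F (timeShift d σ z)
        - timeExt (Ioo 0 T) F z‖ₑ) μ := (hFs.sub (aestronglyMeasurable_timeExt hF.1)).enorm
    rw [lintegral_const_mul'' _ hm2]
    exact hσ
  · rw [← two_mul]; exact hn

end Translation

/-! ### Averages over short times -/

section Steklov

variable {d : ℕ} {T : ℝ}

lemma aestronglyMeasurable_timeShift_prod {F : ℝ × Torus d → ℝ}
    (hF : AEStronglyMeasurable F ((volume : Measure ℝ).prod (volume : Measure (Torus d))))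
    (Θ : Measure ℝ) [SFinite Θ] (h : ℝ) :
    AEStronglyMeasurable (fun w : ℝ × (ℝ × Torus d) => F (timeShift d (h * w.1) w.2))
      (Θ.prod ((volume : Measure ℝ).prod (volume : Measure (Torus d)))) := by
  refine hF.comp_quasiMeasurePreserving (f := fun w : ℝ × (ℝ × Torus d) =>
    timeShift d (h * w.1) w.2) (QuasiMeasurePreserving.prod_of_right ?_ ?_)
  · unfold timeShift; fun_prop
  · exact Eventually.of_forall fun θ => (measurePreserving_timeShift (h * θ)).quasiMeasurePreserving

/-- The pairing of `f` at time `t` with `F` at time `t + h θ`. -/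
noncomputable def shiftPairing (T : ℝ) (f F : ℝ → Torus d → ℝ) (h : ℝ) (w : ℝ × (ℝ × Torus d)) : ℝ :=
  timeExt (Ioo 0 T) f w.2 * timeExt (Ioo 0 T) F (timeShift d (h * w.1) w.2)

lemma integrable_shiftPairing {p q p' q' : ℝ} (hp : p.HolderConjugate p')
    (hq : q.HolderConjugate q') {f F : ℝ → Torus d → ℝ}
    (hf : MemLpLq T (ENNReal.ofReal p) (ENNReal.ofReal q) f)
    (hF : MemLpLq T (ENNReal.ofReal p') (ENNReal.ofReal q') F) (h : ℝ) :
    Integrable (shiftPairing T f F h) (((volume : Measure ℝ).restrict (Ioc 0 1)).prod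
      ((volume : Measure ℝ).prod (volume : Measure (Torus d)))) := by
  have hm : AEStronglyMeasurable (shiftPairing T f F h)
      (((volume : Measure ℝ).restrict (Ioc 0 1)).prod
      ((volume : Measure ℝ).prod (volume : Measure (Torus d)))) :=
    ((aestronglyMeasurable_timeExt hf.1).comp_snd).mul
      (aestronglyMeasurable_timeShift_prod (aestronglyMeasurable_timeExt hF.1) _ h)
  refine ⟨hm, ?_⟩
  unfold HasFiniteIntegral
  rw [lintegral_prod _ hm.enorm]
  refine lt_of_le_of_lt (lintegral_mono fun θ =>
    lintegral_timeExt_mul_shift_le hp hq hf.1 hF.1 (h * θ)) ?_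
  rw [lintegral_const]
  exact ENNReal.mul_lt_top (ENNReal.mul_lt_top hf.2 hF.2) (measure_lt_top _ _)

lemma integrable_integral_shiftPairing {p q p' q' : ℝ} (hp : p.HolderConjugate p')
    (hq : q.HolderConjugate q') {f F : ℝ → Torus d → ℝ}
    (hf : MemLpLq T (ENNReal.ofReal p) (ENNReal.ofReal q) f)
    (hF : MemLpLq T (ENNReal.ofReal p') (ENNReal.ofReal q') F) (h : ℝ) :
    Integrable (fun w : ℝ × ℝ => ∫ x, shiftPairing T f F h (w.1, (w.2, x)))
      (((volume : Measure ℝ).restrict (Ioc 0 1)).prod (volume : Measure ℝ)) := by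
  have h1 := (measurePreserving_prodAssoc ((volume : Measure ℝ).restrict (Ioc 0 1))
    (volume : Measure ℝ) (volume : Measure (Torus d))).integrable_comp_of_integrable
    (integrable_shiftPairing hp hq hf hF h)
  exact h1.integral_prod_left

lemma tendsto_steklov_aux {p q p' q' : ℝ} (hp : p.HolderConjugate p')
    (hq : q.HolderConjugate q') {f F : ℝ → Torus d → ℝ}
    (hf : MemLpLq T (ENNReal.ofReal p) (ENNReal.ofReal q) f)
    (hF : MemLpLq T (ENNReal.ofReal p') (ENNReal.ofReal q') F) :
    Tendsto (fun h => ∫ w : ℝ × ℝ, (∫ x, shiftPairing T f F h (w.1, (w.2, x)))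
        ∂(((volume : Measure ℝ).restrict (Ioc 0 1)).prod (volume : Measure ℝ))) (𝓝 0)
      (𝓝 (∫ w : ℝ × ℝ, (∫ x, shiftPairing T f F 0 (w.1, (w.2, x)))
        ∂(((volume : Measure ℝ).restrict (Ioc 0 1)).prod (volume : Measure ℝ)))) := by
  have hassoc := measurePreserving_prodAssoc ((volume : Measure ℝ).restrict (Ioc 0 1))
    (volume : Measure ℝ) (volume : Measure (Torus d))
  rw [← tendsto_sub_nhds_zero_iff, tendsto_zero_iff_enorm_tendsto_zero]
  have hI := fun h => integrable_shiftPairing hp hq hf hF h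
  have hbound : ∀ h, ‖(∫ w : ℝ × ℝ, (∫ x, shiftPairing T f F h (w.1, (w.2, x)))
        ∂(((volume : Measure ℝ).restrict (Ioc 0 1)).prod (volume : Measure ℝ)))
      - ∫ w : ℝ × ℝ, (∫ x, shiftPairing T f F 0 (w.1, (w.2, x)))
        ∂(((volume : Measure ℝ).restrict (Ioc 0 1)).prod (volume : Measure ℝ))‖ₑ
      ≤ ∫⁻ θ in Ioc (0 : ℝ) 1, ∫⁻ z, ‖timeExt (Ioo 0 T) f z *
        (timeExt (Ioo 0 T) F (timeShift d (h * θ) z) - timeExt (Ioo 0 T) F z)‖ₑ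
        ∂((volume : Measure ℝ).prod (volume : Measure (Torus d))) := by
    intro h
    have h0 := fun h => hassoc.integrable_comp_of_integrable (hI h)
    rw [← integral_sub (integrable_integral_shiftPairing hp hq hf hF h)
      (integrable_integral_shiftPairing hp hq hf hF 0)]
    have e1 : ∀ᵐ w ∂(((volume : Measure ℝ).restrict (Ioc 0 1)).prod (volume : Measure ℝ)),
        ‖(∫ x, shiftPairing T f F h (w.1, (w.2, x))) - ∫ x, shiftPairing T f F 0 (w.1, (w.2, x))‖ₑ
        ≤ ∫⁻ x, ‖shiftPairing T f F h (w.1, (w.2, x)) - shiftPairing T f F 0 (w.1, (w.2, x))‖ₑ := by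
      filter_upwards [(h0 h).prod_right_ae, (h0 0).prod_right_ae] with w h1 h2
      have := integral_sub h1 h2
      simp only [Function.comp_def, MeasurableEquiv.prodAssoc, MeasurableEquiv.coe_mk,
        Equiv.prodAssoc_apply] at this
      rw [← this]
      exact enorm_integral_le_lintegral_enorm _
    refine (enorm_integral_le_lintegral_enorm _).trans ((lintegral_mono_ae e1).trans ?_)
    have hmd : AEMeasurable (fun w : ℝ × (ℝ × Torus d) =>
        ‖shiftPairing T f F h w - shiftPairing T f F 0 w‖ₑ)
        (((volume : Measure ℝ).restrict (Ioc 0 1)).prod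
        ((volume : Measure ℝ).prod (volume : Measure (Torus d)))) := ((hI h).1.sub (hI 0).1).enorm
    have hmd' := hmd.comp_quasiMeasurePreserving hassoc.quasiMeasurePreserving
    have e2 := lintegral_prod _ hmd'
    rw [(show (((fun w : ℝ × (ℝ × Torus d) => ‖shiftPairing T f F h w - shiftPairing T f F 0 w‖ₑ)
      ∘ MeasurableEquiv.prodAssoc)) = fun w => (fun w : ℝ × (ℝ × Torus d) =>
        ‖shiftPairing T f F h w - shiftPairing T f F 0 w‖ₑ) (MeasurableEquiv.prodAssoc w)
        from rfl), hassoc.lintegral_comp_emb (MeasurableEquiv.measurableEmbedding _),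
      lintegral_prod _ hmd] at e2
    refine le_of_eq (Eq.trans e2.symm ?_)
    refine lintegral_congr fun θ => lintegral_congr fun z => ?_
    simp only [shiftPairing, zero_mul]
    rw [mul_sub]
    simp [timeShift]
  refine tendsto_of_tendsto_of_tendsto_of_le_of_le tendsto_const_nhds ?_ (fun _ => zero_le) hbound
  rw [ENNReal.tendsto_nhds_zero]
  intro ε hε
  have h1 := ENNReal.tendsto_nhds_zero.1 (tendsto_integral_mul_timeShift hp hq hf hF) ε hε
  obtain ⟨δ, hδ, hball⟩ := Metric.eventually_nhds_iff.1 h1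
  filter_upwards [Metric.ball_mem_nhds (0 : ℝ) hδ] with h hh
  have h2 : ∀ θ ∈ Ioc (0 : ℝ) 1, ∫⁻ z, ‖timeExt (Ioo 0 T) f z *
        (timeExt (Ioo 0 T) F (timeShift d (h * θ) z) - timeExt (Ioo 0 T) F z)‖ₑ
        ∂((volume : Measure ℝ).prod (volume : Measure (Torus d))) ≤ ε := by
    intro θ hθ
    refine hball ?_
    rw [mem_ball_zero_iff] at hh
    rw [dist_zero_right, norm_mul, Real.norm_of_nonneg hθ.1.le]
    exact lt_of_le_of_lt (mul_le_of_le_one_right (norm_nonneg _) hθ.2) hh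
  refine (setLIntegral_mono measurable_const h2).trans ?_
  simp

/-- Averages over short time intervals: for a dual pair, the averaged pairings at nearby times
converge to the pairing at equal times. -/
lemma tendsto_steklov {p q p' q' : ℝ} (hp : p.HolderConjugate p')
    (hq : q.HolderConjugate q') {f F : ℝ → Torus d → ℝ}
    (hf : MemLpLq T (ENNReal.ofReal p) (ENNReal.ofReal q) f)
    (hF : MemLpLq T (ENNReal.ofReal p') (ENNReal.ofReal q') F) {a b : ℝ} (ha : 0 ≤ a)
    (hb : b ≤ T) :
    (∀ h, IntegrableOn (fun t => ∫ θ in (0 : ℝ)..1, ∫ x, f t x * timeExt (Ioo 0 T) F (t + h * θ, x))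
      (Ioo a b)) ∧
    Tendsto (fun h => ∫ t in Ioo a b, ∫ θ in (0 : ℝ)..1, ∫ x,
        f t x * timeExt (Ioo 0 T) F (t + h * θ, x)) (𝓝 0)
      (𝓝 (∫ t in Ioo a b, ∫ x, f t x * F t x)) := by
  have hsub : Ioo a b ⊆ Ioo 0 T := Ioo_subset_Ioo ha hb
  set f1 : ℝ → Torus d → ℝ := fun t x => (Ioo a b).indicator (fun t => f t x) t with hf1
  have hf1m : MemLpLq T (ENNReal.ofReal p) (ENNReal.ofReal q) f1 := by
    refine hf.mono_norm ?_ (Eventually.of_forall fun z => ?_)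
    · have : (fun z : ℝ × Torus d => f1 z.1 z.2) = (Ioo a b ×ˢ (univ : Set (Torus d))).indicator
          fun z => f z.1 z.2 := by
        funext z
        by_cases h : z.1 ∈ Ioo a b <;> simp [hf1, h]
      rw [this]
      exact hf.1.indicator (measurableSet_Ioo.prod MeasurableSet.univ)
    · simp only [hf1]
      exact norm_indicator_le_norm_self _ _
  have e1 : ∀ h θ t, ∫ x, shiftPairing T f1 F h (θ, (t, x)) = (Ioo a b).indicator
      (fun t => ∫ x, f t x * timeExt (Ioo 0 T) F (t + h * θ, x)) t := by
    intro h θ t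
    by_cases ht : t ∈ Ioo a b
    · rw [indicator_of_mem ht]
      refine integral_congr_ae (Eventually.of_forall fun x => ?_)
      simp only [shiftPairing, timeShift]
      rw [timeExt_of_mem _ (hsub ht)]
      simp only [hf1, indicator_of_mem ht]
    · rw [indicator_of_notMem ht]
      have h0 : ∀ x, timeExt (Ioo 0 T) f1 (t, x) = 0 := by
        intro x
        have h1 : (Ioo a b).indicator (fun t => f t x) t = 0 := indicator_of_notMem ht _
        by_cases ht' : t ∈ Ioo 0 T
        · rw [timeExt_of_mem _ ht']; exact h1
        · exact indicator_of_notMem ht' _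
      simp [shiftPairing, h0]
  have hint := fun h => integrable_integral_shiftPairing hp hq hf1m hF h
  have e2 : ∀ h t, ∫ θ in Ioc (0 : ℝ) 1, ∫ x, shiftPairing T f1 F h (θ, (t, x))
      = (Ioo a b).indicator (fun t => ∫ θ in (0 : ℝ)..1, ∫ x,
        f t x * timeExt (Ioo 0 T) F (t + h * θ, x)) t := by
    intro h t
    simp_rw [e1]
    by_cases ht : t ∈ Ioo a b
    · simp only [indicator_of_mem ht]
      rw [intervalIntegral.integral_of_le zero_le_one]
    · simp [indicator_of_notMem ht]
  have e3 : ∀ h, ∫ w : ℝ × ℝ, (∫ x, shiftPairing T f1 F h (w.1, (w.2, x)))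
        ∂(((volume : Measure ℝ).restrict (Ioc 0 1)).prod (volume : Measure ℝ))
      = ∫ t in Ioo a b, ∫ θ in (0 : ℝ)..1, ∫ x, f t x * timeExt (Ioo 0 T) F (t + h * θ, x) := by
    intro h
    rw [integral_prod_symm _ (hint h), ← integral_indicator measurableSet_Ioo]
    simp_rw [e2]
  refine ⟨fun h => ?_, ?_⟩
  · have := (hint h).integral_prod_right
    simp_rw [e2] at this
    rwa [integrable_indicator_iff measurableSet_Ioo] at this
  · have key := tendsto_steklov_aux hp hq hf1m hF
    simp_rw [e3] at key
    refine key.congr_dist ?_ |>.trans (le_of_eq ?_)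
    · simp
    · congr 1
      refine setIntegral_congr_fun measurableSet_Ioo fun t ht => ?_
      simp only [zero_mul, add_zero, timeExt_of_mem F (hsub ht)]
      simp

end Steklov

/-! ### Distributional derivatives in time -/

section TimeDistribution

variable {T : ℝ}

/-- Integration by parts against the primitive of an integrable function. -/
lemma integral_deriv_mul_primitive {χ : ℝ → ℝ} (hχ : ContDiff ℝ ∞ χ) (hχT : χ T = 0)
    {g : ℝ → ℝ} (hg : IntegrableOn g (Ioo 0 T)) :
    ∫ t in Ioo 0 T, deriv χ t * ∫ s in (0 : ℝ)..t, g s = -∫ t in Ioo 0 T, χ t * g t := by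
  have hd : Continuous (deriv χ) := hχ.continuous_deriv (by simp)
  have hgI : IntegrableOn g (Ioc 0 T) := hg.congr_set_ae Ioo_ae_eq_Ioc.symm
  -- both sides are integrals over the triangle `s ≤ t`
  set μ : Measure ℝ := (volume : Measure ℝ).restrict (Ioc 0 T) with hμ
  have hprod : Integrable (fun z : ℝ × ℝ => deriv χ z.1 * g z.2) (μ.prod μ) := by
    refine Integrable.mul_prod (f := deriv χ) (g := g) ?_ hgI
    exact (hd.integrableOn_Icc (a := 0) (b := T)).mono_set Ioc_subset_Icc_self
  have htri : Integrable (fun z : ℝ × ℝ => {z : ℝ × ℝ | z.2 ≤ z.1}.indicator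
      (fun z => deriv χ z.1 * g z.2) z) (μ.prod μ) :=
    hprod.indicator (measurableSet_le measurable_snd measurable_fst)
  have h1 : ∫ t in Ioo 0 T, deriv χ t * ∫ s in (0 : ℝ)..t, g s
      = ∫ t, ∫ s, {z : ℝ × ℝ | z.2 ≤ z.1}.indicator (fun z => deriv χ z.1 * g z.2) (t, s) ∂μ ∂μ := by
    rw [← integral_Ioc_eq_integral_Ioo]
    refine setIntegral_congr_fun measurableSet_Ioc fun t ht => ?_
    rw [intervalIntegral.integral_of_le ht.1.le, ← integral_const_mul,
      ← integral_indicator measurableSet_Ioc, hμ, ← integral_indicator measurableSet_Ioc]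
    congr 1
    funext s
    by_cases hs : s ∈ Ioc 0 t
    · have hs' : s ∈ Ioc 0 T := ⟨hs.1, hs.2.trans ht.2⟩
      rw [indicator_of_mem hs, indicator_of_mem hs', indicator_of_mem (by exact hs.2)]
    · rw [indicator_of_notMem hs]
      by_cases hs' : s ∈ Ioc 0 T
      · rw [indicator_of_mem hs', indicator_of_notMem]
        exact fun h => hs ⟨hs'.1, h⟩
      · rw [indicator_of_notMem hs']
  have h2 : ∫ s, ∫ t, {z : ℝ × ℝ | z.2 ≤ z.1}.indicator (fun z => deriv χ z.1 * g z.2) (t, s) ∂μ ∂μ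
      = -∫ t in Ioo 0 T, χ t * g t := by
    rw [← integral_Ioc_eq_integral_Ioo, ← integral_neg]
    refine setIntegral_congr_fun measurableSet_Ioc fun s hs => ?_
    have h3 : ∫ t in s..T, deriv χ t = χ T - χ s :=
      intervalIntegral.integral_deriv_eq_sub (fun x _ => hχ.differentiable (by simp) x)
        (hd.intervalIntegrable _ _)
    have h4 : ∫ t, {z : ℝ × ℝ | z.2 ≤ z.1}.indicator (fun z => deriv χ z.1 * g z.2) (t, s) ∂μ
        = (∫ t in s..T, deriv χ t) * g s := by
      have h5 : ∫ t in s..T, deriv χ t = ∫ t in Icc s T, deriv χ t := by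
        rw [intervalIntegral.integral_of_le hs.2, integral_Icc_eq_integral_Ioc]
      rw [h5, ← integral_mul_const, ← integral_indicator measurableSet_Icc, hμ,
        ← integral_indicator measurableSet_Ioc]
      congr 1
      funext t
      by_cases ht : t ∈ Icc s T
      · have ht' : t ∈ Ioc 0 T := ⟨hs.1.trans_le ht.1, ht.2⟩
        rw [indicator_of_mem ht, indicator_of_mem ht', indicator_of_mem (by exact ht.1)]
      · rw [indicator_of_notMem ht]
        by_cases ht' : t ∈ Ioc 0 T
        · rw [indicator_of_mem ht', indicator_of_notMem]
          exact fun h => ht ⟨h, ht'.2⟩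
        · rw [indicator_of_notMem ht']
    rw [h4, h3, hχT]
    ring
  rw [h1, integral_integral_swap (f := fun t s =>
    {z : ℝ × ℝ | z.2 ≤ z.1}.indicator (fun z => deriv χ z.1 * g z.2) (t, s)) htri]
  exact h2

lemma continuousOn_primitive {g : ℝ → ℝ} (hg : IntegrableOn g (Ioo 0 T)) (hT0 : 0 < T) :
    ContinuousOn (fun t => ∫ s in (0 : ℝ)..t, g s) (Icc 0 T) := by
  have := intervalIntegral.continuousOn_primitive_interval (a := 0) (b := T) (f := g)
    (μ := volume) (by
      rw [uIcc_of_le hT0.le]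
      exact hg.congr_set_ae Ioo_ae_eq_Icc.symm)
  rwa [uIcc_of_le hT0.le] at this

/-- du Bois-Reymond: a function on an interval whose distributional derivative is integrable
agrees almost everywhere with a primitive of it. -/
lemma exists_ae_eq_const_add_primitive (hT0 : 0 < T) {U g : ℝ → ℝ} (hU : IntegrableOn U (Ioo 0 T))
    (hg : IntegrableOn g (Ioo 0 T))
    (h : ∀ χ : ℝ → ℝ, ContDiff ℝ ∞ χ → (∃ b < T, ∀ t, b ≤ t → χ t = 0) →
      (∃ a > 0, ∀ t, t ≤ a → χ t = 0) →
      ∫ t in Ioo 0 T, (U t * deriv χ t + g t * χ t) = 0) :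
    ∃ c, ∀ᵐ t ∂((volume : Measure ℝ).restrict (Ioo 0 T)), U t = c + ∫ s in (0 : ℝ)..t, g s := by
  set W : ℝ → ℝ := fun t => U t - ∫ s in (0 : ℝ)..t, g s with hW
  have hprim : IntegrableOn (fun t => ∫ s in (0 : ℝ)..t, g s) (Ioo 0 T) :=
    ((continuousOn_primitive hg hT0).integrableOn_Icc).mono_set Ioo_subset_Icc_self
  have hWi : IntegrableOn W (Ioo 0 T) := hU.sub hprim
  -- multiplying integrable functions by continuous functions
  have hmul : ∀ {u φ : ℝ → ℝ}, IntegrableOn u (Ioo 0 T) → Continuous φ →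
      IntegrableOn (fun t => u t * φ t) (Ioo 0 T) := by
    intro u φ hu hφ
    obtain ⟨C, hC⟩ := isCompact_Icc.exists_bound_of_continuousOn (s := Icc (0 : ℝ) T)
      hφ.continuousOn
    exact Integrable.mul_bdd (c := C) hu hφ.aestronglyMeasurable
      ((ae_restrict_iff' measurableSet_Ioo).2 (Eventually.of_forall fun t ht =>
        hC t (Ioo_subset_Icc_self ht)))
  have h1 : ∀ χ : ℝ → ℝ, ContDiff ℝ ∞ χ → (∃ b < T, ∀ t, b ≤ t → χ t = 0) →
      (∃ a > 0, ∀ t, t ≤ a → χ t = 0) → ∫ t in Ioo 0 T, W t * deriv χ t = 0 := by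
    intro χ hχ hb ha
    have hd : Continuous (deriv χ) := hχ.continuous_deriv (by simp)
    have hχT : χ T = 0 := by obtain ⟨b, hb, hb'⟩ := hb; exact hb' T hb.le
    have e1 := h χ hχ hb ha
    have e2 := integral_deriv_mul_primitive hχ hχT hg
    rw [integral_add (hmul hU hd) (hmul hg hχ.continuous)] at e1
    simp_rw [hW, sub_mul]
    rw [integral_sub (hmul hU hd) (hmul hprim hd)]
    simp_rw [mul_comm (∫ s in (0 : ℝ)..(_ : ℝ), g s), e2]
    simp_rw [mul_comm (χ _)]
    linarith
  -- a fixed bump with integral one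
  obtain ⟨h0, hh0, hh0c, hh0s, hh0i⟩ : ∃ h0 : ℝ → ℝ, ContDiff ℝ ∞ h0 ∧ HasCompactSupport h0 ∧
      tsupport h0 ⊆ Ioo 0 T ∧ ∫ t, h0 t = 1 := by
    let φ : ContDiffBump (T / 2) := ⟨T / 8, T / 4, by positivity, by linarith⟩
    refine ⟨φ.normed volume, φ.contDiff_normed, φ.hasCompactSupport_normed, ?_, φ.integral_normed⟩
    rw [φ.tsupport_normed_eq, Real.closedBall_eq_Icc]
    exact Icc_subset_Ioo (by simp only [φ]; linarith) (by simp only [φ]; linarith)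
  set c := ∫ t in Ioo 0 T, W t * h0 t with hc
  -- supports inside the open interval
  have hsupp : ∀ {k : ℝ → ℝ}, HasCompactSupport k → tsupport k ⊆ Ioo 0 T →
      ∃ a b, 0 < a ∧ a < b ∧ b < T ∧ ∀ t, t ∉ Icc a b → k t = 0 := by
    intro k hkc hks
    rcases (tsupport k).eq_empty_or_nonempty with he | hne
    · refine ⟨T / 4, T / 2, by positivity, by linarith, by linarith, fun t _ => ?_⟩
      exact image_eq_zero_of_notMem_tsupport (by simp [he])
    · have hk : IsCompact (tsupport k) := hkc
      obtain ⟨x, hx, hxm⟩ := hk.exists_isLeast hne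
      obtain ⟨y, hy, hym⟩ := hk.exists_isGreatest hne
      have hx' := hks hx
      have hy' := hks hy
      refine ⟨x, (y + T) / 2, hx'.1, ?_, by linarith [hy'.2], fun t ht => ?_⟩
      · linarith [hxm hy, hy'.2]
      · refine image_eq_zero_of_notMem_tsupport fun htk => ht ⟨hxm htk, ?_⟩
        linarith [hym htk, hy'.2]
  have h2 : ∀ᵐ t ∂(volume : Measure ℝ), t ∈ Ioo 0 T → W t - c = 0 := by
    refine isOpen_Ioo.ae_eq_zero_of_integral_contDiff_smul_eq_zero (μ := volume)
      ((hWi.sub (integrableOn_const (by simp))).locallyIntegrableOn) ?_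
    intro k hk hkc hks
    set m := ∫ t, k t with hm
    set e : ℝ → ℝ := fun t => k t - m * h0 t with he
    have hec : ContDiff ℝ ∞ e := hk.sub (contDiff_const.mul hh0)
    obtain ⟨a1, b1, ha1, hab1, hb1, hz1⟩ := hsupp hkc hks
    obtain ⟨a2, b2, ha2, hab2, hb2, hz2⟩ := hsupp hh0c hh0s
    have hez : ∀ t, t ∉ Icc (min a1 a2) (max b1 b2) → e t = 0 := by
      intro t ht
      have hA : t ∉ Icc a1 b1 := fun h =>
        ht ⟨(min_le_left _ _).trans h.1, h.2.trans (le_max_left _ _)⟩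
      have hB : t ∉ Icc a2 b2 := fun h =>
        ht ⟨(min_le_right _ _).trans h.1, h.2.trans (le_max_right _ _)⟩
      simp [he, hz1 t hA, hz2 t hB]
    have hint0 : ∀ {k : ℝ → ℝ}, Continuous k → (∀ t, t ∉ Ioo 0 T → k t = 0) →
        ∫ t in (0 : ℝ)..T, k t = ∫ t, k t := by
      intro k _ hk0
      rw [intervalIntegral.integral_of_le hT0.le, integral_Ioc_eq_integral_Ioo]
      exact setIntegral_eq_integral_of_forall_compl_eq_zero hk0
    have hks' : ∀ {k : ℝ → ℝ}, tsupport k ⊆ Ioo 0 T → ∀ t, t ∉ Ioo 0 T → k t = 0 := fun h t ht =>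
      image_eq_zero_of_notMem_tsupport fun hh => ht (h hh)
    have hes : ∫ t in (0 : ℝ)..T, e t = 0 := by
      simp only [he]
      rw [intervalIntegral.integral_sub (hk.continuous.intervalIntegrable _ _)
        ((contDiff_const.mul hh0).continuous.intervalIntegrable _ _),
        intervalIntegral.integral_const_mul, hint0 hk.continuous (hks' hks),
        hint0 hh0.continuous (hks' hh0s), hh0i]
      ring
    set χ : ℝ → ℝ := fun t => ∫ s in (0 : ℝ)..t, e s with hχ
    have hχd : ∀ t, HasDerivAt χ (e t) t := fun t =>
      (hec.continuous.integral_hasStrictDerivAt 0 t).hasDerivAt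
    have hχderiv : deriv χ = e := funext fun t => (hχd t).deriv
    have hχc : ContDiff ℝ ∞ χ := by
      rw [contDiff_infty_iff_deriv, hχderiv]
      exact ⟨fun t => (hχd t).differentiableAt, hec⟩
    have hzero : ∀ {s t : ℝ}, (∀ u ∈ uIoc s t, e u = 0) → ∫ u in s..t, e u = 0 := by
      intro s t hst
      rw [intervalIntegral.integral_congr_ae (g := fun _ => (0 : ℝ))
        (Eventually.of_forall hst)]
      simp
    have hχ0 : ∀ t, t ≤ min a1 a2 / 2 → χ t = 0 := by
      intro t ht
      refine hzero fun u hu => hez u fun hu' => ?_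
      have hmin : 0 < min a1 a2 := lt_min ha1 ha2
      rw [uIoc, mem_Ioc] at hu
      have : max 0 t ≤ min a1 a2 / 2 := max_le (by linarith) ht
      linarith [hu.2, hu'.1]
    have hh0c' : Continuous h0 := hh0.continuous
    have hbT : max b1 b2 < T := max_lt hb1 hb2
    have hχT : ∀ t, (max b1 b2 + T) / 2 ≤ t → χ t = 0 := by
      intro t ht
      have e3 : χ t = (∫ s in (0 : ℝ)..T, e s) + ∫ s in T..t, e s :=
        (intervalIntegral.integral_add_adjacent_intervals
          (hec.continuous.intervalIntegrable _ _) (hec.continuous.intervalIntegrable _ _)).symm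
      rw [e3, hes, zero_add]
      refine hzero fun u hu => hez u fun hu' => ?_
      rw [uIoc, mem_Ioc] at hu
      have : (max b1 b2 + T) / 2 ≤ min T t := le_min (by linarith) ht
      linarith [hu.1, hu'.2]
    have e4 := h1 χ hχc ⟨_, by linarith, hχT⟩ ⟨_, half_pos (lt_min ha1 ha2), hχ0⟩
    rw [hχderiv] at e4
    simp only [he, mul_sub] at e4
    rw [integral_sub (hmul hWi hk.continuous)
      (hmul hWi (by fun_prop : Continuous fun t => m * h0 t))] at e4
    simp_rw [mul_left_comm (W _) m] at e4
    rw [integral_const_mul, ← hc] at e4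
    have e5 : ∫ t, k t • (W t - c) = ∫ t in Ioo 0 T, k t • (W t - c) := by
      refine (setIntegral_eq_integral_of_forall_compl_eq_zero fun t ht => ?_).symm
      rw [hks' hks t ht, zero_smul]
    have e6 : ∫ t in Ioo 0 T, k t = m := setIntegral_eq_integral_of_forall_compl_eq_zero (hks' hks)
    have e7 : IntegrableOn k (Ioo 0 T) := (hk.continuous.integrableOn_Icc).mono_set
      Ioo_subset_Icc_self
    rw [e5]
    simp_rw [smul_eq_mul, mul_sub]
    rw [integral_sub ((hmul hWi hk.continuous).congr
      (Eventually.of_forall fun t => mul_comm _ _)) (e7.mul_const c),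
      integral_mul_const, e6]
    simp_rw [mul_comm (k _)]
    exact e4
  refine ⟨c, (ae_restrict_iff' measurableSet_Ioo).2 ?_⟩
  filter_upwards [h2] with t ht ht'
  have := ht ht'
  simp only [hW] at this
  linarith

/-- The same with an initial value. -/
lemma ae_eq_add_primitive (hT0 : 0 < T) {U g : ℝ → ℝ} {U₀ : ℝ} (hU : IntegrableOn U (Ioo 0 T))
    (hg : IntegrableOn g (Ioo 0 T))
    (h : ∀ χ : ℝ → ℝ, ContDiff ℝ ∞ χ → (∃ b < T, ∀ t, b ≤ t → χ t = 0) →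
      (∫ t in Ioo 0 T, (U t * deriv χ t + g t * χ t)) + U₀ * χ 0 = 0) :
    ∀ᵐ t ∂((volume : Measure ℝ).restrict (Ioo 0 T)), U t = U₀ + ∫ s in (0 : ℝ)..t, g s := by
  obtain ⟨c, hc⟩ := exists_ae_eq_const_add_primitive hT0 hU hg fun χ hχ hb ha => by
    have := h χ hχ hb
    obtain ⟨a, ha, ha'⟩ := ha
    rwa [ha' 0 ha.le, mul_zero, add_zero] at this
  -- test with a cutoff that equals one at time zero
  obtain ⟨χ, hχ, hχT, hχ0⟩ : ∃ χ : ℝ → ℝ, ContDiff ℝ ∞ χ ∧ (∃ b < T, ∀ t, b ≤ t → χ t = 0) ∧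
      χ 0 = 1 := by
    refine ⟨fun t => 1 - Real.smoothTransition (2 * t / T), ?_, ⟨T / 2, by linarith, ?_⟩, ?_⟩
    · exact contDiff_const.sub (Real.smoothTransition.contDiff.comp
        ((contDiff_const.mul contDiff_id).div_const _))
    · intro t ht
      change 1 - Real.smoothTransition (2 * t / T) = 0
      rw [Real.smoothTransition.one_of_one_le, sub_self]
      rw [le_div_iff₀ hT0]; linarith
    · simp
  have hd : Continuous (deriv χ) := hχ.continuous_deriv (by simp)
  have hχT' : χ T = 0 := by obtain ⟨b, hb, hb'⟩ := hχT; exact hb' T hb.le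
  have e1 := h χ hχ hχT
  have e2 := integral_deriv_mul_primitive hχ hχT' hg
  have hprim : IntegrableOn (fun t => ∫ s in (0 : ℝ)..t, g s) (Ioo 0 T) :=
    ((continuousOn_primitive hg hT0).integrableOn_Icc).mono_set Ioo_subset_Icc_self
  have hmul : ∀ {u φ : ℝ → ℝ}, IntegrableOn u (Ioo 0 T) → Continuous φ →
      IntegrableOn (fun t => u t * φ t) (Ioo 0 T) := by
    intro u φ hu hφ
    obtain ⟨C, hC⟩ := isCompact_Icc.exists_bound_of_continuousOn (s := Icc (0 : ℝ) T)
      hφ.continuousOn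
    exact Integrable.mul_bdd (c := C) hu hφ.aestronglyMeasurable
      ((ae_restrict_iff' measurableSet_Ioo).2 (Eventually.of_forall fun t ht =>
        hC t (Ioo_subset_Icc_self ht)))
  have hdi : IntegrableOn (deriv χ) (Ioo 0 T) := hd.integrableOn_Icc.mono_set Ioo_subset_Icc_self
  have e3 : ∫ t in Ioo 0 T, deriv χ t = -1 := by
    rw [← integral_Ioc_eq_integral_Ioo, ← intervalIntegral.integral_of_le hT0.le,
      intervalIntegral.integral_deriv_eq_sub (fun x _ => hχ.differentiable (by simp) x)
        (hd.intervalIntegrable _ _), hχT', hχ0]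
    ring
  have e4 : ∫ t in Ioo 0 T, U t * deriv χ t
      = ∫ t in Ioo 0 T, (c * deriv χ t + deriv χ t * ∫ s in (0 : ℝ)..t, g s) := by
    refine integral_congr_ae ?_
    filter_upwards [hc] with t ht
    rw [ht]; ring
  rw [integral_add (hmul hU hd) (hmul hg hχ.continuous), e4,
    integral_add (hdi.const_mul c) ((hmul hprim hd).congr
      (Eventually.of_forall fun t => mul_comm _ _)), e2,
    integral_const_mul, e3, hχ0] at e1
  simp_rw [mul_comm (χ _)] at e1
  have : c = U₀ := by linarith
  rwa [this] at hc

end TimeDistribution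

/-! ### Weak equations between two times -/

section WeakTime

variable {d : ℕ} {T : ℝ}

lemma integral_pd {φ : Torus d → ℝ} (h : IsSmooth φ) (j : Fin d) : ∫ x, pd j φ x = 0 := by
  obtain ⟨C, hC0, hC⟩ := (h.pd j).bounded
  have hder : ∀ (x : Torus d) (s : ℝ), HasDerivAt
      (fun s : ℝ => φ (x + Pi.single j (s : UnitAddCircle)))
      (pd j φ (x + Pi.single j (s : UnitAddCircle))) s := by
    intro x s
    have h1 := h.hasDerivAt j (x + Pi.single j (s : UnitAddCircle))
    have h2 := HasDerivAt.comp_sub_const (x := s) (a := s) (f := fun u : ℝ =>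
      φ (x + Pi.single j (s : UnitAddCircle) + Pi.single j (u : UnitAddCircle))) (by simpa using h1)
    refine h2.congr_of_eventuallyEq (Eventually.of_forall fun u => ?_)
    simp only
    rw [add_assoc, ← Pi.single_add, ← AddCircle.coe_add, add_sub_cancel]
  have hc : ∀ {ψ : Torus d → ℝ}, Continuous ψ → ∀ s : ℝ,
      Continuous fun x : Torus d => ψ (x + Pi.single j (s : UnitAddCircle)) := fun hψ s =>
    hψ.comp (continuous_add_const _)
  have h1 : HasDerivAt (fun s : ℝ => ∫ x : Torus d, φ (x + Pi.single j (s : UnitAddCircle)))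
      (∫ x : Torus d, pd j φ (x + Pi.single j ((0 : ℝ) : UnitAddCircle))) 0 := by
    have k1 : ∀ᶠ s : ℝ in 𝓝 (0 : ℝ), AEStronglyMeasurable
        (fun x => φ (x + Pi.single j (s : UnitAddCircle))) (volume : Measure (Torus d)) :=
      Eventually.of_forall fun s => (hc h.continuous s).aestronglyMeasurable
    have k2 : ∀ᵐ x ∂(volume : Measure (Torus d)), ∀ s ∈ (univ : Set ℝ),
        ‖pd j φ (x + Pi.single j (s : UnitAddCircle))‖ ≤ C :=
      Eventually.of_forall fun x s _ => hC (x + Pi.single j (s : UnitAddCircle))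
    have k3 : ∀ᵐ x ∂(volume : Measure (Torus d)), ∀ s ∈ (univ : Set ℝ),
        HasDerivAt (fun s : ℝ => φ (x + Pi.single j (s : UnitAddCircle)))
          (pd j φ (x + Pi.single j (s : UnitAddCircle))) s :=
      Eventually.of_forall fun x s _ => hder x s
    exact (hasDerivAt_integral_of_dominated_loc_of_deriv_le univ_mem k1
      (integrable_of_continuous (hc h.continuous 0))
      (hc (h.pd j).continuous 0).aestronglyMeasurable k2 (integrable_const C) k3).2
  have h2 : ∀ (ψ : Torus d → ℝ) (a : Torus d), ∫ x, ψ (x + a) = ∫ x, ψ x := fun ψ a =>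
    integral_add_right_eq_self ψ a
  simp_rw [h2] at h1
  exact h1.unique (hasDerivAt_const 0 _)

lemma integral_mul_pd {φ ψ : Torus d → ℝ} (h : IsSmooth φ) (h' : IsSmooth ψ) (j : Fin d) :
    ∫ x, φ x * pd j ψ x = -∫ x, pd j φ x * ψ x := by
  have h1 := integral_pd (h.mul h') j
  simp_rw [pd_mul h h'] at h1
  rw [integral_add (integrable_of_continuous (f := fun x => pd j φ x * ψ x)
      ((h.pd j).continuous.mul h'.continuous))
    (integrable_of_continuous (f := fun x => φ x * pd j ψ x)
      (h.continuous.mul (h'.pd j).continuous))] at h1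
  linarith

/-- A linear functional on smooth functions that is continuous for the `C¹` norm and vanishes at
all trigonometric functions vanishes. -/
lemma eq_zero_of_trig {L : (Torus d → ℝ) → ℝ}
    (hadd : ∀ φ ψ, IsSmooth φ → IsSmooth ψ → L (fun x => φ x + ψ x) = L φ + L ψ)
    (hmul : ∀ (c : ℝ) φ, IsSmooth φ → L (fun x => c * φ x) = c * L φ)
    {C : ℝ} (hC : ∀ φ M, IsSmooth φ → (∀ x, |φ x| ≤ M) → (∀ j x, |pd j φ x| ≤ M) → |L φ| ≤ C * M)
    (htrig : ∀ k, L (trig k) = 0) {φ : Torus d → ℝ} (hφ : IsSmooth φ) : L φ = 0 := by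
  have hφi : Integrable φ := integrable_of_continuous hφ.continuous
  have hsum : ∀ {ι : Type} (s : Finset ι) (f : ι → Torus d → ℝ), (∀ i ∈ s, IsSmooth (f i)) →
      (∀ i ∈ s, L (f i) = 0) → L (fun x => ∑ i ∈ s, f i x) = 0 := by
    classical
    intro ι s f
    induction s using Finset.induction_on with
    | empty =>
      intro _ _
      have := hmul 0 (fun _ => 0) (isSmooth_const 0)
      simpa using this
    | insert i s hi ih =>
      intro hf h0
      have h1 : (fun x => ∑ i ∈ insert i s, f i x) = fun x => f i x + ∑ i ∈ s, f i x :=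
        funext fun x => Finset.sum_insert hi
      have hf' : ∀ j ∈ s, IsSmooth (f j) := fun j hj => hf j (Finset.mem_insert_of_mem hj)
      rw [h1, hadd _ _ (hf i (Finset.mem_insert_self _ _)) (IsSmooth.sum hf'),
        h0 i (Finset.mem_insert_self _ _),
        ih hf' fun j hj => h0 j (Finset.mem_insert_of_mem hj), add_zero]
  have hfej : ∀ N, L (fejer N φ) = 0 := by
    intro N
    have h1 : fejer N φ = fun x => ((N + 1 : ℝ) ^ d)⁻¹ * ∑ n ∈ box d N, ∑ m ∈ box d N,
      ((∫ y, φ y * trig (true, n - m) y) * trig (true, n - m) x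
        + (∫ y, φ y * trig (false, n - m) y) * trig (false, n - m) x) :=
      funext fun x => fejer_eq_sum hφi N x
    have hs : ∀ n m : Fin d → ℤ, IsSmooth (fun x : Torus d =>
        (∫ y, φ y * trig (true, n - m) y) * trig (true, n - m) x
        + (∫ y, φ y * trig (false, n - m) y) * trig (false, n - m) x) := fun n m =>
      ((isSmooth_trig _).const_mul _).add ((isSmooth_trig _).const_mul _)
    rw [h1, hmul _ _ (IsSmooth.sum fun n _ => IsSmooth.sum fun m _ => hs n m),
      hsum _ _ (fun n _ => IsSmooth.sum fun m _ => hs n m), mul_zero]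
    intro n _
    refine hsum _ _ (fun m _ => hs n m) fun m _ => ?_
    rw [hadd _ _ ((isSmooth_trig _).const_mul _) ((isSmooth_trig _).const_mul _),
      hmul _ _ (isSmooth_trig _), hmul _ _ (isSmooth_trig _), htrig, htrig]
    simp
  have hbound : ∀ ε > 0, |L φ| ≤ C * ε := by
    intro ε hε
    have hev : ∀ᶠ N in atTop, (∀ x, |fejer N φ x - φ x| ≤ ε) ∧
        ∀ j x, |fejer N (pd j φ) x - pd j φ x| ≤ ε :=
      (fejer_tendsto_uniform hφ.continuous ε hε).and
        (eventually_all.2 fun j => fejer_tendsto_uniform (hφ.pd j).continuous ε hε)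
    obtain ⟨N, hN, hN'⟩ := hev.exists
    have hsm := isSmooth_fejer hφi N
    have h2 : L (fun x => fejer N φ x + -1 * φ x) = -L φ := by
      rw [hadd _ _ hsm (hφ.const_mul _), hmul _ _ hφ, hfej]; ring
    have h3 := hC (fun x => fejer N φ x + -1 * φ x) ε (hsm.add (hφ.const_mul _))
      (fun x => by simpa [← sub_eq_add_neg] using hN x) (fun j x => by
        rw [pd_add hsm (hφ.const_mul _), pd_const_mul _ hφ,
          pd_fejer hφi (integrable_of_continuous (hφ.pd j).continuous) j
            (fun k => integral_mul_pd hφ (isSmooth_trig k) j) N x]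
        simpa [← sub_eq_add_neg] using hN' j x)
    rwa [h2, abs_neg] at h3
  have hlim : Tendsto (fun ε : ℝ => C * ε) (𝓝[>] 0) (𝓝 0) := by
    have : Tendsto (fun ε : ℝ => C * ε) (𝓝 0) (𝓝 (C * 0)) := tendsto_id.const_mul C
    rw [mul_zero] at this
    exact this.mono_left nhdsWithin_le_nhds
  have := ge_of_tendsto hlim (eventually_mem_nhdsWithin.mono fun ε hε => hbound ε hε)
  exact abs_eq_zero.1 (le_antisymm this (abs_nonneg _))

/-- The spatial integral of `f₀ φ + ∑ fᵢ ∂ᵢφ` at time `t`: the time derivative, tested with `φ`,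
of a field with source `f₀` and flux `f`. -/
noncomputable def weakFlux (f₀ : ℝ → Torus d → ℝ) (f : Fin d → ℝ → Torus d → ℝ) (φ : Torus d → ℝ)
    (t : ℝ) : ℝ := ∫ x, (f₀ t x * φ x + ∑ i, f i t x * pd i φ x)

/-- Multiplying an integrable function on the slab by a bounded continuous function. -/
lemma integrable_slab_mul {f : ℝ → Torus d → ℝ}
    (hf : Integrable (fun z : ℝ × Torus d => f z.1 z.2) (slab d T)) {φ : Torus d → ℝ}
    (h : IsSmooth φ) : Integrable (fun z : ℝ × Torus d => f z.1 z.2 * φ z.2) (slab d T) := by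
  obtain ⟨C, -, hC⟩ := h.bounded
  exact hf.mul_bdd (c := C) (h.continuous.comp continuous_snd).aestronglyMeasurable
    (Eventually.of_forall fun z => hC z.2)

lemma integrable_slab_mul_time {f : ℝ → Torus d → ℝ}
    (hf : Integrable (fun z : ℝ × Torus d => f z.1 z.2) (slab d T)) {χ : ℝ → ℝ}
    (h : Continuous χ) : Integrable (fun z : ℝ × Torus d => f z.1 z.2 * χ z.1) (slab d T) := by
  obtain ⟨C, hC⟩ := isCompact_Icc.exists_bound_of_continuousOn (s := Icc (0 : ℝ) T) h.continuousOn
  refine hf.mul_bdd (c := C) (h.comp continuous_fst).aestronglyMeasurable ?_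
  rw [slab_eq_restrict]
  refine (ae_restrict_iff' (measurableSet_Ioo.prod MeasurableSet.univ)).2
    (Eventually.of_forall fun z hz => hC _ (Ioo_subset_Icc_self hz.1))

lemma integrable_weakFlux_slab {f₀ : ℝ → Torus d → ℝ} {f : Fin d → ℝ → Torus d → ℝ}
    (hf₀ : Integrable (fun z : ℝ × Torus d => f₀ z.1 z.2) (slab d T))
    (hf : ∀ i, Integrable (fun z : ℝ × Torus d => f i z.1 z.2) (slab d T))
    {φ : Torus d → ℝ} (h : IsSmooth φ) :
    Integrable (fun z : ℝ × Torus d => f₀ z.1 z.2 * φ z.2 + ∑ i, f i z.1 z.2 * pd i φ z.2)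
      (slab d T) :=
  (integrable_slab_mul hf₀ h).add
    (integrable_finsetSum _ fun i _ => integrable_slab_mul (hf i) (h.pd i))

lemma integrableOn_weakFlux {f₀ : ℝ → Torus d → ℝ} {f : Fin d → ℝ → Torus d → ℝ}
    (hf₀ : Integrable (fun z : ℝ × Torus d => f₀ z.1 z.2) (slab d T))
    (hf : ∀ i, Integrable (fun z : ℝ × Torus d => f i z.1 z.2) (slab d T))
    {φ : Torus d → ℝ} (h : IsSmooth φ) : IntegrableOn (weakFlux f₀ f φ) (Ioo 0 T) :=
  integrableOn_integral_slice (integrable_weakFlux_slab hf₀ hf h)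

lemma ae_integrable_slice {f : ℝ → Torus d → ℝ}
    (hf : Integrable (fun z : ℝ × Torus d => f z.1 z.2) (slab d T)) :
    ∀ᵐ t ∂((volume : Measure ℝ).restrict (Ioo 0 T)), Integrable (f t) := hf.prod_right_ae

lemma intervalIntegral_congr_ae_of_mem {f g : ℝ → ℝ}
    (h : ∀ᵐ t ∂((volume : Measure ℝ).restrict (Ioo 0 T)), f t = g t) {s t : ℝ}
    (hs : s ∈ Icc 0 T) (ht : t ∈ Icc 0 T) : ∫ τ in s..t, f τ = ∫ τ in s..t, g τ := by
  refine intervalIntegral.integral_congr_ae ?_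
  rw [restrict_Ioo_eq_restrict_Ioc, ae_restrict_iff' measurableSet_Ioc] at h
  filter_upwards [h] with τ h1 h2
  exact h1 (uIoc_subset_Ioc_of_mem_Icc hs ht h2)

lemma intervalIntegral_weakFlux_add {f₀ : ℝ → Torus d → ℝ} {f : Fin d → ℝ → Torus d → ℝ}
    (hf₀ : Integrable (fun z : ℝ × Torus d => f₀ z.1 z.2) (slab d T))
    (hf : ∀ i, Integrable (fun z : ℝ × Torus d => f i z.1 z.2) (slab d T))
    {φ ψ : Torus d → ℝ} (h : IsSmooth φ) (h' : IsSmooth ψ) {s t : ℝ}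
    (hs : s ∈ Icc 0 T) (ht : t ∈ Icc 0 T) :
    ∫ τ in s..t, weakFlux f₀ f (fun x => φ x + ψ x) τ
      = (∫ τ in s..t, weakFlux f₀ f φ τ) + ∫ τ in s..t, weakFlux f₀ f ψ τ := by
  rw [← intervalIntegral.integral_add
    (IntegrableOn.intervalIntegrable_of_mem (integrableOn_weakFlux hf₀ hf h) hs ht)
    (IntegrableOn.intervalIntegrable_of_mem (integrableOn_weakFlux hf₀ hf h') hs ht)]
  refine intervalIntegral_congr_ae_of_mem ?_ hs ht
  filter_upwards [ae_integrable_slice hf₀, ae_all_iff.2 fun i => ae_integrable_slice (hf i)]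
    with τ h1 h2
  unfold weakFlux
  have hI : ∀ {φ : Torus d → ℝ}, IsSmooth φ →
      Integrable fun x => f₀ τ x * φ x + ∑ i, f i τ x * pd i φ x := fun hφ =>
    (hφ.integrable_mul h1).add (integrable_finsetSum _ fun i _ => (hφ.pd i).integrable_mul (h2 i))
  rw [← integral_add (hI h) (hI h')]
  refine integral_congr_ae (Eventually.of_forall fun x => ?_)
  simp only [pd_add h h', mul_add, Finset.sum_add_distrib]
  ring

lemma weakFlux_const_mul {f₀ : ℝ → Torus d → ℝ} {f : Fin d → ℝ → Torus d → ℝ} (c : ℝ)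
    {φ : Torus d → ℝ} (h : IsSmooth φ) (t : ℝ) :
    weakFlux f₀ f (fun x => c * φ x) t = c * weakFlux f₀ f φ t := by
  unfold weakFlux
  rw [← integral_const_mul]
  refine integral_congr_ae (Eventually.of_forall fun x => ?_)
  simp only [pd_const_mul c h, mul_add, Finset.mul_sum]
  congr 1
  · ring
  · exact Finset.sum_congr rfl fun i _ => by ring

/-- `C¹` continuity of the time integral of the flux in the test function. -/
lemma abs_intervalIntegral_weakFlux_le {f₀ : ℝ → Torus d → ℝ} {f : Fin d → ℝ → Torus d → ℝ}
    (hf₀ : Integrable (fun z : ℝ × Torus d => f₀ z.1 z.2) (slab d T))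
    (hf : ∀ i, Integrable (fun z : ℝ × Torus d => f i z.1 z.2) (slab d T))
    {φ : Torus d → ℝ} (h : IsSmooth φ) {M : ℝ} (h1 : ∀ x, |φ x| ≤ M) (h2 : ∀ j x, |pd j φ x| ≤ M)
    {s t : ℝ} (hs : s ∈ Icc 0 T) (ht : t ∈ Icc 0 T) :
    |∫ τ in s..t, weakFlux f₀ f φ τ|
      ≤ (∫ z, (|f₀ z.1 z.2| + ∑ i, |f i z.1 z.2|) ∂(slab d T)) * M := by
  have hI := integrable_weakFlux_slab hf₀ hf h
  refine (abs_intervalIntegral_le_setIntegral (integrableOn_weakFlux hf₀ hf h) hs ht).trans ?_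
  have hA : Integrable (fun z : ℝ × Torus d => (|f₀ z.1 z.2| + ∑ i, |f i z.1 z.2|) * M)
      (slab d T) := (hf₀.abs.add (integrable_finsetSum _ fun i _ => (hf i).abs)).mul_const M
  rw [← integral_mul_const]
  have e : ∫ z, (|f₀ z.1 z.2| + ∑ i, |f i z.1 z.2|) * M ∂(slab d T)
      = ∫ τ in Ioo 0 T, ∫ x, (|f₀ τ x| + ∑ i, |f i τ x|) * M := integral_prod _ hA
  rw [e]
  refine integral_mono_ae (integrableOn_weakFlux hf₀ hf h).abs hA.integral_prod_left ?_
  filter_upwards [ae_integrable_slice (f := fun τ x => (|f₀ τ x| + ∑ i, |f i τ x|) * M) hA]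
    with τ hτ
  unfold weakFlux
  refine (abs_integral_le_integral_abs).trans (integral_mono_of_nonneg
    (Eventually.of_forall fun x => abs_nonneg _) hτ (Eventually.of_forall fun x => ?_))
  simp only
  rw [add_mul, Finset.sum_mul]
  refine (abs_add_le _ _).trans (add_le_add ?_ ((Finset.abs_sum_le_sum_abs _ _).trans
    (Finset.sum_le_sum fun i _ => ?_)))
  · rw [abs_mul]; exact mul_le_mul_of_nonneg_left (h1 x) (abs_nonneg _)
  · rw [abs_mul]; exact mul_le_mul_of_nonneg_left (h2 i x) (abs_nonneg _)

/-- The identity `∫ u(t) φ = ∫ u₁ φ + ∫_{t₁}^t weakFlux φ`, once it holds for every trigonometric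
function at almost every time, holds at almost every time for all smooth functions at once. -/
lemma ae_forall_smooth {u f₀ : ℝ → Torus d → ℝ} {f : Fin d → ℝ → Torus d → ℝ}
    (hu : Integrable (fun z : ℝ × Torus d => u z.1 z.2) (slab d T))
    (hf₀ : Integrable (fun z : ℝ × Torus d => f₀ z.1 z.2) (slab d T))
    (hf : ∀ i, Integrable (fun z : ℝ × Torus d => f i z.1 z.2) (slab d T))
    {u₁ : Torus d → ℝ} (hu₁ : Integrable u₁) {t₁ : ℝ} (ht₁ : t₁ ∈ Icc 0 T)
    (h : ∀ k, ∀ᵐ t ∂((volume : Measure ℝ).restrict (Ioo 0 T)),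
      ∫ x, u t x * trig k x = (∫ x, u₁ x * trig k x) + ∫ τ in t₁..t, weakFlux f₀ f (trig k) τ) :
    ∀ᵐ t ∂((volume : Measure ℝ).restrict (Ioo 0 T)), ∀ φ, IsSmooth φ →
      ∫ x, u t x * φ x = (∫ x, u₁ x * φ x) + ∫ τ in t₁..t, weakFlux f₀ f φ τ := by
  filter_upwards [ae_all_iff.2 h, ae_integrable_slice hu, ae_restrict_mem measurableSet_Ioo]
    with t h1 h2 ht φ hφ
  have ht' : t ∈ Icc 0 T := Ioo_subset_Icc_self ht
  set L : (Torus d → ℝ) → ℝ := fun φ =>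
    (∫ x, u t x * φ x) - (∫ x, u₁ x * φ x) - ∫ τ in t₁..t, weakFlux f₀ f φ τ with hL
  have key : L φ = 0 := by
    refine eq_zero_of_trig (L := L) (fun φ ψ h h' => ?_) (fun c φ h => ?_)
      (C := (∫ x, |u t x|) + (∫ x, |u₁ x|)
        + ∫ z, (|f₀ z.1 z.2| + ∑ i, |f i z.1 z.2|) ∂(slab d T)) (fun φ M h hM hM' => ?_)
      (fun k => ?_) hφ
    · simp only [hL, mul_add]
      rw [integral_add (h.integrable_mul h2) (h'.integrable_mul h2),
        integral_add (h.integrable_mul hu₁) (h'.integrable_mul hu₁),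
        intervalIntegral_weakFlux_add hf₀ hf h h' ht₁ ht']
      ring
    · simp only [hL, mul_left_comm _ c, integral_const_mul, weakFlux_const_mul c h,
        intervalIntegral.integral_const_mul]
      ring
    · have hb : ∀ {w : Torus d → ℝ}, Integrable w → |∫ x, w x * φ x| ≤ (∫ x, |w x|) * M := by
        intro w hw
        rw [← integral_mul_const]
        refine abs_integral_le_integral_abs.trans (integral_mono_of_nonneg
          (Eventually.of_forall fun x => abs_nonneg _) (hw.abs.mul_const M)
          (Eventually.of_forall fun x => ?_))
        simp only [abs_mul]
        exact mul_le_mul_of_nonneg_left (hM x) (abs_nonneg _)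
      have e1 := hb h2
      have e2 := hb hu₁
      have e3 := abs_intervalIntegral_weakFlux_le hf₀ hf h hM hM' ht₁ ht'
      simp only [hL]
      refine (abs_sub _ _).trans ((add_le_add ((abs_sub _ _).trans (add_le_add e1 e2)) e3).trans
        (le_of_eq (by ring)))
    · simp only [hL, h1 k]; ring
  simp only [hL] at key
  linarith

/-- The time integral of a slab integral against a cutoff in time. -/
lemma integral_slab_mul_cutoff {U g : ℝ → Torus d → ℝ}
    (hU : Integrable (fun z : ℝ × Torus d => U z.1 z.2) (slab d T))
    (hg : Integrable (fun z : ℝ × Torus d => g z.1 z.2) (slab d T)) {χ : ℝ → ℝ}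
    (hχ : ContDiff ℝ ∞ χ) :
    ∫ z, (U z.1 z.2 * deriv χ z.1 + g z.1 z.2 * χ z.1) ∂(slab d T)
      = ∫ t in Ioo 0 T, ((∫ x, U t x) * deriv χ t + (∫ x, g t x) * χ t) := by
  have hd : Continuous (deriv χ) := hχ.continuous_deriv (by simp)
  have h1 := integrable_slab_mul_time hU hd
  have h2 := integrable_slab_mul_time hg hχ.continuous
  have e : ∫ z, (U z.1 z.2 * deriv χ z.1 + g z.1 z.2 * χ z.1) ∂(slab d T)
      = ∫ t in Ioo 0 T, ∫ x, (U t x * deriv χ t + g t x * χ t) := integral_prod _ (h1.add h2)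
  rw [e]
  refine integral_congr_ae ?_
  filter_upwards [ae_integrable_slice hU, ae_integrable_slice hg] with t h3 h4
  rw [integral_add (h3.mul_const _) (h4.mul_const _), integral_mul_const, integral_mul_const]

/-- Weak time derivatives with initial values. -/
lemma ae_forall_smooth_of_isTest (hT : 0 < T) {u f₀ : ℝ → Torus d → ℝ}
    {f : Fin d → ℝ → Torus d → ℝ}
    (hu : Integrable (fun z : ℝ × Torus d => u z.1 z.2) (slab d T))
    (hf₀ : Integrable (fun z : ℝ × Torus d => f₀ z.1 z.2) (slab d T))
    (hf : ∀ i, Integrable (fun z : ℝ × Torus d => f i z.1 z.2) (slab d T))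
    {u₁ : Torus d → ℝ} (hu₁ : Integrable u₁)
    (h : ∀ ψ : ℝ → Torus d → ℝ, IsTest T ψ →
      ∫ z, (u z.1 z.2 * timeDeriv ψ z.1 z.2 + (f₀ z.1 z.2 * ψ z.1 z.2
        + ∑ i, f i z.1 z.2 * spaceDeriv i ψ z.1 z.2)) ∂(slab d T) + ∫ x, u₁ x * ψ 0 x = 0) :
    ∀ᵐ t ∂((volume : Measure ℝ).restrict (Ioo 0 T)), ∀ φ, IsSmooth φ →
      ∫ x, u t x * φ x = (∫ x, u₁ x * φ x) + ∫ τ in (0 : ℝ)..t, weakFlux f₀ f φ τ := by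
  refine ae_forall_smooth hu hf₀ hf hu₁ ⟨le_rfl, hT.le⟩ fun k => ?_
  have hk := isSmooth_trig k
  have hU := integrable_slab_mul hu hk
  have hF := integrable_weakFlux_slab hf₀ hf hk
  refine ae_eq_add_primitive hT (integrableOn_integral_slice
    (H := fun t x => u t x * trig k x) hU) (integrableOn_weakFlux hf₀ hf hk) fun χ hχ hχT => ?_
  have := h _ (isTest_mul hχ hχT hk)
  simp_rw [timeDeriv_mul hχ, spaceDeriv_mul hk] at this
  refine Eq.trans ?_ this
  unfold weakFlux
  rw [← integral_mul_const, ← integral_slab_mul_cutoff (U := fun t x => u t x * trig k x)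
    (g := fun t x => f₀ t x * trig k x + ∑ i, f i t x * pd i (trig k) x) hU hF hχ]
  congr 1
  · refine integral_congr_ae (Eventually.of_forall fun z => ?_)
    simp only [add_mul, Finset.sum_mul]
    congr 1
    · ring
    · congr 1
      · ring
      · exact Finset.sum_congr rfl fun i _ => by ring
  · refine integral_congr_ae (Eventually.of_forall fun x => ?_)
    simp only; ring

/-- Weak time derivatives in the interior; the reference time can be taken in any set of full
measure. -/
lemma exists_ae_forall_smooth_of_isInteriorTest (hT : 0 < T) {u f₀ : ℝ → Torus d → ℝ}
    {f : Fin d → ℝ → Torus d → ℝ}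
    (hu : Integrable (fun z : ℝ × Torus d => u z.1 z.2) (slab d T))
    (hf₀ : Integrable (fun z : ℝ × Torus d => f₀ z.1 z.2) (slab d T))
    (hf : ∀ i, Integrable (fun z : ℝ × Torus d => f i z.1 z.2) (slab d T))
    (h : ∀ ψ : ℝ → Torus d → ℝ, IsInteriorTest T ψ →
      ∫ z, (u z.1 z.2 * timeDeriv ψ z.1 z.2 + (f₀ z.1 z.2 * ψ z.1 z.2
        + ∑ i, f i z.1 z.2 * spaceDeriv i ψ z.1 z.2)) ∂(slab d T) = 0) :
    ∃ t₁ ∈ Ioo 0 T, Integrable (u t₁) ∧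
      ∀ᵐ t ∂((volume : Measure ℝ).restrict (Ioo 0 T)), ∀ φ, IsSmooth φ →
      ∫ x, u t x * φ x = (∫ x, u t₁ x * φ x) + ∫ τ in t₁..t, weakFlux f₀ f φ τ := by
  have h1 : ∀ k, ∃ c, ∀ᵐ t ∂((volume : Measure ℝ).restrict (Ioo 0 T)),
      ∫ x, u t x * trig k x = c + ∫ τ in (0 : ℝ)..t, weakFlux f₀ f (trig k) τ := by
    intro k
    have hk := isSmooth_trig k
    have hU := integrable_slab_mul hu hk
    have hF := integrable_weakFlux_slab hf₀ hf hk
    refine exists_ae_eq_const_add_primitive hT (integrableOn_integral_slice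
      (H := fun t x => u t x * trig k x) hU) (integrableOn_weakFlux hf₀ hf hk)
      fun χ hχ hχT hχ0 => ?_
    have := h _ (isInteriorTest_mul hχ hχT hχ0 hk)
    simp_rw [timeDeriv_mul hχ, spaceDeriv_mul hk] at this
    refine Eq.trans ?_ this
    unfold weakFlux
    rw [← integral_slab_mul_cutoff (U := fun t x => u t x * trig k x)
      (g := fun t x => f₀ t x * trig k x + ∑ i, f i t x * pd i (trig k) x) hU hF hχ]
    refine integral_congr_ae (Eventually.of_forall fun z => ?_)
    simp only [add_mul, Finset.sum_mul]
    congr 1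
    · ring
    · congr 1
      · ring
      · exact Finset.sum_congr rfl fun i _ => by ring
  choose c hc using h1
  have hne : (ae ((volume : Measure ℝ).restrict (Ioo 0 T))).NeBot := by
    rw [ae_neBot, Ne, Measure.restrict_eq_zero, Real.volume_Ioo]
    simpa using hT
  obtain ⟨t₁, ⟨ht₁, hu₁⟩, hm₁⟩ := (((ae_all_iff.2 hc).and (ae_integrable_slice hu)).and
    (ae_restrict_mem measurableSet_Ioo)).exists
  refine ⟨t₁, hm₁, hu₁, ae_forall_smooth hu hf₀ hf hu₁ (Ioo_subset_Icc_self hm₁) fun k => ?_⟩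
  filter_upwards [hc k, ae_restrict_mem measurableSet_Ioo] with t ht htm
  have hint : ∀ {s t : ℝ}, s ∈ Icc 0 T → t ∈ Icc 0 T → IntervalIntegrable
      (weakFlux f₀ f (trig k)) volume s t := fun hs ht =>
    IntegrableOn.intervalIntegrable_of_mem (integrableOn_weakFlux hf₀ hf (isSmooth_trig k)) hs ht
  have h0 : (0 : ℝ) ∈ Icc 0 T := ⟨le_rfl, hT.le⟩
  rw [ht, ht₁ k, add_assoc, intervalIntegral.integral_add_adjacent_intervals
    (hint h0 (Ioo_subset_Icc_self hm₁)) (hint (Ioo_subset_Icc_self hm₁) (Ioo_subset_Icc_self htm))]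

/-- A weak spatial derivative on the slab restricts to almost every time. -/
lemma ae_weakDeriv_slice {f g : ℝ → Torus d → ℝ} {j : Fin d}
    (hf : Integrable (fun z : ℝ × Torus d => f z.1 z.2) (slab d T))
    (hg : Integrable (fun z : ℝ × Torus d => g z.1 z.2) (slab d T))
    (h : ∀ ψ : ℝ → Torus d → ℝ, IsInteriorTest T ψ →
      ∫ z, f z.1 z.2 * spaceDeriv j ψ z.1 z.2 ∂(slab d T)
        = -∫ z, g z.1 z.2 * ψ z.1 z.2 ∂(slab d T)) :
    ∀ᵐ t ∂((volume : Measure ℝ).restrict (Ioo 0 T)), ∀ k,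
      ∫ x, f t x * pd j (trig k) x = -∫ x, g t x * trig k x := by
  refine ae_all_iff.2 fun k => ?_
  have hk := isSmooth_trig k
  have hF := integrable_slab_mul hf (hk.pd j)
  have hG := integrable_slab_mul hg hk
  have hW := integrableOn_integral_slice (H := fun t x => f t x * pd j (trig k) x + g t x * trig k x)
    (hF.add hG)
  have key : ∀ᵐ t ∂(volume : Measure ℝ), t ∈ Ioo 0 T →
      ∫ x, (f t x * pd j (trig k) x + g t x * trig k x) = 0 := by
    refine isOpen_Ioo.ae_eq_zero_of_integral_contDiff_smul_eq_zero (μ := volume)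
      hW.locallyIntegrableOn ?_
    intro χ hχ hχc hχs
    have hz : ∀ t, t ∉ Ioo 0 T → χ t = 0 := fun t ht =>
      image_eq_zero_of_notMem_tsupport fun hh => ht (hχs hh)
    obtain ⟨hb, ha⟩ : (∃ b < T, ∀ t, b ≤ t → χ t = 0) ∧ ∃ a > 0, ∀ t, t ≤ a → χ t = 0 := by
      rcases (tsupport χ).eq_empty_or_nonempty with he | hne
      · have h0 : ∀ t, χ t = 0 := fun t => image_eq_zero_of_notMem_tsupport (by simp [he])
        exact ⟨⟨T - 1, by linarith, fun t _ => h0 t⟩, ⟨1, one_pos, fun t _ => h0 t⟩⟩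
      · have hk : IsCompact (tsupport χ) := hχc
        obtain ⟨x, hx, hxm⟩ := hk.exists_isLeast hne
        obtain ⟨y, hy, hym⟩ := hk.exists_isGreatest hne
        have hx' := hχs hx
        have hy' := hχs hy
        refine ⟨⟨(y + T) / 2, by linarith [hy'.2], fun t ht =>
          image_eq_zero_of_notMem_tsupport fun htk => ?_⟩, ⟨x / 2, by linarith [hx'.1], fun t ht =>
          image_eq_zero_of_notMem_tsupport fun htk => ?_⟩⟩
        · linarith [hym htk, hy'.2]
        · linarith [hxm htk, hx'.1]
    have e1 := h _ (isInteriorTest_mul hχ hb ha hk)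
    simp_rw [spaceDeriv_mul hk] at e1
    have hF' := integrable_slab_mul_time (f := fun t x => f t x * pd j (trig k) x) hF hχ.continuous
    have hG' := integrable_slab_mul_time (f := fun t x => g t x * trig k x) hG hχ.continuous
    have e2 : ∫ z, (f z.1 z.2 * pd j (trig k) z.2 * χ z.1 + g z.1 z.2 * trig k z.2 * χ z.1)
        ∂(slab d T) = 0 := by
      rw [integral_add hF' hG']
      have e3 : ∫ z, f z.1 z.2 * pd j (trig k) z.2 * χ z.1 ∂(slab d T)
          = ∫ z, f z.1 z.2 * (χ z.1 * pd j (trig k) z.2) ∂(slab d T) :=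
        integral_congr_ae (Eventually.of_forall fun z => by simp only; ring)
      have e4 : ∫ z, g z.1 z.2 * trig k z.2 * χ z.1 ∂(slab d T)
          = ∫ z, g z.1 z.2 * (χ z.1 * trig k z.2) ∂(slab d T) :=
        integral_congr_ae (Eventually.of_forall fun z => by simp only; ring)
      rw [e3, e4, e1]; ring
    have e5 : ∫ z, (f z.1 z.2 * pd j (trig k) z.2 * χ z.1 + g z.1 z.2 * trig k z.2 * χ z.1)
        ∂(slab d T) = ∫ t in Ioo 0 T, ∫ x, (f t x * pd j (trig k) x * χ t + g t x * trig k x * χ t) :=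
      integral_prod _ (hF'.add hG')
    have e6 := setIntegral_eq_integral_of_forall_compl_eq_zero (μ := volume) (s := Ioo 0 T)
      (f := fun t => χ t • ∫ x, (f t x * pd j (trig k) x + g t x * trig k x))
      fun t ht => by rw [hz t ht, zero_smul]
    refine e6.symm.trans (Eq.trans ?_ (e5.symm.trans e2))
    refine integral_congr_ae (Eventually.of_forall fun t => ?_)
    simp only [smul_eq_mul]
    rw [← integral_const_mul]
    exact integral_congr_ae (Eventually.of_forall fun x => by simp only; ring)
  refine (ae_restrict_iff' measurableSet_Ioo).2 ?_
  have hf' := (ae_restrict_iff' measurableSet_Ioo).1 (ae_integrable_slice hf)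
  have hg' := (ae_restrict_iff' measurableSet_Ioo).1 (ae_integrable_slice hg)
  filter_upwards [key, hf', hg'] with t h1 h2 h3 ht
  have := h1 ht
  rw [integral_add ((hk.pd j).integrable_mul (h2 ht)) (hk.integrable_mul (h3 ht))] at this
  linarith

end WeakTime

/-! ### Regular weak solutions -/

section Regular

variable {d : ℕ}

/-- The entry `(i, j)` of the momentum flux `ϱ v ⊗ v + ϱ^γ I - μ (∇v)ᵀ - (μ + λ) div v I`, where
`A` stands for the velocity gradient. -/
noncomputable def stress (γ mu lam : ℝ) (ρ : ℝ) (u : Vel d) (A : Grad d) (i j : Fin d) : ℝ :=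
  ρ * u i * u j - mu * A (j, i) + if i = j then ρ ^ γ - (mu + lam) * divg A else 0

/-- A weak solution with `ϱ ∈ L^k L^l`, `v ∈ L^a L^b`, `∇v ∈ L^c L^e` and
`∇√ϱ ∈ L^{4/3} L^{4/3}`, for exponents at which the trilinear convective term `ϱ v ⊗ v : ∇v` and
the pressure work `ϱ^γ div v` are integrable. -/
structure IsRegular (T γ mu lam : ℝ) (r₀ : Torus d → ℝ) (v₀ : Torus d → Vel d)
    (r : ℝ → Torus d → ℝ) (v : ℝ → Torus d → Vel d) (G : ℝ → Torus d → Grad d)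
    (k l a b c e : ℝ) : Prop where
  time_pos : 0 < T
  one_lt_gamma : 1 < γ
  sol : IsWeakSolution T γ mu lam r₀ v₀ r v G
  two_le_k : 2 ≤ k
  two_le_l : 2 ≤ l
  four_le_a : 4 ≤ a
  four_le_b : 4 ≤ b
  two_le_c : 2 ≤ c
  two_le_e : 2 ≤ e
  scale_time : 1 / k + 2 / a + 1 / c = 1
  scale_space : 1 / l + 2 / b + 1 / e = 1
  pressure_time : γ / k + 1 / c ≤ 1
  pressure_space : γ / l + 1 / e ≤ 1
  density : MemLpLq T (ENNReal.ofReal k) (ENNReal.ofReal l) r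
  velocity : MemLpLq T (ENNReal.ofReal a) (ENNReal.ofReal b) v
  gradient : MemLpLq T (ENNReal.ofReal c) (ENNReal.ofReal e) G
  sqrt_gradient : GradMemLpLq T (ENNReal.ofReal (4 / 3)) (ENNReal.ofReal (4 / 3))
    (fun t x => √(r t x))

namespace IsRegular

variable {T γ mu lam : ℝ} {r₀ : Torus d → ℝ} {v₀ : Torus d → Vel d}
    {r : ℝ → Torus d → ℝ} {v : ℝ → Torus d → Vel d} {G : ℝ → Torus d → Grad d}
    {k l a b c e : ℝ}

lemma memLpLq_velocity (h : IsRegular T γ mu lam r₀ v₀ r v G k l a b c e) (i : Fin d) :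
    MemLpLq T (ENNReal.ofReal a) (ENNReal.ofReal b) (fun t x => v t x i) :=
  h.velocity.mono_norm ((EuclideanSpace.proj i : Vel d →L[ℝ] ℝ).continuous.comp_aestronglyMeasurable
    h.velocity.1) (Eventually.of_forall fun z => PiLp.norm_apply_le (v z.1 z.2) i)

lemma memLpLq_gradient (h : IsRegular T γ mu lam r₀ v₀ r v G k l a b c e) (ij : Fin d × Fin d) :
    MemLpLq T (ENNReal.ofReal c) (ENNReal.ofReal e) (fun t x => G t x ij) :=
  h.gradient.mono_norm ((EuclideanSpace.proj ij : Grad d →L[ℝ] ℝ).continuous.comp_aestronglyMeasurable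
    h.gradient.1) (Eventually.of_forall fun z => PiLp.norm_apply_le (G z.1 z.2) ij)

lemma memLpLq_divg (h : IsRegular T γ mu lam r₀ v₀ r v G k l a b c e) :
    MemLpLq T (ENNReal.ofReal c) (ENNReal.ofReal e) (fun t x => divg (G t x)) := by
  have hc := h.two_le_c
  have he := h.two_le_e
  unfold divg
  exact memLpLq_finset_sum _ (fun i _ => h.memLpLq_gradient (i, i))
    (ENNReal.one_le_ofReal.2 (by linarith)) (ENNReal.one_le_ofReal.2 (by linarith))
    ENNReal.ofReal_ne_top

lemma conj_c (h : IsRegular T γ mu lam r₀ v₀ r v G k l a b c e) :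
    c.HolderConjugate c.conjExponent :=
  Real.HolderConjugate.conjExponent (by linarith [h.two_le_c])

lemma conj_e (h : IsRegular T γ mu lam r₀ v₀ r v G k l a b c e) :
    e.HolderConjugate e.conjExponent :=
  Real.HolderConjugate.conjExponent (by linarith [h.two_le_e])

lemma inv_conj_c (h : IsRegular T γ mu lam r₀ v₀ r v G k l a b c e) :
    1 / c.conjExponent = 1 / k + 2 / a := by
  have := h.conj_c.inv_add_inv_eq_one
  have := h.scale_time
  simp only [one_div] at *
  linarith

lemma inv_conj_e (h : IsRegular T γ mu lam r₀ v₀ r v G k l a b c e) :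
    1 / e.conjExponent = 1 / l + 2 / b := by
  have := h.conj_e.inv_add_inv_eq_one
  have := h.scale_space
  simp only [one_div] at *
  linarith

lemma conj_c_le (h : IsRegular T γ mu lam r₀ v₀ r v G k l a b c e) : c.conjExponent ≤ c := by
  have hc := h.two_le_c
  rw [Real.conjExponent, div_le_iff₀ (by linarith)]; nlinarith

lemma conj_e_le (h : IsRegular T γ mu lam r₀ v₀ r v G k l a b c e) : e.conjExponent ≤ e := by
  have hc := h.two_le_e
  rw [Real.conjExponent, div_le_iff₀ (by linarith)]; nlinarith

/-- The momentum in its natural mixed norm. -/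
lemma memLpLq_momentum (h : IsRegular T γ mu lam r₀ v₀ r v G k l a b c e) (i : Fin d) :
    MemLpLq T (ENNReal.ofReal (1 / k + 1 / a)⁻¹) (ENNReal.ofReal (1 / l + 1 / b)⁻¹)
      (fun t x => r t x * v t x i) := by
  have h1 := h.two_le_k
  have h2 := h.two_le_l
  have h3 := h.four_le_a
  have h4 := h.four_le_b
  exact h.density.mul (h.memLpLq_velocity i) (by positivity) (by positivity) (by positivity)
    (by simp) (by positivity) (by positivity) (by positivity) (by simp)

/-- The convective flux is dual to the velocity gradient. -/
lemma memLpLq_convection (h : IsRegular T γ mu lam r₀ v₀ r v G k l a b c e) (i j : Fin d) :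
    MemLpLq T (ENNReal.ofReal c.conjExponent) (ENNReal.ofReal e.conjExponent)
      (fun t x => r t x * v t x i * v t x j) := by
  have h1 := h.two_le_k
  have h2 := h.two_le_l
  have h3 := h.four_le_a
  have h4 := h.four_le_b
  have h5 := h.conj_c.symm.pos
  have h6 := h.conj_e.symm.pos
  refine (h.memLpLq_momentum i).mul (h.memLpLq_velocity j) h5 (by positivity) (by positivity)
    ?_ h6 (by positivity) (by positivity) ?_
  · rw [h.inv_conj_c]; simp; ring
  · rw [h.inv_conj_e]; simp; ring

lemma ae_pressure_eq (h : IsRegular T γ mu lam r₀ v₀ r v G k l a b c e) :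
    ∀ᵐ z ∂(slab d T), r z.1 z.2 ^ γ = ‖r z.1 z.2‖ ^ γ := by
  filter_upwards [h.sol.density_nonneg] with z hz
  rw [Real.norm_of_nonneg hz]

lemma memLpLq_pressure (h : IsRegular T γ mu lam r₀ v₀ r v G k l a b c e) :
    MemLpLq T (ENNReal.ofReal c.conjExponent) (ENNReal.ofReal e.conjExponent)
      (fun t x => r t x ^ γ) := by
  have h0 := h.one_lt_gamma
  have h1 := h.two_le_k
  have h2 := h.two_le_l
  have h5 := h.conj_c.symm.pos
  have h6 := h.conj_e.symm.pos
  have h7 := (h.density.norm_rpow (by linarith) (by linarith) (s := γ) (by linarith))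
  have hc := h.conj_c.inv_add_inv_eq_one
  have he := h.conj_e.inv_add_inv_eq_one
  have hp := h.pressure_time
  have hq := h.pressure_space
  refine (h7.mono_exponent (p' := c.conjExponent) (q' := e.conjExponent) ?_
    (by positivity) ?_).mono_norm ?_ ?_
  · rw [← inv_le_inv₀ (by positivity) h5, inv_div]; rw [one_div] at hp; linarith
  · rw [← inv_le_inv₀ (by positivity) h6, inv_div]; rw [one_div] at hq; linarith
  · refine h7.1.congr ?_
    filter_upwards [h.ae_pressure_eq] with z hz using hz.symm
  · filter_upwards [h.ae_pressure_eq] with z hz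
    rw [hz]

lemma memLpLq_stress (h : IsRegular T γ mu lam r₀ v₀ r v G k l a b c e) (i j : Fin d) :
    MemLpLq T (ENNReal.ofReal c.conjExponent) (ENNReal.ofReal e.conjExponent)
      (fun t x => stress γ mu lam (r t x) (v t x) (G t x) i j) := by
  have h1 : (1 : ℝ≥0∞) ≤ ENNReal.ofReal c.conjExponent :=
    ENNReal.one_le_ofReal.2 h.conj_c.symm.lt.le
  have h2 : (1 : ℝ≥0∞) ≤ ENNReal.ofReal e.conjExponent :=
    ENNReal.one_le_ofReal.2 h.conj_e.symm.lt.le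
  have he : 0 < e := by linarith [h.two_le_e]
  have h3 := (h.memLpLq_gradient (j, i)).mono_exponent h.conj_c_le he h.conj_e_le
  have h4 := h.memLpLq_divg.mono_exponent h.conj_c_le he h.conj_e_le
  have h5 : MemLpLq T (ENNReal.ofReal c.conjExponent) (ENNReal.ofReal e.conjExponent)
      (fun t x => if i = j then r t x ^ γ - (mu + lam) * divg (G t x) else 0) := by
    by_cases hij : i = j
    · simp only [hij, if_true]
      have := h.memLpLq_pressure.add (h4.const_mul (-(mu + lam))) h1 h2 ENNReal.ofReal_ne_top
      simpa only [sub_eq_add_neg, neg_mul] using this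
    · simp only [hij, if_false]
      simpa using h4.const_mul 0
  have h6 := ((h.memLpLq_convection i j).add (h3.const_mul (-mu)) h1 h2 ENNReal.ofReal_ne_top).add
    h5 h1 h2 ENNReal.ofReal_ne_top
  unfold stress
  simpa only [sub_eq_add_neg, neg_mul] using h6

/-- The mixed norm of `v ∂v` is dual to that of the momentum. -/
lemma memLpLq_velocity_mul_gradient (h : IsRegular T γ mu lam r₀ v₀ r v G k l a b c e) (j : Fin d)
    (ij : Fin d × Fin d) :
    MemLpLq T (ENNReal.ofReal (1 / a + 1 / c)⁻¹) (ENNReal.ofReal (1 / b + 1 / e)⁻¹)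
      (fun t x => v t x j * G t x ij) := by
  have h1 := h.two_le_c
  have h2 := h.two_le_e
  have h3 := h.four_le_a
  have h4 := h.four_le_b
  exact (h.memLpLq_velocity j).mul (h.memLpLq_gradient ij) (by positivity) (by positivity)
    (by positivity) (by simp) (by positivity) (by positivity) (by positivity) (by simp)

lemma conj_time (h : IsRegular T γ mu lam r₀ v₀ r v G k l a b c e) :
    (1 / a + 1 / c)⁻¹.HolderConjugate (1 / k + 1 / a)⁻¹ := by
  have h1 := h.two_le_c
  have h2 := h.two_le_k
  have h3 := h.four_le_a
  have h4 := h.scale_time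
  rw [Real.holderConjugate_iff]
  have h5 : 0 < 1 / k := by positivity
  have h6 : 0 < 1 / a := by positivity
  have h7 : 0 < 1 / c := by positivity
  have h8 : 2 / a = 1 / a + 1 / a := by ring
  refine ⟨(one_lt_inv₀ (by positivity)).2 (by linarith), ?_⟩
  rw [inv_inv, inv_inv]; linarith

lemma conj_space (h : IsRegular T γ mu lam r₀ v₀ r v G k l a b c e) :
    (1 / b + 1 / e)⁻¹.HolderConjugate (1 / l + 1 / b)⁻¹ := by
  have h1 := h.two_le_e
  have h2 := h.two_le_l
  have h3 := h.four_le_b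
  have h4 := h.scale_space
  rw [Real.holderConjugate_iff]
  have h5 : 0 < 1 / l := by positivity
  have h6 : 0 < 1 / b := by positivity
  have h7 : 0 < 1 / e := by positivity
  have h8 : 2 / b = 1 / b + 1 / b := by ring
  refine ⟨(one_lt_inv₀ (by positivity)).2 (by linarith), ?_⟩
  rw [inv_inv, inv_inv]; linarith

lemma integrable_density (h : IsRegular T γ mu lam r₀ v₀ r v G k l a b c e) :
    Integrable (fun z : ℝ × Torus d => r z.1 z.2) (slab d T) :=
  h.density.integrable (by linarith [h.two_le_k]) (by linarith [h.two_le_l])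

lemma integrable_velocity (h : IsRegular T γ mu lam r₀ v₀ r v G k l a b c e) (i : Fin d) :
    Integrable (fun z : ℝ × Torus d => v z.1 z.2 i) (slab d T) :=
  (h.memLpLq_velocity i).integrable (by linarith [h.four_le_a]) (by linarith [h.four_le_b])

lemma integrable_gradient (h : IsRegular T γ mu lam r₀ v₀ r v G k l a b c e) (i : Fin d × Fin d) :
    Integrable (fun z : ℝ × Torus d => G z.1 z.2 i) (slab d T) :=
  (h.memLpLq_gradient i).integrable (by linarith [h.two_le_c]) (by linarith [h.two_le_e])

lemma integrable_divg (h : IsRegular T γ mu lam r₀ v₀ r v G k l a b c e) :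
    Integrable (fun z : ℝ × Torus d => divg (G z.1 z.2)) (slab d T) :=
  h.memLpLq_divg.integrable (by linarith [h.two_le_c]) (by linarith [h.two_le_e])

lemma integrable_momentum (h : IsRegular T γ mu lam r₀ v₀ r v G k l a b c e) (i : Fin d) :
    Integrable (fun z : ℝ × Torus d => r z.1 z.2 * v z.1 z.2 i) (slab d T) :=
  (h.memLpLq_momentum i).integrable h.conj_time.symm.lt.le h.conj_space.symm.lt.le

lemma integrable_stress (h : IsRegular T γ mu lam r₀ v₀ r v G k l a b c e) (i j : Fin d) :
    Integrable (fun z : ℝ × Torus d => stress γ mu lam (r z.1 z.2) (v z.1 z.2) (G z.1 z.2) i j)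
      (slab d T) :=
  (h.memLpLq_stress i j).integrable h.conj_c.symm.lt.le h.conj_e.symm.lt.le

lemma integrable_pressure_work (h : IsRegular T γ mu lam r₀ v₀ r v G k l a b c e) :
    Integrable (fun z : ℝ × Torus d => r z.1 z.2 ^ γ * divg (G z.1 z.2)) (slab d T) :=
  h.memLpLq_pressure.integrable_mul h.conj_c.symm h.conj_e.symm h.memLpLq_divg

lemma integrable_r₀ (h : IsRegular T γ mu lam r₀ v₀ r v G k l a b c e) : Integrable r₀ :=
  h.sol.initial.density_memLp.integrable (ENNReal.one_le_ofReal.2 h.one_lt_gamma.le)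

lemma integrable_momentum₀ (h : IsRegular T γ mu lam r₀ v₀ r v G k l a b c e) (j : Fin d) :
    Integrable (fun x => r₀ x * v₀ x j) := by
  have hm : AEStronglyMeasurable (fun x => r₀ x * v₀ x j) :=
    h.integrable_r₀.1.mul ((EuclideanSpace.proj j : Vel d →L[ℝ] ℝ).continuous.comp_aestronglyMeasurable
      h.sol.initial.velocity_measurable)
  refine (h.integrable_r₀.add h.sol.initial.kinetic_integrable).mono' hm ?_
  filter_upwards [h.sol.initial.density_nonneg] with x hx
  have h1 : |v₀ x j| ≤ ‖v₀ x‖ := PiLp.norm_apply_le (v₀ x) j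
  have h2 : |v₀ x j| ≤ 1 + ‖v₀ x‖ ^ 2 := by nlinarith [norm_nonneg (v₀ x)]
  rw [norm_mul, Real.norm_of_nonneg hx, Real.norm_eq_abs]
  calc r₀ x * |v₀ x j| ≤ r₀ x * (1 + ‖v₀ x‖ ^ 2) := mul_le_mul_of_nonneg_left h2 hx
    _ = _ := by simp only [Pi.add_apply]; ring

/-- The continuity equation at almost every time. -/
lemma ae_mass (h : IsRegular T γ mu lam r₀ v₀ r v G k l a b c e) :
    ∀ᵐ t ∂((volume : Measure ℝ).restrict (Ioo 0 T)), ∀ φ, IsSmooth φ →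
      ∫ x, r t x * φ x = (∫ x, r₀ x * φ x)
        + ∫ τ in (0 : ℝ)..t, weakFlux 0 (fun i t x => r t x * v t x i) φ τ := by
  refine ae_forall_smooth_of_isTest h.time_pos h.integrable_density (integrable_zero _ _ _)
    h.integrable_momentum h.integrable_r₀ fun ψ hψ => ?_
  simpa using h.sol.mass ψ hψ

/-- The momentum equation at almost every time. -/
lemma ae_momentum (h : IsRegular T γ mu lam r₀ v₀ r v G k l a b c e) (j : Fin d) :
    ∀ᵐ t ∂((volume : Measure ℝ).restrict (Ioo 0 T)), ∀ φ, IsSmooth φ →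
      ∫ x, r t x * v t x j * φ x = (∫ x, r₀ x * v₀ x j * φ x)
        + ∫ τ in (0 : ℝ)..t, weakFlux 0
          (fun i t x => stress γ mu lam (r t x) (v t x) (G t x) i j) φ τ := by
  refine ae_forall_smooth_of_isTest h.time_pos (h.integrable_momentum j) (integrable_zero _ _ _)
    (fun i => h.integrable_stress i j) (h.integrable_momentum₀ j) fun ψ hψ => ?_
  refine Eq.trans ?_ (h.sol.momentum ψ hψ j)
  congr 1
  refine integral_congr_ae (Eventually.of_forall fun z => ?_)
  simp only [Pi.zero_apply, zero_mul, zero_add, stress, add_mul, sub_mul, ite_mul,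
    Finset.sum_add_distrib, Finset.sum_sub_distrib, Finset.sum_ite_eq', Finset.mem_univ, if_true,
    Finset.mul_sum]
  simp only [mul_assoc]
  ring

end IsRegular
end Regular

/-! ### Cut-off primitives -/

section Cutoff

/-- The primitive of `g` cut off at arguments between `n` and `n + 1`. -/
noncomputable def cutoffPrimitive (g : ℝ → ℝ) (n : ℕ) (s : ℝ) : ℝ :=
  ∫ σ in (0 : ℝ)..s, max 0 (min 1 (n + 1 - σ)) * g σ

variable {g : ℝ → ℝ}

lemma hasDerivAt_cutoffPrimitive (hg : Continuous g) (n : ℕ) (s : ℝ) :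
    HasDerivAt (cutoffPrimitive g n) (max 0 (min 1 (n + 1 - s)) * g s) s := by
  have : Continuous fun σ : ℝ => max 0 (min 1 (n + 1 - σ)) * g σ := by fun_prop
  exact (this.integral_hasStrictDerivAt 0 s).hasDerivAt

lemma deriv_cutoffPrimitive (hg : Continuous g) (n : ℕ) (s : ℝ) :
    deriv (cutoffPrimitive g n) s = max 0 (min 1 (n + 1 - s)) * g s :=
  (hasDerivAt_cutoffPrimitive hg n s).deriv

lemma contDiff_cutoffPrimitive (hg : Continuous g) (n : ℕ) :
    ContDiff ℝ 1 (cutoffPrimitive g n) := by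
  rw [contDiff_one_iff_deriv]
  refine ⟨fun s => (hasDerivAt_cutoffPrimitive hg n s).differentiableAt, ?_⟩
  rw [show deriv (cutoffPrimitive g n) = _ from funext (deriv_cutoffPrimitive hg n)]
  fun_prop

lemma deriv_cutoffPrimitive_of_le (hg : Continuous g) (n : ℕ) {s : ℝ} (hs : (n + 1 : ℝ) ≤ s) :
    deriv (cutoffPrimitive g n) s = 0 := by
  rw [deriv_cutoffPrimitive hg, max_eq_left, zero_mul]
  exact (min_le_right _ _).trans (by linarith)

lemma deriv_cutoffPrimitive_eq (hg : Continuous g) {n : ℕ} {s : ℝ} (hs : s ≤ n) :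
    deriv (cutoffPrimitive g n) s = g s := by
  rw [deriv_cutoffPrimitive hg, min_eq_left (by linarith), max_eq_right zero_le_one, one_mul]

lemma abs_deriv_cutoffPrimitive_le (hg : Continuous g) (n : ℕ) (s : ℝ) :
    |deriv (cutoffPrimitive g n) s| ≤ |g s| := by
  rw [deriv_cutoffPrimitive hg, abs_mul, abs_of_nonneg (le_max_left _ _)]
  exact mul_le_of_le_one_left (abs_nonneg _) (max_le zero_le_one (min_le_left _ _))

lemma cutoffPrimitive_eq {n : ℕ} {s : ℝ} (hs : s ≤ n) :
    cutoffPrimitive g n s = ∫ σ in (0 : ℝ)..s, g σ := by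
  refine intervalIntegral.integral_congr fun σ hσ => ?_
  have : σ ≤ n := hσ.2.trans (max_le (by positivity) hs)
  rw [min_eq_left (by linarith), max_eq_right zero_le_one, one_mul]

lemma cutoffPrimitive_nonneg (hg0 : ∀ s, 0 ≤ g s) (n : ℕ) {s : ℝ}
    (hs : 0 ≤ s) : 0 ≤ cutoffPrimitive g n s :=
  intervalIntegral.integral_nonneg hs fun σ _ => mul_nonneg (le_max_left _ _) (hg0 σ)

lemma cutoffPrimitive_le (hg : Continuous g) (hg0 : ∀ s, 0 ≤ g s) (n : ℕ) {s : ℝ}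
    (hs : 0 ≤ s) : cutoffPrimitive g n s ≤ ∫ σ in (0 : ℝ)..s, g σ := by
  refine intervalIntegral.integral_mono_on hs ?_ (hg.intervalIntegrable _ _) fun σ _ => ?_
  · exact (by fun_prop : Continuous fun σ : ℝ => max 0 (min 1 (n + 1 - σ)) * g σ).intervalIntegrable
      _ _
  · exact mul_le_of_le_one_left (hg0 σ) (max_le zero_le_one (min_le_left _ _))

/-- Cut-off primitives are bounded. -/
lemma exists_cutoffPrimitive_bound (hg : Continuous g) (hg0 : ∀ s, 0 ≤ g s) (n : ℕ) :
    ∃ C, ∀ s, 0 ≤ s → |cutoffPrimitive g n s| ≤ C := by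
  refine ⟨∫ σ in (0 : ℝ)..(n + 1), g σ, fun s hs => ?_⟩
  rw [abs_of_nonneg (cutoffPrimitive_nonneg hg0 n hs)]
  have hmono : ∀ {a b : ℝ}, 0 ≤ a → a ≤ b →
      ∫ σ in (0 : ℝ)..a, g σ ≤ ∫ σ in (0 : ℝ)..b, g σ := by
    intro a b ha hab
    rw [← intervalIntegral.integral_add_adjacent_intervals (hg.intervalIntegrable 0 a)
      (hg.intervalIntegrable a b)]
    linarith [intervalIntegral.integral_nonneg (μ := volume) hab fun σ (_ : σ ∈ Icc a b) => hg0 σ]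
  rcases le_total s (n + 1) with h | h
  · exact (cutoffPrimitive_le hg hg0 n hs).trans (hmono hs h)
  · have hc : Continuous fun σ : ℝ => max 0 (min 1 (n + 1 - σ)) * g σ := by fun_prop
    have e : cutoffPrimitive g n s = cutoffPrimitive g n (n + 1) := by
      unfold cutoffPrimitive
      rw [← intervalIntegral.integral_add_adjacent_intervals (hc.intervalIntegrable 0 (n + 1))
        (hc.intervalIntegrable (n + 1) s), add_eq_left]
      rw [intervalIntegral.integral_congr (g := fun _ => (0 : ℝ)), intervalIntegral.integral_zero]
      intro σ hσ
      rw [uIcc_of_le h] at hσ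
      simp only
      rw [max_eq_left, zero_mul]
      exact (min_le_right _ _).trans (by linarith [hσ.1])
    rw [e]
    exact cutoffPrimitive_le hg hg0 n (by positivity)

end Cutoff

/-! ### Renormalization between two times -/

section Renormalized

variable {d : ℕ}

/-- Dominated convergence on the slab, for integrals over a time interval. -/
lemma tendsto_intervalIntegral_of_dominated {T : ℝ} {F : ℕ → ℝ → Torus d → ℝ}
    {F' B : ℝ → Torus d → ℝ}
    (hm : ∀ n, AEStronglyMeasurable (fun z : ℝ × Torus d => F n z.1 z.2) (slab d T))
    (hB : Integrable (fun z : ℝ × Torus d => B z.1 z.2) (slab d T))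
    (hle : ∀ n, ∀ᵐ z ∂(slab d T), |F n z.1 z.2| ≤ B z.1 z.2)
    (hlim : ∀ᵐ z ∂(slab d T), Tendsto (fun n => F n z.1 z.2) atTop (𝓝 (F' z.1 z.2)))
    {s t : ℝ} (hs : s ∈ Icc 0 T) (ht : t ∈ Icc 0 T) :
    Tendsto (fun n => ∫ τ in s..t, ∫ x, F n τ x) atTop (𝓝 (∫ τ in s..t, ∫ x, F' τ x)) := by
  have hFi : ∀ n, Integrable (fun z : ℝ × Torus d => F n z.1 z.2) (slab d T) := fun n =>
    hB.mono' (hm n) (hle n)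
  have hm' : AEStronglyMeasurable (fun z : ℝ × Torus d => F' z.1 z.2) (slab d T) :=
    aestronglyMeasurable_of_tendsto_ae atTop hm hlim
  have hle' : ∀ᵐ z ∂(slab d T), |F' z.1 z.2| ≤ B z.1 z.2 := by
    filter_upwards [ae_all_iff.2 hle, hlim] with z h1 h2
    exact le_of_tendsto h2.abs (Eventually.of_forall h1)
  have hFi' : Integrable (fun z : ℝ × Torus d => F' z.1 z.2) (slab d T) := hB.mono' hm' hle'
  have h1 : Tendsto (fun n => ∫ z, |F n z.1 z.2 - F' z.1 z.2| ∂(slab d T)) atTop (𝓝 0) := by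
    have := tendsto_integral_of_dominated_convergence (μ := slab d T)
      (F := fun n (z : ℝ × Torus d) => |F n z.1 z.2 - F' z.1 z.2|)
      (f := fun _ => 0) (fun z : ℝ × Torus d => B z.1 z.2 + B z.1 z.2)
      (fun n => ((hFi n).sub hFi').abs.1) (hB.add hB) (fun n => by
        filter_upwards [hle n, hle'] with z h1 h2
        rw [Real.norm_eq_abs, abs_abs]
        exact (abs_sub _ _).trans (add_le_add h1 h2)) (by
        filter_upwards [hlim] with z hz
        have := (hz.sub_const (F' z.1 z.2)).abs
        simpa using this)
    simpa using this
  rw [tendsto_iff_norm_sub_tendsto_zero]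
  refine squeeze_zero (fun n => norm_nonneg _) (fun n => ?_) h1
  have hint : ∀ {H : ℝ → Torus d → ℝ}, Integrable (fun z : ℝ × Torus d => H z.1 z.2) (slab d T) →
      IntervalIntegrable (fun τ => ∫ x, H τ x) volume s t := fun hH =>
    IntegrableOn.intervalIntegrable_of_mem (integrableOn_integral_slice hH) hs ht
  have hd : Integrable (fun z : ℝ × Torus d => F n z.1 z.2 - F' z.1 z.2) (slab d T) :=
    (hFi n).sub hFi'
  rw [← intervalIntegral.integral_sub (hint (hFi n)) (hint hFi')]
  rw [Real.norm_eq_abs, intervalIntegral_congr_ae_of_mem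
    (g := fun τ => ∫ x, (F n τ x - F' τ x)) (by
      filter_upwards [ae_integrable_slice (hFi n), ae_integrable_slice hFi'] with τ h2 h3
      rw [integral_sub h2 h3]) hs ht]
  have hsl := integrableOn_integral_slice (H := fun τ x => F n τ x - F' τ x) hd
  refine (abs_intervalIntegral_le_setIntegral hsl hs ht).trans ?_
  have e : ∫ z, |F n z.1 z.2 - F' z.1 z.2| ∂(slab d T)
      = ∫ τ in Ioo 0 T, ∫ x, |F n τ x - F' τ x| := integral_prod _ hd.abs
  rw [e]
  refine integral_mono_ae hsl.abs (Integrable.integral_prod_left hd.abs)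
    (Eventually.of_forall fun τ => abs_integral_le_integral_abs)

namespace IsRegular

variable {T γ mu lam : ℝ} {r₀ : Torus d → ℝ} {v₀ : Torus d → Vel d}
    {r : ℝ → Torus d → ℝ} {v : ℝ → Torus d → Vel d} {G : ℝ → Torus d → Grad d}
    {k l a b c e : ℝ}

lemma aestronglyMeasurable_comp_density (h : IsRegular T γ mu lam r₀ v₀ r v G k l a b c e)
    {β : ℝ → ℝ} (hβ : Continuous β) :
    AEStronglyMeasurable (fun z : ℝ × Torus d => β (r z.1 z.2)) (slab d T) :=
  hβ.comp_aestronglyMeasurable h.integrable_density.1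

/-- Renormalization by a cut-off primitive, between any two times of a set of full measure. -/
lemma exists_set_cutoff (h : IsRegular T γ mu lam r₀ v₀ r v G k l a b c e) {g : ℝ → ℝ}
    (hg : Continuous g) (hg0 : ∀ s, 0 ≤ g s) (n : ℕ) :
    ∃ S : Set ℝ, (∀ᵐ t ∂((volume : Measure ℝ).restrict (Ioo 0 T)), t ∈ S) ∧ S ⊆ Ioo 0 T ∧
      ∀ s ∈ S, ∀ t ∈ S, ∀ φ, IsSmooth φ →
      ∫ x, cutoffPrimitive g n (r t x) * φ x = (∫ x, cutoffPrimitive g n (r s x) * φ x)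
        + ∫ τ in s..t, weakFlux (fun t x => (cutoffPrimitive g n (r t x)
          - deriv (cutoffPrimitive g n) (r t x) * r t x) * divg (G t x))
          (fun i t x => cutoffPrimitive g n (r t x) * v t x i) φ τ := by
  set β := cutoffPrimitive g n with hβ
  have hβc : ContDiff ℝ 1 β := contDiff_cutoffPrimitive hg n
  obtain ⟨C, hC⟩ := exists_cutoffPrimitive_bound hg hg0 n
  have hdc : Continuous (deriv β) := hβc.continuous_deriv le_rfl
  obtain ⟨D, hD⟩ : ∃ D, ∀ s, 0 ≤ s → |deriv β s * s| ≤ D := by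
    obtain ⟨D, hD⟩ := isCompact_Icc.exists_bound_of_continuousOn (s := Icc (0 : ℝ) (n + 1))
      (f := fun s => deriv β s * s) (by fun_prop)
    refine ⟨max D 0, fun s hs => ?_⟩
    rcases le_total s (n + 1) with h | h
    · exact (hD s ⟨hs, h⟩).trans (le_max_left _ _)
    · rw [hβ, deriv_cutoffPrimitive_of_le hg n h]; simp
  have hu : Integrable (fun z : ℝ × Torus d => β (r z.1 z.2)) (slab d T) :=
    Integrable.of_bound (h.aestronglyMeasurable_comp_density hβc.continuous) C (by
      filter_upwards [h.sol.density_nonneg] with z hz using hC _ hz)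
  have hf : ∀ i, Integrable (fun z : ℝ × Torus d => β (r z.1 z.2) * v z.1 z.2 i) (slab d T) :=
    fun i => (h.integrable_velocity i).bdd_mul (c := C)
      (h.aestronglyMeasurable_comp_density hβc.continuous) (by
        filter_upwards [h.sol.density_nonneg] with z hz using hC _ hz)
  have hf₀ : Integrable (fun z : ℝ × Torus d => (β (r z.1 z.2)
      - deriv β (r z.1 z.2) * r z.1 z.2) * divg (G z.1 z.2)) (slab d T) :=
    h.integrable_divg.bdd_mul (c := C + D)
      (h.aestronglyMeasurable_comp_density (β := fun s => β s - deriv β s * s)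
        (hβc.continuous.sub (hdc.mul continuous_id))) (by
        filter_upwards [h.sol.density_nonneg] with z hz
        exact (norm_sub_le _ _).trans (add_le_add (hC _ hz) (hD _ hz)))
  obtain ⟨t₁, ht₁, -, h1⟩ := exists_ae_forall_smooth_of_isInteriorTest h.time_pos
    (u := fun t x => β (r t x)) (f₀ := fun t x => (β (r t x) - deriv β (r t x) * r t x)
      * divg (G t x)) (f := fun i t x => β (r t x) * v t x i) hu hf₀ hf fun ψ hψ => by
      rw [← h.sol.renormalized β hβc ⟨n + 1, fun s hs => deriv_cutoffPrimitive_of_le hg n hs⟩ ψ hψ]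
      refine integral_congr_ae (Eventually.of_forall fun z => ?_)
      simp only
      ring
  refine ⟨_, (h1.and (ae_restrict_mem measurableSet_Ioo)), fun t ht => ht.2,
    fun s hs t ht φ hφ => ?_⟩
  have hint : ∀ {s t : ℝ}, s ∈ Ioo 0 T → t ∈ Ioo 0 T → IntervalIntegrable
      (weakFlux (fun t x => (β (r t x) - deriv β (r t x) * r t x) * divg (G t x))
        (fun i t x => β (r t x) * v t x i) φ) volume s t := fun hs ht =>
    IntegrableOn.intervalIntegrable_of_mem (integrableOn_weakFlux hf₀ hf hφ)
      (Ioo_subset_Icc_self hs) (Ioo_subset_Icc_self ht)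
  rw [ht.1 φ hφ, hs.1 φ hφ, add_assoc, intervalIntegral.integral_add_adjacent_intervals
    (hint ht₁ hs.2) (hint hs.2 ht.2)]

/-- Renormalization by the arctangent, between any two times of a set of full measure. -/
lemma exists_set_arctan (h : IsRegular T γ mu lam r₀ v₀ r v G k l a b c e) :
    ∃ S : Set ℝ, (∀ᵐ t ∂((volume : Measure ℝ).restrict (Ioo 0 T)), t ∈ S) ∧ S ⊆ Ioo 0 T ∧
      ∀ s ∈ S, ∀ t ∈ S, ∀ φ, IsSmooth φ →
      ∫ x, Real.arctan (r t x) * φ x = (∫ x, Real.arctan (r s x) * φ x)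
        + ∫ τ in s..t, weakFlux (fun t x => (Real.arctan (r t x)
          - r t x / (1 + r t x ^ 2)) * divg (G t x))
          (fun i t x => Real.arctan (r t x) * v t x i) φ τ := by
  set g : ℝ → ℝ := fun s => 1 / (1 + s ^ 2) with hg
  have hgc : Continuous g := continuous_const.div (by fun_prop) fun s => by positivity
  have hg0 : ∀ s, 0 ≤ g s := fun s => by positivity
  have hprim : ∀ s : ℝ, ∫ σ in (0 : ℝ)..s, g σ = Real.arctan s := fun s => by
    simp [hg]
  choose S hS hST hSeq using fun n : ℕ => h.exists_set_cutoff hgc hg0 n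
  have hle : ∀ (n : ℕ) {s : ℝ}, 0 ≤ s → |cutoffPrimitive g n s| ≤ 2 := fun n s hs => by
    rw [abs_of_nonneg (cutoffPrimitive_nonneg hg0 n hs)]
    have := cutoffPrimitive_le hgc hg0 n hs
    rw [hprim] at this
    linarith [Real.arctan_lt_pi_div_two s, Real.pi_lt_four]
  have hle' : ∀ (n : ℕ) {s : ℝ}, 0 ≤ s → |deriv (cutoffPrimitive g n) s * s| ≤ 1 :=
    fun n s hs => by
      rw [abs_mul]
      refine (mul_le_mul_of_nonneg_right (abs_deriv_cutoffPrimitive_le hgc n s)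
        (abs_nonneg _)).trans ?_
      rw [abs_of_nonneg (hg0 s), abs_of_nonneg hs, hg, one_div_mul_eq_div, div_le_one (by positivity)]
      nlinarith [sq_nonneg (s - 1)]
  have hev : ∀ s : ℝ, ∀ᶠ n : ℕ in atTop, cutoffPrimitive g n s = Real.arctan s ∧
      deriv (cutoffPrimitive g n) s * s = s / (1 + s ^ 2) := fun s => by
    filter_upwards [tendsto_natCast_atTop_atTop.eventually_ge_atTop s] with n hn
    rw [cutoffPrimitive_eq hn, hprim, deriv_cutoffPrimitive_eq hgc hn]
    exact ⟨rfl, by simp only [hg]; ring⟩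
  have hslice : ∀ᵐ t ∂((volume : Measure ℝ).restrict (Ioo 0 T)),
      AEStronglyMeasurable (r t) ∧ ∀ᵐ x, 0 ≤ r t x :=
    (ae_aestronglyMeasurable_slice h.integrable_density.1).and
      (Measure.ae_ae_of_ae_prod h.sol.density_nonneg)
  refine ⟨_, (ae_all_iff.2 hS).and hslice, fun t ht => hST 0 (ht.1 0), fun s hs t ht φ hφ => ?_⟩
  obtain ⟨K, hK0, hK⟩ := hφ.bounded
  choose K' hK'0 hK' using fun i => (hφ.pd i).bounded
  have hspace : ∀ {ρ : Torus d → ℝ}, AEStronglyMeasurable ρ → (∀ᵐ x, 0 ≤ ρ x) →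
      Tendsto (fun n : ℕ => ∫ x, cutoffPrimitive g n (ρ x) * φ x) atTop
        (𝓝 (∫ x, Real.arctan (ρ x) * φ x)) := by
    intro ρ hρ hρ0
    refine tendsto_integral_of_dominated_convergence (fun _ => 2 * K) (fun n => ?_)
      (integrable_const _) (fun n => ?_) (Eventually.of_forall fun x => ?_)
    · exact ((contDiff_cutoffPrimitive hgc n).continuous.comp_aestronglyMeasurable hρ).mul
        (hφ.aestronglyMeasurable _)
    · filter_upwards [hρ0] with x hx
      rw [norm_mul]
      exact mul_le_mul (hle n hx) (hK x) (norm_nonneg _) (by norm_num)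
    · refine Tendsto.mul_const _ (tendsto_const_nhds.congr' ?_)
      filter_upwards [hev (ρ x)] with n hn using hn.1.symm
  have h1 := hspace hs.2.1 hs.2.2
  have h2 := hspace ht.2.1 ht.2.2
  have h3 : Tendsto (fun n : ℕ => ∫ τ in s..t, weakFlux (fun t x => (cutoffPrimitive g n (r t x)
          - deriv (cutoffPrimitive g n) (r t x) * r t x) * divg (G t x))
          (fun i t x => cutoffPrimitive g n (r t x) * v t x i) φ τ) atTop
      (𝓝 (∫ τ in s..t, weakFlux (fun t x => (Real.arctan (r t x)
          - r t x / (1 + r t x ^ 2)) * divg (G t x))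
          (fun i t x => Real.arctan (r t x) * v t x i) φ τ)) := by
    unfold weakFlux
    refine tendsto_intervalIntegral_of_dominated
      (B := fun t x => 3 * |divg (G t x)| * K + ∑ i, 2 * |v t x i| * K' i) (fun n => ?_) ?_
      (fun n => ?_) (Eventually.of_forall fun z => ?_)
      (Ioo_subset_Icc_self (hST 0 (hs.1 0))) (Ioo_subset_Icc_self (hST 0 (ht.1 0)))
    · have hdc : Continuous (deriv (cutoffPrimitive g n)) :=
        (contDiff_cutoffPrimitive hgc n).continuous_deriv le_rfl
      have hbc := (contDiff_cutoffPrimitive hgc n).continuous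
      have := h.aestronglyMeasurable_comp_density (β := fun s => cutoffPrimitive g n s
        - deriv (cutoffPrimitive g n) s * s) (hbc.sub (hdc.mul continuous_id))
      refine ((this.mul h.integrable_divg.1).mul
        (hφ.continuous.comp continuous_snd).aestronglyMeasurable).add
        (Finset.aestronglyMeasurable_fun_sum _ fun i _ => ?_)
      exact ((h.aestronglyMeasurable_comp_density hbc).mul (h.integrable_velocity i).1).mul
        ((hφ.pd i).continuous.comp continuous_snd).aestronglyMeasurable
    · exact ((h.integrable_divg.abs.const_mul 3).mul_const K).add
        (integrable_finsetSum _ fun i _ => ((h.integrable_velocity i).abs.const_mul 2).mul_const _)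
    · filter_upwards [h.sol.density_nonneg] with z hz
      refine (abs_add_le _ _).trans (add_le_add ?_ ((Finset.abs_sum_le_sum_abs _ _).trans
        (Finset.sum_le_sum fun i _ => ?_)))
      · rw [abs_mul, abs_mul]
        refine mul_le_mul (mul_le_mul_of_nonneg_right ?_ (abs_nonneg _)) (hK _) (abs_nonneg _)
          (by positivity)
        exact (abs_sub _ _).trans (by linarith [hle n hz, hle' n hz])
      · rw [abs_mul, abs_mul]
        exact mul_le_mul (mul_le_mul_of_nonneg_right (hle n hz) (abs_nonneg _)) (hK' i _)
          (abs_nonneg _) (by positivity)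
    · refine tendsto_const_nhds.congr' ?_
      filter_upwards [hev (r z.1 z.2)] with n hn
      simp only [hn.1, hn.2]
  exact tendsto_nhds_unique h2 ((h1.add h3).congr fun n => (hSeq n s (hs.1 n) t (ht.1 n) φ hφ).symm)

end IsRegular
end Renormalized

/-! ### Riesz representation in weighted L² -/

section Riesz

variable {d : ℕ}

/-- The smooth functions as a subspace. -/
def smoothSubmodule (d : ℕ) : Submodule ℝ (Torus d → ℝ) where
  carrier := {φ | IsSmooth φ}
  add_mem' h h' := IsSmooth.add h h'
  zero_mem' := isSmooth_const 0
  smul_mem' c _ h := IsSmooth.const_mul c h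

/-- Riesz representation of a functional on smooth functions that is bounded for the norm of
`L²(ν)`. -/
lemma exists_memLp_of_sq_le {ν : Measure (Torus d)} [IsFiniteMeasure ν] {L : (Torus d → ℝ) → ℝ}
    (hadd : ∀ φ ψ, IsSmooth φ → IsSmooth ψ → L (fun x => φ x + ψ x) = L φ + L ψ)
    (hmul : ∀ (c : ℝ) φ, IsSmooth φ → L (fun x => c * φ x) = c * L φ) {C : ℝ}
    (hC : ∀ φ, IsSmooth φ → L φ ^ 2 ≤ C * ∫ x, φ x ^ 2 ∂ν) (hC0 : 0 ≤ C) :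
    ∃ f, MemLp f 2 ν ∧ (∀ φ, IsSmooth φ → ∫ x, f x * φ x ∂ν = L φ) ∧ ∫ x, f x ^ 2 ∂ν ≤ C := by
  let ι : smoothSubmodule d →ₗ[ℝ] Lp ℝ 2 ν :=
    { toFun := fun φ => (IsSmooth.memLp φ.2 ν 2).toLp
      map_add' := fun φ ψ => MemLp.toLp_add _ _
      map_smul' := fun c φ => MemLp.toLp_const_smul _ _ }
  let F : smoothSubmodule d →ₗ[ℝ] ℝ :=
    { toFun := fun φ => L φ.1
      map_add' := fun φ ψ => hadd _ _ φ.2 ψ.2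
      map_smul' := fun c φ => hmul c _ φ.2 }
  have hι : ∀ φ : smoothSubmodule d, ‖ι φ‖ ^ 2 = ∫ x, φ.1 x ^ 2 ∂ν := by
    intro φ
    rw [← real_inner_self_eq_norm_sq, L2.inner_def]
    refine integral_congr_ae ?_
    filter_upwards [(IsSmooth.memLp φ.2 ν 2).coeFn_toLp] with x hx
    have : (ι φ) x = φ.1 x := hx
    simp only [this, real_inner_self_eq_norm_sq, Real.norm_eq_abs, sq_abs]
  have hd : DenseRange ι := by
    refine Metric.denseRange_iff.2 fun g ε hε => ?_
    obtain ⟨φ, hφ, hle⟩ := exists_isSmooth_eLpNorm_sub_le (p := 2) (ν := ν) (by norm_num) (by simp)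
      (Lp.memLp g) (ε := ENNReal.ofReal (ε / 2)) (by simpa using hε)
    refine ⟨⟨φ, hφ⟩, ?_⟩
    have e : eLpNorm (fun x => g x - φ x) 2 ν
        = eLpNorm (fun x => (g - ι ⟨φ, hφ⟩ : Lp ℝ 2 ν) x) 2 ν := by
      refine eLpNorm_congr_ae ?_
      filter_upwards [(IsSmooth.memLp hφ ν 2).coeFn_toLp, Lp.coeFn_sub g (ι ⟨φ, hφ⟩)] with x h1 h2
      have : (ι ⟨φ, hφ⟩) x = φ x := h1
      rw [h2, Pi.sub_apply, this]
    rw [dist_eq_norm, Lp.norm_def, ← e]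
    refine lt_of_le_of_lt (ENNReal.toReal_le_of_le_ofReal (by positivity) hle) (by linarith)
  have hb : ∀ φ, ‖F φ‖ ≤ √C * ‖ι φ‖ := by
    intro φ
    refine abs_le_of_sq_le_sq ?_ (by positivity)
    rw [mul_pow, Real.sq_sqrt hC0, hι]
    exact hC _ φ.2
  set E := F.extendOfNorm ι with hE
  set g : Lp ℝ 2 ν := (InnerProductSpace.toDual ℝ (Lp ℝ 2 ν)).symm E with hg
  have hEn : ‖E‖ ≤ √C := F.opNorm_extendOfNorm_le hd (Real.sqrt_nonneg _) hb
  have hgn : ‖g‖ ≤ √C := by rw [hg, LinearIsometryEquiv.norm_map]; exact hEn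
  refine ⟨g, Lp.memLp g, fun φ hφ => ?_, ?_⟩
  · have h1 : inner ℝ g (ι ⟨φ, hφ⟩) = F ⟨φ, hφ⟩ := by
      rw [hg, InnerProductSpace.toDual_symm_apply, hE, F.extendOfNorm_eq hd ⟨_, hb⟩]
    rw [L2.inner_def] at h1
    refine Eq.trans (integral_congr_ae ?_) h1
    filter_upwards [(IsSmooth.memLp hφ ν 2).coeFn_toLp] with x hx
    have : (ι ⟨φ, hφ⟩) x = φ x := hx
    simp only [this, RCLike.inner_apply, conj_trivial]
    ring
  · have h1 : ‖g‖ ^ 2 = ∫ x, g x ^ 2 ∂ν := by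
      rw [← real_inner_self_eq_norm_sq, L2.inner_def]
      refine integral_congr_ae (Eventually.of_forall fun x => ?_)
      simp only [real_inner_self_eq_norm_sq, Real.norm_eq_abs, sq_abs]
    rw [← h1, ← Real.sq_sqrt hC0]
    exact pow_le_pow_left₀ (norm_nonneg _) hgn 2

end Riesz

/-! ### Sequences of good times -/

section Sequences

variable {T : ℝ}

/-- Near every time there are times of a given set of full measure at which an integrable function
`A` is small compared with the inverse distance. -/
lemma exists_seq_tendsto_mul (hT : 0 < T) {A : ℝ → ℝ} (hA : IntegrableOn A (Ioo 0 T))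
    (hA0 : ∀ t, 0 ≤ A t) {P : ℝ → Prop} (hP : ∀ᵐ t ∂((volume : Measure ℝ).restrict (Ioo 0 T)), P t)
    {s : ℝ} (hs : s ∈ Icc 0 T) :
    ∃ t : ℕ → ℝ, (∀ n, t n ∈ Ioo 0 T ∧ P (t n)) ∧ Tendsto t atTop (𝓝 s) ∧
      Tendsto (fun n => |t n - s| * A (t n)) atTop (𝓝 0) := by
  have hAi : IntervalIntegrable A volume 0 T :=
    IntegrableOn.intervalIntegrable_of_mem hA ⟨le_rfl, hT.le⟩ ⟨hT.le, le_rfl⟩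
  -- an interval inside `(0, T)` with endpoint `s`
  obtain ⟨δ, hδ0, hδ⟩ : ∃ δ : ℝ, δ ≠ 0 ∧ ∀ θ ∈ Ioo (0 : ℝ) 1, s + θ * δ ∈ Ioo 0 T := by
    rcases lt_or_ge s T with h | h
    · refine ⟨T - s, by linarith, fun θ hθ => ⟨?_, ?_⟩⟩
      · nlinarith [hs.1, hθ.1, mul_pos hθ.1 (sub_pos.2 h)]
      · nlinarith [hθ.2, sub_pos.2 h]
    · have : s = T := le_antisymm hs.2 h
      subst this
      exact ⟨-s, by linarith, fun θ hθ => ⟨by nlinarith [hθ.2], by nlinarith [hθ.1]⟩⟩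
  -- the integral of `A` over the shrinking interval tends to zero
  have hη : ∀ η > 0, ∃ θ ∈ Ioo (0 : ℝ) 1, ∃ t, t ∈ Ioo 0 T ∧ P t ∧ |t - s| ≤ θ * |δ| ∧
      |t - s| * A t ≤ η ∧ θ ≤ η := by
    intro η hη
    have hcont := continuousOn_primitive hA hT
    have hlim : Tendsto (fun θ : ℝ => ∫ τ in s..(s + θ * δ), A τ) (𝓝[>] 0) (𝓝 0) := by
      have h1 : Tendsto (fun θ : ℝ => s + θ * δ) (𝓝[>] 0) (𝓝[Icc 0 T] s) := by
        refine tendsto_nhdsWithin_iff.2 ⟨?_, ?_⟩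
        · have : Tendsto (fun θ : ℝ => s + θ * δ) (𝓝 0) (𝓝 (s + 0 * δ)) :=
            (continuous_const.add (continuous_id.mul continuous_const)).tendsto _
          rw [zero_mul, add_zero] at this
          exact this.mono_left nhdsWithin_le_nhds
        · filter_upwards [Ioo_mem_nhdsGT (zero_lt_one (α := ℝ))] with θ hθ
          exact Ioo_subset_Icc_self (hδ θ hθ)
      have h2 := ((hcont s hs).tendsto.comp h1).sub_const (∫ τ in (0 : ℝ)..s, A τ)
      rw [sub_self] at h2
      refine h2.congr' ?_
      filter_upwards [Ioo_mem_nhdsGT (zero_lt_one (α := ℝ))] with θ hθ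
      simp only [Function.comp]
      rw [intervalIntegral.integral_interval_sub_left
        (IntegrableOn.intervalIntegrable_of_mem hA ⟨le_rfl, hT.le⟩ (Ioo_subset_Icc_self (hδ θ hθ)))
        (IntegrableOn.intervalIntegrable_of_mem hA ⟨le_rfl, hT.le⟩ hs)]
    obtain ⟨θ, ⟨h1, h2⟩, h3⟩ := (((hlim.eventually (Metric.ball_mem_nhds 0 hη)).and
      (Ioo_mem_nhdsGT (zero_lt_one (α := ℝ)))).and (Ioo_mem_nhdsGT hη)).exists
    have hI : uIoc s (s + θ * δ) ⊆ Ioc 0 T :=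
      uIoc_subset_Ioc_of_mem_Icc hs (Ioo_subset_Icc_self (hδ θ h2))
    have hlen : |s + θ * δ - s| = θ * |δ| := by
      rw [add_sub_cancel_left, abs_mul, abs_of_pos h2.1]
    have hpos : 0 < θ * |δ| := mul_pos h2.1 (abs_pos.2 hδ0)
    set μ : Measure ℝ := volume.restrict (uIoc s (s + θ * δ)) with hμ
    have hvol : volume (uIoc s (s + θ * δ)) = ENNReal.ofReal (θ * |δ|) := by
      rw [Real.volume_uIoc, hlen]
    have hμ0 : μ ≠ 0 := by
      rw [hμ, Ne, Measure.restrict_eq_zero, hvol]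
      simpa using hpos
    have hAμ : Integrable A μ :=
      (IntegrableOn.intervalIntegrable_of_mem hA hs (Ioo_subset_Icc_self (hδ θ h2))).def'
    have hPμ : ∀ᵐ t ∂μ, P t ∧ t ∈ Ioo 0 T ∧ t ∈ uIoc s (s + θ * δ) := by
      have h4 : ∀ᵐ t ∂((volume : Measure ℝ).restrict (Ioo 0 T)), P t ∧ t ∈ Ioo 0 T :=
        hP.and (ae_restrict_mem measurableSet_Ioo)
      rw [restrict_Ioo_eq_restrict_Ioc] at h4
      filter_upwards [ae_restrict_of_ae_restrict_of_subset hI h4,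
        ae_restrict_mem measurableSet_uIoc] with t h5 h6
      exact ⟨h5.1, h5.2, h6⟩
    have : IsFiniteMeasure μ :=
      ⟨by rw [hμ, Measure.restrict_apply_univ, hvol]; exact ENNReal.ofReal_lt_top⟩
    obtain ⟨t, ht, hle⟩ := exists_notMem_null_le_average hμ0 hAμ (ae_iff.1 hPμ)
    simp only [mem_ofPred_eq, not_not] at ht
    have hts : |t - s| ≤ θ * |δ| := by
      rw [← hlen]
      rcases mem_uIoc.1 ht.2.2 with h | h
      · rw [abs_of_nonneg (by linarith), abs_of_nonneg (by linarith)]; linarith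
      · rw [abs_of_nonpos (by linarith), abs_of_nonpos (by linarith)]; linarith
    refine ⟨θ, h2, t, ht.2.1, ht.1, hts, ?_, h3.2.le⟩
    have e : ∫ τ, A τ ∂μ = |∫ τ in s..(s + θ * δ), A τ| := by
      rw [intervalIntegral.abs_intervalIntegral_eq, abs_of_nonneg
        (integral_nonneg fun τ => hA0 τ)]
    rw [average_eq, e, smul_eq_mul, measureReal_restrict_apply_univ, measureReal_def, hvol,
      ENNReal.toReal_ofReal hpos.le] at hle
    rw [dist_zero_right, Real.norm_eq_abs] at h1
    calc |t - s| * A t ≤ (θ * |δ|) * ((θ * |δ|)⁻¹ * |∫ τ in s..(s + θ * δ), A τ|) :=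
          mul_le_mul hts hle (hA0 t) hpos.le
      _ = |∫ τ in s..(s + θ * δ), A τ| := by rw [← mul_assoc, mul_inv_cancel₀ hpos.ne', one_mul]
      _ ≤ η := h1.le
  choose θ hθ t ht hPt hts hA' hθη using fun n : ℕ => hη (1 / (n + 1)) (by positivity)
  have hz : Tendsto (fun n : ℕ => 1 / ((n : ℝ) + 1)) atTop (𝓝 0) :=
    tendsto_one_div_add_atTop_nhds_zero_nat
  refine ⟨t, fun n => ⟨ht n, hPt n⟩, ?_, squeeze_zero
    (fun n => mul_nonneg (abs_nonneg _) (hA0 _)) hA' hz⟩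
  rw [tendsto_iff_norm_sub_tendsto_zero]
  refine squeeze_zero (g := fun n : ℕ => 1 / ((n : ℝ) + 1) * |δ|) (fun n => norm_nonneg _)
    (fun n => (hts n).trans (mul_le_mul_of_nonneg_right (hθη n) (abs_nonneg _))) ?_
  simpa using hz.mul_const |δ|

end Sequences

/-! ### A gradient bound for the arctangent of the density -/

section FluxBound

variable {d : ℕ}

lemma hasDerivAt_arctan_sq (s : ℝ) :
    HasDerivAt (fun s : ℝ => Real.arctan (s ^ 2)) (2 * s / (1 + s ^ 4)) s := by
  have h := ((hasDerivAt_pow 2 s).arctan)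
  refine h.congr_deriv ?_
  rw [← pow_mul]; norm_num; ring

lemma abs_two_mul_div_le (s : ℝ) : |2 * s / (1 + s ^ 4)| ≤ 2 := by
  rw [abs_div, abs_of_pos (by positivity : (0 : ℝ) < 1 + s ^ 4), div_le_iff₀ (by positivity),
    abs_mul, abs_two]
  have h1 : |s| ^ 2 = s ^ 2 := sq_abs s
  have h2 : s ^ 4 = (s ^ 2) ^ 2 := by ring
  rw [h2, ← h1]
  nlinarith [sq_nonneg (|s| - 1), sq_nonneg (|s| ^ 2 - 1), sq_nonneg (|s| ^ 2), abs_nonneg s]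

lemma abs_arctan_sq_sub_le (x y : ℝ) :
    |Real.arctan (x ^ 2) - Real.arctan (y ^ 2)| ≤ 2 * |x - y| :=
  convex_univ.norm_image_sub_le_of_norm_hasDerivWithin_le (𝕜 := ℝ)
    (f := fun s : ℝ => Real.arctan (s ^ 2)) (f' := fun s => 2 * s / (1 + s ^ 4))
    (fun s _ => (hasDerivAt_arctan_sq s).hasDerivWithinAt) (fun s _ => abs_two_mul_div_le s)
    (mem_univ y) (mem_univ x)

lemma abs_arctan_le_two (x : ℝ) : |Real.arctan x| ≤ 2 := by
  rw [abs_le]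
  constructor
  · linarith [Real.neg_pi_div_two_lt_arctan x, Real.pi_le_four]
  · linarith [Real.arctan_lt_pi_div_two x, Real.pi_le_four]

lemma abs_div_one_add_sq_le (x : ℝ) : |x / (1 + x ^ 2)| ≤ 1 := by
  rw [abs_div, abs_of_pos (by positivity : (0 : ℝ) < 1 + x ^ 2), div_le_one (by positivity),
    ← sq_abs]
  nlinarith [sq_nonneg (|x| - 1)]

lemma mul_le_pow_four_add {x y : ℝ} (hx : 0 ≤ x) (hy : 0 ≤ y) :
    x * y ≤ x ^ (4 : ℝ) + y ^ (4 / 3 : ℝ) := by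
  have h : (4 : ℝ).HolderConjugate (4 / 3) := by
    rw [Real.holderConjugate_iff]; norm_num
  have h1 := Real.young_inequality_of_nonneg hx hy h
  have h2 : 0 ≤ x ^ (4 : ℝ) := by positivity
  have h3 : 0 ≤ y ^ (4 / 3 : ℝ) := by positivity
  linarith [div_le_self h2 (by norm_num : (1 : ℝ) ≤ 4),
    div_le_self h3 (by norm_num : (1 : ℝ) ≤ 4 / 3)]

lemma integral_rpow_fejer_le {q : ℝ} (hq : 1 ≤ q) {f : Torus d → ℝ}
    (hf : MemLp f (ENNReal.ofReal q)) (N : ℕ) :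
    ∫ x, ‖fejer N f x‖ ^ q ≤ ∫ x, ‖f x‖ ^ q := by
  have hq' : (1 : ℝ≥0∞) ≤ ENNReal.ofReal q := ENNReal.one_le_ofReal.2 hq
  have hi := hf.integrable hq'
  have hN : MemLp (fejer N f) (ENNReal.ofReal q) := (isSmooth_fejer hi N).memLp _ _
  have h0 : ENNReal.ofReal q ≠ 0 := (zero_lt_one.trans_le hq').ne'
  have h := eLpNorm_fejer_le hq' ENNReal.ofReal_ne_top hf.1 N
  rw [hN.eLpNorm_eq_integral_rpow_norm h0 ENNReal.ofReal_ne_top,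
    hf.eLpNorm_eq_integral_rpow_norm h0 ENNReal.ofReal_ne_top,
    ENNReal.toReal_ofReal (by linarith)] at h
  have hn : ∀ g : Torus d → ℝ, 0 ≤ ∫ x, ‖g x‖ ^ q := fun g =>
    integral_nonneg fun x => by positivity
  rw [ENNReal.ofReal_le_ofReal_iff (Real.rpow_nonneg (hn _) _)] at h
  exact (Real.rpow_le_rpow_iff (hn _) (hn _) (by positivity)).1 h

namespace IsRegular

variable {T γ mu lam : ℝ} {r₀ : Torus d → ℝ} {v₀ : Torus d → Vel d}
    {r : ℝ → Torus d → ℝ} {v : ℝ → Torus d → Vel d} {G : ℝ → Torus d → Grad d}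
    {k l a b c e : ℝ}

/-- The flux of `arctan ϱ`, tested with smooth approximations of `arctan ϱ(t)` itself, is bounded
by an integrable function of the two times involved. This is the only place where the regularity
of `√ϱ` enters. -/
lemma exists_arctan_flux_bound (h : IsRegular T γ mu lam r₀ v₀ r v G k l a b c e) :
    ∃ A : ℝ → ℝ, IntegrableOn A (Ioo 0 T) ∧ (∀ t, 0 ≤ A t) ∧
      ∀ᵐ t ∂((volume : Measure ℝ).restrict (Ioo 0 T)), ∃ φ : ℕ → Torus d → ℝ,
        (∀ N, IsSmooth (φ N)) ∧
        Tendsto (fun N => eLpNorm (fun x => φ N x - Real.arctan (r t x)) 2 volume) atTop (𝓝 0) ∧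
        ∀ N, ∀ᵐ τ ∂((volume : Measure ℝ).restrict (Ioo 0 T)),
          |weakFlux (fun t x => (Real.arctan (r t x) - r t x / (1 + r t x ^ 2)) * divg (G t x))
            (fun i t x => Real.arctan (r t x) * v t x i) (φ N) τ| ≤ A t + A τ := by
  obtain ⟨H, ⟨hw, hHi, hwg⟩, hHm⟩ := h.sqrt_gradient
  have hHj : ∀ j, MemLpLq T (ENNReal.ofReal (4 / 3)) (ENNReal.ofReal (4 / 3))
      (fun t x => H t x j) := fun j =>
    hHm.mono_norm ((EuclideanSpace.proj j : Vel d →L[ℝ] ℝ).continuous.comp_aestronglyMeasurable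
      hHm.1) (Eventually.of_forall fun z => PiLp.norm_apply_le (H z.1 z.2) j)
  have hHji : ∀ j, Integrable (fun z : ℝ × Torus d => H z.1 z.2 j) (slab d T) := fun j =>
    (hHj j).integrable (by norm_num) (by norm_num)
  have hHp : ∀ j, Integrable (fun z : ℝ × Torus d => ‖H z.1 z.2 j‖ ^ (4 / 3 : ℝ)) (slab d T) :=
    fun j => ((hHj j).norm_rpow (by norm_num) (by norm_num) (s := 4 / 3)
      (by norm_num)).integrable (by norm_num) (by norm_num)
  have ha := h.four_le_a
  have hb := h.four_le_b
  have hvp : ∀ j, Integrable (fun z : ℝ × Torus d => ‖v z.1 z.2 j‖ ^ (4 : ℝ)) (slab d T) :=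
    fun j => ((h.memLpLq_velocity j).norm_rpow (by linarith) (by linarith) (s := 4)
      (by norm_num)).integrable (by linarith) (by linarith)
  set B : ℝ → Torus d → ℝ := fun t x =>
    6 * |divg (G t x)| + ∑ i, 4 * (‖v t x i‖ ^ (4 : ℝ) + ‖H t x i‖ ^ (4 / 3 : ℝ)) with hB
  have hBi : Integrable (fun z : ℝ × Torus d => B z.1 z.2) (slab d T) :=
    (h.integrable_divg.abs.const_mul 6).add
      (integrable_finsetSum _ fun i _ => ((hvp i).add (hHp i)).const_mul 4)
  refine ⟨fun t => ∫ x, B t x, integrableOn_integral_slice hBi,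
    fun t => integral_nonneg fun x => by simp only [hB]; positivity, ?_⟩
  have hd0 : ∀ᵐ t ∂((volume : Measure ℝ).restrict (Ioo 0 T)), ∀ᵐ x, 0 ≤ r t x :=
    Measure.ae_ae_of_ae_prod h.sol.density_nonneg
  have hgrad : ∀ᵐ t ∂((volume : Measure ℝ).restrict (Ioo 0 T)), ∀ j k,
      ∫ x, √(r t x) * pd j (trig k) x = -∫ x, H t x j * trig k x :=
    ae_all_iff.2 fun j => ae_weakDeriv_slice hw (hHji j) fun ψ hψ => hwg ψ hψ j
  filter_upwards [hd0, hgrad, ae_integrable_slice h.integrable_density,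
    ae_all_iff.2 fun j => (hHj j).ae_memLp (by norm_num) (by norm_num),
    ae_all_iff.2 fun j => ae_integrable_slice (f := fun t x => ‖v t x j‖ ^ (4 : ℝ)) (hvp j),
    ae_all_iff.2 fun j => ae_integrable_slice (f := fun t x => ‖H t x j‖ ^ (4 / 3 : ℝ)) (hHp j),
    ae_integrable_slice (f := fun t x => divg (G t x)) h.integrable_divg]
    with t ht0 htg htr htH htv htHp htd
  -- `√ϱ(t)` is square integrable, since `ϱ(t)` is integrable
  have hwm : AEStronglyMeasurable (fun x => √(r t x)) :=
    Real.continuous_sqrt.comp_aestronglyMeasurable htr.1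
  have hw2 : MemLp (fun x => √(r t x)) 2 := by
    rw [memLp_two_iff_integrable_sq hwm]
    refine htr.congr ?_
    filter_upwards [ht0] with x hx
    rw [Real.sq_sqrt hx]
  have hw1 : Integrable (fun x => √(r t x)) := hw2.integrable (by norm_num)
  have hH1 : ∀ j, Integrable (fun x => H t x j) := fun j => (htH j).integrable (by norm_num)
  have hsm : ∀ N, IsSmooth (fejer N fun x => √(r t x)) := fun N => isSmooth_fejer hw1 N
  have hθ : ContDiff ℝ ∞ (fun s : ℝ => Real.arctan (s ^ 2)) :=
    Real.contDiff_arctan.comp (contDiff_id.pow 2)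
  refine ⟨fun N x => Real.arctan (fejer N (fun x => √(r t x)) x ^ 2),
    fun N => (hsm N).comp hθ, ?_, fun N => ?_⟩
  · have h1 := tendsto_eLpNorm_fejer_sub (q := 2) (by norm_num) (by norm_num) hw2
    have h2 : Tendsto (fun N => ENNReal.ofReal 2 *
        eLpNorm (fun x => fejer N (fun x => √(r t x)) x - √(r t x)) 2 volume) atTop (𝓝 0) := by
      have := ENNReal.Tendsto.const_mul (a := ENNReal.ofReal 2) h1 (Or.inr ENNReal.ofReal_ne_top)
      rwa [mul_zero] at this
    refine tendsto_of_tendsto_of_tendsto_of_le_of_le tendsto_const_nhds h2 (fun _ => zero_le) ?_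
    intro N
    refine eLpNorm_le_mul_eLpNorm_of_ae_le_mul ?_ 2
    filter_upwards [ht0] with x hx
    have := abs_arctan_sq_sub_le (fejer N (fun x => √(r t x)) x) (√(r t x))
    rwa [Real.sq_sqrt hx] at this
  · filter_upwards [ae_all_iff.2 fun j =>
        ae_integrable_slice (f := fun t x => ‖v t x j‖ ^ (4 : ℝ)) (hvp j),
      ae_all_iff.2 fun j =>
        ae_integrable_slice (f := fun t x => ‖H t x j‖ ^ (4 / 3 : ℝ)) (hHp j),
      ae_integrable_slice (f := fun t x => divg (G t x)) h.integrable_divg] with τ hτv hτH hτd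
    have hpd : ∀ i x, pd i (fun x => Real.arctan (fejer N (fun x => √(r t x)) x ^ 2)) x
        = 2 * fejer N (fun x => √(r t x)) x / (1 + fejer N (fun x => √(r t x)) x ^ 4)
          * fejer N (fun x => H t x i) x := fun i x => by
      rw [pd_comp (hsm N) hasDerivAt_arctan_sq, pd_fejer hw1 (hH1 i) i (htg i)]
    have hfi : ∀ i, Integrable fun x => ‖fejer N (fun x => H t x i) x‖ ^ (4 / 3 : ℝ) := fun i =>
      integrable_of_continuous (((isSmooth_fejer (hH1 i) N).continuous.norm).rpow_const
        fun x => Or.inr (by norm_num))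
    have hRi : Integrable fun x => 6 * |divg (G τ x)| + ∑ i, 4 * (‖v τ x i‖ ^ (4 : ℝ)
        + ‖fejer N (fun x => H t x i) x‖ ^ (4 / 3 : ℝ)) :=
      (hτd.abs.const_mul 6).add (integrable_finsetSum _ fun i _ =>
        ((hτv i).add (hfi i)).const_mul 4)
    have step1 : |weakFlux (fun t x => (Real.arctan (r t x) - r t x / (1 + r t x ^ 2))
          * divg (G t x)) (fun i t x => Real.arctan (r t x) * v t x i)
          (fun x => Real.arctan (fejer N (fun x => √(r t x)) x ^ 2)) τ|
        ≤ ∫ x, (6 * |divg (G τ x)| + ∑ i, 4 * (‖v τ x i‖ ^ (4 : ℝ)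
        + ‖fejer N (fun x => H t x i) x‖ ^ (4 / 3 : ℝ))) := by
      unfold weakFlux
      refine abs_integral_le_integral_abs.trans (integral_mono_of_nonneg
        (Eventually.of_forall fun x => abs_nonneg _) hRi (Eventually.of_forall fun x => ?_))
      refine (abs_add_le _ _).trans (add_le_add ?_ ((Finset.abs_sum_le_sum_abs _ _).trans
        (Finset.sum_le_sum fun i _ => ?_)))
      · rw [abs_mul, abs_mul]
        have e1 : |Real.arctan (r τ x) - r τ x / (1 + r τ x ^ 2)| ≤ 3 :=
          (abs_sub _ _).trans (by linarith [abs_arctan_le_two (r τ x), abs_div_one_add_sq_le (r τ x)])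
        have e2 := abs_arctan_le_two (fejer N (fun x => √(r t x)) x ^ 2)
        calc _ ≤ 3 * |divg (G τ x)| * 2 :=
              mul_le_mul (mul_le_mul_of_nonneg_right e1 (abs_nonneg _)) e2 (abs_nonneg _)
                (by positivity)
          _ = _ := by ring
      · rw [hpd, abs_mul, abs_mul, abs_mul]
        have e1 := abs_arctan_le_two (r τ x)
        have e2 := abs_two_mul_div_le (fejer N (fun x => √(r t x)) x)
        have e3 := mul_le_pow_four_add (norm_nonneg (v τ x i))
          (norm_nonneg (fejer N (fun x => H t x i) x))
        calc _ ≤ 2 * |v τ x i| * (2 * |fejer N (fun x => H t x i) x|) :=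
              mul_le_mul (mul_le_mul_of_nonneg_right e1 (abs_nonneg _))
                (mul_le_mul_of_nonneg_right e2 (abs_nonneg _)) (by positivity) (by positivity)
          _ = 4 * (‖v τ x i‖ * ‖fejer N (fun x => H t x i) x‖) := by
              simp only [Real.norm_eq_abs]; ring
          _ ≤ _ := mul_le_mul_of_nonneg_left e3 (by norm_num)
    refine step1.trans ?_
    have hsplit : ∀ {D : Torus d → ℝ} {V K : Fin d → Torus d → ℝ}, Integrable D →
        (∀ i, Integrable (V i)) → (∀ i, Integrable (K i)) →
        ∫ x, (6 * |D x| + ∑ i, 4 * (V i x + K i x))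
          = 6 * (∫ x, |D x|) + ∑ i, 4 * ((∫ x, V i x) + ∫ x, K i x) := by
      intro D V K hD hV hK
      have hVK : ∀ i, Integrable fun x => 4 * (V i x + K i x) := fun i =>
        ((hV i).add (hK i)).const_mul 4
      rw [integral_add (hD.abs.const_mul 6) (integrable_finsetSum _ fun i _ => hVK i),
        integral_const_mul, integral_finsetSum _ fun i _ => hVK i]
      congr 1
      refine Finset.sum_congr rfl fun i _ => ?_
      rw [integral_const_mul, integral_add (hV i) (hK i)]
    simp only [hB]
    rw [hsplit htd htv htHp, hsplit hτd hτv hτH, hsplit hτd hτv hfi]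
    have e2 : ∑ i, 4 * ((∫ x, ‖v τ x i‖ ^ (4 : ℝ))
          + ∫ x, ‖fejer N (fun x => H t x i) x‖ ^ (4 / 3 : ℝ))
        ≤ ∑ i, (4 * ((∫ x, ‖v t x i‖ ^ (4 : ℝ)) + ∫ x, ‖H t x i‖ ^ (4 / 3 : ℝ))
          + 4 * ((∫ x, ‖v τ x i‖ ^ (4 : ℝ)) + ∫ x, ‖H τ x i‖ ^ (4 / 3 : ℝ))) := by
      refine Finset.sum_le_sum fun i _ => ?_
      have e3 := integral_rpow_fejer_le (by norm_num) (htH i) N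
      have e4 : 0 ≤ ∫ x, ‖v t x i‖ ^ (4 : ℝ) := integral_nonneg fun x => by positivity
      have e5 : 0 ≤ ∫ x, ‖H τ x i‖ ^ (4 / 3 : ℝ) := integral_nonneg fun x => by positivity
      linarith
    rw [Finset.sum_add_distrib] at e2
    have e6 : 0 ≤ ∫ x, |divg (G t x)| := integral_nonneg fun x => abs_nonneg _
    linarith

end IsRegular
end FluxBound

/-! ### Weak convergence in Lebesgue spaces -/

section WeakConvergence

variable {d : ℕ} {q q' : ℝ}

lemma abs_integral_mul_le_eLpNorm (h : q.HolderConjugate q') {f g : Torus d → ℝ}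
    (hf : MemLp f (ENNReal.ofReal q)) (hg : MemLp g (ENNReal.ofReal q')) :
    Integrable (fun x => f x * g x) ∧ |∫ x, f x * g x|
      ≤ (eLpNorm f (ENNReal.ofReal q) volume * eLpNorm g (ENNReal.ofReal q') volume).toReal := by
  have h1 := lintegral_enorm_mul_le hf.1 hg.1 h
  have h2 : eLpNorm f (ENNReal.ofReal q) volume * eLpNorm g (ENNReal.ofReal q') volume ≠ ⊤ :=
    ENNReal.mul_ne_top hf.2.ne hg.2.ne
  have h3 : Integrable (fun x => f x * g x) := ⟨hf.1.mul hg.1, h1.trans_lt h2.lt_top⟩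
  refine ⟨h3, ?_⟩
  calc |∫ x, f x * g x| ≤ ∫ x, ‖f x * g x‖ := norm_integral_le_integral_norm (fun x => f x * g x)
    _ = (∫⁻ x, ‖f x * g x‖ₑ).toReal := integral_norm_eq_lintegral_enorm h3.1
    _ ≤ _ := ENNReal.toReal_mono h2 h1

/-- Strong convergence in `L^q` passes to the limit in the pairing with `L^{q'}`. -/
lemma tendsto_integral_mul_of_eLpNorm (h : q.HolderConjugate q') {f : Torus d → ℝ}
    (hf : MemLp f (ENNReal.ofReal q')) {g : ℕ → Torus d → ℝ} {g' : Torus d → ℝ}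
    (hg : ∀ n, MemLp (g n) (ENNReal.ofReal q)) (hg' : MemLp g' (ENNReal.ofReal q))
    (hlim : Tendsto (fun n => eLpNorm (fun x => g n x - g' x) (ENNReal.ofReal q) volume)
      atTop (𝓝 0)) :
    Tendsto (fun n => ∫ x, f x * g n x) atTop (𝓝 (∫ x, f x * g' x)) := by
  rw [tendsto_iff_norm_sub_tendsto_zero]
  have h1 : Tendsto (fun n => (eLpNorm f (ENNReal.ofReal q') volume
      * eLpNorm (fun x => g n x - g' x) (ENNReal.ofReal q) volume).toReal) atTop (𝓝 0) := by
    have := ENNReal.Tendsto.const_mul (a := eLpNorm f (ENNReal.ofReal q') volume) hlim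
      (Or.inr hf.2.ne)
    rw [mul_zero] at this
    exact (ENNReal.tendsto_toReal ENNReal.zero_ne_top).comp this
  refine squeeze_zero (fun n => norm_nonneg _) (fun n => ?_) h1
  rw [← integral_sub (abs_integral_mul_le_eLpNorm h.symm hf (hg n)).1
    (abs_integral_mul_le_eLpNorm h.symm hf hg').1]
  simp_rw [← mul_sub]
  exact (abs_integral_mul_le_eLpNorm h.symm hf ((hg n).sub hg')).2

/-- Bounded sequences converging against smooth functions converge weakly. -/
lemma tendsto_integral_mul_of_smooth (h : q.HolderConjugate q') {ι : Type*} {l : Filter ι}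
    {f : ι → Torus d → ℝ} {f' : Torus d → ℝ} {C : ℝ≥0∞} (hC : C ≠ ⊤)
    (hf : ∀ᶠ n in l, MemLp (f n) (ENNReal.ofReal q') ∧
      eLpNorm (f n) (ENNReal.ofReal q') volume ≤ C)
    (hf' : MemLp f' (ENNReal.ofReal q'))
    (hlim : ∀ φ, IsSmooth φ → Tendsto (fun n => ∫ x, f n x * φ x) l (𝓝 (∫ x, f' x * φ x)))
    {g : Torus d → ℝ} (hg : MemLp g (ENNReal.ofReal q)) :
    Tendsto (fun n => ∫ x, f n x * g x) l (𝓝 (∫ x, f' x * g x)) := by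
  have hq1 : (1 : ℝ≥0∞) ≤ ENNReal.ofReal q := ENNReal.one_le_ofReal.2 h.lt.le
  set K := (C + eLpNorm f' (ENNReal.ofReal q') volume).toReal with hK
  have hCf : C + eLpNorm f' (ENNReal.ofReal q') volume ≠ ⊤ := ENNReal.add_ne_top.2 ⟨hC, hf'.2.ne⟩
  rw [Metric.tendsto_nhds]
  intro ε hε
  set η := ε / (2 * (K + 1)) with hη
  have hK0 : 0 ≤ K := ENNReal.toReal_nonneg
  have hη0 : 0 < η := by positivity
  obtain ⟨φ, hφ, hle⟩ := exists_isSmooth_eLpNorm_sub_le hq1 ENNReal.ofReal_ne_top hg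
    (ε := ENNReal.ofReal η) (by simpa using hη0)
  have hφm := hφ.memLp volume (ENNReal.ofReal q)
  filter_upwards [hf, (Metric.tendsto_nhds.1 (hlim φ hφ)) (ε / 2) (by positivity)] with n hn hn'
  rw [Real.dist_eq] at hn' ⊢
  have e1 := (abs_integral_mul_le_eLpNorm h.symm hn.1 hg).1
  have e2 := (abs_integral_mul_le_eLpNorm h.symm hn.1 hφm).1
  have e3 := (abs_integral_mul_le_eLpNorm h.symm hf' hg).1
  have e4 := (abs_integral_mul_le_eLpNorm h.symm hf' hφm).1
  have e5 : (∫ x, f n x * g x) - ∫ x, f' x * g x = ((∫ x, f n x * φ x) - ∫ x, f' x * φ x)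
      + ∫ x, (f n x - f' x) * (g x - φ x) := by
    have : (fun x => (f n x - f' x) * (g x - φ x))
        = fun x => (f n x * g x - f n x * φ x) - (f' x * g x - f' x * φ x) := by
      funext x; ring
    have e12 : Integrable fun x => f n x * g x - f n x * φ x := e1.sub e2
    have e34 : Integrable fun x => f' x * g x - f' x * φ x := e3.sub e4
    rw [this, integral_sub e12 e34, integral_sub e1 e2, integral_sub e3 e4]
    ring
  have hq1' : (1 : ℝ≥0∞) ≤ ENNReal.ofReal q' := ENNReal.one_le_ofReal.2 h.symm.lt.le
  have e6 := (abs_integral_mul_le_eLpNorm h.symm (hn.1.sub hf') (hg.sub hφm)).2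
  have e7 : (eLpNorm (f n - f') (ENNReal.ofReal q') volume
      * eLpNorm (g - φ) (ENNReal.ofReal q) volume).toReal ≤ K * η := by
    have e8 : eLpNorm (f n - f') (ENNReal.ofReal q') volume
        ≤ C + eLpNorm f' (ENNReal.ofReal q') volume :=
      (eLpNorm_sub_le hn.1.1 hf'.1 hq1').trans (add_le_add hn.2 le_rfl)
    have e9 : K * η = ((C + eLpNorm f' (ENNReal.ofReal q') volume) * ENNReal.ofReal η).toReal := by
      rw [ENNReal.toReal_mul, ENNReal.toReal_ofReal hη0.le]
    rw [e9]
    exact ENNReal.toReal_mono (ENNReal.mul_ne_top hCf ENNReal.ofReal_ne_top) (mul_le_mul' e8 hle)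
  have e10 : K * η < ε / 2 := by
    rw [hη, mul_div_assoc', div_lt_iff₀ (by positivity)]
    nlinarith
  rw [e5]
  refine (abs_add_le _ _).trans_lt ?_
  simp only [Pi.sub_apply] at e6
  linarith

end WeakConvergence

lemma sq_integral_abs_le {d : ℕ} {f : Torus d → ℝ} (hf : Integrable f)
    (hf2 : Integrable fun x => f x ^ 2) : (∫ x, |f x|) ^ 2 ≤ ∫ x, f x ^ 2 := by
  have h := ConvexOn.map_integral_le (μ := (volume : Measure (Torus d))) (g := fun s : ℝ => s ^ 2)
    (s := Ici 0) (f := fun x => |f x|) (convexOn_pow 2) (by fun_prop) isClosed_Ici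
    (Eventually.of_forall fun x => abs_nonneg (f x)) hf.abs
    (by simpa [Function.comp_def] using hf2)
  simpa using h

/-! ### Continuity of integrals in time -/

section TimeContinuity

variable {T : ℝ}

lemma continuousOn_intervalIntegral (hT : 0 < T) {g : ℝ → ℝ} (hg : IntegrableOn g (Ioo 0 T))
    {t₁ : ℝ} (ht₁ : t₁ ∈ Icc 0 T) :
    ContinuousOn (fun t => ∫ s in t₁..t, g s) (Icc 0 T) := by
  have h0 : (0 : ℝ) ∈ Icc 0 T := ⟨le_rfl, hT.le⟩
  refine ((continuousOn_primitive hg hT).sub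
    (continuousOn_const (c := ∫ s in (0 : ℝ)..t₁, g s))).congr fun t ht => ?_
  exact (intervalIntegral.integral_interval_sub_left
    (IntegrableOn.intervalIntegrable_of_mem hg h0 ht)
    (IntegrableOn.intervalIntegrable_of_mem hg h0 ht₁)).symm

lemma tendsto_intervalIntegral_zero (hT : 0 < T) {g : ℝ → ℝ} (hg : IntegrableOn g (Ioo 0 T))
    {s : ℝ} (hs : s ∈ Icc 0 T) {t : ℕ → ℝ} (ht : ∀ n, t n ∈ Icc 0 T)
    (hlim : Tendsto t atTop (𝓝 s)) : Tendsto (fun n => ∫ τ in s..t n, g τ) atTop (𝓝 0) := by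
  have h1 := (continuousOn_intervalIntegral hT hg hs s hs).tendsto.comp
    (tendsto_nhdsWithin_iff.2 ⟨hlim, Eventually.of_forall ht⟩)
  simpa [Function.comp_def] using h1

lemma abs_intervalIntegral_le_of_ae_le {g B : ℝ → ℝ} (hB : IntegrableOn B (Ioo 0 T))
    (h : ∀ᵐ τ ∂((volume : Measure ℝ).restrict (Ioo 0 T)), |g τ| ≤ B τ) {s t : ℝ}
    (hs : s ∈ Icc 0 T) (ht : t ∈ Icc 0 T) : |∫ τ in s..t, g τ| ≤ |∫ τ in s..t, B τ| := by
  refine intervalIntegral.norm_integral_le_abs_of_norm_le (f := g) (g := B) ?_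
    (IntegrableOn.intervalIntegrable_of_mem hB hs ht)
  rw [restrict_Ioo_eq_restrict_Ioc] at h
  exact ae_restrict_of_ae_restrict_of_subset (uIoc_subset_Ioc_of_mem_Icc hs ht) h

end TimeContinuity

/-! ### Strong traces of the density -/

section Trace

variable {d : ℕ}

/-- A bounded function with a weak time derivative of divergence form has weak traces in `L²`. -/
lemma exists_memLp_weak_trace {T : ℝ} (hT : 0 < T) {w f₀ : ℝ → Torus d → ℝ}
    {f : Fin d → ℝ → Torus d → ℝ}
    (hf₀ : Integrable (fun z : ℝ × Torus d => f₀ z.1 z.2) (slab d T))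
    (hf : ∀ i, Integrable (fun z : ℝ × Torus d => f i z.1 z.2) (slab d T)) {S : Set ℝ}
    (hS : ∀ᵐ t ∂((volume : Measure ℝ).restrict (Ioo 0 T)), t ∈ S) (hST : S ⊆ Ioo 0 T)
    (hw : ∀ t ∈ S, AEStronglyMeasurable (w t)) (hw2 : ∀ t ∈ S, ∀ x, |w t x| ≤ 2)
    (hSeq : ∀ s ∈ S, ∀ t ∈ S, ∀ φ, IsSmooth φ →
      ∫ x, w t x * φ x = (∫ x, w s x * φ x) + ∫ τ in s..t, weakFlux f₀ f φ τ)
    {s : ℝ} (hs : s ∈ Icc 0 T) :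
    ∃ u, MemLp u 2 ∧ ∀ t ∈ S, ∀ φ, IsSmooth φ →
      ∫ x, w t x * φ x = (∫ x, u x * φ x) + ∫ τ in s..t, weakFlux f₀ f φ τ := by
  obtain ⟨σ, hσ, hσs, -⟩ := exists_seq_tendsto_mul hT (A := 0) (integrable_zero _ _ _)
    (fun _ => le_rfl) hS hs
  have hσI : ∀ n, σ n ∈ Icc 0 T := fun n => Ioo_subset_Icc_self (hσ n).1
  have hwi : ∀ {t : ℝ}, t ∈ S → Integrable (w t) := fun ht =>
    Integrable.of_bound (hw _ ht) 2 (Eventually.of_forall fun x => hw2 _ ht x)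
  have hFi : ∀ {φ : Torus d → ℝ}, IsSmooth φ → IntegrableOn (weakFlux f₀ f φ) (Ioo 0 T) :=
    fun hφ => integrableOn_weakFlux hf₀ hf hφ
  have hadd : ∀ φ ψ : Torus d → ℝ, IsSmooth φ → IsSmooth ψ →
      (∫ x, w (σ 0) x * (φ x + ψ x)) + ∫ τ in σ 0..s, weakFlux f₀ f (fun x => φ x + ψ x) τ
      = ((∫ x, w (σ 0) x * φ x) + ∫ τ in σ 0..s, weakFlux f₀ f φ τ)
        + ((∫ x, w (σ 0) x * ψ x) + ∫ τ in σ 0..s, weakFlux f₀ f ψ τ) := by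
    intro φ ψ hφ hψ
    simp only [mul_add]
    rw [integral_add (hφ.integrable_mul (hwi (hσ 0).2)) (hψ.integrable_mul (hwi (hσ 0).2)),
      intervalIntegral_weakFlux_add hf₀ hf hφ hψ (hσI 0) hs]
    ring
  have hmul : ∀ (c : ℝ) (φ : Torus d → ℝ), IsSmooth φ →
      (∫ x, w (σ 0) x * (c * φ x)) + ∫ τ in σ 0..s, weakFlux f₀ f (fun x => c * φ x) τ
      = c * ((∫ x, w (σ 0) x * φ x) + ∫ τ in σ 0..s, weakFlux f₀ f φ τ) := by
    intro c φ hφ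
    simp only [weakFlux_const_mul c hφ, mul_left_comm _ c, integral_const_mul,
      intervalIntegral.integral_const_mul]
    ring
  have hbound : ∀ φ : Torus d → ℝ, IsSmooth φ →
      ((∫ x, w (σ 0) x * φ x) + ∫ τ in σ 0..s, weakFlux f₀ f φ τ) ^ 2 ≤ 4 * ∫ x, φ x ^ 2 := by
    intro φ hφ
    -- the bound holds at the times of `S`, and passes to the limit
    have h1 : Tendsto (fun n => ∫ x, w (σ n) x * φ x) atTop
        (𝓝 ((∫ x, w (σ 0) x * φ x) + ∫ τ in σ 0..s, weakFlux f₀ f φ τ)) := by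
      have h2 := (continuousOn_intervalIntegral hT (hFi hφ) (hσI 0) s hs).tendsto.comp
        (tendsto_nhdsWithin_iff.2 ⟨hσs, Eventually.of_forall hσI⟩)
      exact (h2.const_add (∫ x, w (σ 0) x * φ x)).congr fun n =>
        (hSeq _ (hσ 0).2 _ (hσ n).2 φ hφ).symm
    have hφ2 : Integrable fun x => φ x ^ 2 := integrable_of_continuous (hφ.continuous.pow 2)
    refine le_of_tendsto (h1.pow 2) (Eventually.of_forall fun n => ?_)
    have h3 : |∫ x, w (σ n) x * φ x| ≤ ∫ x, 2 * |φ x| := by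
      refine abs_integral_le_integral_abs.trans (integral_mono_of_nonneg
        (Eventually.of_forall fun x => abs_nonneg _)
        ((integrable_of_continuous hφ.continuous.abs).const_mul 2)
        (Eventually.of_forall fun x => ?_))
      simp only [abs_mul]
      exact mul_le_mul_of_nonneg_right (hw2 _ (hσ n).2 x) (abs_nonneg _)
    have h4 := sq_integral_abs_le (integrable_of_continuous hφ.continuous) hφ2
    rw [integral_const_mul] at h3
    have h5 : 0 ≤ ∫ x, |φ x| := integral_nonneg fun x => abs_nonneg _
    rw [← sq_abs]
    nlinarith [abs_nonneg (∫ x, w (σ n) x * φ x)]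
  obtain ⟨u, hu, huL, -⟩ := exists_memLp_of_sq_le (ν := (volume : Measure (Torus d)))
    (L := fun φ => (∫ x, w (σ 0) x * φ x) + ∫ τ in σ 0..s, weakFlux f₀ f φ τ) hadd hmul hbound
    (by norm_num)
  refine ⟨u, hu, fun t ht φ hφ => ?_⟩
  have htI : t ∈ Icc 0 T := Ioo_subset_Icc_self (hST ht)
  rw [huL φ hφ, hSeq _ (hσ 0).2 t ht φ hφ, add_assoc,
    intervalIntegral.integral_add_adjacent_intervals
    (IntegrableOn.intervalIntegrable_of_mem (hFi hφ) (hσI 0) hs)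
    (IntegrableOn.intervalIntegrable_of_mem (hFi hφ) hs htI)]

namespace IsRegular

variable {T γ mu lam : ℝ} {r₀ : Torus d → ℝ} {v₀ : Torus d → Vel d}
    {r : ℝ → Torus d → ℝ} {v : ℝ → Torus d → Vel d} {G : ℝ → Torus d → Grad d}
    {k l a b c e : ℝ}

lemma integrable_arctan_source (h : IsRegular T γ mu lam r₀ v₀ r v G k l a b c e) :
    Integrable (fun z : ℝ × Torus d => (Real.arctan (r z.1 z.2)
      - r z.1 z.2 / (1 + r z.1 z.2 ^ 2)) * divg (G z.1 z.2)) (slab d T) := by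
  refine h.integrable_divg.bdd_mul (c := 3) (h.aestronglyMeasurable_comp_density
    (β := fun s => Real.arctan s - s / (1 + s ^ 2)) (Real.continuous_arctan.sub
      (continuous_id.div (by fun_prop) fun s => by positivity)))
    (Eventually.of_forall fun z => (abs_sub _ _).trans ?_)
  linarith [abs_arctan_le_two (r z.1 z.2), abs_div_one_add_sq_le (r z.1 z.2)]

lemma integrable_arctan_flux (h : IsRegular T γ mu lam r₀ v₀ r v G k l a b c e) (i : Fin d) :
    Integrable (fun z : ℝ × Torus d => Real.arctan (r z.1 z.2) * v z.1 z.2 i) (slab d T) :=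
  (h.integrable_velocity i).bdd_mul (c := 2)
    (h.aestronglyMeasurable_comp_density Real.continuous_arctan)
    (Eventually.of_forall fun _ => abs_arctan_le_two _)

/-- Weak traces of `arctan ϱ` at every time. -/
lemma exists_arctan_weak_trace (h : IsRegular T γ mu lam r₀ v₀ r v G k l a b c e) :
    ∃ S : Set ℝ, (∀ᵐ t ∂((volume : Measure ℝ).restrict (Ioo 0 T)), t ∈ S) ∧ S ⊆ Ioo 0 T ∧
      ∀ s ∈ Icc 0 T, ∃ u, MemLp u 2 ∧ ∀ t ∈ S, ∀ φ, IsSmooth φ →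
        ∫ x, Real.arctan (r t x) * φ x = (∫ x, u x * φ x)
        + ∫ τ in s..t, weakFlux (fun t x => (Real.arctan (r t x)
          - r t x / (1 + r t x ^ 2)) * divg (G t x))
          (fun i t x => Real.arctan (r t x) * v t x i) φ τ := by
  obtain ⟨S, hS, hST, hSeq⟩ := h.exists_set_arctan
  obtain ⟨S', hS', hSi⟩ : ∃ S' : Set ℝ, (∀ᵐ t ∂((volume : Measure ℝ).restrict (Ioo 0 T)), t ∈ S') ∧
      ∀ t ∈ S', t ∈ S ∧ AEStronglyMeasurable fun x => Real.arctan (r t x) := by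
    refine ⟨{t | t ∈ S ∧ AEStronglyMeasurable (fun x => Real.arctan (r t x))
      (volume : Measure (Torus d))}, ?_, fun t ht => ht⟩
    filter_upwards [hS, ae_integrable_slice h.integrable_density] with t h1 h2
    exact ⟨h1, Real.continuous_arctan.comp_aestronglyMeasurable h2.1⟩
  refine ⟨S', hS', fun t ht => hST (hSi t ht).1, fun s hs => ?_⟩
  exact exists_memLp_weak_trace (w := fun t x => Real.arctan (r t x))
    (f₀ := fun t x => (Real.arctan (r t x) - r t x / (1 + r t x ^ 2)) * divg (G t x))
    (f := fun i t x => Real.arctan (r t x) * v t x i) h.time_pos h.integrable_arctan_source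
    h.integrable_arctan_flux hS' (fun t ht => hST (hSi t ht).1) (fun t ht => (hSi t ht).2)
    (fun t _ x => abs_arctan_le_two _)
    (fun t ht t' ht' φ hφ => hSeq t (hSi t ht).1 t' (hSi t' ht').1 φ hφ) hs

/-- Strong traces of the density: at every time of `[0, T]` the density is an almost everywhere
limit of densities at times of any given set of full measure. -/
lemma exists_density_trace (h : IsRegular T γ mu lam r₀ v₀ r v G k l a b c e)
    {P : ℝ → Prop} (hP : ∀ᵐ t ∂((volume : Measure ℝ).restrict (Ioo 0 T)), P t)
    {s : ℝ} (hs : s ∈ Icc 0 T) :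
    ∃ ρ : Torus d → ℝ, AEStronglyMeasurable ρ ∧ (∀ᵐ x, 0 ≤ ρ x) ∧ ∃ t : ℕ → ℝ,
      (∀ n, t n ∈ Ioo 0 T ∧ P (t n)) ∧ Tendsto t atTop (𝓝 s) ∧
      ∀ᵐ x, Tendsto (fun n => r (t n) x) atTop (𝓝 (ρ x)) := by
  obtain ⟨A, hA, hA0, hAφ⟩ := h.exists_arctan_flux_bound
  obtain ⟨S, hS, hST, hSu⟩ := h.exists_arctan_weak_trace
  obtain ⟨u, hu, hSeq⟩ := hSu s hs
  set F := weakFlux (fun t x => (Real.arctan (r t x) - r t x / (1 + r t x ^ 2)) * divg (G t x))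
    (fun i t x => Real.arctan (r t x) * v t x i) with hF
  have hr0 : ∀ᵐ t ∂((volume : Measure ℝ).restrict (Ioo 0 T)), ∀ᵐ x, 0 ≤ r t x :=
    Measure.ae_ae_of_ae_prod h.sol.density_nonneg
  have hmass : ∀ᵐ t ∂((volume : Measure ℝ).restrict (Ioo 0 T)), ∫ x, r t x = ∫ x, r₀ x := by
    filter_upwards [h.ae_mass] with t ht
    have hpd : ∀ (i : Fin d) (x : Torus d), pd i (fun _ : Torus d => (1 : ℝ)) x = 0 := fun i x => by
      simp [pd]
    simpa [weakFlux, hpd] using ht _ (isSmooth_const 1)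
  obtain ⟨t, htP, hts, htA⟩ := exists_seq_tendsto_mul h.time_pos hA hA0
    (hP.and (hS.and (hr0.and ((ae_integrable_slice h.integrable_density).and (hmass.and hAφ))))) hs
  have htI : ∀ n, t n ∈ Icc 0 T := fun n => Ioo_subset_Icc_self (htP n).1
  have hP' : ∀ n, P (t n) := fun n => (htP n).2.1
  have hSn : ∀ n, t n ∈ S := fun n => (htP n).2.2.1
  have h0n : ∀ n, ∀ᵐ x, 0 ≤ r (t n) x := fun n => (htP n).2.2.2.1
  have hrn : ∀ n, Integrable (r (t n)) := fun n => (htP n).2.2.2.2.1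
  have hmn : ∀ n, ∫ x, r (t n) x = ∫ x, r₀ x := fun n => (htP n).2.2.2.2.2.1
  have hφn := fun n => (htP n).2.2.2.2.2.2
  have hconj : (2 : ℝ).HolderConjugate 2 := by rw [Real.holderConjugate_iff]; norm_num
  have hu2 : MemLp u (ENNReal.ofReal 2) := by rwa [ENNReal.ofReal_ofNat]
  have hun : ∀ n, MemLp (fun x => Real.arctan (r (t n) x)) (ENNReal.ofReal 2) := fun n =>
    MemLp.of_bound (Real.continuous_arctan.comp_aestronglyMeasurable (hrn n).1) 2
      (Eventually.of_forall fun x => abs_arctan_le_two _)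
  have hmul := fun {f g : Torus d → ℝ} (hf : MemLp f (ENNReal.ofReal 2))
    (hg : MemLp g (ENNReal.ofReal 2)) => (abs_integral_mul_le_eLpNorm hconj hf hg).1
  have hF0 : ∀ φ, IsSmooth φ → ∀ n, ∫ x, (Real.arctan (r (t n) x) - u x) * φ x
      = ∫ τ in s..t n, F φ τ := by
    intro φ hφ n
    have h1 := hSeq (t n) (hSn n) φ hφ
    have hφ2 := hφ.memLp volume (ENNReal.ofReal 2)
    simp_rw [sub_mul]
    rw [integral_sub (hmul (hun n) hφ2) (hmul hu2 hφ2), h1]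
    ring
  -- testing with approximations of `arctan ϱ(t)`
  have hX : ∀ n, |∫ x, (Real.arctan (r (t n) x) - u x) * Real.arctan (r (t n) x)|
      ≤ |t n - s| * A (t n) + |∫ τ in s..t n, A τ| := by
    intro n
    obtain ⟨φ, hφ, hφlim, hφle⟩ := hφn n
    have h1 := tendsto_integral_mul_of_eLpNorm hconj (f := fun x => Real.arctan (r (t n) x) - u x)
      ((hun n).sub hu2) (g := φ) (fun N => (hφ N).memLp _ _) (hun n)
      (by simpa only [ENNReal.ofReal_ofNat] using hφlim)
    refine le_of_tendsto h1.abs (Eventually.of_forall fun N => ?_)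
    rw [hF0 _ (hφ N)]
    have hB : IntegrableOn (fun τ => A (t n) + A τ) (Ioo 0 T) :=
      (integrableOn_const (by simp)).add hA
    refine (abs_intervalIntegral_le_of_ae_le hB (hφle N) hs (htI n)).trans ?_
    rw [intervalIntegral.integral_add (by simp)
      (IntegrableOn.intervalIntegrable_of_mem hA hs (htI n)), intervalIntegral.integral_const,
      smul_eq_mul]
    refine (abs_add_le _ _).trans ?_
    rw [abs_mul, abs_of_nonneg (hA0 (t n))]
  have hXlim : Tendsto (fun n => |t n - s| * A (t n) + |∫ τ in s..t n, A τ|) atTop (𝓝 0) := by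
    simpa using htA.add (tendsto_intervalIntegral_zero h.time_pos hA hs htI hts).abs
  have hY : Tendsto (fun n => ∫ x, Real.arctan (r (t n) x) * u x) atTop (𝓝 (∫ x, u x * u x)) := by
    refine tendsto_integral_mul_of_smooth hconj (C := ENNReal.ofReal 2) ENNReal.ofReal_ne_top
      (Eventually.of_forall fun n => ⟨hun n, ?_⟩) hu2 (fun φ hφ => ?_) hu2
    · refine (eLpNorm_le_of_ae_bound (C := 2)
        (Eventually.of_forall fun x => abs_arctan_le_two _)).trans ?_
      simp
    · have h1 := tendsto_intervalIntegral_zero h.time_pos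
        (integrableOn_weakFlux (f₀ := fun t x => (Real.arctan (r t x)
          - r t x / (1 + r t x ^ 2)) * divg (G t x))
          (f := fun i t x => Real.arctan (r t x) * v t x i) h.integrable_arctan_source
          h.integrable_arctan_flux hφ) hs htI hts
      have h2 := h1.const_add (∫ x, u x * φ x)
      rw [add_zero] at h2
      exact h2.congr fun n => (hSeq (t n) (hSn n) φ hφ).symm
  have hE : Tendsto (fun n => ∫ x, (Real.arctan (r (t n) x) - u x) ^ 2) atTop (𝓝 0) := by
    have hY' : Tendsto (fun n => |(∫ x, Real.arctan (r (t n) x) * u x) - ∫ x, u x * u x|)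
        atTop (𝓝 0) := by simpa using (hY.sub_const (∫ x, u x * u x)).abs
    refine squeeze_zero (fun n => integral_nonneg fun x => sq_nonneg _) (fun n => ?_)
      (by simpa using hXlim.add hY')
    have e1 : ∫ x, (Real.arctan (r (t n) x) - u x) ^ 2
        = (∫ x, (Real.arctan (r (t n) x) - u x) * Real.arctan (r (t n) x))
          - ((∫ x, Real.arctan (r (t n) x) * u x) - ∫ x, u x * u x) := by
      have e2 : Integrable fun x => Real.arctan (r (t n) x) * u x - u x * u x :=
        (hmul (hun n) hu2).sub (hmul hu2 hu2)
      rw [← integral_sub (hmul (hun n) hu2) (hmul hu2 hu2), ← integral_sub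
        (hmul (f := fun x => Real.arctan (r (t n) x) - u x) ((hun n).sub hu2) (hun n)) e2]
      refine integral_congr_ae (Eventually.of_forall fun x => ?_)
      simp only
      ring
    rw [e1]
    exact (le_abs_self _).trans ((abs_sub _ _).trans (add_le_add (hX n) le_rfl))
  have hsq : ∀ n, Integrable fun x => (Real.arctan (r (t n) x) - u x) ^ 2 := fun n => by
    simp_rw [pow_two]
    exact hmul ((hun n).sub hu2) ((hun n).sub hu2)
  have hmeas : TendstoInMeasure volume (fun n x => (Real.arctan (r (t n) x) - u x) ^ 2) atTop
      fun _ => (0 : ℝ) := by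
    refine tendstoInMeasure_of_tendsto_eLpNorm one_ne_zero (fun n => (hsq n).1)
      aestronglyMeasurable_const ?_
    have e1 : ∀ n, eLpNorm ((fun x => (Real.arctan (r (t n) x) - u x) ^ 2) - fun _ => (0 : ℝ)) 1
        volume = ENNReal.ofReal (∫ x, (Real.arctan (r (t n) x) - u x) ^ 2) := by
      intro n
      rw [eLpNorm_one_eq_lintegral_enorm, ofReal_integral_eq_lintegral_ofReal (hsq n)
        (Eventually.of_forall fun x => sq_nonneg _)]
      refine lintegral_congr fun x => ?_
      simp only [Pi.sub_apply, sub_zero]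
      exact Real.enorm_of_nonneg (sq_nonneg _)
    simp_rw [e1]
    simpa using ENNReal.tendsto_ofReal hE
  obtain ⟨ns, hns, hae⟩ := hmeas.exists_seq_tendsto_ae
  have hconv : ∀ᵐ x, Tendsto (fun i => Real.arctan (r (t (ns i)) x)) atTop (𝓝 (u x)) := by
    filter_upwards [hae] with x hx
    have h1 := hx.sqrt
    simp only [Real.sqrt_sq_eq_abs, Real.sqrt_zero] at h1
    rw [tendsto_iff_norm_sub_tendsto_zero]
    exact h1
  -- by Fatou's lemma the limit of the densities is finite almost everywhere
  have hfin : ∀ᵐ x, liminf (fun i => ENNReal.ofReal (r (t (ns i)) x)) atTop < ⊤ := by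
    have hm : ∀ i, AEMeasurable (fun x => ENNReal.ofReal (r (t (ns i)) x))
        (volume : Measure (Torus d)) := fun i => (hrn (ns i)).1.aemeasurable.ennreal_ofReal
    have hm' : AEMeasurable (fun x => liminf (fun i => ENNReal.ofReal (r (t (ns i)) x)) atTop)
        (volume : Measure (Torus d)) := by
      refine ⟨fun x => liminf (fun i => (hm i).mk _ x) atTop,
        Measurable.liminf fun i => (hm i).measurable_mk, ?_⟩
      filter_upwards [ae_all_iff.2 fun i => (hm i).ae_eq_mk] with x hx
      exact congrArg (fun f : ℕ → ℝ≥0∞ => liminf f atTop) (funext hx)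
    refine ae_lt_top' hm' (ne_of_lt ?_)
    refine (lintegral_liminf_le' hm).trans_lt ?_
    have e1 : ∀ i, ∫⁻ x, ENNReal.ofReal (r (t (ns i)) x) = ENNReal.ofReal (∫ x, r₀ x) := fun i => by
      rw [← ofReal_integral_eq_lintegral_ofReal (hrn (ns i)) (h0n (ns i)), hmn]
    simp_rw [e1]
    simp
  have hlim : ∀ᵐ x, Tendsto (fun i => r (t (ns i)) x) atTop (𝓝 (Real.tan (u x))) := by
    filter_upwards [hconv, hfin, ae_all_iff.2 fun i => h0n (ns i)] with x h1 h2 h3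
    have h4 : 0 ≤ u x := ge_of_tendsto h1 (Eventually.of_forall fun i =>
      Real.arctan_nonneg.2 (h3 i))
    have h5 : u x ≤ Real.pi / 2 := le_of_tendsto h1 (Eventually.of_forall fun i =>
      (Real.arctan_lt_pi_div_two _).le)
    have h6 : u x ≠ Real.pi / 2 := by
      intro h7
      have h8 : Tendsto (fun i => r (t (ns i)) x) atTop atTop := by
        refine tendsto_atTop.2 fun M => ?_
        rw [h7] at h1
        filter_upwards [h1.eventually (lt_mem_nhds (Real.arctan_lt_pi_div_two M))] with i hi
        exact (Real.arctan_strictMono.lt_iff_lt.1 hi).le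
      have h9 := (ENNReal.tendsto_ofReal_nhds_top.2 h8).liminf_eq
      exact h2.ne h9
    have h7 : Real.cos (u x) ≠ 0 := (Real.cos_pos_of_mem_Ioo
      ⟨by linarith [Real.pi_pos], lt_of_le_of_ne h5 h6⟩).ne'
    have h8 := (Real.continuousAt_tan.2 h7).tendsto.comp h1
    simpa [Function.comp_def, Real.tan_arctan] using h8
  refine ⟨fun x => Real.tan (u x), aestronglyMeasurable_of_tendsto_ae atTop
    (fun i => (hrn (ns i)).1) hlim, ?_, fun i => t (ns i),
    fun i => ⟨(htP (ns i)).1, hP' (ns i)⟩, hts.comp hns.tendsto_atTop, hlim⟩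
  filter_upwards [hlim, ae_all_iff.2 fun i => h0n (ns i)] with x h1 h2
  exact ge_of_tendsto h1 (Eventually.of_forall h2)

end IsRegular
end Trace

/-! ### Convergence of densities -/

section UniformIntegrability

variable {d : ℕ}

lemma sub_min_le_rpow {γ y M : ℝ} (hγ : 1 < γ) (hy : 0 ≤ y) (hM : 0 < M) :
    y - min y M ≤ M ^ (1 - γ) * y ^ γ := by
  rcases le_total y M with h | h
  · rw [min_eq_left h, sub_self]; positivity
  · rw [min_eq_right h]
    have hy0 : 0 < y := hM.trans_le h
    have h1 : y ^ (1 - γ) ≤ M ^ (1 - γ) :=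
      Real.rpow_le_rpow_of_nonpos hM h (by linarith)
    have h2 : y ^ (1 - γ) * y ^ γ = y := by
      rw [← Real.rpow_add hy0]; simp
    calc y - M ≤ y := by linarith
      _ = y ^ (1 - γ) * y ^ γ := h2.symm
      _ ≤ _ := mul_le_mul_of_nonneg_right h1 (by positivity)

lemma le_one_add_rpow {γ y : ℝ} (hγ : 1 ≤ γ) (hy : 0 ≤ y) : y ≤ 1 + y ^ γ := by
  rcases le_total y 1 with h | h
  · linarith [Real.rpow_nonneg hy γ]
  · calc y = y ^ (1 : ℝ) := (Real.rpow_one y).symm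
      _ ≤ y ^ γ := Real.rpow_le_rpow_of_exponent_le h hγ
      _ ≤ _ := by linarith

lemma integrable_of_integrable_rpow {γ : ℝ} (hγ : 1 ≤ γ) {ρ : Torus d → ℝ}
    (hm : AEStronglyMeasurable ρ) (h0 : ∀ᵐ x, 0 ≤ ρ x) (h : Integrable fun x => ρ x ^ γ) :
    Integrable ρ := by
  refine ((integrable_const (1 : ℝ)).add h).mono' hm ?_
  filter_upwards [h0] with x hx
  rw [Real.norm_of_nonneg hx]
  exact le_one_add_rpow hγ hx

lemma integrable_min_const {ρ : Torus d → ℝ} (hm : AEStronglyMeasurable ρ)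
    (h0 : ∀ᵐ x, 0 ≤ ρ x) {M : ℝ} (hM : 0 ≤ M) : Integrable fun x => min (ρ x) M := by
  refine Integrable.of_bound (hm.inf aestronglyMeasurable_const) M ?_
  filter_upwards [h0] with x hx
  rw [Real.norm_of_nonneg (le_min hx hM)]
  exact min_le_right _ _

/-- Fatou's lemma for the internal energy. -/
lemma integrable_rpow_of_tendsto {γ C : ℝ} {f : ℕ → Torus d → ℝ} {ρ : Torus d → ℝ}
    (hm : AEStronglyMeasurable ρ) (h0 : ∀ n, ∀ᵐ x, 0 ≤ f n x)
    (hi : ∀ n, Integrable fun x => f n x ^ γ) (hC : ∀ n, ∫ x, f n x ^ γ ≤ C)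
    (hγ : 0 < γ) (hlim : ∀ᵐ x, Tendsto (fun n => f n x) atTop (𝓝 (ρ x))) :
    Integrable (fun x => ρ x ^ γ) ∧ ∫ x, ρ x ^ γ ≤ C := by
  have hC0 : 0 ≤ C := le_trans (integral_nonneg_of_ae (by
    filter_upwards [h0 0] with x hx using Real.rpow_nonneg hx γ)) (hC 0)
  have hρ0 : ∀ᵐ x, 0 ≤ ρ x := by
    filter_upwards [hlim, ae_all_iff.2 h0] with x h1 h2
    exact ge_of_tendsto h1 (Eventually.of_forall h2)
  have hmγ : AEStronglyMeasurable fun x => ρ x ^ γ :=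
    (Real.continuous_rpow_const hγ.le).comp_aestronglyMeasurable hm
  have h1 : ∫⁻ x, ENNReal.ofReal (ρ x ^ γ) ≤ ENNReal.ofReal C := by
    have h2 : ∀ᵐ x, ENNReal.ofReal (ρ x ^ γ)
        = liminf (fun n => ENNReal.ofReal (f n x ^ γ)) atTop := by
      filter_upwards [hlim] with x hx
      exact (ENNReal.tendsto_ofReal (((Real.continuous_rpow_const hγ.le).tendsto _).comp
        hx)).liminf_eq.symm
    rw [lintegral_congr_ae h2]
    refine (lintegral_liminf_le' fun n => (hi n).1.aemeasurable.ennreal_ofReal).trans ?_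
    refine liminf_le_of_frequently_le' (Frequently.of_forall fun n => ?_)
    rw [← ofReal_integral_eq_lintegral_ofReal (hi n)
      (by filter_upwards [h0 n] with x hx using Real.rpow_nonneg hx γ)]
    exact ENNReal.ofReal_le_ofReal (hC n)
  have h3 : 0 ≤ᵐ[volume] fun x => ρ x ^ γ := by
    filter_upwards [hρ0] with x hx using Real.rpow_nonneg hx γ
  have h4 : Integrable fun x => ρ x ^ γ :=
    ⟨hmγ, by rw [hasFiniteIntegral_iff_ofReal h3]; exact h1.trans_lt ENNReal.ofReal_lt_top⟩
  refine ⟨h4, ?_⟩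
  rw [integral_eq_lintegral_of_nonneg_ae h3 hmγ]
  exact ENNReal.toReal_le_of_le_ofReal hC0 h1

/-- Almost everywhere convergence of a sequence of densities with bounded internal energy implies
convergence against bounded functions. -/
lemma tendsto_integral_mul_of_ae {γ C : ℝ} (hγ : 1 < γ) {f : ℕ → Torus d → ℝ} {ρ : Torus d → ℝ}
    (hfm : ∀ n, AEStronglyMeasurable (f n)) (hm : AEStronglyMeasurable ρ)
    (h0 : ∀ n, ∀ᵐ x, 0 ≤ f n x)
    (hi : ∀ n, Integrable fun x => f n x ^ γ) (hC : ∀ n, ∫ x, f n x ^ γ ≤ C)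
    (hlim : ∀ᵐ x, Tendsto (fun n => f n x) atTop (𝓝 (ρ x))) {φ : Torus d → ℝ} (hφ : IsSmooth φ) :
    Tendsto (fun n => ∫ x, f n x * φ x) atTop (𝓝 (∫ x, ρ x * φ x)) := by
  have hρ0 : ∀ᵐ x, 0 ≤ ρ x := by
    filter_upwards [hlim, ae_all_iff.2 h0] with x h1 h2
    exact ge_of_tendsto h1 (Eventually.of_forall h2)
  obtain ⟨hρi, hρC⟩ := integrable_rpow_of_tendsto hm h0 hi hC (by linarith) hlim
  have hC0 : 0 ≤ C := le_trans (integral_nonneg_of_ae (by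
    filter_upwards [h0 0] with x hx using Real.rpow_nonneg hx γ)) (hC 0)
  obtain ⟨K, hK0, hK⟩ := hφ.bounded
  -- the tails of all the densities involved are uniformly small
  have htail : ∀ {g : Torus d → ℝ}, AEStronglyMeasurable g → (∀ᵐ x, 0 ≤ g x) →
      Integrable (fun x => g x ^ γ) → ∫ x, g x ^ γ ≤ C → ∀ M > 0,
      |(∫ x, g x * φ x) - ∫ x, min (g x) M * φ x| ≤ K * (M ^ (1 - γ) * C) := by
    intro g hgm hg0 hgi hgC M hM
    rw [← integral_sub (hφ.integrable_mul (integrable_of_integrable_rpow hγ.le hgm hg0 hgi))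
      (hφ.integrable_mul (integrable_min_const hgm hg0 hM.le))]
    calc |∫ x, (g x * φ x - min (g x) M * φ x)| ≤ ∫ x, |g x * φ x - min (g x) M * φ x| :=
          abs_integral_le_integral_abs
      _ ≤ ∫ x, K * (M ^ (1 - γ) * g x ^ γ) := by
          refine integral_mono_of_nonneg (Eventually.of_forall fun x => abs_nonneg _)
            ((hgi.const_mul _).const_mul _) ?_
          filter_upwards [hg0] with x hx
          rw [← sub_mul, abs_mul, mul_comm, abs_of_nonneg (sub_nonneg.2 (min_le_left _ _))]
          exact mul_le_mul (hK x) (sub_min_le_rpow hγ hx hM) (sub_nonneg.2 (min_le_left _ _)) hK0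
      _ = K * (M ^ (1 - γ) * ∫ x, g x ^ γ) := by rw [integral_const_mul, integral_const_mul]
      _ ≤ _ := by gcongr
  rw [Metric.tendsto_nhds]
  intro ε hε
  obtain ⟨M, hM0, hM⟩ : ∃ M : ℝ, 0 < M ∧ K * (M ^ (1 - γ) * C) < ε / 3 := by
    have h1 : Tendsto (fun M : ℝ => K * (M ^ (1 - γ) * C)) atTop (𝓝 (K * (0 * C))) := by
      have := tendsto_rpow_neg_atTop (y := γ - 1) (by linarith)
      rw [neg_sub] at this
      exact (this.mul_const C).const_mul K
    rw [zero_mul, mul_zero] at h1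
    exact ((eventually_gt_atTop 0).and (h1.eventually (gt_mem_nhds (by positivity)))).exists
  have h2 : Tendsto (fun n => ∫ x, min (f n x) M * φ x) atTop (𝓝 (∫ x, min (ρ x) M * φ x)) := by
    refine tendsto_integral_of_dominated_convergence (fun _ => M * K) (fun n => ?_)
      (integrable_const _) (fun n => ?_) ?_
    · exact ((hfm n).inf aestronglyMeasurable_const).mul (hφ.aestronglyMeasurable _)
    · filter_upwards [h0 n] with x hx
      rw [norm_mul, Real.norm_of_nonneg (le_min hx hM0.le)]
      exact mul_le_mul (min_le_right _ _) (hK x) (norm_nonneg _) hM0.le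
    · filter_upwards [hlim] with x hx
      exact (hx.min tendsto_const_nhds).mul_const _
  filter_upwards [(Metric.tendsto_nhds.1 h2) (ε / 3) (by positivity)] with n hn
  rw [Real.dist_eq] at hn ⊢
  have e1 := htail (hfm n) (h0 n) (hi n) (hC n) M hM0
  have e2 := htail hm hρ0 hρi hρC M hM0
  have e3 : (∫ x, f n x * φ x) - ∫ x, ρ x * φ x
      = ((∫ x, f n x * φ x) - ∫ x, min (f n x) M * φ x)
        + ((∫ x, min (f n x) M * φ x) - ∫ x, min (ρ x) M * φ x)
        - ((∫ x, ρ x * φ x) - ∫ x, min (ρ x) M * φ x) := by ring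
  rw [e3]
  refine (abs_sub _ _).trans_lt ?_
  have e4 := abs_add_le ((∫ x, f n x * φ x) - ∫ x, min (f n x) M * φ x)
    ((∫ x, min (f n x) M * φ x) - ∫ x, min (ρ x) M * φ x)
  linarith

end UniformIntegrability

/-! ### States at a given time -/

section Slices

variable {d : ℕ}

/-- The value at time `s`, tested with `φ`, of the quantity with initial value `u₀` and flux `f`. -/
noncomputable def evolved (u₀ : Torus d → ℝ) (f : Fin d → ℝ → Torus d → ℝ) (φ : Torus d → ℝ)
    (s : ℝ) : ℝ := (∫ x, u₀ x * φ x) + ∫ τ in (0 : ℝ)..s, weakFlux 0 f φ τ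

variable {T : ℝ} {u₀ : Torus d → ℝ} {f : Fin d → ℝ → Torus d → ℝ}

lemma integrable_slab_zero (T : ℝ) : Integrable
    (fun z : ℝ × Torus d => (0 : ℝ → Torus d → ℝ) z.1 z.2) (slab d T) := integrable_zero _ _ _

lemma evolved_add (hu₀ : Integrable u₀)
    (hf : ∀ i, Integrable (fun z : ℝ × Torus d => f i z.1 z.2) (slab d T)) {φ ψ : Torus d → ℝ}
    (h : IsSmooth φ) (h' : IsSmooth ψ) {s : ℝ} (hs : s ∈ Icc 0 T) :
    evolved u₀ f (fun x => φ x + ψ x) s = evolved u₀ f φ s + evolved u₀ f ψ s := by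
  unfold evolved
  simp only [mul_add]
  rw [integral_add (h.integrable_mul hu₀) (h'.integrable_mul hu₀),
    intervalIntegral_weakFlux_add (integrable_slab_zero T) hf h h' ⟨le_rfl, hs.1.trans hs.2⟩ hs]
  ring

lemma evolved_const_mul (c : ℝ) {φ : Torus d → ℝ} (h : IsSmooth φ) (s : ℝ) :
    evolved u₀ f (fun x => c * φ x) s = c * evolved u₀ f φ s := by
  simp only [evolved, weakFlux_const_mul c h, mul_left_comm _ c, integral_const_mul,
    intervalIntegral.integral_const_mul]
  ring

lemma continuousOn_evolved (hT : 0 < T)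
    (hf : ∀ i, Integrable (fun z : ℝ × Torus d => f i z.1 z.2) (slab d T)) {φ : Torus d → ℝ}
    (h : IsSmooth φ) : ContinuousOn (evolved u₀ f φ) (Icc 0 T) :=
  continuousOn_const.add (continuousOn_intervalIntegral hT
    (integrableOn_weakFlux (integrable_slab_zero T) hf h) ⟨le_rfl, hT.le⟩)

lemma tendsto_evolved (hT : 0 < T)
    (hf : ∀ i, Integrable (fun z : ℝ × Torus d => f i z.1 z.2) (slab d T)) {φ : Torus d → ℝ}
    (h : IsSmooth φ) {s : ℝ} (hs : s ∈ Icc 0 T) {t : ℕ → ℝ} (ht : ∀ n, t n ∈ Icc 0 T)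
    (hlim : Tendsto t atTop (𝓝 s)) :
    Tendsto (fun n => evolved u₀ f φ (t n)) atTop (𝓝 (evolved u₀ f φ s)) :=
  (continuousOn_evolved hT hf h s hs).tendsto.comp
    (tendsto_nhdsWithin_iff.2 ⟨hlim, Eventually.of_forall ht⟩)

/-- The mass at time `s`, tested with `φ`, prescribed by the continuity equation. -/
noncomputable def massAt (r₀ : Torus d → ℝ) (r : ℝ → Torus d → ℝ) (v : ℝ → Torus d → Vel d) :
    (Torus d → ℝ) → ℝ → ℝ :=
  evolved r₀ (fun i t x => r t x * v t x i)

/-- The momentum at time `s`, tested with `φ`, prescribed by the momentum equation. -/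
noncomputable def momentumAt (γ mu lam : ℝ) (r₀ : Torus d → ℝ) (v₀ : Torus d → Vel d)
    (r : ℝ → Torus d → ℝ) (v : ℝ → Torus d → Vel d) (G : ℝ → Torus d → Grad d) (j : Fin d) :
    (Torus d → ℝ) → ℝ → ℝ :=
  evolved (fun x => r₀ x * v₀ x j) (fun i t x => stress γ mu lam (r t x) (v t x) (G t x) i j)

/-- `(ρ, u)` is a state with energy bound `C` whose density and momentum are those prescribed by
the equations at time `s`. -/
structure IsSlice (γ mu lam : ℝ) (r₀ : Torus d → ℝ) (v₀ : Torus d → Vel d)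
    (r : ℝ → Torus d → ℝ) (v : ℝ → Torus d → Vel d) (G : ℝ → Torus d → Grad d)
    (C s : ℝ) (ρ : Torus d → ℝ) (u : Torus d → Vel d) : Prop where
  measurable_density : AEStronglyMeasurable ρ
  nonneg : ∀ᵐ x, 0 ≤ ρ x
  measurable_velocity : AEStronglyMeasurable u
  integrable_pressure : Integrable fun x => ρ x ^ γ
  pressure_le : ∫ x, ρ x ^ γ ≤ C
  integrable_kinetic : Integrable fun x => ρ x * ‖u x‖ ^ 2
  kinetic_le : ∫ x, ρ x * ‖u x‖ ^ 2 ≤ C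
  mass : ∀ φ, IsSmooth φ → ∫ x, ρ x * φ x = massAt r₀ r v φ s
  momentum : ∀ j φ, IsSmooth φ →
    ∫ x, ρ x * u x j * φ x = momentumAt γ mu lam r₀ v₀ r v G j φ s

section SliceLemmas

variable {γ mu lam : ℝ} {r₀ : Torus d → ℝ} {v₀ : Torus d → Vel d}
    {r : ℝ → Torus d → ℝ} {v : ℝ → Torus d → Vel d} {G : ℝ → Torus d → Grad d}
    {C s : ℝ} {ρ : Torus d → ℝ} {u : Torus d → Vel d}

lemma measurable_component (hu : AEStronglyMeasurable u) (j : Fin d) :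
    AEStronglyMeasurable fun x => u x j :=
  (EuclideanSpace.proj j : Vel d →L[ℝ] ℝ).continuous.comp_aestronglyMeasurable hu

namespace IsSlice

lemma integrable_density (h : IsSlice γ mu lam r₀ v₀ r v G C s ρ u) (hγ : 1 < γ) :
    Integrable ρ :=
  integrable_of_integrable_rpow hγ.le h.measurable_density h.nonneg h.integrable_pressure

lemma integrable_momentum (h : IsSlice γ mu lam r₀ v₀ r v G C s ρ u) (hγ : 1 < γ) (j : Fin d) :
    Integrable fun x => ρ x * u x j := by
  refine ((h.integrable_density hγ).add h.integrable_kinetic).mono'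
    (h.measurable_density.mul (measurable_component h.measurable_velocity j)) ?_
  filter_upwards [h.nonneg] with x hx
  have h1 : |u x j| ≤ ‖u x‖ := PiLp.norm_apply_le (u x) j
  have h2 : |u x j| ≤ 1 + ‖u x‖ ^ 2 := by nlinarith [norm_nonneg (u x)]
  rw [norm_mul, Real.norm_of_nonneg hx, Real.norm_eq_abs]
  calc ρ x * |u x j| ≤ ρ x * (1 + ‖u x‖ ^ 2) := mul_le_mul_of_nonneg_left h2 hx
    _ = _ := by simp only [Pi.add_apply]; ring

/-- Density and momentum of a slice are determined by the equations. -/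
lemma unique (h : IsSlice γ mu lam r₀ v₀ r v G C s ρ u) (hγ : 1 < γ) {C' : ℝ} {ρ' : Torus d → ℝ}
    {u' : Torus d → Vel d} (h' : IsSlice γ mu lam r₀ v₀ r v G C' s ρ' u') :
    ρ =ᵐ[volume] ρ' ∧ ∀ j, (fun x => ρ x * u x j) =ᵐ[volume] fun x => ρ' x * u' x j :=
  ⟨ae_eq_of_integral_mul_smooth (h.integrable_density hγ) (h'.integrable_density hγ)
    fun φ hφ => (h.mass φ hφ).trans (h'.mass φ hφ).symm,
  fun j => ae_eq_of_integral_mul_smooth (h.integrable_momentum hγ j) (h'.integrable_momentum hγ j)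
    fun φ hφ => (h.momentum j φ hφ).trans (h'.momentum j φ hφ).symm⟩

end IsSlice

/-- Cauchy–Schwarz for the weight `ρ`. -/
lemma sq_integral_weight_le {w φ : Torus d → ℝ} (hρm : AEStronglyMeasurable ρ)
    (h0 : ∀ᵐ x, 0 ≤ ρ x) (hw : AEStronglyMeasurable w) (hw2 : Integrable fun x => ρ x * w x ^ 2)
    (hφ : AEStronglyMeasurable φ) (hφ2 : Integrable fun x => ρ x * φ x ^ 2) :
    Integrable (fun x => ρ x * w x * φ x) ∧
    (∫ x, ρ x * w x * φ x) ^ 2 ≤ (∫ x, ρ x * w x ^ 2) * ∫ x, ρ x * φ x ^ 2 := by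
  have hconj : (2 : ℝ).HolderConjugate 2 := by rw [Real.holderConjugate_iff]; norm_num
  have hsq : AEStronglyMeasurable fun x => √(ρ x) :=
    Real.continuous_sqrt.comp_aestronglyMeasurable hρm
  have key : ∀ {g : Torus d → ℝ}, AEStronglyMeasurable g → Integrable (fun x => ρ x * g x ^ 2) →
      MemLp (fun x => √(ρ x) * g x) (ENNReal.ofReal 2) ∧
      (eLpNorm (fun x => √(ρ x) * g x) (ENNReal.ofReal 2) volume).toReal ^ 2
        = ∫ x, ρ x * g x ^ 2 := by
    intro g hg hg2
    have e : (fun x => (√(ρ x) * g x) ^ 2) =ᵐ[volume] fun x => ρ x * g x ^ 2 := by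
      filter_upwards [h0] with x hx
      rw [mul_pow, Real.sq_sqrt hx]
    have hmem : MemLp (fun x => √(ρ x) * g x) (ENNReal.ofReal 2) := by
      have hm : AEStronglyMeasurable fun x => √(ρ x) * g x := hsq.mul hg
      rw [ENNReal.ofReal_ofNat, memLp_two_iff_integrable_sq hm]
      exact hg2.congr e.symm
    refine ⟨hmem, ?_⟩
    rw [← integral_congr_ae e, hmem.eLpNorm_eq_integral_rpow_norm (by simp) ENNReal.ofReal_ne_top,
      ENNReal.toReal_ofReal (by positivity), ENNReal.toReal_ofReal (by norm_num)]
    have e2 : ∀ x, ‖√(ρ x) * g x‖ ^ (2 : ℝ) = (√(ρ x) * g x) ^ 2 := fun x => by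
      rw [Real.rpow_two, Real.norm_eq_abs, sq_abs]
    simp_rw [e2]
    rw [← Real.rpow_natCast, ← Real.rpow_mul (integral_nonneg fun x => sq_nonneg _)]
    norm_num
  obtain ⟨h1, h2⟩ := key hw hw2
  obtain ⟨h3, h4⟩ := key hφ hφ2
  obtain ⟨h5, h6⟩ := abs_integral_mul_le_eLpNorm hconj h1 h3
  have e : (fun x => √(ρ x) * w x * (√(ρ x) * φ x)) =ᵐ[volume] fun x => ρ x * w x * φ x := by
    filter_upwards [h0] with x hx
    calc √(ρ x) * w x * (√(ρ x) * φ x) = (√(ρ x) * √(ρ x)) * w x * φ x := by ring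
      _ = _ := by rw [Real.mul_self_sqrt hx]
  refine ⟨h5.congr e, ?_⟩
  rw [integral_congr_ae e] at h6
  rw [← sq_abs, ← h2, ← h4, ← mul_pow, ← ENNReal.toReal_mul]
  exact pow_le_pow_left₀ (abs_nonneg _) h6 2

end SliceLemmas
end Slices

/-! ### Existence of slices and balance of internal energy -/

section SliceExistence

variable {d : ℕ}

lemma exists_bound_of_memLpLq_top {T : ℝ} {f : ℝ → Torus d → ℝ} (h : MemLpLq T ⊤ 1 f)
    (h0 : ∀ᵐ z ∂(slab d T), 0 ≤ f z.1 z.2) :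
    ∃ C, 0 ≤ C ∧ ∀ᵐ t ∂((volume : Measure ℝ).restrict (Ioo 0 T)),
      Integrable (f t) ∧ ∫ x, f t x ≤ C := by
  have hfin := h.2
  rw [eLpNorm_exponent_top] at hfin
  refine ⟨(eLpNormEssSup (fun t : ℝ => eLpNorm (f t) 1 (volume : Measure (Torus d)))
    ((volume : Measure ℝ).restrict (Ioo 0 T))).toReal, ENNReal.toReal_nonneg, ?_⟩
  filter_upwards [ae_le_eLpNormEssSup (f := fun t : ℝ => eLpNorm (f t) 1
    (volume : Measure (Torus d))) (μ := (volume : Measure ℝ).restrict (Ioo 0 T)),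
    ae_aestronglyMeasurable_slice h.1, Measure.ae_ae_of_ae_prod h0] with t h1 h2 h3
  rw [enorm_eq_self] at h1
  have h4 : MemLp (f t) 1 := ⟨h2, h1.trans_lt hfin⟩
  have h5 := memLp_one_iff_integrable.1 h4
  refine ⟨h5, ?_⟩
  rw [integral_eq_lintegral_of_nonneg_ae h3 h2]
  refine ENNReal.toReal_mono hfin.ne (le_trans (le_of_eq ?_) h1)
  rw [eLpNorm_one_eq_lintegral_enorm]
  refine lintegral_congr_ae ?_
  filter_upwards [h3] with x hx
  rw [Real.enorm_of_nonneg hx]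

lemma integral_withDensity_ofReal {ρ : Torus d → ℝ} (hρm : AEStronglyMeasurable ρ)
    (hρ0 : ∀ᵐ x, 0 ≤ ρ x) (g : Torus d → ℝ) :
    ∫ x, g x ∂(volume.withDensity fun x => ENNReal.ofReal (ρ x)) = ∫ x, ρ x * g x := by
  rw [integral_withDensity_eq_integral_toReal_smul₀ hρm.aemeasurable.ennreal_ofReal
    (Eventually.of_forall fun x => ENNReal.ofReal_lt_top)]
  refine integral_congr_ae ?_
  filter_upwards [hρ0] with x hx
  rw [ENNReal.toReal_ofReal hx, smul_eq_mul]

lemma integrable_withDensity_ofReal_iff {ρ : Torus d → ℝ} (hρm : AEStronglyMeasurable ρ)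
    (hρ0 : ∀ᵐ x, 0 ≤ ρ x) {g : Torus d → ℝ} :
    Integrable g (volume.withDensity fun x => ENNReal.ofReal (ρ x))
      ↔ Integrable fun x => ρ x * g x := by
  rw [integrable_withDensity_iff_integrable_smul₀' hρm.aemeasurable.ennreal_ofReal
    (Eventually.of_forall fun x => ENNReal.ofReal_lt_top)]
  refine integrable_congr ?_
  filter_upwards [hρ0] with x hx
  rw [ENNReal.toReal_ofReal hx, smul_eq_mul]

namespace IsRegular

variable {T γ mu lam : ℝ} {r₀ : Torus d → ℝ} {v₀ : Torus d → Vel d}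
    {r : ℝ → Torus d → ℝ} {v : ℝ → Torus d → Vel d} {G : ℝ → Torus d → Grad d}
    {k l a b c e : ℝ}

/-- Almost every time gives a slice. -/
lemma exists_ae_isSlice (h : IsRegular T γ mu lam r₀ v₀ r v G k l a b c e) :
    ∃ C, 0 ≤ C ∧ ∀ᵐ t ∂((volume : Measure ℝ).restrict (Ioo 0 T)),
      IsSlice γ mu lam r₀ v₀ r v G C t (r t) (v t) := by
  have h0 := h.sol.density_nonneg
  obtain ⟨C₁, hC₁, h1⟩ := exists_bound_of_memLpLq_top h.sol.pressure_bound (by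
    filter_upwards [h0] with z hz using Real.rpow_nonneg hz γ)
  obtain ⟨C₂, hC₂, h2⟩ := exists_bound_of_memLpLq_top h.sol.kinetic_bound (by
    filter_upwards [h0] with z hz using mul_nonneg hz (sq_nonneg _))
  refine ⟨max C₁ C₂, hC₁.trans (le_max_left _ _), ?_⟩
  filter_upwards [h1, h2, ae_integrable_slice h.integrable_density, Measure.ae_ae_of_ae_prod h0,
    ae_aestronglyMeasurable_slice h.velocity.1, h.ae_mass, ae_all_iff.2 h.ae_momentum]
    with t a1 a2 a3 a4 a5 a6 a7
  exact ⟨a3.1, a4, a5, a1.1, a1.2.trans (le_max_left _ _), a2.1, a2.2.trans (le_max_right _ _),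
    a6, a7⟩

lemma tendsto_massAt (h : IsRegular T γ mu lam r₀ v₀ r v G k l a b c e) {φ : Torus d → ℝ}
    (hφ : IsSmooth φ) {s : ℝ} (hs : s ∈ Icc 0 T) {t : ℕ → ℝ} (ht : ∀ n, t n ∈ Icc 0 T)
    (hlim : Tendsto t atTop (𝓝 s)) :
    Tendsto (fun n => massAt r₀ r v φ (t n)) atTop (𝓝 (massAt r₀ r v φ s)) :=
  tendsto_evolved h.time_pos h.integrable_momentum hφ hs ht hlim

lemma tendsto_momentumAt (h : IsRegular T γ mu lam r₀ v₀ r v G k l a b c e) (j : Fin d)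
    {φ : Torus d → ℝ} (hφ : IsSmooth φ) {s : ℝ} (hs : s ∈ Icc 0 T) {t : ℕ → ℝ}
    (ht : ∀ n, t n ∈ Icc 0 T) (hlim : Tendsto t atTop (𝓝 s)) :
    Tendsto (fun n => momentumAt γ mu lam r₀ v₀ r v G j φ (t n)) atTop
      (𝓝 (momentumAt γ mu lam r₀ v₀ r v G j φ s)) :=
  tendsto_evolved h.time_pos (fun i => h.integrable_stress i j) hφ hs ht hlim

/-- A trace of the density along slices extends to a slice: the velocity is the density of the
momentum with respect to the mass. -/
lemma exists_slice_of_trace (h : IsRegular T γ mu lam r₀ v₀ r v G k l a b c e) {C : ℝ}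
    (hC0 : 0 ≤ C) {s : ℝ} (hs : s ∈ Icc 0 T) {t : ℕ → ℝ} (htI : ∀ n, t n ∈ Icc 0 T)
    (ht : ∀ n, IsSlice γ mu lam r₀ v₀ r v G C (t n) (r (t n)) (v (t n)))
    (hts : Tendsto t atTop (𝓝 s)) {ρ : Torus d → ℝ} (hρm : AEStronglyMeasurable ρ)
    (hρ0 : ∀ᵐ x, 0 ≤ ρ x) (hlim : ∀ᵐ x, Tendsto (fun n => r (t n) x) atTop (𝓝 (ρ x))) :
    ∃ u, IsSlice γ mu lam r₀ v₀ r v G (d * C + C) s ρ u := by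
  have hγ := h.one_lt_gamma
  obtain ⟨hρi, hρC⟩ := integrable_rpow_of_tendsto hρm (fun n => (ht n).nonneg)
    (fun n => (ht n).integrable_pressure) (fun n => (ht n).pressure_le) (by linarith) hlim
  have hρ1 : Integrable ρ := integrable_of_integrable_rpow hγ.le hρm hρ0 hρi
  have hmass : ∀ φ, IsSmooth φ → ∫ x, ρ x * φ x = massAt r₀ r v φ s := fun φ hφ => by
    refine tendsto_nhds_unique (tendsto_integral_mul_of_ae hγ (fun n => (ht n).measurable_density)
      hρm (fun n => (ht n).nonneg) (fun n => (ht n).integrable_pressure)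
      (fun n => (ht n).pressure_le) hlim hφ) ?_
    exact (h.tendsto_massAt hφ hs htI hts).congr fun n => ((ht n).mass φ hφ).symm
  -- the momentum is bounded by the square root of the mass
  have hbound : ∀ j φ, IsSmooth φ →
      momentumAt γ mu lam r₀ v₀ r v G j φ s ^ 2 ≤ C * ∫ x, ρ x * φ x ^ 2 := by
    intro j φ hφ
    have hφ2 : IsSmooth fun x => φ x ^ 2 := by simpa only [pow_two] using hφ.mul hφ
    rw [hmass _ hφ2]
    refine le_of_tendsto_of_tendsto ((h.tendsto_momentumAt j hφ hs htI hts).pow 2)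
      ((h.tendsto_massAt hφ2 hs htI hts).const_mul C) (Eventually.of_forall fun n => ?_)
    have hn := ht n
    have hvm := measurable_component hn.measurable_velocity j
    have hle : ∀ᵐ x, r (t n) x * v (t n) x j ^ 2 ≤ r (t n) x * ‖v (t n) x‖ ^ 2 := by
      filter_upwards [hn.nonneg] with x hx
      refine mul_le_mul_of_nonneg_left ?_ hx
      rw [← sq_abs]
      exact pow_le_pow_left₀ (abs_nonneg _) (PiLp.norm_apply_le (v (t n) x) j) 2
    have hw2 : Integrable fun x => r (t n) x * v (t n) x j ^ 2 := by
      refine hn.integrable_kinetic.mono' (hn.measurable_density.mul (hvm.pow 2)) ?_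
      filter_upwards [hle, hn.nonneg] with x h1 h2
      rwa [Real.norm_of_nonneg (mul_nonneg h2 (sq_nonneg _))]
    have h1 := (sq_integral_weight_le hn.measurable_density hn.nonneg hvm hw2
      (hφ.aestronglyMeasurable _) (hφ2.integrable_mul (hn.integrable_density hγ))).2
    simp only
    rw [← hn.momentum j φ hφ, ← hn.mass _ hφ2]
    refine h1.trans (mul_le_mul_of_nonneg_right ?_ ?_)
    · exact (integral_mono_ae hw2 hn.integrable_kinetic hle).trans hn.kinetic_le
    · refine integral_nonneg_of_ae ?_
      filter_upwards [hn.nonneg] with x hx using mul_nonneg hx (sq_nonneg _)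
  set ν : Measure (Torus d) := volume.withDensity fun x => ENNReal.ofReal (ρ x) with hν
  have hνfin : IsFiniteMeasure ν := isFiniteMeasure_withDensity_ofReal hρ1.2
  have hνint : ∀ g : Torus d → ℝ, ∫ x, g x ∂ν = ∫ x, ρ x * g x :=
    integral_withDensity_ofReal hρm hρ0
  have hνi : ∀ g : Torus d → ℝ, Integrable g ν → Integrable fun x => ρ x * g x := fun g =>
    (integrable_withDensity_ofReal_iff hρm hρ0).1
  have hw : ∀ j, ∃ w : Torus d → ℝ, StronglyMeasurable w ∧
      (∀ φ, IsSmooth φ → ∫ x, ρ x * w x * φ x = momentumAt γ mu lam r₀ v₀ r v G j φ s) ∧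
      (Integrable fun x => ρ x * w x ^ 2) ∧ ∫ x, ρ x * w x ^ 2 ≤ C := by
    intro j
    obtain ⟨w, hw, hwφ, hwC⟩ := exists_memLp_of_sq_le (ν := ν)
      (L := fun φ => momentumAt γ mu lam r₀ v₀ r v G j φ s) (C := C)
      (fun φ ψ hφ hψ => evolved_add (h.integrable_momentum₀ j) (fun i => h.integrable_stress i j)
        hφ hψ hs) (fun c φ hφ => evolved_const_mul c hφ s)
      (fun φ hφ => by simp only [hνint]; exact hbound j φ hφ) hC0
    have hae : hw.1.mk w =ᵐ[ν] w := hw.1.ae_eq_mk.symm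
    refine ⟨hw.1.mk w, hw.1.stronglyMeasurable_mk, fun φ hφ => ?_, ?_, ?_⟩
    · rw [← hwφ φ hφ]
      simp_rw [mul_assoc]
      rw [← hνint]
      refine integral_congr_ae ?_
      filter_upwards [hae] with x hx
      rw [hx]
    · refine hνi (fun x => hw.1.mk w x ^ 2) ((hw.integrable_sq).congr ?_)
      filter_upwards [hae] with x hx
      rw [hx]
    · rw [← hνint]
      refine le_trans (le_of_eq (integral_congr_ae ?_)) hwC
      filter_upwards [hae] with x hx
      rw [hx]
  choose w hwm hwφ hwi hwC using hw
  have hum : AEStronglyMeasurable (fun x => (WithLp.toLp 2 fun j => w j x : Vel d))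
      (volume : Measure (Torus d)) := by
    have h1 : Measurable fun x => fun j => w j x := measurable_pi_lambda _ fun j => (hwm j).measurable
    exact ((PiLp.continuous_toLp 2 (fun _ : Fin d => ℝ)).measurable.comp h1).aestronglyMeasurable
  have hun : ∀ x, ρ x * ‖(WithLp.toLp 2 fun j => w j x : Vel d)‖ ^ 2
      = ∑ j, ρ x * w j x ^ 2 := fun x => by
    rw [EuclideanSpace.norm_sq_eq, Finset.mul_sum]
    simp only [Real.norm_eq_abs, sq_abs]
  refine ⟨fun x => WithLp.toLp 2 fun j => w j x, hρm, hρ0, hum, hρi, ?_, ?_, ?_, hmass,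
    fun j φ hφ => hwφ j φ hφ⟩
  · have : (0 : ℝ) ≤ d * C := by positivity
    linarith
  · simp_rw [hun]
    exact integrable_finsetSum _ fun j _ => hwi j
  · simp_rw [hun]
    rw [integral_finsetSum _ fun j _ => hwi j]
    calc ∑ j, ∫ x, ρ x * w j x ^ 2 ≤ ∑ _j : Fin d, C := Finset.sum_le_sum fun j _ => hwC j
      _ = d * C := by simp
      _ ≤ _ := by linarith

/-- The pressure law is a primitive of a continuous function on the whole line, as the
cut-off renormalization requires. -/
lemma integral_pressure_deriv {γ : ℝ} (hγ : 1 < γ) {s : ℝ} (hs : 0 ≤ s) :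
    ∫ σ in (0 : ℝ)..s, γ * max σ 0 ^ (γ - 1) = s ^ γ := by
  have h1 : ∫ σ in (0 : ℝ)..s, γ * max σ 0 ^ (γ - 1) = ∫ σ in (0 : ℝ)..s, γ * σ ^ (γ - 1) := by
    refine intervalIntegral.integral_congr fun σ hσ => ?_
    rw [uIcc_of_le hs] at hσ
    simp only [max_eq_left hσ.1]
  rw [h1, intervalIntegral.integral_const_mul, integral_rpow (Or.inl (by linarith)),
    sub_add_cancel, Real.zero_rpow (by linarith), sub_zero]
  field_simp

/-- The balance of internal energy between two traces of the density. -/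
lemma pressure_balance (h : IsRegular T γ mu lam r₀ v₀ r v G k l a b c e) :
    ∃ S : Set ℝ, (∀ᵐ t ∂((volume : Measure ℝ).restrict (Ioo 0 T)), t ∈ S) ∧
      ∀ s ∈ Icc 0 T, ∀ s' ∈ Icc 0 T, ∀ ρ ρ' : Torus d → ℝ, ∀ t t' : ℕ → ℝ,
        AEStronglyMeasurable ρ → AEStronglyMeasurable ρ' → (∀ᵐ x, 0 ≤ ρ x) → (∀ᵐ x, 0 ≤ ρ' x) →
        Integrable (fun x => ρ x ^ γ) → Integrable (fun x => ρ' x ^ γ) →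
        (∀ n, t n ∈ S) → (∀ n, t' n ∈ S) → Tendsto t atTop (𝓝 s) → Tendsto t' atTop (𝓝 s') →
        (∀ᵐ x, Tendsto (fun n => r (t n) x) atTop (𝓝 (ρ x))) →
        (∀ᵐ x, Tendsto (fun n => r (t' n) x) atTop (𝓝 (ρ' x))) →
        ∫ x, ρ x ^ γ = (∫ x, ρ' x ^ γ)
          + ∫ τ in s'..s, ∫ x, (r τ x ^ γ - γ * r τ x ^ γ) * divg (G τ x) := by
  have hγ := h.one_lt_gamma
  set g : ℝ → ℝ := fun σ => γ * max σ 0 ^ (γ - 1) with hg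
  have hgc : Continuous g := continuous_const.mul
    ((continuous_id.max continuous_const).rpow_const fun _ => Or.inr (by linarith))
  have hg0 : ∀ σ, 0 ≤ g σ := fun σ => mul_nonneg (by linarith)
    (Real.rpow_nonneg (le_max_right _ _) _)
  have hprim : ∀ {y : ℝ}, 0 ≤ y → ∫ σ in (0 : ℝ)..y, g σ = y ^ γ := fun hy =>
    integral_pressure_deriv hγ hy
  have hgs : ∀ {y : ℝ}, 0 ≤ y → g y * y = γ * y ^ γ := by
    intro y hy
    rcases hy.eq_or_lt with h0 | h0
    · rw [← h0, mul_zero, Real.zero_rpow (by linarith), mul_zero]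
    · simp only [hg, max_eq_left hy]
      rw [mul_assoc, ← Real.rpow_add_one h0.ne', sub_add_cancel]
  choose S hS hST hSeq using fun n : ℕ => h.exists_set_cutoff hgc hg0 n
  have hr0 : ∀ᵐ t ∂((volume : Measure ℝ).restrict (Ioo 0 T)), (∀ᵐ x, 0 ≤ r t x) ∧
      AEStronglyMeasurable (r t) :=
    (Measure.ae_ae_of_ae_prod h.sol.density_nonneg).and
      (ae_aestronglyMeasurable_slice h.integrable_density.1)
  have hcb : ∀ n, Continuous (cutoffPrimitive g n) := fun n =>
    (contDiff_cutoffPrimitive hgc n).continuous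
  have hdc : ∀ n, Continuous (deriv (cutoffPrimitive g n)) := fun n =>
    (contDiff_cutoffPrimitive hgc n).continuous_deriv le_rfl
  have hev : ∀ {y : ℝ}, 0 ≤ y → ∀ᶠ n : ℕ in atTop, cutoffPrimitive g n y = y ^ γ ∧
      deriv (cutoffPrimitive g n) y * y = γ * y ^ γ := fun {y} hy => by
    filter_upwards [tendsto_natCast_atTop_atTop.eventually_ge_atTop y] with n hn
    rw [cutoffPrimitive_eq hn, hprim hy, deriv_cutoffPrimitive_eq hgc hn]
    exact ⟨rfl, hgs hy⟩
  have hdom : ∀ n {y D : ℝ}, 0 ≤ y → |(cutoffPrimitive g n y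
      - deriv (cutoffPrimitive g n) y * y) * D| ≤ (1 + γ) * |y ^ γ * D| := by
    intro n y D hy
    have hy' := Real.rpow_nonneg hy γ
    rw [abs_mul, abs_mul, abs_of_nonneg hy', ← mul_assoc]
    refine mul_le_mul_of_nonneg_right ((abs_sub _ _).trans ?_) (abs_nonneg _)
    have h1 : |cutoffPrimitive g n y| ≤ y ^ γ := by
      rw [abs_of_nonneg (cutoffPrimitive_nonneg hg0 n hy), ← hprim hy]
      exact cutoffPrimitive_le hgc hg0 n hy
    have h2 : |deriv (cutoffPrimitive g n) y * y| ≤ γ * y ^ γ := by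
      rw [abs_mul, ← hgs hy, abs_of_nonneg hy, ← abs_of_nonneg (hg0 y)]
      exact mul_le_mul_of_nonneg_right (abs_deriv_cutoffPrimitive_le hgc n y) hy
    linarith
  refine ⟨{t | (∀ n, t ∈ S n) ∧ (∀ᵐ x, 0 ≤ r t x) ∧
    AEStronglyMeasurable (r t) (volume : Measure (Torus d))}, (ae_all_iff.2 hS).and hr0, ?_⟩
  intro s hs s' hs' ρ ρ' t t' hm hm' hρ0 hρ0' hi hi' ht ht' hts hts' hlim hlim'
  have htI : ∀ n, t n ∈ Icc 0 T := fun n => Ioo_subset_Icc_self (hST 0 ((ht n).1 0))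
  have htI' : ∀ n, t' n ∈ Icc 0 T := fun n => Ioo_subset_Icc_self (hST 0 ((ht' n).1 0))
  -- the balance for cut-off pressures
  have hW : ∀ n, Integrable (fun z : ℝ × Torus d => (cutoffPrimitive g n (r z.1 z.2)
      - deriv (cutoffPrimitive g n) (r z.1 z.2) * r z.1 z.2) * divg (G z.1 z.2)) (slab d T) := by
    intro n
    have hmeas : AEStronglyMeasurable (fun z : ℝ × Torus d => (cutoffPrimitive g n (r z.1 z.2)
      - deriv (cutoffPrimitive g n) (r z.1 z.2) * r z.1 z.2) * divg (G z.1 z.2)) (slab d T) :=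
      (h.aestronglyMeasurable_comp_density (β := fun s => cutoffPrimitive g n s
        - deriv (cutoffPrimitive g n) s * s) ((hcb n).sub ((hdc n).mul continuous_id))).mul
        h.integrable_divg.1
    refine ((h.integrable_pressure_work.abs).const_mul (1 + γ)).mono' hmeas ?_
    filter_upwards [h.sol.density_nonneg] with z hz using hdom n hz
  have hbal : ∀ n, ∫ x, cutoffPrimitive g n (ρ x) = (∫ x, cutoffPrimitive g n (ρ' x))
      + ∫ τ in s'..s, ∫ x, (cutoffPrimitive g n (r τ x)
        - deriv (cutoffPrimitive g n) (r τ x) * r τ x) * divg (G τ x) := by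
    intro n
    obtain ⟨C, hC⟩ := exists_cutoffPrimitive_bound hgc hg0 n
    have hspace : ∀ {q : ℕ → ℝ} {σ : Torus d → ℝ}, (∀ j, (∀ᵐ x, 0 ≤ r (q j) x) ∧
        AEStronglyMeasurable (r (q j)) (volume : Measure (Torus d))) →
        (∀ᵐ x, Tendsto (fun j => r (q j) x) atTop (𝓝 (σ x))) →
        Tendsto (fun j => ∫ x, cutoffPrimitive g n (r (q j) x)) atTop
          (𝓝 (∫ x, cutoffPrimitive g n (σ x))) := by
      intro q σ hq hσ
      refine tendsto_integral_of_dominated_convergence (fun _ => C)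
        (fun j => (hcb n).comp_aestronglyMeasurable (hq j).2) (integrable_const _) (fun j => ?_) ?_
      · filter_upwards [(hq j).1] with x hx using hC _ hx
      · filter_upwards [hσ] with x hx using ((hcb n).tendsto _).comp hx
    have hslice := integrableOn_integral_slice (H := fun τ x => (cutoffPrimitive g n (r τ x)
      - deriv (cutoffPrimitive g n) (r τ x) * r τ x) * divg (G τ x)) (hW n)
    set w : ℝ → ℝ := fun τ => ∫ x, (cutoffPrimitive g n (r τ x)
      - deriv (cutoffPrimitive g n) (r τ x) * r τ x) * divg (G τ x) with hw
    have hii : ∀ {p q : ℝ}, p ∈ Icc 0 T → q ∈ Icc 0 T → IntervalIntegrable w volume p q :=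
      fun hp hq => IntegrableOn.intervalIntegrable_of_mem hslice hp hq
    have h1 : ∀ j, ∫ x, cutoffPrimitive g n (r (t j) x)
        = (∫ x, cutoffPrimitive g n (r (t' j) x)) + ((∫ τ in s'..s, w τ)
          + (∫ τ in s..t j, w τ) - ∫ τ in s'..t' j, w τ) := by
      intro j
      have h2 := hSeq n (t' j) ((ht' j).1 n) (t j) ((ht j).1 n) (fun _ => 1) (isSmooth_const 1)
      have h3 : ∀ i, pd i (fun _ : Torus d => (1 : ℝ)) = fun _ => 0 := fun i => by
        funext x; simp [pd]
      simp only [weakFlux, h3, mul_one, mul_zero, Finset.sum_const_zero, add_zero] at h2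
      rw [h2, intervalIntegral.integral_add_adjacent_intervals (hii hs' hs) (hii hs (htI j)),
        intervalIntegral.integral_interval_sub_left (hii hs' (htI j)) (hii hs' (htI' j))]
    have h4 := tendsto_intervalIntegral_zero h.time_pos hslice hs htI hts
    have h5 := tendsto_intervalIntegral_zero h.time_pos hslice hs' htI' hts'
    have h6 := (hspace (fun j => (ht' j).2) hlim').add
      (((tendsto_const_nhds (x := ∫ τ in s'..s, w τ)).add h4).sub h5)
    rw [add_zero, sub_zero] at h6
    exact tendsto_nhds_unique ((hspace (fun j => (ht j).2) hlim).congr h1) h6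
  -- removal of the cut-off
  have hpow : ∀ {σ : Torus d → ℝ}, AEStronglyMeasurable σ → (∀ᵐ x, 0 ≤ σ x) →
      Integrable (fun x => σ x ^ γ) → Tendsto (fun n => ∫ x, cutoffPrimitive g n (σ x)) atTop
        (𝓝 (∫ x, σ x ^ γ)) := by
    intro σ hσm hσ0 hσ
    refine tendsto_integral_of_dominated_convergence (fun x => σ x ^ γ)
      (fun n => (hcb n).comp_aestronglyMeasurable hσm) hσ (fun n => ?_) ?_
    · filter_upwards [hσ0] with x hx
      rw [Real.norm_of_nonneg (cutoffPrimitive_nonneg hg0 n hx), ← hprim hx]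
      exact cutoffPrimitive_le hgc hg0 n hx
    · filter_upwards [hσ0] with x hx
      refine tendsto_const_nhds.congr' ?_
      filter_upwards [hev hx] with n hn using hn.1.symm
  have hflux := tendsto_intervalIntegral_of_dominated (T := T)
    (F := fun n τ x => (cutoffPrimitive g n (r τ x)
      - deriv (cutoffPrimitive g n) (r τ x) * r τ x) * divg (G τ x))
    (F' := fun τ x => (r τ x ^ γ - γ * r τ x ^ γ) * divg (G τ x))
    (B := fun τ x => (1 + γ) * |r τ x ^ γ * divg (G τ x)|) (fun n => (hW n).1)
    ((h.integrable_pressure_work.abs).const_mul (1 + γ)) (fun n => by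
      filter_upwards [h.sol.density_nonneg] with z hz using hdom n hz) (by
      filter_upwards [h.sol.density_nonneg] with z hz
      refine tendsto_const_nhds.congr' ?_
      filter_upwards [hev hz] with n hn
      rw [hn.1, hn.2]) hs' hs
  exact tendsto_nhds_unique ((hpow hm hρ0 hi).congr hbal) ((hpow hm' hρ0' hi').add hflux)

end IsRegular
end SliceExistence

/-! ### The weakly continuous representative -/

section Representative

variable {d : ℕ}

lemma memLp_and_eLpNorm_le_of_integral_rpow_le {f : Torus d → ℝ} {p C : ℝ} (hp : 0 < p)
    (hm : AEStronglyMeasurable f) (h0 : ∀ᵐ x, 0 ≤ f x) (hi : Integrable fun x => f x ^ p)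
    (hC : ∫ x, f x ^ p ≤ C) :
    MemLp f (ENNReal.ofReal p) ∧
      eLpNorm f (ENNReal.ofReal p) volume ≤ ENNReal.ofReal (C ^ p⁻¹) := by
  have hp0 : ENNReal.ofReal p ≠ 0 := by simpa using hp
  have hpr : (ENNReal.ofReal p).toReal = p := ENNReal.toReal_ofReal hp.le
  have e : (fun x => f x ^ p) =ᵐ[volume] fun x => ‖f x‖ ^ p := by
    filter_upwards [h0] with x hx
    rw [Real.norm_of_nonneg hx]
  have hmem : MemLp f (ENNReal.ofReal p) := by
    rw [← integrable_norm_rpow_iff hm hp0 ENNReal.ofReal_ne_top, hpr]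
    exact hi.congr e
  refine ⟨hmem, ?_⟩
  rw [hmem.eLpNorm_eq_integral_rpow_norm hp0 ENNReal.ofReal_ne_top, hpr, ← integral_congr_ae e]
  refine ENNReal.ofReal_le_ofReal (Real.rpow_le_rpow (integral_nonneg_of_ae ?_) hC (by positivity))
  filter_upwards [h0] with x hx using Real.rpow_nonneg hx p

section SliceBounds

variable {γ mu lam : ℝ} {r₀ : Torus d → ℝ} {v₀ : Torus d → Vel d}
    {r : ℝ → Torus d → ℝ} {v : ℝ → Torus d → Vel d} {G : ℝ → Torus d → Grad d}
    {C s : ℝ} {ρ : Torus d → ℝ} {u : Torus d → Vel d}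

namespace IsSlice

lemma memLp_density (h : IsSlice γ mu lam r₀ v₀ r v G C s ρ u) (hγ : 1 < γ) :
    MemLp ρ (ENNReal.ofReal γ) ∧
      eLpNorm ρ (ENNReal.ofReal γ) volume ≤ ENNReal.ofReal (C ^ γ⁻¹) :=
  memLp_and_eLpNorm_le_of_integral_rpow_le (by linarith) h.measurable_density h.nonneg
    h.integrable_pressure h.pressure_le

/-- The momentum `ρ u = √ρ (√ρ u)` is a product of a factor in `L^{2γ}` and a factor in `L²`. -/
lemma memLp_momentum (h : IsSlice γ mu lam r₀ v₀ r v G C s ρ u) (hγ : 1 < γ) :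
    MemLp (fun x => ρ x • u x) (ENNReal.ofReal (2 * γ / (γ + 1))) ∧
      eLpNorm (fun x => ρ x • u x) (ENNReal.ofReal (2 * γ / (γ + 1))) volume
        ≤ ENNReal.ofReal (C ^ (2 * γ)⁻¹) * ENNReal.ofReal (C ^ (2 : ℝ)⁻¹) := by
  have hsm : AEStronglyMeasurable fun x => √(ρ x) :=
    Real.continuous_sqrt.comp_aestronglyMeasurable h.measurable_density
  have e1 : (fun x => √(ρ x) ^ (2 * γ)) =ᵐ[volume] fun x => ρ x ^ γ := by
    filter_upwards [h.nonneg] with x hx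
    rw [Real.rpow_mul (Real.sqrt_nonneg _), Real.rpow_two, Real.sq_sqrt hx]
  have e2 : (fun x => (√(ρ x) * ‖u x‖) ^ (2 : ℝ)) =ᵐ[volume] fun x => ρ x * ‖u x‖ ^ 2 := by
    filter_upwards [h.nonneg] with x hx
    rw [Real.rpow_two, mul_pow, Real.sq_sqrt hx]
  have h1 := memLp_and_eLpNorm_le_of_integral_rpow_le (p := 2 * γ) (by linarith) hsm
    (Eventually.of_forall fun x => Real.sqrt_nonneg _) (h.integrable_pressure.congr e1.symm)
    ((integral_congr_ae e1).trans_le h.pressure_le)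
  have h2 := memLp_and_eLpNorm_le_of_integral_rpow_le (p := 2) (by norm_num)
    (f := fun x => √(ρ x) * ‖u x‖) (hsm.mul h.measurable_velocity.norm)
    (Eventually.of_forall fun x => mul_nonneg (Real.sqrt_nonneg _) (norm_nonneg _))
    (h.integrable_kinetic.congr e2.symm) ((integral_congr_ae e2).trans_le h.kinetic_le)
  have hle := eLpNorm_real_mul_le hsm h2.1.1 (p := 2 * γ / (γ + 1)) (p₁ := 2 * γ) (p₂ := 2)
    (by positivity) (by linarith) (by norm_num) (by field_simp; ring)
  have e3 : eLpNorm (fun x => ρ x • u x) (ENNReal.ofReal (2 * γ / (γ + 1))) volume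
      = eLpNorm (fun x => √(ρ x) * (√(ρ x) * ‖u x‖)) (ENNReal.ofReal (2 * γ / (γ + 1))) volume := by
    refine eLpNorm_congr_norm_ae ?_
    filter_upwards [h.nonneg] with x hx
    rw [← mul_assoc, Real.mul_self_sqrt hx, norm_smul, norm_mul, norm_norm]
  have h4 := hle.trans (mul_le_mul' h1.2 h2.2)
  rw [← e3] at h4
  exact ⟨⟨h.measurable_density.smul h.measurable_velocity,
    h4.trans_lt (ENNReal.mul_lt_top ENNReal.ofReal_lt_top ENNReal.ofReal_lt_top)⟩, h4⟩

lemma memLp_momentum_component (h : IsSlice γ mu lam r₀ v₀ r v G C s ρ u) (hγ : 1 < γ)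
    (j : Fin d) :
    MemLp (fun x => ρ x * u x j) (ENNReal.ofReal (2 * γ / (γ + 1))) ∧
      eLpNorm (fun x => ρ x * u x j) (ENNReal.ofReal (2 * γ / (γ + 1))) volume
        ≤ ENNReal.ofReal (C ^ (2 * γ)⁻¹) * ENNReal.ofReal (C ^ (2 : ℝ)⁻¹) := by
  obtain ⟨h1, h2⟩ := h.memLp_momentum hγ
  have hle : ∀ x, ‖ρ x * u x j‖ ≤ ‖ρ x • u x‖ := fun x => PiLp.norm_apply_le (ρ x • u x) j
  exact ⟨h1.mono (h.measurable_density.mul (measurable_component h.measurable_velocity j))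
    (Eventually.of_forall hle), (eLpNorm_mono hle).trans h2⟩

end IsSlice

end SliceBounds

namespace IsRegular

variable {T γ mu lam : ℝ} {r₀ : Torus d → ℝ} {v₀ : Torus d → Vel d}
    {r : ℝ → Torus d → ℝ} {v : ℝ → Torus d → Vel d} {G : ℝ → Torus d → Grad d}
    {k l a b c e : ℝ}

/-- The initial datum is a slice at time zero. -/
lemma isSlice_zero (h : IsRegular T γ mu lam r₀ v₀ r v G k l a b c e) :
    IsSlice γ mu lam r₀ v₀ r v G (max (∫ x, r₀ x ^ γ) (∫ x, r₀ x * ‖v₀ x‖ ^ 2)) 0 r₀ v₀ := by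
  have hγ := h.one_lt_gamma
  have hI := h.sol.initial
  refine ⟨hI.density_memLp.1, hI.density_nonneg, hI.velocity_measurable, ?_, le_max_left _ _,
    hI.kinetic_integrable, le_max_right _ _, fun φ hφ => ?_, fun j φ hφ => ?_⟩
  · have h1 := (integrable_norm_rpow_iff hI.density_memLp.1 (p := ENNReal.ofReal γ)
      (by simpa using (zero_lt_one.trans hγ)) ENNReal.ofReal_ne_top).2 hI.density_memLp
    rw [ENNReal.toReal_ofReal (by linarith)] at h1
    refine h1.congr ?_
    filter_upwards [hI.density_nonneg] with x hx
    rw [Real.norm_of_nonneg hx]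
  · simp [massAt, evolved]
  · simp [momentumAt, evolved]

/-- There is a representative all of whose time slices satisfy the equations, and for which the
balance of internal energy holds between any two times. -/
lemma exists_representative (h : IsRegular T γ mu lam r₀ v₀ r v G k l a b c e) :
    ∃ (C : ℝ) (r' : ℝ → Torus d → ℝ) (v' : ℝ → Torus d → Vel d), 0 ≤ C ∧
      (∀ᵐ t ∂((volume : Measure ℝ).restrict (Ioo 0 T)), r' t = r t ∧ v' t = v t) ∧
      (∀ s ∈ Icc 0 T, IsSlice γ mu lam r₀ v₀ r v G C s (r' s) (v' s)) ∧
      ∀ s ∈ Icc 0 T, ∀ s' ∈ Icc 0 T, ∫ x, r' s x ^ γ = (∫ x, r' s' x ^ γ)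
        + ∫ τ in s'..s, ∫ x, (r τ x ^ γ - γ * r τ x ^ γ) * divg (G τ x) := by
  obtain ⟨C, hC0, hC⟩ := h.exists_ae_isSlice
  obtain ⟨S, hS, hbal⟩ := h.pressure_balance
  set P : ℝ → Prop := fun t => IsSlice γ mu lam r₀ v₀ r v G C t (r t) (v t) ∧ t ∈ S with hP
  have hPae : ∀ᵐ t ∂((volume : Measure ℝ).restrict (Ioo 0 T)), P t := hC.and hS
  have hdC : (0 : ℝ) ≤ d * C := by positivity
  have key : ∀ s ∈ Icc 0 T, ∃ (ρ : Torus d → ℝ) (u : Torus d → Vel d) (t : ℕ → ℝ),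
      (P s → ρ = r s ∧ u = v s) ∧ IsSlice γ mu lam r₀ v₀ r v G (d * C + C) s ρ u ∧
      (∀ n, t n ∈ S) ∧ Tendsto t atTop (𝓝 s) ∧
      ∀ᵐ x, Tendsto (fun n => r (t n) x) atTop (𝓝 (ρ x)) := by
    intro s hs
    by_cases hPs : P s
    · have h1 := hPs.1
      refine ⟨r s, v s, fun _ => s, fun _ => ⟨rfl, rfl⟩, ⟨h1.1, h1.2, h1.3, h1.4,
        h1.5.trans (by linarith), h1.6, h1.7.trans (by linarith), h1.8, h1.9⟩, fun _ => hPs.2,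
        tendsto_const_nhds, Eventually.of_forall fun x => tendsto_const_nhds⟩
    · obtain ⟨ρ, hρm, hρ0, t, ht, hts, hlim⟩ := h.exists_density_trace hPae hs
      obtain ⟨u, hu⟩ := h.exists_slice_of_trace hC0 hs
        (fun n => Ioo_subset_Icc_self (ht n).1) (fun n => (ht n).2.1) hts hρm hρ0 hlim
      exact ⟨ρ, u, t, fun h' => absurd h' hPs, hu, fun n => (ht n).2.2, hts, hlim⟩
  choose! r' v' t h1 h2 h3 h4 h5 using key
  refine ⟨d * C + C, r', v', by linarith, ?_, h2, fun s hs s' hs' => ?_⟩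
  · filter_upwards [hPae, ae_restrict_mem measurableSet_Ioo] with τ hτ hτI
    exact h1 τ (Ioo_subset_Icc_self hτI) hτ
  · exact hbal s hs s' hs' (r' s) (r' s') (t s) (t s') (h2 s hs).measurable_density
      (h2 s' hs').measurable_density (h2 s hs).nonneg (h2 s' hs').nonneg
      (h2 s hs).integrable_pressure (h2 s' hs').integrable_pressure (h3 s hs) (h3 s' hs')
      (h4 s hs) (h4 s' hs') (h5 s hs) (h5 s' hs')

/-- A representative all of whose time slices satisfy the equations is weakly continuous. -/
lemma isWeaklyContinuousRep (h : IsRegular T γ mu lam r₀ v₀ r v G k l a b c e) {C : ℝ}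
    {r' : ℝ → Torus d → ℝ} {v' : ℝ → Torus d → Vel d}
    (hae : ∀ᵐ t ∂((volume : Measure ℝ).restrict (Ioo 0 T)), r' t = r t ∧ v' t = v t)
    (hsl : ∀ s ∈ Icc 0 T, IsSlice γ mu lam r₀ v₀ r v G C s (r' s) (v' s)) :
    IsWeaklyContinuousRep T γ r₀ v₀ r v r' v' := by
  have hγ := h.one_lt_gamma
  have h0 := (hsl 0 ⟨le_rfl, h.time_pos.le⟩).unique hγ h.isSlice_zero
  refine ⟨?_, fun t ht => (hsl t ht).nonneg, fun t ht => ((hsl t ht).memLp_density hγ).1,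
    fun t ht => ((hsl t ht).memLp_momentum hγ).1, fun φ hφ t ht => ?_, fun φ hφ => ?_, h0.1, ?_⟩
  · filter_upwards [Measure.quasiMeasurePreserving_fst.ae hae] with z hz
    rw [hz.1, hz.2]
    exact ⟨rfl, rfl⟩
  · have hconj : (γ / (γ - 1)).HolderConjugate γ := (Real.HolderConjugate.conjExponent hγ).symm
    refine tendsto_integral_mul_of_smooth hconj (l := 𝓝[Icc 0 T] t)
      (C := ENNReal.ofReal (C ^ γ⁻¹)) ENNReal.ofReal_ne_top ?_ ((hsl t ht).memLp_density hγ).1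
      (fun ψ hψ => ?_) hφ
    · filter_upwards [self_mem_nhdsWithin] with s hs using (hsl s hs).memLp_density hγ
    · rw [(hsl t ht).mass ψ hψ]
      refine ((continuousOn_evolved h.time_pos h.integrable_momentum hψ t ht).tendsto).congr' ?_
      filter_upwards [self_mem_nhdsWithin] with s hs using ((hsl s hs).mass ψ hψ).symm
  · have hconj : (2 * γ / (γ - 1)).HolderConjugate (2 * γ / (γ + 1)) := by
      rw [Real.holderConjugate_iff]
      have h1 : 0 < γ - 1 := by linarith
      constructor
      · rw [lt_div_iff₀ h1]; linarith
      · field_simp; ring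
    have hcomp : ∀ j, MemLp (fun x => φ x j) (ENNReal.ofReal (2 * γ / (γ - 1))) := fun j =>
      hφ.mono (measurable_component hφ.1 j) (Eventually.of_forall fun x => PiLp.norm_apply_le _ j)
    have e : ∀ t ∈ Icc 0 T, ∫ x, inner ℝ (r' t x • v' t x) (φ x)
        = ∑ j, ∫ x, r' t x * v' t x j * φ x j := by
      intro t ht
      rw [← integral_finsetSum _ fun j _ => (abs_integral_mul_le_eLpNorm hconj.symm
        ((hsl t ht).memLp_momentum_component hγ j).1 (hcomp j)).1]
      refine integral_congr_ae (Eventually.of_forall fun x => ?_)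
      simp only [PiLp.inner_apply, PiLp.smul_apply, smul_eq_mul, RCLike.inner_apply, conj_trivial]
      exact Finset.sum_congr rfl fun j _ => mul_comm _ _
    refine ContinuousOn.congr (continuousOn_finsetSum _ fun j _ => ?_) e
    intro t ht
    refine tendsto_integral_mul_of_smooth hconj (l := 𝓝[Icc 0 T] t)
      (C := ENNReal.ofReal (C ^ (2 * γ)⁻¹) * ENNReal.ofReal (C ^ (2 : ℝ)⁻¹))
      (ENNReal.mul_lt_top ENNReal.ofReal_lt_top ENNReal.ofReal_lt_top).ne ?_
      ((hsl t ht).memLp_momentum_component hγ j).1 (fun ψ hψ => ?_) (hcomp j)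
    · filter_upwards [self_mem_nhdsWithin] with s hs using (hsl s hs).memLp_momentum_component hγ j
    · rw [(hsl t ht).momentum j ψ hψ]
      refine ((continuousOn_evolved h.time_pos (fun i => h.integrable_stress i j) hψ t
        ht).tendsto).congr' ?_
      filter_upwards [self_mem_nhdsWithin] with s hs using ((hsl s hs).momentum j ψ hψ).symm
  · filter_upwards [ae_all_iff.2 h0.2] with x hx
    ext j
    exact hx j

end IsRegular
end Representative

/-! ### Functions with increments bounded below -/

section OneSided

variable {T : ℝ} {K A β : ℝ → ℝ} {B : ℝ → ℝ → ℝ}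

/-- A function `K` whose increments from almost every time are bounded below by integrals of
`B t` has, between its Lebesgue points, increments given by the diagonal of `B`: forward
difference quotients bound them from below and backward ones from above. -/
lemma sub_eq_integral_of_increments (hK : IntegrableOn K (Ioo 0 T))
    (hinc : ∀ᵐ t ∂((volume : Measure ℝ).restrict (Ioo 0 T)), ∀ s ∈ Icc 0 T,
      K t + ∫ τ in t..s, B t τ ≤ K s)
    (hBi : ∀ a b : ℝ, 0 ≤ a → b ≤ T → ∀ h : ℝ,
      IntegrableOn (fun t => ∫ θ in (0 : ℝ)..1, B t (t + h * θ)) (Ioo a b))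
    (hB : ∀ a b : ℝ, 0 ≤ a → b ≤ T → Tendsto (fun h : ℝ => ∫ t in Ioo a b,
      ∫ θ in (0 : ℝ)..1, B t (t + h * θ)) (𝓝 0) (𝓝 (∫ t in Ioo a b, β t)))
    {a b : ℝ} (ha : 0 < a) (hab : a < b) (hb : b < T)
    (hda : HasDerivAt (fun x => ∫ τ in (0 : ℝ)..x, K τ) (K a) a)
    (hdb : HasDerivAt (fun x => ∫ τ in (0 : ℝ)..x, K τ) (K b) b) :
    K b - K a = ∫ t in a..b, β t := by
  have hT : 0 ≤ T := by linarith
  have ha' : a ∈ Icc 0 T := ⟨ha.le, by linarith⟩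
  have hb' : b ∈ Icc 0 T := ⟨by linarith, hb.le⟩
  have h0' : (0 : ℝ) ∈ Icc 0 T := ⟨le_rfl, hT⟩
  have hKi : ∀ {s t : ℝ}, s ∈ Icc 0 T → t ∈ Icc 0 T → IntervalIntegrable K volume s t :=
    fun hs ht => IntegrableOn.intervalIntegrable_of_mem hK hs ht
  set Φ : ℝ → ℝ := fun x => ∫ τ in (0 : ℝ)..x, K τ with hΦ
  set D : ℝ → ℝ := fun h => h⁻¹ * ((Φ (b + h) - Φ b) - (Φ (a + h) - Φ a)) with hD
  have hDlim : Tendsto D (𝓝[≠] 0) (𝓝 (K b - K a)) := by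
    have h1 := hasDerivAt_iff_tendsto_slope_zero.1 hdb
    have h2 := hasDerivAt_iff_tendsto_slope_zero.1 hda
    refine (h1.sub h2).congr fun h => ?_
    simp only [hD, smul_eq_mul]
    ring
  set Ψ : ℝ → ℝ := fun h => ∫ t in Ioo a b, ∫ θ in (0 : ℝ)..1, B t (t + h * θ) with hΨ
  have hΨlim : Tendsto Ψ (𝓝 0) (𝓝 (∫ t in Ioo a b, β t)) := hB a b ha.le hb.le
  have hsmall : ∀ᶠ h in 𝓝 (0 : ℝ), |h| < min a (T - b) := by
    have : Tendsto (fun h : ℝ => |h|) (𝓝 0) (𝓝 |0|) := continuous_abs.tendsto 0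
    rw [abs_zero] at this
    exact this.eventually (gt_mem_nhds (lt_min ha (by linarith)))
  have hmem : ∀ {h : ℝ}, |h| < min a (T - b) → ∀ {t : ℝ}, t ∈ Icc a b → t + h ∈ Icc 0 T := by
    intro h hh t ht
    have h1 := abs_lt.1 (hh.trans_le (min_le_left _ _))
    have h2 := abs_lt.1 (hh.trans_le (min_le_right _ _))
    constructor <;> linarith [ht.1, ht.2]
  -- the integrated increments bound `h` times the averaged pairings
  have key : ∀ {h : ℝ}, |h| < min a (T - b) → h * Ψ h ≤ (Φ (b + h) - Φ b) - (Φ (a + h) - Φ a) := by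
    intro h hh
    have hah : a + h ∈ Icc 0 T := hmem hh ⟨le_rfl, hab.le⟩
    have hbh : b + h ∈ Icc 0 T := hmem hh ⟨hab.le, le_rfl⟩
    have e1 : (Φ (b + h) - Φ b) - (Φ (a + h) - Φ a)
        = (∫ t in a..b, K (t + h)) - ∫ t in a..b, K t := by
      rw [intervalIntegral.integral_comp_add_right,
        ← intervalIntegral.integral_interval_sub_left (hKi h0' hbh) (hKi h0' hah),
        ← intervalIntegral.integral_interval_sub_left (hKi h0' hb') (hKi h0' ha')]
      ring
    have hKh : IntervalIntegrable (fun t => K (t + h)) volume a b := by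
      have := (hKi hah hbh).comp_add_right h
      simpa using this
    have hΨi := (hBi a b ha.le hb.le h).const_mul h
    have hΨii : IntervalIntegrable (fun t => h * ∫ θ in (0 : ℝ)..1, B t (t + h * θ)) volume a b := by
      rw [intervalIntegrable_iff_integrableOn_Ioo_of_le hab.le]
      exact hΨi
    rw [e1, ← intervalIntegral.integral_sub hKh (hKi ha' hb'), hΨ]
    simp only
    rw [← integral_const_mul, ← integral_Ioc_eq_integral_Ioo,
      ← intervalIntegral.integral_of_le hab.le]
    refine intervalIntegral.integral_mono_ae_restrict hab.le hΨii (hKh.sub (hKi ha' hb')) ?_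
    have h2 : ∀ᵐ t ∂((volume : Measure ℝ).restrict (Icc a b)), ∀ s ∈ Icc 0 T,
        K t + ∫ τ in t..s, B t τ ≤ K s :=
      ae_restrict_of_ae_restrict_of_subset (Icc_subset_Ioo ha hb) hinc
    filter_upwards [h2, ae_restrict_mem measurableSet_Icc] with t ht htI
    have h3 := ht (t + h) (hmem hh htI)
    have h4 := intervalIntegral.mul_integral_comp_add_mul (a := 0) (b := 1) (f := B t) h t
    rw [mul_zero, add_zero, mul_one] at h4
    rw [h4]
    linarith
  have hpos : ∀ᶠ h in 𝓝[>] (0 : ℝ), Ψ h ≤ D h := by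
    filter_upwards [nhdsWithin_le_nhds hsmall, self_mem_nhdsWithin] with h h1 h2
    have h2' : 0 < h := h2
    simp only [hD]
    rw [inv_mul_eq_div, le_div_iff₀ h2', mul_comm]
    exact key h1
  have hneg : ∀ᶠ h in 𝓝[<] (0 : ℝ), D h ≤ Ψ h := by
    filter_upwards [nhdsWithin_le_nhds hsmall, self_mem_nhdsWithin] with h h1 h2
    have h2' : h < 0 := h2
    simp only [hD]
    rw [inv_mul_eq_div, div_le_iff_of_neg h2', mul_comm]
    exact key h1
  rw [intervalIntegral.integral_of_le hab.le, integral_Ioc_eq_integral_Ioo]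
  refine le_antisymm ?_ ?_
  · exact le_of_tendsto_of_tendsto (b := 𝓝[<] (0 : ℝ)) (hDlim.mono_left
      (nhdsWithin_mono _ fun x hx => ne_of_lt hx)) (hΨlim.mono_left nhdsWithin_le_nhds) hneg
  · exact le_of_tendsto_of_tendsto (b := 𝓝[>] (0 : ℝ)) (hΨlim.mono_left nhdsWithin_le_nhds)
      (hDlim.mono_left (nhdsWithin_mono _ fun x hx => ne_of_gt hx)) hpos

/-- In every time interval there is an admissible time at which the pairing error is controlled. -/
lemma exists_mem_abs_integral_le (hA : IntegrableOn A (Ioo 0 T)) (hA0 : ∀ t, 0 ≤ A t)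
    (hBA : ∀ᵐ t ∂((volume : Measure ℝ).restrict (Ioo 0 T)),
      ∀ᵐ τ ∂((volume : Measure ℝ).restrict (Ioo 0 T)), |B t τ| ≤ A t + A τ)
    {P : ℝ → Prop} (hP : ∀ᵐ t ∂((volume : Measure ℝ).restrict (Ioo 0 T)), P t)
    {p q s : ℝ} (hp : 0 ≤ p) (hpq : p < q) (hq : q ≤ T) (hs : s ∈ Icc p q) :
    ∃ t ∈ Ioo p q, P t ∧ |∫ τ in t..s, B t τ| ≤ 2 * ∫ τ in p..q, A τ := by
  have hsub : Ioo p q ⊆ Ioo 0 T := Ioo_subset_Ioo hp hq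
  have hall := ((hBA.and hP).filter_mono (ae_mono (Measure.restrict_mono hsub le_rfl))).and
    (ae_restrict_mem (μ := (volume : Measure ℝ)) (measurableSet_Ioo (a := p) (b := q)))
  have hAi := hA.mono_set hsub
  have hne : (volume : Measure ℝ).restrict (Ioo p q) ≠ 0 := by
    rw [Ne, Measure.restrict_eq_zero, Real.volume_Ioo]
    simpa using hpq
  obtain ⟨t, ht, htA⟩ := exists_notMem_null_le_average hne hAi (ae_iff.1 hall)
  rw [notMem_ofPred_iff, not_not] at ht
  obtain ⟨⟨hBt, hPt⟩, htI⟩ := ht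
  refine ⟨t, htI, hPt, ?_⟩
  have hpT : p ∈ Icc 0 T := ⟨hp, by linarith⟩
  have hqT : q ∈ Icc 0 T := ⟨by linarith, hq⟩
  have htT : t ∈ Icc 0 T := Ioo_subset_Icc_self (hsub htI)
  have hsT : s ∈ Icc 0 T := ⟨hp.trans hs.1, hs.2.trans hq⟩
  have havg : (q - p) * A t ≤ ∫ τ in p..q, A τ := by
    rw [setAverage_eq, smul_eq_mul, Measure.real, Real.volume_Ioo,
      ENNReal.toReal_ofReal (by linarith), inv_mul_eq_div, le_div_iff₀ (by linarith)] at htA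
    rw [intervalIntegral.integral_of_le hpq.le, integral_Ioc_eq_integral_Ioo]
    linarith
  have h1 := abs_intervalIntegral_le_of_ae_le (T := T) (g := B t) (B := fun τ => A t + A τ)
    ((integrable_const _).add hA) hBt htT hsT
  refine h1.trans ?_
  have hii : IntervalIntegrable (fun τ => A t + A τ) volume p q :=
    IntegrableOn.intervalIntegrable_of_mem (T := T) ((integrable_const _).add hA) hpT hqT
  have h2 : |∫ τ in t..s, (A t + A τ)| ≤ |∫ τ in p..q, (A t + A τ)| := by
    refine intervalIntegral.abs_integral_mono_interval (uIoc_subset_uIoc_of_uIcc_subset_uIcc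
      (uIcc_subset_uIcc ?_ ?_)) (Eventually.of_forall fun τ => add_nonneg (hA0 _) (hA0 _)) hii
    · rw [uIcc_of_le hpq.le]; exact Ioo_subset_Icc_self htI
    · rwa [uIcc_of_le hpq.le]
  refine h2.trans ?_
  rw [abs_of_nonneg (intervalIntegral.integral_nonneg hpq.le fun τ _ => add_nonneg (hA0 _) (hA0 _)),
    intervalIntegral.integral_add intervalIntegrable_const
      (IntegrableOn.intervalIntegrable_of_mem hA hpT hqT), intervalIntegral.integral_const, smul_eq_mul]
  linarith

/-- A lower semicontinuous function whose increments from almost every time are bounded below by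
integrals of `B t` is a primitive of the diagonal of `B`. -/
lemma eq_add_integral_of_increments (hT : 0 < T) (hK : IntegrableOn K (Ioo 0 T))
    (hA : IntegrableOn A (Ioo 0 T)) (hA0 : ∀ t, 0 ≤ A t) (hβ : IntegrableOn β (Ioo 0 T))
    (hinc : ∀ᵐ t ∂((volume : Measure ℝ).restrict (Ioo 0 T)), ∀ s ∈ Icc 0 T,
      K t + ∫ τ in t..s, B t τ ≤ K s)
    (hBA : ∀ᵐ t ∂((volume : Measure ℝ).restrict (Ioo 0 T)),
      ∀ᵐ τ ∂((volume : Measure ℝ).restrict (Ioo 0 T)), |B t τ| ≤ A t + A τ)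
    (hBi : ∀ a b : ℝ, 0 ≤ a → b ≤ T → ∀ h : ℝ,
      IntegrableOn (fun t => ∫ θ in (0 : ℝ)..1, B t (t + h * θ)) (Ioo a b))
    (hB : ∀ a b : ℝ, 0 ≤ a → b ≤ T → Tendsto (fun h : ℝ => ∫ t in Ioo a b,
      ∫ θ in (0 : ℝ)..1, B t (t + h * θ)) (𝓝 0) (𝓝 (∫ t in Ioo a b, β t)))
    (hlsc : ∀ s ∈ Icc 0 T, ∀ t : ℕ → ℝ, (∀ n, t n ∈ Icc 0 T) → Tendsto t atTop (𝓝 s) → ∀ c,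
      Tendsto (fun n => K (t n)) atTop (𝓝 c) → K s ≤ c) {s t : ℝ} (hs : s ∈ Icc 0 T)
    (ht : t ∈ Icc 0 T) : K t = K s + ∫ τ in s..t, β τ := by
  have h0' : (0 : ℝ) ∈ Icc 0 T := ⟨le_rfl, hT.le⟩
  have hT' : T ∈ Icc 0 T := ⟨hT.le, le_rfl⟩
  have hβi : ∀ {s t : ℝ}, s ∈ Icc 0 T → t ∈ Icc 0 T → IntervalIntegrable β volume s t :=
    fun hs ht => IntegrableOn.intervalIntegrable_of_mem hβ hs ht
  have hLeb : ∀ᵐ t ∂((volume : Measure ℝ).restrict (Ioo 0 T)), t ∈ Ioo 0 T ∧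
      HasDerivAt (fun x => ∫ τ in (0 : ℝ)..x, K τ) (K t) t := by
    have h1 := (IntegrableOn.intervalIntegrable_of_mem hK h0' hT').ae_hasDerivAt_integral
    filter_upwards [ae_restrict_of_ae h1, ae_restrict_mem measurableSet_Ioo] with t h2 h3
    refine ⟨h3, h2 ?_ 0 ?_⟩
    · rw [uIcc_of_le hT.le]; exact Ioo_subset_Icc_self h3
    · rw [uIcc_of_le hT.le]; exact h0'
  have hgood : ∀ {a b : ℝ}, a ∈ Ioo 0 T → b ∈ Ioo 0 T →
      HasDerivAt (fun x => ∫ τ in (0 : ℝ)..x, K τ) (K a) a →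
      HasDerivAt (fun x => ∫ τ in (0 : ℝ)..x, K τ) (K b) b → K b - K a = ∫ t in a..b, β t := by
    intro a b ha hb hda hdb
    rcases lt_trichotomy a b with h | h | h
    · exact sub_eq_integral_of_increments hK hinc hBi hB ha.1 h hb.2 hda hdb
    · rw [h, sub_self, intervalIntegral.integral_same]
    · have := sub_eq_integral_of_increments hK hinc hBi hB hb.1 h ha.2 hdb hda
      rw [intervalIntegral.integral_symm, ← this]
      ring
  obtain ⟨t₀, -, ⟨ht₀, hd₀⟩, -⟩ := exists_mem_abs_integral_le hA hA0 hBA hLeb le_rfl hT le_rfl h0'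
  have ht₀' := Ioo_subset_Icc_self ht₀
  have hmain : ∀ s ∈ Icc 0 T, K s = K t₀ + ∫ τ in t₀..s, β τ := by
    intro s hs
    -- intervals shrinking to `s`
    set p : ℕ → ℝ := fun n => max 0 (s - 1 / (n + 1)) with hp
    set q : ℕ → ℝ := fun n => min T (s + 1 / (n + 1)) with hq
    have hpos : ∀ n : ℕ, (0 : ℝ) < 1 / (n + 1) := fun n => by positivity
    have hps : ∀ n, p n ≤ s := fun n => max_le hs.1 (by linarith [hpos n])
    have hsq : ∀ n, s ≤ q n := fun n => le_min hs.2 (by linarith [hpos n])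
    have hpq : ∀ n, p n < q n := fun n => by
      simp only [hp, hq, max_lt_iff, lt_min_iff]
      have := hpos n
      refine ⟨⟨hT, ?_⟩, ?_, ?_⟩ <;> linarith [hs.1, hs.2]
    have hplim : Tendsto p atTop (𝓝 s) := by
      have h1 := (tendsto_const_nhds (x := (0 : ℝ))).max
        ((tendsto_const_nhds (x := s)).sub tendsto_one_div_add_atTop_nhds_zero_nat)
      rwa [sub_zero, max_eq_right hs.1] at h1
    have hqlim : Tendsto q atTop (𝓝 s) := by
      have h1 := (tendsto_const_nhds (x := T)).min
        ((tendsto_const_nhds (x := s)).add tendsto_one_div_add_atTop_nhds_zero_nat)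
      rwa [add_zero, min_eq_right hs.2] at h1
    have hp0 : ∀ n, 0 ≤ p n := fun n => le_max_left _ _
    have hqT : ∀ n, q n ≤ T := fun n => min_le_left _ _
    have hpT : ∀ n, p n ∈ Icc 0 T := fun n => ⟨hp0 n, (hpq n).le.trans (hqT n)⟩
    have hqT' : ∀ n, q n ∈ Icc 0 T := fun n => ⟨(hp0 n).trans (hpq n).le, hqT n⟩
    choose t htI hPt hBt using fun n => exists_mem_abs_integral_le hA hA0 hBA (hLeb.and hinc)
      (hp0 n) (hpq n) (hqT n) ⟨hps n, hsq n⟩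
    have htT : ∀ n, t n ∈ Icc 0 T := fun n => Ioo_subset_Icc_self (hPt n).1.1
    have htlim : Tendsto t atTop (𝓝 s) := tendsto_of_tendsto_of_tendsto_of_le_of_le hplim hqlim
      (fun n => (htI n).1.le) (fun n => (htI n).2.le)
    have hKt : ∀ n, K (t n) = K t₀ + ∫ τ in t₀..t n, β τ := fun n => by
      linarith [hgood ht₀ (hPt n).1.1 hd₀ (hPt n).1.2]
    have hKlim : Tendsto (fun n => K (t n)) atTop (𝓝 (K t₀ + ∫ τ in t₀..s, β τ)) := by
      simp_rw [hKt]
      exact ((continuousOn_intervalIntegral hT hβ ht₀' s hs).tendsto.comp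
        (tendsto_nhdsWithin_iff.2 ⟨htlim, Eventually.of_forall htT⟩)).const_add _
    refine le_antisymm (hlsc s hs t htT htlim _ hKlim) ?_
    have hAlim : Tendsto (fun n => 2 * ∫ τ in p n..q n, A τ) atTop (𝓝 0) := by
      have h1 := (tendsto_intervalIntegral_zero hT hA hs hqT' hqlim).sub
        (tendsto_intervalIntegral_zero hT hA hs hpT hplim)
      have h2 := h1.const_mul 2
      rw [sub_zero, mul_zero] at h2
      refine h2.congr fun n => ?_
      rw [intervalIntegral.integral_interval_sub_left
        (IntegrableOn.intervalIntegrable_of_mem hA hs (hqT' n))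
        (IntegrableOn.intervalIntegrable_of_mem hA hs (hpT n))]
    refine le_of_tendsto (by simpa using hKlim.sub hAlim) (Eventually.of_forall fun n => ?_)
    have h1 := (hPt n).2 s hs
    have h2 := (abs_le.1 (hBt n)).1
    linarith
  rw [hmain s hs, hmain t ht, add_assoc,
    intervalIntegral.integral_add_adjacent_intervals (hβi ht₀' hs) (hβi hs ht)]

end OneSided

/-! ### Kinetic energy of slices -/

section Kinetic

variable {d : ℕ}

section SliceKinetic

variable {γ mu lam : ℝ} {r₀ : Torus d → ℝ} {v₀ : Torus d → Vel d}
    {r : ℝ → Torus d → ℝ} {v : ℝ → Torus d → Vel d} {G : ℝ → Torus d → Grad d}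
    {C s : ℝ} {ρ : Torus d → ℝ} {u : Torus d → Vel d}

namespace IsSlice

lemma integrable_component_sq (h : IsSlice γ mu lam r₀ v₀ r v G C s ρ u) (j : Fin d) :
    Integrable fun x => ρ x * u x j ^ 2 := by
  refine h.integrable_kinetic.mono'
    (h.measurable_density.mul ((measurable_component h.measurable_velocity j).pow 2)) ?_
  filter_upwards [h.nonneg] with x hx
  rw [Real.norm_of_nonneg (mul_nonneg hx (sq_nonneg _))]
  refine mul_le_mul_of_nonneg_left ?_ hx
  rw [← sq_abs]
  exact pow_le_pow_left₀ (abs_nonneg _) (PiLp.norm_apply_le (u x) j) 2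

/-- The kinetic energy as a Legendre transform: testing momentum and mass with `φ` and `|φ|² / 2`
falls short of the kinetic energy by the weighted distance from `φ` to the velocity. -/
lemma kinetic_eq (h : IsSlice γ mu lam r₀ v₀ r v G C s ρ u) (hγ : 1 < γ)
    {φ : Fin d → Torus d → ℝ} (hφ : ∀ j, IsSmooth (φ j)) :
    1 / 2 * ∫ x, ρ x * ‖u x‖ ^ 2 = (∑ j, momentumAt γ mu lam r₀ v₀ r v G j (φ j) s)
      - 1 / 2 * massAt r₀ r v (fun x => ∑ j, φ j x * φ j x) s
      + 1 / 2 * ∑ j, ∫ x, ρ x * (u x j - φ j x) ^ 2 := by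
  have hφ2 : IsSmooth fun x => ∑ j, φ j x * φ j x := IsSmooth.sum fun j _ => (hφ j).mul (hφ j)
  have i1 : ∀ j, Integrable fun x => ρ x * u x j * φ j x := fun j =>
    (hφ j).integrable_mul (h.integrable_momentum hγ j)
  have i2 : ∀ j, Integrable fun x => ρ x * (φ j x * φ j x) := fun j =>
    ((hφ j).mul (hφ j)).integrable_mul (h.integrable_density hγ)
  have i3 := fun j => h.integrable_component_sq j
  have e1 : ∀ j, ∫ x, ρ x * (u x j - φ j x) ^ 2 = (∫ x, ρ x * u x j ^ 2)
      - 2 * (∫ x, ρ x * u x j * φ j x) + ∫ x, ρ x * (φ j x * φ j x) := by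
    intro j
    have i4 : Integrable fun x => ρ x * u x j ^ 2 - 2 * (ρ x * u x j * φ j x) :=
      (i3 j).sub ((i1 j).const_mul 2)
    rw [← integral_const_mul, ← integral_sub (i3 j) ((i1 j).const_mul 2),
      ← integral_add i4 (i2 j)]
    refine integral_congr_ae (Eventually.of_forall fun x => ?_)
    simp only
    ring
  have e2 : ∫ x, ρ x * ‖u x‖ ^ 2 = ∑ j, ∫ x, ρ x * u x j ^ 2 := by
    rw [← integral_finsetSum _ fun j _ => i3 j]
    refine integral_congr_ae (Eventually.of_forall fun x => ?_)
    simp only [EuclideanSpace.norm_sq_eq, Finset.mul_sum, Real.norm_eq_abs, sq_abs]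
  have e3 : massAt r₀ r v (fun x => ∑ j, φ j x * φ j x) s
      = ∑ j, ∫ x, ρ x * (φ j x * φ j x) := by
    rw [← h.mass _ hφ2, ← integral_finsetSum _ fun j _ => i2 j]
    simp only [Finset.mul_sum]
  rw [e2, e3]
  simp_rw [← h.momentum _ _ (hφ _), e1]
  simp only [Finset.sum_add_distrib, Finset.sum_sub_distrib, ← Finset.mul_sum]
  ring

lemma defect_nonneg (h : IsSlice γ mu lam r₀ v₀ r v G C s ρ u) (φ : Fin d → Torus d → ℝ) :
    0 ≤ ∑ j, ∫ x, ρ x * (u x j - φ j x) ^ 2 :=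
  Finset.sum_nonneg fun j _ => integral_nonneg_of_ae (by
    filter_upwards [h.nonneg] with x hx using mul_nonneg hx (sq_nonneg _))

/-- Smooth fields are dense in the velocities of finite kinetic energy. -/
lemma exists_smooth_defect_le (h : IsSlice γ mu lam r₀ v₀ r v G C s ρ u) (hγ : 1 < γ)
    {ε : ℝ} (hε : 0 < ε) :
    ∃ φ : Fin d → Torus d → ℝ, (∀ j, IsSmooth (φ j)) ∧
      ∀ j, ∫ x, ρ x * (u x j - φ j x) ^ 2 ≤ ε := by
  set ν : Measure (Torus d) := volume.withDensity fun x => ENNReal.ofReal (ρ x) with hν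
  have hfin : IsFiniteMeasure ν := isFiniteMeasure_withDensity_ofReal (h.integrable_density hγ).2
  have hac : ν ≪ volume := withDensity_absolutelyContinuous _ _
  have key : ∀ j, ∃ φ, IsSmooth φ ∧ ∫ x, ρ x * (u x j - φ x) ^ 2 ≤ ε := by
    intro j
    have hum : AEStronglyMeasurable (fun x => u x j) ν :=
      (measurable_component h.measurable_velocity j).mono_ac hac
    have hmem : MemLp (fun x => u x j) 2 ν := by
      rw [memLp_two_iff_integrable_sq hum]
      exact (integrable_withDensity_ofReal_iff h.measurable_density h.nonneg).2
        (h.integrable_component_sq j)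
    obtain ⟨φ, hφ, hle⟩ := exists_isSmooth_eLpNorm_sub_le (ν := ν) (p := 2) (by norm_num)
      (by norm_num) hmem (ε := ENNReal.ofReal √ε) (by simpa using hε)
    refine ⟨φ, hφ, ?_⟩
    rw [← integral_withDensity_ofReal h.measurable_density h.nonneg (fun x => (u x j - φ x) ^ 2)]
    have hd : MemLp (fun x => u x j - φ x) 2 ν := hmem.sub (hφ.memLp ν 2)
    rw [hd.eLpNorm_eq_integral_rpow_norm (by norm_num) (by norm_num),
      ENNReal.ofReal_le_ofReal_iff (Real.sqrt_nonneg _), ENNReal.toReal_ofNat] at hle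
    have e : ∀ x, ‖u x j - φ x‖ ^ (2 : ℝ) = (u x j - φ x) ^ 2 := fun x => by
      rw [Real.rpow_two, Real.norm_eq_abs, sq_abs]
    simp_rw [e] at hle
    rw [show (2 : ℝ)⁻¹ = 1 / 2 by norm_num, ← Real.sqrt_eq_rpow] at hle
    exact (Real.sqrt_le_sqrt_iff hε.le).1 hle
  choose φ hφ hφε using key
  exact ⟨φ, hφ, hφε⟩

end IsSlice
end SliceKinetic

namespace IsRegular

variable {T γ mu lam : ℝ} {r₀ : Torus d → ℝ} {v₀ : Torus d → Vel d}
    {r : ℝ → Torus d → ℝ} {v : ℝ → Torus d → Vel d} {G : ℝ → Torus d → Grad d}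
    {k l a b c e : ℝ}

/-- The kinetic energy of the slices is lower semicontinuous in time, as a supremum of continuous
functions. -/
lemma kinetic_lsc (h : IsRegular T γ mu lam r₀ v₀ r v G k l a b c e) {C : ℝ}
    {r' : ℝ → Torus d → ℝ} {v' : ℝ → Torus d → Vel d}
    (hsl : ∀ s ∈ Icc 0 T, IsSlice γ mu lam r₀ v₀ r v G C s (r' s) (v' s)) {s : ℝ}
    (hs : s ∈ Icc 0 T) {t : ℕ → ℝ} (ht : ∀ n, t n ∈ Icc 0 T) (hts : Tendsto t atTop (𝓝 s))
    {K : ℝ} (hK : Tendsto (fun n => 1 / 2 * ∫ x, r' (t n) x * ‖v' (t n) x‖ ^ 2) atTop (𝓝 K)) :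
    1 / 2 * ∫ x, r' s x * ‖v' s x‖ ^ 2 ≤ K := by
  have hγ := h.one_lt_gamma
  refine le_of_forall_pos_le_add fun ε hε => ?_
  have hd : (0 : ℝ) < d + 1 := by positivity
  obtain ⟨φ, hφ, hφε⟩ := (hsl s hs).exists_smooth_defect_le hγ (div_pos hε hd)
  have hφ2 : IsSmooth fun x => ∑ j, φ j x * φ j x := IsSmooth.sum fun j _ => (hφ j).mul (hφ j)
  have h1 : Tendsto (fun n => (∑ j, momentumAt γ mu lam r₀ v₀ r v G j (φ j) (t n))
      - 1 / 2 * massAt r₀ r v (fun x => ∑ j, φ j x * φ j x) (t n)) atTop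
      (𝓝 ((∑ j, momentumAt γ mu lam r₀ v₀ r v G j (φ j) s)
      - 1 / 2 * massAt r₀ r v (fun x => ∑ j, φ j x * φ j x) s)) :=
    (tendsto_finsetSum _ fun j _ => h.tendsto_momentumAt j (hφ j) hs ht hts).sub
      ((h.tendsto_massAt hφ2 hs ht hts).const_mul _)
  have h2 := le_of_tendsto_of_tendsto h1 hK (Eventually.of_forall fun n => by
    have := (hsl (t n) (ht n)).kinetic_eq hγ hφ
    have := (hsl (t n) (ht n)).defect_nonneg φ
    simp only
    linarith)
  have h3 : ∑ j, ∫ x, r' s x * (v' s x j - φ j x) ^ 2 ≤ ε := by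
    calc ∑ j, ∫ x, r' s x * (v' s x j - φ j x) ^ 2 ≤ ∑ _j : Fin d, ε / (d + 1) :=
          Finset.sum_le_sum fun j _ => hφε j
      _ = d * (ε / (d + 1)) := by simp
      _ ≤ ε := by rw [mul_div_assoc', div_le_iff₀ hd]; nlinarith
  have h4 := (hsl s hs).kinetic_eq hγ hφ
  linarith

end IsRegular

section Flux

variable {T : ℝ} {u₀ : Torus d → ℝ} {f : Fin d → ℝ → Torus d → ℝ} {φ : Torus d → ℝ}

lemma evolved_sub (hf : ∀ i, Integrable (fun z : ℝ × Torus d => f i z.1 z.2) (slab d T))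
    (hφ : IsSmooth φ) {s t : ℝ} (hs : s ∈ Icc 0 T) (ht : t ∈ Icc 0 T) :
    evolved u₀ f φ s - evolved u₀ f φ t = ∑ i, ∫ τ in t..s, ∫ x, f i τ x * pd i φ x := by
  have h0 : (0 : ℝ) ∈ Icc 0 T := ⟨le_rfl, hs.1.trans hs.2⟩
  have hw := integrableOn_weakFlux (integrable_slab_zero T) hf hφ
  have hfi := fun i => integrable_slab_mul (hf i) (hφ.pd i)
  have hii : ∀ i, IntervalIntegrable (fun τ => ∫ x, f i τ x * pd i φ x) volume t s := fun i =>
    IntegrableOn.intervalIntegrable_of_mem (integrableOn_integral_slice (hfi i)) ht hs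
  unfold evolved
  rw [add_sub_add_left_eq_sub, intervalIntegral.integral_interval_sub_left
    (IntegrableOn.intervalIntegrable_of_mem hw h0 hs)
    (IntegrableOn.intervalIntegrable_of_mem hw h0 ht),
    ← intervalIntegral.integral_finsetSum fun i _ => hii i]
  refine intervalIntegral_congr_ae_of_mem ?_ ht hs
  filter_upwards [ae_all_iff.2 fun i => ae_integrable_slice
    (f := fun τ x => f i τ x * pd i φ x) (hfi i)] with τ hτ
  simp only [weakFlux, Pi.zero_apply, zero_mul, zero_add]
  rw [integral_finsetSum _ fun i _ => hτ i]

end Flux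

/-- Products of Fejér means converge at the Hölder exponent. -/
lemma tendsto_eLpNorm_fejer_mul_sub {p p₁ p₂ : ℝ} (hp : 1 ≤ p) (hp₁ : 1 ≤ p₁) (hp₂ : 1 ≤ p₂)
    (h : 1 / p = 1 / p₁ + 1 / p₂) {f g : Torus d → ℝ} (hf : MemLp f (ENNReal.ofReal p₁))
    (hg : MemLp g (ENNReal.ofReal p₂)) :
    (∀ N, MemLp (fun x => fejer N f x * fejer N g x) (ENNReal.ofReal p)) ∧
    Tendsto (fun N => eLpNorm (fun x => fejer N f x * fejer N g x - f x * g x)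
      (ENNReal.ofReal p) volume) atTop (𝓝 0) := by
  have q₁ : (1 : ℝ≥0∞) ≤ ENNReal.ofReal p₁ := ENNReal.one_le_ofReal.2 hp₁
  have q₂ : (1 : ℝ≥0∞) ≤ ENNReal.ofReal p₂ := ENNReal.one_le_ofReal.2 hp₂
  have hfi := hf.integrable q₁
  have hgi := hg.integrable q₂
  have hsf := isSmooth_fejer hfi
  have hsg := isSmooth_fejer hgi
  refine ⟨fun N => ((hsf N).mul (hsg N)).memLp volume _, ?_⟩
  have h1 := tendsto_eLpNorm_fejer_sub q₁ ENNReal.ofReal_ne_top hf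
  have h2 := tendsto_eLpNorm_fejer_sub q₂ ENNReal.ofReal_ne_top hg
  have h3 : Tendsto (fun N => eLpNorm (fun x => fejer N f x - f x) (ENNReal.ofReal p₁) volume
      * eLpNorm g (ENNReal.ofReal p₂) volume
      + eLpNorm f (ENNReal.ofReal p₁) volume
      * eLpNorm (fun x => fejer N g x - g x) (ENNReal.ofReal p₂) volume) atTop (𝓝 0) := by
    have := (ENNReal.Tendsto.mul_const h1 (Or.inr hg.2.ne)).add
      (ENNReal.Tendsto.const_mul h2 (Or.inr hf.2.ne))
    simpa using this
  refine tendsto_of_tendsto_of_tendsto_of_le_of_le tendsto_const_nhds h3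
    (fun N => zero_le) fun N => ?_
  have m1 : AEStronglyMeasurable fun x => fejer N f x - f x :=
    ((hsf N).aestronglyMeasurable _).sub hf.1
  have m2 : AEStronglyMeasurable fun x => fejer N g x - g x :=
    ((hsg N).aestronglyMeasurable _).sub hg.1
  have e : (fun x => fejer N f x * fejer N g x - f x * g x)
      = (fun x => (fejer N f x - f x) * fejer N g x) + fun x => f x * (fejer N g x - g x) := by
    funext x
    simp only [Pi.add_apply]
    ring
  rw [e]
  refine (eLpNorm_add_le (m1.mul ((hsg N).aestronglyMeasurable _)) (hf.1.mul m2)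
    (ENNReal.one_le_ofReal.2 hp)).trans (add_le_add ?_ ?_)
  · refine (eLpNorm_real_mul_le m1 ((hsg N).aestronglyMeasurable _) (by linarith)
      (by linarith) (by linarith) h).trans ?_
    gcongr
    exact eLpNorm_fejer_le q₂ ENNReal.ofReal_ne_top hg.1 N
  · exact eLpNorm_real_mul_le hf.1 m2 (by linarith) (by linarith) (by linarith) h

end Kinetic

/-! ### Increments of the kinetic energy -/

section Increment

variable {d : ℕ}

/-- The weighted distance from a function to its Fejér means tends to zero. -/
lemma tendsto_defect_fejer {p q b l : ℝ} (hpq : p.HolderConjugate q) (hb : 1 ≤ b) (hl : 0 < l)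
    (hpb : p ≤ b) (hq : 1 / q = 1 / l + 1 / b) {ρ w : Torus d → ℝ}
    (hρ : MemLp ρ (ENNReal.ofReal l)) (hw : MemLp w (ENNReal.ofReal b)) :
    Tendsto (fun N => ∫ x, ρ x * (w x - fejer N w x) ^ 2) atTop (𝓝 0) := by
  have hb1 : (1 : ℝ≥0∞) ≤ ENNReal.ofReal b := ENNReal.one_le_ofReal.2 hb
  have hsm := isSmooth_fejer (hw.integrable hb1)
  set δ : ℕ → ℝ≥0∞ := fun N => eLpNorm (fun x => fejer N w x - w x) (ENNReal.ofReal b) volume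
    with hδ
  have hδlim : Tendsto δ atTop (𝓝 0) := tendsto_eLpNorm_fejer_sub hb1 ENNReal.ofReal_ne_top hw
  have hlim : Tendsto (fun N => (δ N * (eLpNorm ρ (ENNReal.ofReal l) volume * δ N)).toReal) atTop
      (𝓝 0) := by
    have h1 := ENNReal.Tendsto.mul hδlim (Or.inr (by simp))
      (ENNReal.Tendsto.const_mul hδlim (Or.inr hρ.2.ne)) (Or.inr (by simp))
    rw [mul_zero, mul_zero] at h1
    exact (ENNReal.tendsto_toReal ENNReal.zero_ne_top).comp h1
  refine squeeze_zero_norm (fun N => ?_) hlim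
  have hdm : MemLp (fun x => fejer N w x - w x) (ENNReal.ofReal b) :=
    ((hsm N).memLp volume _).sub hw
  have h1 : MemLp (fun x => fejer N w x - w x) (ENNReal.ofReal p) :=
    hdm.mono_exponent (ENNReal.ofReal_le_ofReal hpb)
  have h2 := eLpNorm_real_mul_le hρ.1 hdm.1 hpq.symm.pos hl (by linarith) hq
  have h3 : MemLp (fun x => ρ x * (fejer N w x - w x)) (ENNReal.ofReal q) :=
    ⟨hρ.1.mul hdm.1, h2.trans_lt (ENNReal.mul_lt_top hρ.2 hdm.2)⟩
  have h4 := (abs_integral_mul_le_eLpNorm hpq h1 h3).2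
  have e : ∫ x, ρ x * (w x - fejer N w x) ^ 2
      = ∫ x, (fejer N w x - w x) * (ρ x * (fejer N w x - w x)) :=
    integral_congr_ae (Eventually.of_forall fun x => by ring)
  rw [e, Real.norm_eq_abs]
  refine h4.trans (ENNReal.toReal_mono ?_ (mul_le_mul' ?_ h2))
  · exact ENNReal.mul_ne_top hdm.2.ne (ENNReal.mul_ne_top hρ.2.ne hdm.2.ne)
  · exact eLpNorm_le_eLpNorm_of_exponent_le (ENNReal.ofReal_le_ofReal hpb) hdm.1

/-- The rate of change, due to the fluxes at time `τ`, of the lower bound for the kinetic energy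
obtained by testing with the velocity at time `t`. -/
noncomputable def energyTransfer (T γ mu lam : ℝ) (r : ℝ → Torus d → ℝ) (v : ℝ → Torus d → Vel d)
    (G : ℝ → Torus d → Grad d) (t τ : ℝ) : ℝ :=
  ∑ i, ∑ j, ((∫ x, G t x (j, i) * timeExt (Ioo 0 T)
      (fun t x => stress γ mu lam (r t x) (v t x) (G t x) i j) (τ, x))
    - ∫ x, v t x j * G t x (j, i) * timeExt (Ioo 0 T) (fun t x => r t x * v t x i) (τ, x))

namespace IsRegular

variable {T γ mu lam : ℝ} {r₀ : Torus d → ℝ} {v₀ : Torus d → Vel d}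
    {r : ℝ → Torus d → ℝ} {v : ℝ → Torus d → Vel d} {G : ℝ → Torus d → Grad d}
    {k l a b c e : ℝ}

lemma ae_weakDeriv (h : IsRegular T γ mu lam r₀ v₀ r v G k l a b c e) :
    ∀ᵐ t ∂((volume : Measure ℝ).restrict (Ioo 0 T)), ∀ i j m,
      ∫ x, v t x j * pd i (trig m) x = -∫ x, G t x (j, i) * trig m x := by
  refine ae_all_iff.2 fun i => ae_all_iff.2 fun j => ?_
  exact ae_weakDeriv_slice (f := fun t x => v t x j) (g := fun t x => G t x (j, i))
    (h.integrable_velocity j) (h.integrable_gradient (j, i))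
    fun ψ hψ => h.sol.weakGrad.2.2 ψ hψ j i

lemma pairing_space_le (h : IsRegular T γ mu lam r₀ v₀ r v G k l a b c e) :
    (1 / b + 1 / e)⁻¹ ≤ b := by
  have h1 := h.two_le_e
  have h3 := h.four_le_b
  rw [inv_le_comm₀ (by positivity) (by positivity), ← one_div]
  have : 0 < 1 / e := by positivity
  linarith

/-- Increments of the kinetic energy from almost every time are bounded below: the momentum and
continuity equations are tested with Fejér means of the velocity at that time. -/
lemma ae_kinetic_increment (h : IsRegular T γ mu lam r₀ v₀ r v G k l a b c e) {C : ℝ}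
    {r' : ℝ → Torus d → ℝ} {v' : ℝ → Torus d → Vel d}
    (hae : ∀ᵐ t ∂((volume : Measure ℝ).restrict (Ioo 0 T)), r' t = r t ∧ v' t = v t)
    (hsl : ∀ s ∈ Icc 0 T, IsSlice γ mu lam r₀ v₀ r v G C s (r' s) (v' s)) :
    ∀ᵐ t ∂((volume : Measure ℝ).restrict (Ioo 0 T)), ∀ s ∈ Icc 0 T,
      (1 / 2 * ∫ x, r' t x * ‖v' t x‖ ^ 2) + ∫ τ in t..s, energyTransfer T γ mu lam r v G t τ
        ≤ 1 / 2 * ∫ x, r' s x * ‖v' s x‖ ^ 2 := by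
  have hγ := h.one_lt_gamma
  have hk := h.two_le_k
  have hl := h.two_le_l
  have hb := h.four_le_b
  have he := h.two_le_e
  filter_upwards [hae, h.ae_weakDeriv, h.density.ae_memLp (by linarith) (by linarith),
    ae_all_iff.2 fun j => (h.memLpLq_velocity j).ae_memLp (by linarith [h.four_le_a])
      (by linarith),
    ae_all_iff.2 fun ij => (h.memLpLq_gradient ij).ae_memLp (by linarith [h.two_le_c])
      (by linarith),
    ae_restrict_mem measurableSet_Ioo] with t h1 h2 h3 h4 h5 h6 s hs
  have htI := Ioo_subset_Icc_self h6
  have hslt := hsl t htI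
  set φ : ℕ → Fin d → Torus d → ℝ := fun N j => fejer N fun x => v t x j with hφ
  have hvi : ∀ j, Integrable fun x => v t x j := fun j =>
    (h4 j).integrable (ENNReal.one_le_ofReal.2 (by linarith))
  have hGi : ∀ ij, Integrable fun x => G t x ij := fun ij =>
    (h5 ij).integrable (ENNReal.one_le_ofReal.2 (by linarith))
  have hφs : ∀ N j, IsSmooth (φ N j) := fun N j => isSmooth_fejer (hvi j) N
  have hpd : ∀ N i j x, pd i (φ N j) x = fejer N (fun x => G t x (j, i)) x := fun N i j x =>
    pd_fejer (hvi j) (hGi (j, i)) i (h2 i j) N x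
  have hprod := fun i j => tendsto_eLpNorm_fejer_mul_sub (p := (1 / b + 1 / e)⁻¹)
    h.conj_space.lt.le (by linarith) (by linarith) (by simp) (h4 j) (h5 (j, i))
  have hvG : ∀ j ij, MemLp (fun x => v t x j * G t x ij) (ENNReal.ofReal (1 / b + 1 / e)⁻¹) :=
    fun j ij => ⟨(h4 j).1.mul (h5 ij).1, (eLpNorm_real_mul_le (h4 j).1 (h5 ij).1
      h.conj_space.pos (by linarith) (by linarith) (by simp)).trans_lt
      (ENNReal.mul_lt_top (h4 j).2 (h5 ij).2)⟩
  -- the balance for a fixed Fejér mean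
  set X : ℕ → ℝ := fun N => ∑ j, ∑ i, ∫ τ in t..s, ∫ x,
    stress γ mu lam (r τ x) (v τ x) (G τ x) i j * fejer N (fun x => G t x (j, i)) x with hX
  set Y : ℕ → ℝ := fun N => ∑ i, ∑ j, ∫ τ in t..s, ∫ x,
    r τ x * v τ x i * (fejer N (fun x => v t x j) x * fejer N (fun x => G t x (j, i)) x) with hY
  have hfin : ∀ N, (1 / 2 * ∫ x, r' t x * ‖v' t x‖ ^ 2)
      - 1 / 2 * (∑ j, ∫ x, r' t x * (v' t x j - φ N j x) ^ 2) + (X N - Y N)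
      ≤ 1 / 2 * ∫ x, r' s x * ‖v' s x‖ ^ 2 := by
    intro N
    have hφ2 : IsSmooth fun x => ∑ j, φ N j x * φ N j x :=
      IsSmooth.sum fun j _ => (hφs N j).mul (hφs N j)
    have k1 := hslt.kinetic_eq hγ (hφs N)
    have k2 := (hsl s hs).kinetic_eq hγ (hφs N)
    have k3 := (hsl s hs).defect_nonneg (φ N)
    have k4 : (∑ j, momentumAt γ mu lam r₀ v₀ r v G j (φ N j) s)
        - ∑ j, momentumAt γ mu lam r₀ v₀ r v G j (φ N j) t = X N := by
      rw [← Finset.sum_sub_distrib]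
      refine Finset.sum_congr rfl fun j _ => ?_
      refine (evolved_sub (fun i => h.integrable_stress i j) (hφs N j) hs htI).trans ?_
      simp only [hpd]
    have k5 : massAt r₀ r v (fun x => ∑ j, φ N j x * φ N j x) s
        - massAt r₀ r v (fun x => ∑ j, φ N j x * φ N j x) t = 2 * Y N := by
      refine (evolved_sub h.integrable_momentum hφ2 hs htI).trans ?_
      rw [hY, Finset.mul_sum]
      refine Finset.sum_congr rfl fun i _ => ?_
      have e1 : ∀ x, pd i (fun x => ∑ j, φ N j x * φ N j x) x = ∑ j, 2 *
          (fejer N (fun x => v t x j) x * fejer N (fun x => G t x (j, i)) x) := fun x => by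
        rw [pd_sum fun j _ => (hφs N j).mul (hφs N j)]
        refine Finset.sum_congr rfl fun j _ => ?_
        rw [pd_mul (hφs N j) (hφs N j), hpd]
        simp only [hφ]
        ring
      have hsm : ∀ j, IsSmooth fun x =>
          fejer N (fun x => v t x j) x * fejer N (fun x => G t x (j, i)) x := fun j =>
        (isSmooth_fejer (hvi j) N).mul (isSmooth_fejer (hGi (j, i)) N)
      have i1 := fun j => integrable_slab_mul
        (f := fun τ x => r τ x * v τ x i) (h.integrable_momentum i) (hsm j)
      have i2 : ∀ j, IntervalIntegrable (fun τ => ∫ x, r τ x * v τ x i *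
          (fejer N (fun x => v t x j) x * fejer N (fun x => G t x (j, i)) x)) volume t s :=
        fun j => IntegrableOn.intervalIntegrable_of_mem (integrableOn_integral_slice (i1 j)) htI hs
      rw [← intervalIntegral.integral_finsetSum fun j _ => i2 j,
        ← intervalIntegral.integral_const_mul]
      refine intervalIntegral_congr_ae_of_mem ?_ htI hs
      filter_upwards [ae_all_iff.2 fun j => ae_integrable_slice (f := fun τ x => r τ x * v τ x i *
        (fejer N (fun x => v t x j) x * fejer N (fun x => G t x (j, i)) x)) (i1 j)] with τ hτ
      rw [← integral_finsetSum _ fun j _ => hτ j, ← integral_const_mul]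
      refine integral_congr_ae (Eventually.of_forall fun x => ?_)
      simp only [e1, Finset.mul_sum]
      exact Finset.sum_congr rfl fun j _ => by ring
    linarith
  have hXlim : Tendsto X atTop (𝓝 (∑ j, ∑ i, ∫ τ in t..s, ∫ x,
      stress γ mu lam (r τ x) (v τ x) (G τ x) i j * G t x (j, i))) := by
    refine tendsto_finsetSum _ fun j _ => tendsto_finsetSum _ fun i _ => ?_
    exact tendsto_integral_pairing h.conj_c h.conj_e (h.memLpLq_stress i j)
      (fun N => (isSmooth_fejer (hGi (j, i)) N).memLp volume _) (h5 (j, i))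
      (tendsto_eLpNorm_fejer_sub (ENNReal.one_le_ofReal.2 (by linarith)) ENNReal.ofReal_ne_top
        (h5 (j, i))) htI hs
  have hYlim : Tendsto Y atTop (𝓝 (∑ i, ∑ j, ∫ τ in t..s, ∫ x,
      r τ x * v τ x i * (v t x j * G t x (j, i)))) := by
    refine tendsto_finsetSum _ fun i _ => tendsto_finsetSum _ fun j _ => ?_
    exact tendsto_integral_pairing h.conj_time h.conj_space (h.memLpLq_momentum i) (hprod i j).1
      (hvG j (j, i)) (hprod i j).2 htI hs
  have hDlim : Tendsto (fun N => ∑ j, ∫ x, r' t x * (v' t x j - φ N j x) ^ 2) atTop (𝓝 0) := by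
    rw [h1.1, h1.2, ← Finset.sum_const_zero (s := (Finset.univ : Finset (Fin d)))]
    exact tendsto_finsetSum _ fun j _ => tendsto_defect_fejer h.conj_space (by linarith)
      (by linarith) h.pairing_space_le (by simp) h3 (h4 j)
  have hlim := le_of_tendsto (((hDlim.const_mul (1 / 2)).const_sub _).add (hXlim.sub hYlim))
    (Eventually.of_forall hfin)
  rw [mul_zero, sub_zero] at hlim
  refine le_trans (le_of_eq ?_) hlim
  congr 1
  have hS : ∀ i j, IntervalIntegrable (fun τ => ∫ x,
      stress γ mu lam (r τ x) (v τ x) (G τ x) i j * G t x (j, i)) volume t s := fun i j =>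
    IntegrableOn.intervalIntegrable_of_mem (integrableOn_integral_slice
      (H := fun τ x => stress γ mu lam (r τ x) (v τ x) (G τ x) i j * G t x (j, i))
      ((h.memLpLq_stress i j).integrable_mul h.conj_c.symm h.conj_e.symm
        (memLpLq_const_time (h5 (j, i)) (ENNReal.ofReal c)))) htI hs
  have hM : ∀ i j, IntervalIntegrable (fun τ => ∫ x,
      r τ x * v τ x i * (v t x j * G t x (j, i))) volume t s := fun i j =>
    IntegrableOn.intervalIntegrable_of_mem (integrableOn_integral_slice
      (H := fun τ x => r τ x * v τ x i * (v t x j * G t x (j, i)))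
      ((h.memLpLq_momentum i).integrable_mul h.conj_time.symm h.conj_space.symm
        (memLpLq_const_time (hvG j (j, i)) (ENNReal.ofReal (1 / a + 1 / c)⁻¹)))) htI hs
  rw [Finset.sum_comm, ← Finset.sum_sub_distrib]
  simp_rw [← Finset.sum_sub_distrib]
  rw [Finset.sum_congr rfl fun i _ => Finset.sum_congr rfl fun j _ =>
    (intervalIntegral.integral_sub (hS i j) (hM i j)).symm]
  rw [Finset.sum_congr rfl fun i _ => (intervalIntegral.integral_finsetSum
    fun j _ => (hS i j).sub (hM i j)).symm]
  have hI : ∀ i, IntervalIntegrable (fun τ => ∑ j,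
      ((∫ x, stress γ mu lam (r τ x) (v τ x) (G τ x) i j * G t x (j, i))
        - ∫ x, r τ x * v τ x i * (v t x j * G t x (j, i)))) volume t s := fun i => by
    rw [intervalIntegrable_iff]
    exact integrable_finsetSum _ fun j _ => intervalIntegrable_iff.1 ((hS i j).sub (hM i j))
  rw [← intervalIntegral.integral_finsetSum fun i _ => hI i]
  refine intervalIntegral_congr_ae_of_mem ?_ htI hs
  filter_upwards [ae_restrict_mem measurableSet_Ioo] with τ hτ
  simp only [energyTransfer, timeExt_of_mem _ hτ]
  refine Finset.sum_congr rfl fun i _ => Finset.sum_congr rfl fun j _ => ?_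
  congr 1 <;> exact integral_congr_ae (Eventually.of_forall fun x => mul_comm _ _)

end IsRegular
end Increment

/-! ### Balance of kinetic energy and energy equality -/

section KineticBalance

variable {d : ℕ}

lemma ae_intervalIntegrable_pairing {T p q p' q' : ℝ} (hp : p.HolderConjugate p')
    (hq : q.HolderConjugate q') {f F : ℝ → Torus d → ℝ}
    (hf : MemLpLq T (ENNReal.ofReal p) (ENNReal.ofReal q) f)
    (hF : MemLpLq T (ENNReal.ofReal p') (ENNReal.ofReal q') F) (h : ℝ) :
    ∀ᵐ t ∂((volume : Measure ℝ).restrict (Ioo 0 T)), IntervalIntegrable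
      (fun θ => ∫ x, f t x * timeExt (Ioo 0 T) F (t + h * θ, x)) volume 0 1 := by
  filter_upwards [ae_restrict_of_ae (integrable_integral_shiftPairing hp hq hf hF h).prod_left_ae,
    ae_restrict_mem measurableSet_Ioo] with t h1 h2
  rw [intervalIntegrable_iff_integrableOn_Ioc_of_le zero_le_one]
  simp only [shiftPairing, timeExt_of_mem _ h2, timeShift] at h1
  exact h1

/-- At equal times, the energy transfer is the work of the pressure minus the dissipation. -/
lemma sum_stress_mul_gradient (γ mu lam ρ : ℝ) (u : Vel d) (A : Grad d) :
    ∑ i, ∑ j, (A (j, i) * stress γ mu lam ρ u A i j - u j * A (j, i) * (ρ * u i))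
      = ρ ^ γ * divg A - (mu * ‖A‖ ^ 2 + (mu + lam) * divg A ^ 2) := by
  have h1 : ∀ i j, A (j, i) * stress γ mu lam ρ u A i j - u j * A (j, i) * (ρ * u i)
      = -mu * A (j, i) ^ 2
        + if i = j then (ρ ^ γ - (mu + lam) * divg A) * A (j, i) else 0 := fun i j => by
    unfold stress
    split_ifs <;> ring
  have h2 : ‖A‖ ^ 2 = ∑ i, ∑ j, A (j, i) ^ 2 := by
    rw [EuclideanSpace.norm_sq_eq, Fintype.sum_prod_type, Finset.sum_comm]
    simp only [Real.norm_eq_abs, sq_abs]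
  simp only [h1, Finset.sum_add_distrib, Finset.sum_ite_eq, Finset.mem_univ, if_true,
    ← Finset.mul_sum]
  rw [h2]
  unfold divg
  ring

namespace IsRegular

variable {T γ mu lam : ℝ} {r₀ : Torus d → ℝ} {v₀ : Torus d → Vel d}
    {r : ℝ → Torus d → ℝ} {v : ℝ → Torus d → Vel d} {G : ℝ → Torus d → Grad d}
    {k l a b c e : ℝ}

lemma ae_abs_energyTransfer_le (h : IsRegular T γ mu lam r₀ v₀ r v G k l a b c e) :
    ∃ A : ℝ → ℝ, IntegrableOn A (Ioo 0 T) ∧ (∀ t, 0 ≤ A t) ∧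
      ∀ᵐ t ∂((volume : Measure ℝ).restrict (Ioo 0 T)),
        ∀ᵐ τ ∂((volume : Measure ℝ).restrict (Ioo 0 T)),
          |energyTransfer T γ mu lam r v G t τ| ≤ A t + A τ := by
  have hc := h.two_le_c
  have he := h.two_le_e
  choose A₁ hA₁ hA₁0 hA₁le using fun i j => exists_pairing_bound h.conj_c h.conj_e
    (h.memLpLq_gradient (j, i)) (h.memLpLq_stress i j)
  choose A₂ hA₂ hA₂0 hA₂le using fun i j => exists_pairing_bound h.conj_time h.conj_space
    (h.memLpLq_velocity_mul_gradient j (j, i)) (h.memLpLq_momentum i)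
  refine ⟨fun t => ∑ i, ∑ j, (A₁ i j t + A₂ i j t), ?_, fun t => Finset.sum_nonneg fun i _ =>
    Finset.sum_nonneg fun j _ => add_nonneg (hA₁0 i j t) (hA₂0 i j t), ?_⟩
  · exact integrable_finsetSum _ fun i _ => integrable_finsetSum _ fun j _ =>
      (hA₁ i j).add (hA₂ i j)
  have m1 := ae_all_iff.2 fun ij => (h.memLpLq_gradient ij).ae_memLp (by linarith) (by linarith)
  have m2 := ae_all_iff.2 fun i => ae_all_iff.2 fun j => (h.memLpLq_stress i j).ae_memLp
    h.conj_c.symm.pos h.conj_e.symm.pos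
  have m3 := ae_all_iff.2 fun j => ae_all_iff.2 fun ij => (h.memLpLq_velocity_mul_gradient j
    ij).ae_memLp h.conj_time.pos h.conj_space.pos
  have m4 := ae_all_iff.2 fun i => (h.memLpLq_momentum i).ae_memLp
    h.conj_time.symm.pos h.conj_space.symm.pos
  filter_upwards [m1, m3] with t h1 h3
  filter_upwards [m2, m4, ae_restrict_mem measurableSet_Ioo] with τ h2 h4 hτ
  simp only [energyTransfer, timeExt_of_mem _ hτ, ← Finset.sum_add_distrib]
  refine (Finset.abs_sum_le_sum_abs _ _).trans (Finset.sum_le_sum fun i _ =>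
    (Finset.abs_sum_le_sum_abs _ _).trans (Finset.sum_le_sum fun j _ => ?_))
  have k1 := abs_integral_le_integral_abs.trans (hA₁le i j t τ (h1 (j, i)) (h2 i j)).2
  have k2 := abs_integral_le_integral_abs.trans (hA₂le i j t τ (h3 j (j, i)) (h4 i)).2
  refine (abs_sub _ _).trans ?_
  linarith

/-- The rate of change of the kinetic energy. -/
lemma integral_pairing_diag (h : IsRegular T γ mu lam r₀ v₀ r v G k l a b c e) :
    ∀ᵐ t ∂((volume : Measure ℝ).restrict (Ioo 0 T)),
      ∑ i, ∑ j, ((∫ x, G t x (j, i) * stress γ mu lam (r t x) (v t x) (G t x) i j)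
        - ∫ x, v t x j * G t x (j, i) * (r t x * v t x i))
      = ∫ x, (r t x ^ γ * divg (G t x)
        - (mu * ‖G t x‖ ^ 2 + (mu + lam) * divg (G t x) ^ 2)) := by
  have h1 := ae_all_iff.2 fun i => ae_all_iff.2 fun j => ae_integrable_slice
    (f := fun t x => G t x (j, i) * stress γ mu lam (r t x) (v t x) (G t x) i j)
    ((h.memLpLq_gradient (j, i)).integrable_mul h.conj_c h.conj_e (h.memLpLq_stress i j))
  have h2 := ae_all_iff.2 fun i => ae_all_iff.2 fun j => ae_integrable_slice
    (f := fun t x => v t x j * G t x (j, i) * (r t x * v t x i))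
    ((h.memLpLq_velocity_mul_gradient j (j, i)).integrable_mul h.conj_time h.conj_space
      (h.memLpLq_momentum i))
  filter_upwards [h1, h2] with t h1 h2
  have h3 : ∀ i j, Integrable fun x => G t x (j, i) * stress γ mu lam (r t x) (v t x) (G t x) i j
      - v t x j * G t x (j, i) * (r t x * v t x i) := fun i j => (h1 i j).sub (h2 i j)
  simp_rw [fun x => (sum_stress_mul_gradient γ mu lam (r t x) (v t x) (G t x)).symm]
  rw [integral_finsetSum _ fun i _ => integrable_finsetSum _ fun j _ => h3 i j]
  refine Finset.sum_congr rfl fun i _ => ?_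
  rw [integral_finsetSum _ fun j _ => h3 i j]
  exact Finset.sum_congr rfl fun j _ => (integral_sub (h1 i j) (h2 i j)).symm

lemma integrable_kinetic_rate (h : IsRegular T γ mu lam r₀ v₀ r v G k l a b c e) :
    Integrable (fun z : ℝ × Torus d => r z.1 z.2 ^ γ * divg (G z.1 z.2)
        - (mu * ‖G z.1 z.2‖ ^ 2 + (mu + lam) * divg (G z.1 z.2) ^ 2)) (slab d T) := by
  simp_rw [fun z : ℝ × Torus d =>
    (sum_stress_mul_gradient γ mu lam (r z.1 z.2) (v z.1 z.2) (G z.1 z.2)).symm]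
  exact integrable_finsetSum _ fun i _ => integrable_finsetSum _ fun j _ =>
    ((h.memLpLq_gradient (j, i)).integrable_mul h.conj_c h.conj_e (h.memLpLq_stress i j)).sub
    ((h.memLpLq_velocity_mul_gradient j (j, i)).integrable_mul h.conj_time h.conj_space
      (h.memLpLq_momentum i))

lemma integrable_kinetic (h : IsRegular T γ mu lam r₀ v₀ r v G k l a b c e) :
    Integrable (fun z : ℝ × Torus d => r z.1 z.2 * ‖v z.1 z.2‖ ^ 2) (slab d T) := by
  have e : ∀ z : ℝ × Torus d, r z.1 z.2 * ‖v z.1 z.2‖ ^ 2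
      = ∑ i, r z.1 z.2 * v z.1 z.2 i * v z.1 z.2 i := fun z => by
    simp only [EuclideanSpace.norm_sq_eq, Finset.mul_sum, Real.norm_eq_abs, sq_abs]
    exact Finset.sum_congr rfl fun i _ => by ring
  simp_rw [e]
  exact integrable_finsetSum _ fun i _ => (h.memLpLq_convection i i).integrable
    h.conj_c.symm.lt.le h.conj_e.symm.lt.le

/-- Averages over short times of the energy transfer converge to the rate of change of the
kinetic energy. -/
lemma tendsto_energyTransfer (h : IsRegular T γ mu lam r₀ v₀ r v G k l a b c e) {p q : ℝ}
    (hp : 0 ≤ p) (hq : q ≤ T) :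
    (∀ η : ℝ, IntegrableOn (fun t => ∫ θ in (0 : ℝ)..1,
      energyTransfer T γ mu lam r v G t (t + η * θ)) (Ioo p q)) ∧
    Tendsto (fun η : ℝ => ∫ t in Ioo p q, ∫ θ in (0 : ℝ)..1,
      energyTransfer T γ mu lam r v G t (t + η * θ)) (𝓝 0)
      (𝓝 (∫ t in Ioo p q, ∫ x, (r t x ^ γ * divg (G t x)
        - (mu * ‖G t x‖ ^ 2 + (mu + lam) * divg (G t x) ^ 2)))) := by
  have hsub : Ioo p q ⊆ Ioo 0 T := Ioo_subset_Ioo hp hq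
  set S : Fin d → Fin d → ℝ → Torus d → ℝ := fun i j t x =>
    stress γ mu lam (r t x) (v t x) (G t x) i j with hS
  set M : Fin d → ℝ → Torus d → ℝ := fun i t x => r t x * v t x i with hM
  have s1 := fun i j => tendsto_steklov h.conj_c h.conj_e (h.memLpLq_gradient (j, i))
    (h.memLpLq_stress i j) hp hq
  have s2 := fun i j => tendsto_steklov h.conj_time h.conj_space
    (h.memLpLq_velocity_mul_gradient j (j, i)) (h.memLpLq_momentum i) hp hq
  have hsplit : ∀ η : ℝ, ∀ᵐ t ∂((volume : Measure ℝ).restrict (Ioo p q)),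
      ∫ θ in (0 : ℝ)..1, energyTransfer T γ mu lam r v G t (t + η * θ)
      = ∑ i, ∑ j, ((∫ θ in (0 : ℝ)..1, ∫ x, G t x (j, i) * timeExt (Ioo 0 T) (S i j) (t + η * θ, x))
        - ∫ θ in (0 : ℝ)..1, ∫ x, v t x j * G t x (j, i)
          * timeExt (Ioo 0 T) (M i) (t + η * θ, x)) := by
    intro η
    refine ae_restrict_of_ae_restrict_of_subset hsub ?_
    filter_upwards [ae_all_iff.2 fun i => ae_all_iff.2 fun j => ae_intervalIntegrable_pairing
        h.conj_c h.conj_e (h.memLpLq_gradient (j, i)) (h.memLpLq_stress i j) η,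
      ae_all_iff.2 fun i => ae_all_iff.2 fun j => ae_intervalIntegrable_pairing
        h.conj_time h.conj_space (h.memLpLq_velocity_mul_gradient j (j, i))
        (h.memLpLq_momentum i) η] with t h1 h2
    unfold energyTransfer
    rw [intervalIntegral.integral_finsetSum fun i _ => ?_]
    · refine Finset.sum_congr rfl fun i _ => ?_
      rw [intervalIntegral.integral_finsetSum fun j _ => (h1 i j).sub (h2 i j)]
      exact Finset.sum_congr rfl fun j _ => intervalIntegral.integral_sub (h1 i j) (h2 i j)
    · rw [intervalIntegrable_iff]
      exact integrable_finsetSum _ fun j _ => intervalIntegrable_iff.1 ((h1 i j).sub (h2 i j))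
  have hint : ∀ η : ℝ, ∀ i j, IntegrableOn (fun t => (∫ θ in (0 : ℝ)..1, ∫ x,
      G t x (j, i) * timeExt (Ioo 0 T) (S i j) (t + η * θ, x))
        - ∫ θ in (0 : ℝ)..1, ∫ x, v t x j * G t x (j, i)
          * timeExt (Ioo 0 T) (M i) (t + η * θ, x)) (Ioo p q) := fun η i j =>
    ((s1 i j).1 η).sub ((s2 i j).1 η)
  refine ⟨fun η => ?_, ?_⟩
  · exact (integrable_finsetSum _ fun i _ => integrable_finsetSum _ fun j _ => hint η i j).congr
      ((hsplit η).mono fun t ht => ht.symm)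
  · have hlim := tendsto_finsetSum Finset.univ fun i (_ : i ∈ Finset.univ) =>
      tendsto_finsetSum Finset.univ fun j (_ : j ∈ Finset.univ) => (s1 i j).2.sub (s2 i j).2
    have d1 : ∀ i j, IntegrableOn (fun t => ∫ x, G t x (j, i) * S i j t x) (Ioo p q) := fun i j =>
      (integrableOn_integral_slice (H := fun t x => G t x (j, i) * S i j t x)
        ((h.memLpLq_gradient (j, i)).integrable_mul h.conj_c h.conj_e
          (h.memLpLq_stress i j))).mono_set hsub
    have d2 : ∀ i j, IntegrableOn (fun t => ∫ x, v t x j * G t x (j, i) * M i t x) (Ioo p q) :=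
      fun i j => (integrableOn_integral_slice (H := fun t x => v t x j * G t x (j, i) * M i t x)
        ((h.memLpLq_velocity_mul_gradient j (j, i)).integrable_mul h.conj_time h.conj_space
          (h.memLpLq_momentum i))).mono_set hsub
    have d3 : ∀ i j, IntegrableOn (fun t => (∫ x, G t x (j, i) * S i j t x)
        - ∫ x, v t x j * G t x (j, i) * M i t x) (Ioo p q) := fun i j => (d1 i j).sub (d2 i j)
    have e1 : ∫ t in Ioo p q, ∫ x, (r t x ^ γ * divg (G t x)
        - (mu * ‖G t x‖ ^ 2 + (mu + lam) * divg (G t x) ^ 2))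
        = ∑ i, ∑ j, ((∫ t in Ioo p q, ∫ x, G t x (j, i) * S i j t x)
          - ∫ t in Ioo p q, ∫ x, v t x j * G t x (j, i) * M i t x) := by
      rw [← integral_congr_ae (ae_restrict_of_ae_restrict_of_subset hsub h.integral_pairing_diag),
        integral_finsetSum _ fun i _ => integrable_finsetSum _ fun j _ => d3 i j]
      refine Finset.sum_congr rfl fun i _ => ?_
      rw [integral_finsetSum _ fun j _ => d3 i j]
      exact Finset.sum_congr rfl fun j _ => integral_sub (d1 i j) (d2 i j)
    rw [e1]
    refine hlim.congr fun η => ?_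
    rw [integral_congr_ae (hsplit η),
      integral_finsetSum _ fun i _ => integrable_finsetSum _ fun j _ => hint η i j]
    refine Finset.sum_congr rfl fun i _ => ?_
    rw [integral_finsetSum _ fun j _ => hint η i j]
    exact Finset.sum_congr rfl fun j _ => (integral_sub ((s1 i j).1 η) ((s2 i j).1 η)).symm

/-- The balance of kinetic energy between any two times. -/
lemma kinetic_balance (h : IsRegular T γ mu lam r₀ v₀ r v G k l a b c e) {C : ℝ}
    {r' : ℝ → Torus d → ℝ} {v' : ℝ → Torus d → Vel d}
    (hae : ∀ᵐ t ∂((volume : Measure ℝ).restrict (Ioo 0 T)), r' t = r t ∧ v' t = v t)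
    (hsl : ∀ s ∈ Icc 0 T, IsSlice γ mu lam r₀ v₀ r v G C s (r' s) (v' s)) {s t : ℝ}
    (hs : s ∈ Icc 0 T) (ht : t ∈ Icc 0 T) :
    1 / 2 * ∫ x, r' t x * ‖v' t x‖ ^ 2 = (1 / 2 * ∫ x, r' s x * ‖v' s x‖ ^ 2)
      + ∫ τ in s..t, ∫ x, (r τ x ^ γ * divg (G τ x)
        - (mu * ‖G τ x‖ ^ 2 + (mu + lam) * divg (G τ x) ^ 2)) := by
  obtain ⟨A, hA, hA0, hBA⟩ := h.ae_abs_energyTransfer_le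
  refine eq_add_integral_of_increments (K := fun t => 1 / 2 * ∫ x, r' t x * ‖v' t x‖ ^ 2)
    h.time_pos ?_ hA hA0
    (integrableOn_integral_slice (H := fun τ x => r τ x ^ γ * divg (G τ x)
        - (mu * ‖G τ x‖ ^ 2 + (mu + lam) * divg (G τ x) ^ 2)) h.integrable_kinetic_rate)
    (h.ae_kinetic_increment hae hsl) hBA (fun p q hp hq => (h.tendsto_energyTransfer hp hq).1)
    (fun p q hp hq => (h.tendsto_energyTransfer hp hq).2)
    (fun s hs t ht hts K hK => h.kinetic_lsc hsl hs ht hts hK) hs ht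
  refine ((integrableOn_integral_slice (H := fun τ x => r τ x * ‖v τ x‖ ^ 2)
    h.integrable_kinetic).const_mul (1 / 2)).congr ?_
  filter_upwards [hae] with τ hτ
  rw [hτ.1, hτ.2]

/-- The energy equality for regular solutions: the work of the pressure cancels between the
balances of kinetic and internal energy. -/
theorem energyEquality (h : IsRegular T γ mu lam r₀ v₀ r v G k l a b c e) :
    EnergyEquality T γ mu lam r₀ v₀ r v G := by
  have hγ := h.one_lt_gamma
  obtain ⟨C, r', v', hC, hae, hsl, hpress⟩ := h.exists_representative
  have h0 : (0 : ℝ) ∈ Icc 0 T := ⟨le_rfl, h.time_pos.le⟩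
  have hrep := h.isWeaklyContinuousRep hae hsl
  have hen : ∀ {C s : ℝ} {ρ : Torus d → ℝ} {u : Torus d → Vel d},
      IsSlice γ mu lam r₀ v₀ r v G C s ρ u → Integrable (energyDensity γ ρ u) ∧
      energy γ ρ u = (1 / 2 * ∫ x, ρ x * ‖u x‖ ^ 2) + (∫ x, ρ x ^ γ) / (γ - 1) := by
    intro C s ρ u hs
    have i1 : Integrable fun x => 1 / 2 * ρ x * ‖u x‖ ^ 2 := by
      simpa only [mul_assoc] using hs.integrable_kinetic.const_mul (1 / 2)
    have i2 := hs.integrable_pressure.div_const (γ - 1)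
    refine ⟨i1.add i2, ?_⟩
    unfold energy energyDensity
    rw [integral_add i1 i2, integral_div]
    simp only [mul_assoc, integral_const_mul]
  refine ⟨r', v', hrep, fun t ht => ⟨(hen (hsl t ht)).1, ?_⟩⟩
  have huniq := (hsl 0 h0).unique hγ h.isSlice_zero
  have hkin0 : ∫ x, r' 0 x * ‖v' 0 x‖ ^ 2 = ∫ x, r₀ x * ‖v₀ x‖ ^ 2 := by
    refine integral_congr_ae ?_
    filter_upwards [huniq.1, ae_all_iff.2 huniq.2] with x h1 h2
    rw [h1]
    rcases eq_or_ne (r₀ x) 0 with h3 | h3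
    · rw [h3, zero_mul, zero_mul]
    · have : v' 0 x = v₀ x := by
        ext j
        have := h2 j
        rw [h1] at this
        exact mul_left_cancel₀ h3 this
      rw [this]
  have hpr0 : ∫ x, r' 0 x ^ γ = ∫ x, r₀ x ^ γ := integral_congr_ae (by
    filter_upwards [huniq.1] with x hx
    rw [hx])
  have hdis : Integrable (fun z : ℝ × Torus d => mu * ‖G z.1 z.2‖ ^ 2
      + (mu + lam) * divg (G z.1 z.2) ^ 2) (slab d T) := by
    refine (h.integrable_pressure_work.sub h.integrable_kinetic_rate).congr
      (Eventually.of_forall fun z => ?_)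
    simp only [Pi.sub_apply]
    ring
  have hW := integrableOn_integral_slice (H := fun τ x => r τ x ^ γ * divg (G τ x))
    h.integrable_pressure_work
  have hD := integrableOn_integral_slice (H := fun τ x => mu * ‖G τ x‖ ^ 2
      + (mu + lam) * divg (G τ x) ^ 2) hdis
  have e1 : dissipation mu lam G t = ∫ τ in (0 : ℝ)..t, ∫ x, (mu * ‖G τ x‖ ^ 2
      + (mu + lam) * divg (G τ x) ^ 2) := by
    unfold dissipation
    have hdt : Integrable (fun z : ℝ × Torus d => mu * ‖G z.1 z.2‖ ^ 2
        + (mu + lam) * divg (G z.1 z.2) ^ 2) (slab d t) := by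
      refine hdis.mono_measure ?_
      exact Measure.prod_mono (Measure.restrict_mono (Ioo_subset_Ioo le_rfl ht.2) le_rfl) le_rfl
    rw [slab, integral_prod _ hdt, intervalIntegral.integral_of_le ht.1,
      integral_Ioc_eq_integral_Ioo]
  have e2 : ∫ τ in (0 : ℝ)..t, ∫ x, (r τ x ^ γ * divg (G τ x)
        - (mu * ‖G τ x‖ ^ 2 + (mu + lam) * divg (G τ x) ^ 2))
      = (∫ τ in (0 : ℝ)..t, ∫ x, r τ x ^ γ * divg (G τ x)) - dissipation mu lam G t := by
    rw [e1, ← intervalIntegral.integral_sub (IntegrableOn.intervalIntegrable_of_mem hW h0 ht)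
      (IntegrableOn.intervalIntegrable_of_mem hD h0 ht)]
    refine intervalIntegral_congr_ae_of_mem ?_ h0 ht
    filter_upwards [ae_integrable_slice (f := fun τ x => r τ x ^ γ * divg (G τ x))
      h.integrable_pressure_work, ae_integrable_slice (f := fun τ x => mu * ‖G τ x‖ ^ 2
      + (mu + lam) * divg (G τ x) ^ 2) hdis] with τ h1 h2
    exact integral_sub h1 h2
  have e3 : ∫ τ in (0 : ℝ)..t, ∫ x, (r τ x ^ γ - γ * r τ x ^ γ) * divg (G τ x)
      = -(γ - 1) * ∫ τ in (0 : ℝ)..t, ∫ x, r τ x ^ γ * divg (G τ x) := by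
    simp only [← intervalIntegral.integral_const_mul, ← integral_const_mul]
    refine intervalIntegral.integral_congr fun τ _ => ?_
    exact integral_congr_ae (Eventually.of_forall fun x => by ring)
  have hk := h.kinetic_balance hae hsl h0 ht
  have hp := hpress t ht 0 h0
  rw [(hen (hsl t ht)).2, (hen h.isSlice_zero).2, hk, hp, hkin0, hpr0, e2, e3]
  have : γ - 1 ≠ 0 := by linarith
  field_simp
  ring

end IsRegular
end KineticBalance

/-! ### The two regularity classes -/

section Exponents

variable {d : ℕ} {T γ mu lam : ℝ} {r₀ : Torus d → ℝ} {v₀ : Torus d → Vel d}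
    {r : ℝ → Torus d → ℝ} {v : ℝ → Torus d → Vel d} {G : ℝ → Torus d → Grad d} {k l : ℝ}

lemma GradMemLpLq.mono_exponent {p q p' q' : ℝ} {f : ℝ → Torus d → ℝ}
    (h : GradMemLpLq T (ENNReal.ofReal p) (ENNReal.ofReal q) f) (hp : p' ≤ p) (hq' : 0 < q')
    (hq : q' ≤ q) : GradMemLpLq T (ENNReal.ofReal p') (ENNReal.ofReal q') f := by
  obtain ⟨H, hH, hm⟩ := h
  exact ⟨H, hH, hm.mono_exponent hp (hq'.trans_le hq) hq⟩

/-- Square-integrable velocity gradient: the exponents `a = 4k/(k-2)` and `c = 2`. -/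
lemma isRegular_of_velocity (hT : 0 < T) (hγ : 1 < γ)
    (hsol : IsWeakSolution T γ mu lam r₀ v₀ r v G) (hk : 2 * γ < k) (hl : 2 * γ < l)
    (hG : MemLpLq T 2 2 G) (hr : MemLpLq T (ENNReal.ofReal k) (ENNReal.ofReal l) r)
    (hs : GradMemLpLq T (ENNReal.ofReal (4 * k / (k + 4))) (ENNReal.ofReal (4 * l / (l + 4)))
      (fun t x => √(r t x)))
    (hv : MemLpLq T (ENNReal.ofReal (4 * k / (k - 2))) (ENNReal.ofReal (4 * l / (l - 2))) v) :
    IsRegular T γ mu lam r₀ v₀ r v G k l (4 * k / (k - 2)) (4 * l / (l - 2)) 2 2 := by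
  have hk2 : 0 < k - 2 := by linarith
  have hl2 : 0 < l - 2 := by linarith
  have hk0 : 0 < k := by linarith
  have hl0 : 0 < l := by linarith
  refine ⟨hT, hγ, hsol, by linarith, by linarith, ?_, ?_, le_rfl, le_rfl, ?_, ?_, ?_, ?_, hr, hv,
    by simpa using hG, hs.mono_exponent ?_ (by norm_num) ?_⟩
  · rw [le_div_iff₀ hk2]; linarith
  · rw [le_div_iff₀ hl2]; linarith
  · field_simp; ring
  · field_simp; ring
  · have : γ / k ≤ 1 / 2 := by rw [div_le_div_iff₀ hk0 two_pos]; linarith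
    linarith
  · have : γ / l ≤ 1 / 2 := by rw [div_le_div_iff₀ hl0 two_pos]; linarith
    linarith
  · rw [div_le_div_iff₀ (by norm_num) (by linarith)]; linarith
  · rw [div_le_div_iff₀ (by norm_num) (by linarith)]; linarith

/-- Velocity in `L⁴L⁴`: the exponents `a = 4` and `c = 2k/(k-2)`. -/
lemma isRegular_of_gradient (hT : 0 < T) (hγ : 1 < γ)
    (hsol : IsWeakSolution T γ mu lam r₀ v₀ r v G) (hk : max 2 (2 * (γ - 1)) < k)
    (hl : max 2 (2 * (γ - 1)) < l) (hv : MemLpLq T 4 4 v)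
    (hr : MemLpLq T (ENNReal.ofReal k) (ENNReal.ofReal l) r)
    (hs : GradMemLpLq T (ENNReal.ofReal (4 * k / (k - 2))) (ENNReal.ofReal (4 * l / (l - 2)))
      (fun t x => √(r t x)))
    (hG : MemLpLq T (ENNReal.ofReal (2 * k / (k - 2))) (ENNReal.ofReal (2 * l / (l - 2))) G) :
    IsRegular T γ mu lam r₀ v₀ r v G k l 4 4 (2 * k / (k - 2)) (2 * l / (l - 2)) := by
  obtain ⟨hk2, hkγ⟩ := max_lt_iff.1 hk
  obtain ⟨hl2, hlγ⟩ := max_lt_iff.1 hl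
  have hk2' : 0 < k - 2 := by linarith
  have hl2' : 0 < l - 2 := by linarith
  have hk0 : 0 < k := by linarith
  have hl0 : 0 < l := by linarith
  have key : ∀ {m : ℝ}, 0 < m → 0 < m - 2 → 2 * (γ - 1) < m →
      γ / m + 1 / (2 * m / (m - 2)) ≤ 1 := by
    intro m hm hm2 hmγ
    rw [one_div_div, div_add_div _ _ hm.ne' (by positivity), div_le_one (by positivity)]
    nlinarith
  refine ⟨hT, hγ, hsol, hk2.le, hl2.le, le_rfl, le_rfl, ?_, ?_, ?_, ?_, key hk0 hk2' hkγ,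
    key hl0 hl2' hlγ, hr, by simpa using hv, hG, hs.mono_exponent ?_ (by norm_num) ?_⟩
  · rw [le_div_iff₀ hk2']; linarith
  · rw [le_div_iff₀ hl2']; linarith
  · field_simp; ring
  · field_simp; ring
  · rw [div_le_div_iff₀ (by norm_num) hk2']; linarith
  · rw [div_le_div_iff₀ (by norm_num) hl2']; linarith

end Exponents

end CompressibleNS

theorem mainTheorem3 (d : ℕ) (hd : 2 ≤ d) (T γ mu lam : ℝ) (hT : 0 < T) (hγ : 1 < γ)
    (hmu : 0 ≤ mu) (hlam : 0 < 2 * mu + d * lam)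
    (r₀ : CompressibleNS.Torus d → ℝ) (v₀ : CompressibleNS.Torus d → CompressibleNS.Vel d)
    (r : ℝ → CompressibleNS.Torus d → ℝ)
    (v : ℝ → CompressibleNS.Torus d → CompressibleNS.Vel d)
    (G : ℝ → CompressibleNS.Torus d → CompressibleNS.Grad d)
    (hsol : CompressibleNS.IsWeakSolution T γ mu lam r₀ v₀ r v G) :
    (∀ k l : ℝ, 2 * γ < k → 2 * γ < l →
      (0 < (8 - d) * l + 2 * d →
        (2 * (2 * (d + 4) * γ + d) * l - 4 * d * (2 * γ + 1)) / ((8 - d) * l + 2 * d) < k) →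
      CompressibleNS.MemLpLq T 2 2 G →
      CompressibleNS.MemLpLq T (ENNReal.ofReal k) (ENNReal.ofReal l) r →
      CompressibleNS.GradMemLpLq T (ENNReal.ofReal (4 * k / (k + 4)))
        (ENNReal.ofReal (4 * l / (l + 4))) (fun t x => √(r t x)) →
      CompressibleNS.MemLpLq T (ENNReal.ofReal (4 * k / (k - 2)))
        (ENNReal.ofReal (4 * l / (l - 2))) v →
      MemLp v₀ (ENNReal.ofReal (max (2 * γ / (γ - 1)) (2 * l / (l - 2)))) →
      CompressibleNS.EnergyEquality T γ mu lam r₀ v₀ r v G) ∧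
    (∀ k l : ℝ, max 2 (2 * (γ - 1)) < k → max 2 (2 * (γ - 1)) < l →
      (d < 8 → 4 * (γ - 1) * (d + 4) / (8 - d) < k) →
      CompressibleNS.MemLpLq T 4 4 v →
      CompressibleNS.MemLpLq T (ENNReal.ofReal k) (ENNReal.ofReal l) r →
      CompressibleNS.GradMemLpLq T (ENNReal.ofReal (4 * k / (k - 2)))
        (ENNReal.ofReal (4 * l / (l - 2))) (fun t x => √(r t x)) →
      CompressibleNS.MemLpLq T (ENNReal.ofReal (2 * k / (k - 2)))
        (ENNReal.ofReal (2 * l / (l - 2))) G →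
      MemLp v₀ (ENNReal.ofReal (2 * γ / (γ - 1))) →
      CompressibleNS.EnergyEquality T γ mu lam r₀ v₀ r v G) := by
  refine ⟨fun k l hk hl _ hG hr hs hv _ => ?_, fun k l hk hl _ hv hr hs hG _ => ?_⟩
  · exact (CompressibleNS.isRegular_of_velocity hT hγ hsol hk hl hG hr hs hv).energyEquality
  · exact (CompressibleNS.isRegular_of_gradient hT hγ hsol hk hl hv hr hs hG).energyEquality
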